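/- **Conventions.** All graphs are finite. For a graph $H$, a collection $C$ of *cells* is a collection of $6$-cycles of $H$ such that every $2$-path of $H$ is contained in precisely one cycle of $C$. The dual $H^*$ (with respect to $C$) is the multigraph whose vertices are the cells and in which each edge $e$ of $H$ gives a dual edge $e^*$ joining the two cells that contain $e$. A *locally grid graph* is a connected $4$-regular graph such that for every vertex $x$ there are an ordering $x_1,\dots,x_4$ of the neighbours $N(x)$ and four different vertices $y_1,\dots,y_4$ (different from $x$) with, indices modulo $4$, $N(x_i)\cap N(x_{i+1})=\{x,y_i\}$, $N(x_i)\cap N(x_{i+2})=\{x\}$, and no more adjacencies among $x,x_i,y_i$ than these conditions require. For a set $P$ of edges of $H$ write $H\xrightarrow{P}(G,G')$ if the following holds. (i) For every set $Q$ of edges consisting of all but exactly one edge of each class of parallel edges of $H/P$, the multigraph obtained from $H$ by contracting $P$ and deleting $Q$ has no loops and no parallel edges and is isomorphic to $G$. (ii) $H$ has a collection of cells such that for every such $Q$, deleting $\{e^*:e\in P\}$ from $H^*$ and contracting $\{e^*:e\in Q\}$ gives a multigraph without loops or parallel edges that is isomorphic to $G'$. **Grid families.** $T^\delta_{p,q},K^0_{p,q},K^1_{p,q},K^2_{p,q}$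 are obtained from the $p\times q$ grid with vertices $(i,j)$, $0\le i<p$, $0\le j<q$, by adding the edges $\{(0,j),(p-1,j)\}$ and, for $0\le i<p$: $\{(i,0),(i+\delta,q-1)\}$ for $T^\delta_{p,q}$; $\{(i,0),(p-1-i,q-1)\}$ for $K^0_{p,q}$ ($p$ even) and $K^1_{p,q}$ ($p$ odd); $\{(i,0),(p-i,q-1)\}$ for $K^2_{p,q}$ ($p$ even); first coordinates modulo $p$. $S_{p,q}$ is obtained from the same grid by adding, if $p\le q$, the edges $\{(j,0),(p-1,q-p+j)\}$ and $\{(0,j),(j,q-1)\}$ ($0\le j<p$) and $\{(0,i),(p-1,i-p)\}$ ($p\le i<q$); if $q<p$, the edges $\{(j,0),(0,q-1-j)\}$ and $\{(p-1-j,q-1),(p-1,j)\}$ ($0\le j<q$) and $\{(i,q-1),(i+q,0)\}$ ($0\le i<p-q$). **Hexagonal families.** The hexagonal cylinder of length $k$ and breadth $m$ has vertices $(i,j)$, $0\le i\le m$, $j\in\mathbb Z_{2k}$, and edges $\{(i,j),(i,j+1)\}$ and, for $i<m$ and $i+j$ odd, $\{(i,j),(i+1,j)\}$. Put $z_j=(0,2j)$,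 and $x_j=(m,2j)$ for $m$ odd, $x_j=(m,2j+1)$ for $m$ even ($0\le j<k$). From it: * $H_{k,m,r}$ by adding $\{z_j,x_{j+r}\}$ (indices modulo $k$), where $m\ge2,\ k\ge3,\ 0\le r\le\lfloor k/2\rfloor$, or $m=1,\ k>3,\ 2\le r\le\lfloor k/2\rfloor$, or (degenerate case) $m=0$, $2\le r$, $2r+3\le k$; * $H_{k,m,a}$ ($m\ge2$, $k\ge3$) by adding $\{z_0,x_1\},\{z_1,x_0\}$ and $\{z_i,x_{k+1-i}\}$, $2\le i\le k-1$; * $H_{k,m,b}$ ($k\ge4$ even, $m\ge3$ odd) by adding $\{z_0,x_0\}$ and $\{z_i,x_{k-i}\}$, $1\le i\le k-1$; * $H_{k,m,c}$ ($k\ge6$ even, $m\ge1$) by adding $\{z_i,z_{i+k/2}\}$ and $\{x_i,x_{i+k/2}\}$, $0\le i<k/2$; * $H_{k,m,f}$ ($k\ge7$ odd, $m\ge0$) by adding two cycles $w_0\cdots w_{k-1}$, $v_0\cdots v_{k-1}$ and the edges $\{z_i,w_{2i}\},\{x_i,v_{2i}\}$, $0\le i\le\frac{k-1}2$, and $\{z_{(k+2i+1)/2},w_{2i+1}\},\{x_{(k+2i+1)/2},v_{2i+1}\}$,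 $0\le i<\frac{k-1}2$. For even $R$ let $B_{R,k}$ have vertices $(i,j)$, $i\in\mathbb Z_R$, $0\le j<k$, and edges $\{(i,j),(i,j+1)\}$ and, for $i+j$ even, $\{(i,j),(i+1,j)\}$. Let $\tilde H_{k,m,c}$ be $B_{2m+2,k}$ with the edges $\{(i,0),(2m+1-i,k-1)\}$ added, and $\tilde H_{k,m,f}$ be $B_{2m+4,k}$ with the edges $\{(i,0),(-i,k-1)\}$ added. The hexagonal ladder of length $k$ and breadth $m$ is the graph on the pairs $(i,j)$ with $0\le i\le m$, $0\le j<2k+m$, $m-1\le i+j\le 2k+m$, in which $(i,j)$ is adjacent to $(i,j+1)$, and to $(i+1,j)$ unless $i+j\in\{m,m+2,\dots,m+2k-2\}$. * $H_{k,m,g}$ ($m\ge3$, $k\ge m+1$): from the ladder of length $k$ and breadth $m+1$ delete the vertices $(m+1,i)$, $0\le i\le 2(k-m)-3$, and add $\{(0,2k+m),(m+1,2(k-m-1))\}$; $\{(0,2k+m-(2j+1)),(m,2(k-m-1)-(2j+2))\}$, $0\le j\le k-m-2$; and $\{(0,m+2i+1),(i+1,2k+m-i)\}$, $\{(m-i,i),(m+1,2k-(2i+1))\}$,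 $0\le i\le m$. * $H_{k,m,h}$ ($2\le k\le m-2$): to the ladder of length $k$ and breadth $m$ add two vertices $s=(0,2k+m)$, $t=(m-k-1,3k+2)$ and the edges $\{s,(0,2k+m-1)\}$, $\{s,(k+1,m-k-2)\}$, $\{t,(m-k-1,3k+1)\}$, $\{t,(m,0)\}$; $\{(j,2k+m-j),(k+j+1,m-k-j-2)\}$, $1\le j\le m-k-2$; $\{(0,2k+m-2i),(i,m-i-1)\}$, $0\le i\le k$; $\{t,(m,2k)\}$; and $\{(m-k+i,3k-i),(m,2k-2i-1)\}$, $0\le i\le k-1$. **Theorem 3.2.** For all parameters in the ranges above: 1. With $P=\{\{(i,2j),(i,2j+1)\}:0\le i\le m,\,0\le j<k\}$, $P$ is a perfect matching and $H_{k,m,r}\xrightarrow{P}(T^r_{k,m+1},T^r_{k,m+1})$; $H_{k,m,a}\xrightarrow{P}(K^0_{k,m+1},K^2_{k,m+1})$ if $k$ is even and $H_{k,m,a}\xrightarrow{P}(K^1_{k,m+1},K^1_{k,m+1})$ if $k$ is odd; $H_{k,m,b}\xrightarrow{P}(K^2_{k,m+1},K^0_{k,m+1})$. 2. $H_{k,m,c}\cong\tilde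 H_{k,m,c}$; $P=\{\{(i,2j),(i,2j+1)\}:0\le i\le 2m+1,\,0\le j<k/2\}$ is a perfect matching of $\tilde H_{k,m,c}$ and $\tilde H_{k,m,c}\xrightarrow{P}(K^0_{2m+2,k/2},K^2_{2m+2,k/2})$. 3. $H_{k,m,f}\cong\tilde H_{k,m,f}$; for every even $l$ with $0\le l\le k-3$, the set $P$ of the edges $\{(i,j),(i,j+1)\}$, $0\le i\le 2m+3$, with $j\in\{0,2,\dots,l\}\cup\{l+1,l+3,\dots,k-2\}$ is not a matching, and $\tilde H_{k,m,f}\xrightarrow{P}(K^2_{2m+4,(k-1)/2},K^0_{2m+4,(k-1)/2})$. 4. The edges $\{(0,m+2j),(0,m+2j+1)\}$ ($0\le j<k$), $\{(i,m-i+2j),(i,m-i+2j+1)\}$ ($1\le i\le m$, $0\le j\le k$), $\{(m+1,j),(m+1,j+1)\}$ ($j=2(k-m)-1,2(k-m)+1,\dots,2k-1$) and $\{(0,2k+m),(m+1,2(k-m-1))\}$ form a perfect matching $P$ of $H_{k,m,g}$, and $H_{k,m,g}\xrightarrow{P}(S_{m+1,k+2},S_{m+1,k+2})$. 5. The edges $\{(i,m-i-1+2j),(i,m-i+2j)\}$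 ($0\le i<m$, $0\le j\le k$), $\{(m,2j+1),(m,2j+2)\}$ ($0\le j<k$) and $\{t,(m,0)\}$ form a perfect matching $P$ of $H_{k,m,h}$, and $H_{k,m,h}\xrightarrow{P}(S_{m+1,k+1},S_{m+1,k+1})$. Moreover the graphs $G$ and $G'$ that occur here are locally grid graphs whenever their parameters satisfy: for $K^0_{p,q}$, $p\ge5$ and $q\ge4$; for $K^1_{p,q}$ and $K^2_{p,q}$, $p\ge5$ and $q\ge5$; for $S_{p,q}$, $q\ge6$ (always so in item 4); for $T^\delta_{p,q}$, $p\ge5$, $2\delta\le p$, and one of: $q\ge4$ and $\delta+q\ge5$; $q=3$ and $\delta\ge3$; $q=2$ and $4\le\delta<p/2$; $q=1$ and $a+b\delta\not\equiv0\pmod p$ for all integers $(a,b)\ne(0,0)$ with $|a|+|b|\le4$ or with $|a|+|b|=5$ and $|a|,|b|\ge2$. -/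

import Mathlib

namespace HexTiling

/-! ### Multigraphs: contraction, parallel edges, geometric dual -/

/-- Contraction `M / F` of a set `F` of edges of a multigraph `M`: the edges of `F` are removed
and their ends are identified (`Quot` takes the generated equivalence relation).  All other edges
keep their names; loops and parallel edges are kept. -/
def contract {α β : Type*} (M : Graph α β) (F : Set β) :
    Graph (Quot fun x y : α => ∃ e ∈ F, M.IsLink e x y) β :=
  (M.deleteEdges F).map (Quot.mk _)

/-- `Q` is a set of edges whose deletion from `M` deletes the parallel edges: `Q` leaves exactly
one edge in every class of edges with the same ends. -/
def IsParallelDeletion {α β : Type*} (M : Graph α β) (Q : Set β) : Prop :=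
  Q ⊆ M.edgeSet ∧
    ∀ e ∈ M.edgeSet, ∃! f, f ∈ M.edgeSet \ Q ∧ ∃ x y, M.IsLink e x y ∧ M.IsLink f x y

/-- The multigraph `M` is (up to isomorphism) the simple graph `G`: it has neither loops nor
parallel edges, and its simple graph is isomorphic to `G`. -/
def IsCopyOf {α β W : Type*} (M : Graph α β) (G : SimpleGraph W) : Prop :=
  M.Simple ∧ Nonempty (M.toSimpleGraph ≃g G)

/-- `c` is the edge set of a `6`-cycle of `G`. -/
def IsHexagon {V : Type*} (G : SimpleGraph V) (c : Set (Sym2 V)) : Prop :=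
  ∃ f : Fin 6 → V, Function.Injective f ∧ (∀ i, G.Adj (f i) (f (i + 1))) ∧
    c = Set.range fun i => s(f i, f (i + 1))

/-- `C` is a collection of cells of `G`: a collection of `6`-cycles (given by their edge sets)
such that every `2`-path of `G` is contained in precisely one cycle of `C`. -/
def IsCellCollection {V : Type*} (G : SimpleGraph V) (C : Set (Set (Sym2 V))) : Prop :=
  (∀ c ∈ C, IsHexagon G c) ∧
    ∀ u v w, G.Adj u v → G.Adj v w → u ≠ w → ∃! c, c ∈ C ∧ s(u, v) ∈ c ∧ s(v, w) ∈ c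

/-- The geometric dual with respect to the collection `C` of faces: its vertices are the faces,
and an edge `e` (whose dual edge carries the same name) joins the two faces that contain `e`. -/
def dual {V : Type*} (C : Set (Set (Sym2 V))) : Graph (Set (Sym2 V)) (Sym2 V) where
  vertexSet := C
  IsLink e c d := c ∈ C ∧ d ∈ C ∧ ∀ x ∈ C, e ∈ x ↔ x = c ∨ x = d
  isLink_symm := by
    intro e _
    refine ⟨fun c d h => ⟨h.2.1, h.1, fun x hx => ?_⟩⟩
    rw [h.2.2 x hx, or_comm]
  eq_or_eq_of_isLink_of_isLink := by
    intro e x y v w h h'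
    exact (h'.2.2 x h.1).1 ((h.2.2 x h.1).2 (Or.inl rfl))
  left_mem_of_isLink := by
    intro e x y h
    exact h.1

/-- No two different edges of `P` share a vertex. -/
def IsMatching {V : Type*} (P : Set (Sym2 V)) : Prop :=
  ∀ e ∈ P, ∀ f ∈ P, e ≠ f → ∀ v, ¬ (v ∈ e ∧ v ∈ f)

/-- `P` is (the edge set of) a perfect matching of `H`. -/
def IsPerfectMatching {V : Type*} (H : SimpleGraph V) (P : Set (Sym2 V)) : Prop :=
  P ⊆ H.edgeSet ∧ IsMatching P ∧ ∀ v, ∃ e ∈ P, v ∈ e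

/-- The set `P` of edges of `H` yields `G`, and dually `G'`: contracting `P` in `H` and deleting
the resulting parallel edges `Q` gives `G`; and `H` has a collection of cells such that deleting
the dual edges of `P` and contracting the dual edges of `Q` in the dual of `H` gives `G'`. -/
def Yields {V W W' : Type*} (H : SimpleGraph V) (P : Set (Sym2 V))
    (G : SimpleGraph W) (G' : SimpleGraph W') : Prop :=
  P ⊆ H.edgeSet ∧
  (∀ Q, IsParallelDeletion (contract (Graph.ofSimpleGraph H) P) Q →
    IsCopyOf ((contract (Graph.ofSimpleGraph H) P).deleteEdges Q) G) ∧
  ∃ C, IsCellCollection H C ∧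
    ∀ Q, IsParallelDeletion (contract (Graph.ofSimpleGraph H) P) Q →
      IsCopyOf (contract ((dual C).deleteEdges P) Q) G'

/-- Locally grid graphs.  The `4`-regularity is part of `Set.range x = G.neighborSet v`
with `x` injective. -/
def IsLocallyGrid {V : Type*} (G : SimpleGraph V) : Prop :=
  G.Connected ∧ ∀ v : V, ∃ x y : Fin 4 → V,
    Function.Injective x ∧ Set.range x = G.neighborSet v ∧
    Function.Injective y ∧
    (∀ i, y i ≠ v ∧ G.neighborSet (x i) ∩ G.neighborSet (x (i + 1)) = {v, y i}) ∧
    (∀ i, G.neighborSet (x i) ∩ G.neighborSet (x (i + 2)) = {v}) ∧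
    (∀ i j, ¬ G.Adj (x i) (x j)) ∧ (∀ i j, ¬ G.Adj (y i) (y j)) ∧ (∀ i, ¬ G.Adj v (y i)) ∧
    (∀ i j, G.Adj (x i) (y j) → i = j ∨ i = j + 1)

/-- The simple graph with vertex set `S` whose edges are the pairs `{u, v}` with `E u v`. -/
def graphOn {α : Type*} (S : Set α) (E : α → α → Prop) : SimpleGraph S :=
  SimpleGraph.fromRel fun u v : S => E u v

/-- The set of the pairs `{u, v}` of elements of `S` with `R u v`. -/
def pairsOn {α : Type*} (S : Set α) (R : α → α → Prop) : Set (Sym2 S) :=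
  {e | ∃ u v : S, R u v ∧ e = s(u, v)}

/-! ### Families of locally grid graphs on the vertices of the `p × q` grid -/

def gridV (p q : ℕ) : Set (ℕ × ℕ) := {v | v.1 < p ∧ v.2 < q}

/-- Edges of the grid `P_p × P_q`. -/
def gridE (u v : ℕ × ℕ) : Prop :=
  (v.1 = u.1 + 1 ∧ v.2 = u.2) ∨ (v.1 = u.1 ∧ v.2 = u.2 + 1)

/-- The edges `{(0, j), (p - 1, j)}`. -/
def sideE (p : ℕ) (u v : ℕ × ℕ) : Prop := u.1 = 0 ∧ v.1 = p - 1 ∧ v.2 = u.2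

/-- `T_{p,q}^δ`. -/
def torusT (p q δ : ℕ) : SimpleGraph (gridV p q) :=
  graphOn (gridV p q) fun u v =>
    gridE u v ∨ sideE p u v ∨ (u.2 = 0 ∧ v.1 = (u.1 + δ) % p ∧ v.2 = q - 1)

/-- `K_{p,q}^0` (for `p` even): the edges `{(j, 0), (p - j - 1, q - 1)}` are added. -/
def kleinK0 (p q : ℕ) : SimpleGraph (gridV p q) :=
  graphOn (gridV p q) fun u v =>
    gridE u v ∨ sideE p u v ∨ (u.2 = 0 ∧ v.1 = p - u.1 - 1 ∧ v.2 = q - 1)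

/-- `K_{p,q}^1` (for `p` odd): given by the same formula as `K_{p,q}^0`. -/
def kleinK1 (p q : ℕ) : SimpleGraph (gridV p q) :=
  graphOn (gridV p q) fun u v =>
    gridE u v ∨ sideE p u v ∨ (u.2 = 0 ∧ v.1 = p - u.1 - 1 ∧ v.2 = q - 1)

/-- `K_{p,q}^2` (for `p` even): the edges `{(j, 0), (p - j, q - 1)}` are added, first coordinates
modulo `p`. -/
def kleinK2 (p q : ℕ) : SimpleGraph (gridV p q) :=
  graphOn (gridV p q) fun u v =>
    gridE u v ∨ sideE p u v ∨ (u.2 = 0 ∧ v.1 = (p - u.1) % p ∧ v.2 = q - 1)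

/-- The exterior edges of `S_{p,q}` if `p ≤ q`. -/
def gridSE₁ (p q : ℕ) (u v : ℕ × ℕ) : Prop :=
  (∃ j, j < p ∧ u = (j, 0) ∧ v = (p - 1, q - p + j)) ∨
  (∃ i, i < p ∧ u = (0, i) ∧ v = (i, q - 1)) ∨
  (∃ i, p ≤ i ∧ i < q ∧ u = (0, i) ∧ v = (p - 1, i - p))

/-- The exterior edges of `S_{p,q}` if `q < p`. -/
def gridSE₂ (p q : ℕ) (u v : ℕ × ℕ) : Prop :=
  (∃ j, j < q ∧ u = (j, 0) ∧ v = (0, q - 1 - j)) ∨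
  (∃ i, i < q ∧ u = (p - 1 - i, q - 1) ∧ v = (p - 1, i)) ∨
  (∃ i, i + q < p ∧ u = (i, q - 1) ∧ v = (i + q, 0))

/-- `S_{p,q}`. -/
def gridS (p q : ℕ) : SimpleGraph (gridV p q) :=
  graphOn (gridV p q) fun u v =>
    gridE u v ∨ (p ≤ q ∧ gridSE₁ p q u v) ∨ (q < p ∧ gridSE₂ p q u v)

/-- Parameters of the locally grid graphs `T_{p,q}^δ`.  For `q = 1` the graph is the circulant
graph on `ℤ/p` with connection set `{±1, ±δ}`, and the condition excludes short relations. -/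
def TorusRange (p q δ : ℕ) : Prop :=
  5 ≤ p ∧ 2 * δ ≤ p ∧
    ((4 ≤ q ∧ 5 ≤ δ + q) ∨ (q = 3 ∧ 3 ≤ δ) ∨ (q = 2 ∧ 4 ≤ δ ∧ 2 * δ < p) ∨
      (q = 1 ∧ ∀ a b : ℤ, (a ≠ 0 ∨ b ≠ 0) →
        (|a| + |b| ≤ 4 ∨ (|a| + |b| = 5 ∧ 2 ≤ |a| ∧ 2 ≤ |b|)) → ¬ (p : ℤ) ∣ a + b * δ))

/-! ### Hexagonal cylinders and the families built on them -/

/-- Vertices of the hexagonal cylinder of length `k` and breadth `m`. -/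
def cylV (k m : ℕ) : Set (ℕ × ℕ) := {v | v.1 ≤ m ∧ v.2 < 2 * k}

/-- Edges of the hexagonal cylinder of length `k` and breadth `m`: those of the
`(m + 1) × 2k` cylinder grid, without the edges `{(2i, 2j), (2i + 1, 2j)}` and
`{(2i + 1, 2j + 1), (2i + 2, 2j + 1)}`. -/
def cylE (k : ℕ) (u v : ℕ × ℕ) : Prop :=
  (v.1 = u.1 ∧ v.2 = u.2 + 1) ∨ (v.1 = u.1 ∧ u.2 = 0 ∧ v.2 = 2 * k - 1) ∨
  (v.1 = u.1 + 1 ∧ v.2 = u.2 ∧ Odd (u.1 + u.2))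

/-- The vertices `z_j` of degree two. -/
def cylZ (j : ℕ) : ℕ × ℕ := (0, 2 * j)

/-- The vertices `x_j` of degree two. -/
def cylX (m j : ℕ) : ℕ × ℕ := (m, if m % 2 = 1 then 2 * j else 2 * j + 1)

/-- The edges `{(i, 2j), (i, 2j + 1)}`. -/
def brickP (u v : ℕ × ℕ) : Prop := v.1 = u.1 ∧ v.2 = u.2 + 1 ∧ Even u.2

/-- The matching `{(i, 2j), (i, 2j + 1)}` of the cylinder. -/
def cylP (k m : ℕ) : Set (Sym2 (cylV k m)) := pairsOn (cylV k m) brickP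

/-- `H_{k,m,r}`. -/
def hexR (k m r : ℕ) : SimpleGraph (cylV k m) :=
  graphOn (cylV k m) fun u v =>
    cylE k u v ∨ ∃ j, j < k ∧ u = cylZ j ∧ v = cylX m ((j + r) % k)

/-- Parameters of the family `H_{k,m,r}`, with the degenerate case `m = 0` (a cycle of length
`2k` with the chords `{2j, 2j + 2r + 1}`). -/
def HexRRange (k m r : ℕ) : Prop :=
  (2 ≤ m ∧ 3 ≤ k ∧ r ≤ k / 2) ∨ (m = 1 ∧ 3 < k ∧ 2 ≤ r ∧ r ≤ k / 2) ∨
  (m = 0 ∧ 2 ≤ r ∧ 2 * r + 3 ≤ k)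

/-- `H_{k,m,a}`. -/
def hexA (k m : ℕ) : SimpleGraph (cylV k m) :=
  graphOn (cylV k m) fun u v =>
    cylE k u v ∨ (u = cylZ 0 ∧ v = cylX m 1) ∨ (u = cylZ 1 ∧ v = cylX m 0) ∨
      ∃ i, 2 ≤ i ∧ i ≤ k - 1 ∧ u = cylZ i ∧ v = cylX m (k + 1 - i)

/-- `H_{k,m,b}`. -/
def hexB (k m : ℕ) : SimpleGraph (cylV k m) :=
  graphOn (cylV k m) fun u v =>
    cylE k u v ∨ (u = cylZ 0 ∧ v = cylX m 0) ∨
      ∃ i, 1 ≤ i ∧ i ≤ k - 1 ∧ u = cylZ i ∧ v = cylX m (k - i)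

/-- `H_{k,m,c}`. -/
def hexC (k m : ℕ) : SimpleGraph (cylV k m) :=
  graphOn (cylV k m) fun u v =>
    cylE k u v ∨ ∃ i, i < k / 2 ∧
      ((u = cylZ i ∧ v = cylZ (i + k / 2)) ∨ (u = cylX m i ∧ v = cylX m (i + k / 2)))

/-- Vertices of `H_{k,m,f}`: those of the cylinder, `w_j = inr (inl j)` and `v_j = inr (inr j)`,
`0 ≤ j ≤ k - 1`. -/
def hexFV (k m : ℕ) : Set ((ℕ × ℕ) ⊕ (ℕ ⊕ ℕ)) :=
  {a | (∃ u ∈ cylV k m, a = .inl u) ∨ ∃ j, j < k ∧ (a = .inr (.inl j) ∨ a = .inr (.inr j))}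

/-- `H_{k,m,f}`: the cycles `w_0 ⋯ w_{k-1}` and `v_0 ⋯ v_{k-1}` are added to the cylinder, with
the edges `{z_i, w_{2i}}`, `{x_i, v_{2i}}`, `{z_{(k+2i+1)/2}, w_{2i+1}}` and
`{x_{(k+2i+1)/2}, v_{2i+1}}`. -/
def hexF (k m : ℕ) : SimpleGraph (hexFV k m) :=
  graphOn (hexFV k m) fun a b =>
    (∃ u v, cylE k u v ∧ a = .inl u ∧ b = .inl v) ∨
    (∃ i, i < k ∧ a = .inr (.inl i) ∧ b = .inr (.inl ((i + 1) % k))) ∨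
    (∃ i, i < k ∧ a = .inr (.inr i) ∧ b = .inr (.inr ((i + 1) % k))) ∨
    (∃ i, i ≤ (k - 1) / 2 ∧ a = .inl (cylZ i) ∧ b = .inr (.inl (2 * i))) ∨
    (∃ i, i ≤ (k - 1) / 2 ∧ a = .inl (cylX m i) ∧ b = .inr (.inr (2 * i))) ∨
    (∃ i, i < (k - 1) / 2 ∧ a = .inl (cylZ ((k + 2 * i + 1) / 2)) ∧
      b = .inr (.inl (2 * i + 1))) ∨
    (∃ i, i < (k - 1) / 2 ∧ a = .inl (cylX m ((k + 2 * i + 1) / 2)) ∧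
      b = .inr (.inr (2 * i + 1)))

/-! ### The Klein bottle forms of `H_{k,m,c}` and `H_{k,m,f}` -/

/-- Edges of the `R × k` grid (`R` even) without `{(2i, 2j + 1), (2i + 1, 2j + 1)}` and
`{(2i + 1, 2j), (2i + 2, 2j)}`, and the edges `{(0, 2i + 1), (R - 1, 2i + 1)}`. -/
def kleinHexE (R : ℕ) (u v : ℕ × ℕ) : Prop :=
  (v.1 = u.1 ∧ v.2 = u.2 + 1) ∨ (v.1 = u.1 + 1 ∧ v.2 = u.2 ∧ Even (u.1 + u.2)) ∨
  (u.1 = 0 ∧ v.1 = R - 1 ∧ v.2 = u.2 ∧ Odd u.2)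

/-- Klein bottle form of `H_{k,m,c}`: the edges `{(i, 0), (2m + 1 - i, k - 1)}` are added. -/
def hexCKlein (k m : ℕ) : SimpleGraph (gridV (2 * m + 2) k) :=
  graphOn (gridV (2 * m + 2) k) fun u v =>
    kleinHexE (2 * m + 2) u v ∨ (u.2 = 0 ∧ v.1 = 2 * m + 1 - u.1 ∧ v.2 = k - 1)

def hexCKleinP (k m : ℕ) : Set (Sym2 (gridV (2 * m + 2) k)) :=
  pairsOn (gridV (2 * m + 2) k) brickP

/-- Klein bottle form of `H_{k,m,f}`: the edges `{(0, 0), (0, k - 1)}` and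
`{(i, 0), (2m + 4 - i, k - 1)}`, `i ≥ 1`, are added. -/
def hexFKlein (k m : ℕ) : SimpleGraph (gridV (2 * m + 4) k) :=
  graphOn (gridV (2 * m + 4) k) fun u v =>
    kleinHexE (2 * m + 4) u v ∨
      (u.2 = 0 ∧ v.1 = (2 * m + 4 - u.1) % (2 * m + 4) ∧ v.2 = k - 1)

/-- The edges `{(i, 0), (i, 1)}, {(i, 2), (i, 3)}, …, {(i, l), (i, l + 1)}` and
`{(i, l + 1), (i, l + 2)}, {(i, l + 3), (i, l + 4)}, …, {(i, k - 2), (i, k - 1)}` of all rows. -/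
def hexFKleinP (k m l : ℕ) : Set (Sym2 (gridV (2 * m + 4) k)) :=
  pairsOn (gridV (2 * m + 4) k) fun u v =>
    v.1 = u.1 ∧ v.2 = u.2 + 1 ∧ ((u.2 ≤ l ∧ Even u.2) ∨ (l + 1 ≤ u.2 ∧ Odd u.2))

/-! ### Hexagonal ladders and the families built on them -/

/-- Vertices of the hexagonal ladder of length `k` and breadth `m`: the `(m + 1) × (2k + m)` grid
without `(j, i)`, `i ≤ m - 2 - j`, and `(j, 2k + i)`, `m + 1 - j ≤ i ≤ m - 1`. -/
def ladV (k m : ℕ) : Set (ℕ × ℕ) :=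
  {v | v.1 ≤ m ∧ v.2 < 2 * k + m ∧ m ≤ v.1 + v.2 + 1 ∧ v.1 + v.2 ≤ 2 * k + m}

/-- Edges of the hexagonal ladder of length `k` and breadth `m`: those of the grid without
`{(i, m - i + 2j), (i + 1, m - i + 2j)}`, `j ≤ k - 1`. -/
def ladE (k m : ℕ) (u v : ℕ × ℕ) : Prop :=
  u ∈ ladV k m ∧ v ∈ ladV k m ∧
    ((v.1 = u.1 ∧ v.2 = u.2 + 1) ∨
      (v.1 = u.1 + 1 ∧ v.2 = u.2 ∧ ¬ ∃ j, j < k ∧ u.1 + u.2 = m + 2 * j))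

/-- Vertices of `H_{k,m,g}`: those of the ladder of length `k` and breadth `m + 1` without
`(m + 1, i)`, `0 ≤ i ≤ 2(k - m) - 3`. -/
def hexGV (k m : ℕ) : Set (ℕ × ℕ) :=
  {v | v ∈ ladV k (m + 1) ∧ ¬ (v.1 = m + 1 ∧ v.2 < 2 * (k - m) - 2)}

/-- `H_{k,m,g}`.  The second and third lines complete the twisted hexagonal cylinder; the last two
lines are the edges `{z_i, w_i}` and `{x_i, v_i}`, `0 ≤ i ≤ m`. -/
def hexG (k m : ℕ) : SimpleGraph (hexGV k m) :=
  graphOn (hexGV k m) fun u v =>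
    ladE k (m + 1) u v ∨
    (u = (0, 2 * k + m) ∧ v = (m + 1, 2 * (k - m - 1))) ∨
    (∃ j, j + m + 2 ≤ k ∧ u = (0, 2 * k + m - (2 * j + 1)) ∧
      v = (m, 2 * (k - m - 1) - (2 * j + 2))) ∨
    (∃ i, i ≤ m ∧ u = (0, m + 2 * i + 1) ∧ v = (i + 1, 2 * k + m - i)) ∨
    (∃ i, i ≤ m ∧ u = (m - i, i) ∧ v = (m + 1, 2 * k - (2 * i + 1)))

/-- The perfect matching of `H_{k,m,g}`. -/
def hexGP (k m : ℕ) : Set (Sym2 (hexGV k m)) :=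
  pairsOn (hexGV k m) fun u v =>
    (∃ j, j < k ∧ u = (0, m + 2 * j) ∧ v = (0, m + 2 * j + 1)) ∨
    (∃ i j, 1 ≤ i ∧ i ≤ m ∧ j ≤ k ∧ u = (i, m - i + 2 * j) ∧ v = (i, m - i + 2 * j + 1)) ∨
    (∃ j, j ≤ m ∧ u = (m + 1, 2 * (k - m) - 1 + 2 * j) ∧ v = (m + 1, 2 * (k - m) + 2 * j)) ∨
    (u = (0, 2 * k + m) ∧ v = (m + 1, 2 * (k - m - 1)))

/-- Vertices of `H_{k,m,h}`: those of the ladder of length `k` and breadth `m`, and two more. -/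
def hexHV (k m : ℕ) : Set (ℕ × ℕ) :=
  {v | v ∈ ladV k m ∨ v = (0, 2 * k + m) ∨ v = (m - k - 1, 3 * k + 2)}

/-- `H_{k,m,h}`.  The lines up to the edges `{(j, 2k + m - j), (k + j + 1, m - k - j - 2)}` form
the twisted hexagonal cylinder; then come the edges `{z_i, x_i}`, `0 ≤ i ≤ k`, the edge
`{v_0, w_0}`, and the edges `{v_{i+1}, w_{i+1}}`, `0 ≤ i ≤ k - 1`. -/
def hexH (k m : ℕ) : SimpleGraph (hexHV k m) :=
  graphOn (hexHV k m) fun u v =>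
    ladE k m u v ∨
    (u = (0, 2 * k + m) ∧ v = (0, 2 * k + m - 1)) ∨
    (u = (0, 2 * k + m) ∧ v = (k + 1, m - k - 2)) ∨
    (u = (m - k - 1, 3 * k + 2) ∧ v = (m - k - 1, 3 * k + 1)) ∨
    (u = (m - k - 1, 3 * k + 2) ∧ v = (m, 0)) ∨
    (∃ j, 1 ≤ j ∧ j ≤ m - k - 2 ∧ u = (j, 2 * k + m - j) ∧ v = (k + j + 1, m - k - j - 2)) ∨
    (∃ i, i ≤ k ∧ u = (0, 2 * k + m - 2 * i) ∧ v = (i, m - (i + 1))) ∨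
    (u = (m - k - 1, 3 * k + 2) ∧ v = (m, 2 * k)) ∨
    (∃ i, i < k ∧ u = (m - k + i, 3 * k - i) ∧ v = (m, 2 * k - (2 * i + 1)))

/-- The perfect matching of `H_{k,m,h}`. -/
def hexHP (k m : ℕ) : Set (Sym2 (hexHV k m)) :=
  pairsOn (hexHV k m) fun u v =>
    (∃ i j, i < m ∧ j ≤ k ∧ u = (i, m - (i + 1) + 2 * j) ∧ v = (i, m - i + 2 * j)) ∨
    (∃ j, j < k ∧ u = (m, 2 * j + 1) ∧ v = (m, 2 * j + 2)) ∨
    (u = (m - k - 1, 3 * k + 2) ∧ v = (m, 0))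

end HexTiling

open HexTiling

namespace HexTiling

/-! ### Contractions that are simple graphs -/

section Contraction

variable {α β W : Type*}

theorem contract_isLink {M : Graph α β} {F : Set β} {e : β}
    {a b : Quot fun x y : α => ∃ e ∈ F, M.IsLink e x y} :
    (contract M F).IsLink e a b ↔
      e ∉ F ∧ ∃ x y, M.IsLink e x y ∧ Quot.mk _ x = a ∧ Quot.mk _ y = b := by
  unfold contract
  simp only [Graph.map_isLink, Relation.Map, Graph.deleteEdges_isLink]
  constructor
  · rintro ⟨x, y, ⟨h, hF⟩, hx, hy⟩
    exact ⟨hF, x, y, h, hx, hy⟩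
  · rintro ⟨hF, x, y, h, hx, hy⟩
    exact ⟨x, y, ⟨h, hF⟩, hx, hy⟩

theorem contract_vertexSet {M : Graph α β} {F : Set β} :
    (contract M F).vertexSet = Quot.mk _ '' M.vertexSet := by
  simp [contract]

/-- Since `G` is irreflexive, preservation of edges already excludes loops; parallel edges are
excluded by `huniq`. What remains is a bijection on vertices under which links and adjacencies
correspond. The map may be arbitrary outside the vertex set. -/
theorem isCopyOf_of_map {N : Graph α β} {G : SimpleGraph W} (g : α → W)
    (hg : ∀ x ∈ N.vertexSet, ∀ y ∈ N.vertexSet, g x = g y → x = y)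
    (hsurj : ∀ w, ∃ x ∈ N.vertexSet, g x = w)
    (hadj : ∀ e x y, N.IsLink e x y → G.Adj (g x) (g y))
    (hadj' : ∀ a b, G.Adj a b → ∃ e x y, N.IsLink e x y ∧ g x = a ∧ g y = b)
    (huniq : ∀ e f x y, N.IsLink e x y → N.IsLink f x y → e = f) : IsCopyOf N G := by
  have hloop : ∀ e x, ¬ N.IsLink e x x := fun e x h => (hadj e x x h).ne rfl
  refine ⟨{ not_isLoopAt := fun e x h => hloop e x h, eq_of_isLink := fun e f x y => huniq e f x y },
    ⟨⟨Equiv.ofBijective (fun v : N.vertexSet => g v) ⟨?_, ?_⟩, ?_⟩⟩⟩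
  · rintro ⟨x, hx⟩ ⟨y, hy⟩ h
    exact Subtype.ext (hg x hx y hy h)
  · intro w
    obtain ⟨x, hx, rfl⟩ := hsurj w
    exact ⟨⟨x, hx⟩, rfl⟩
  · rintro ⟨x, hx⟩ ⟨y, hy⟩
    simp only [Graph.toSimpleGraph_adj]
    constructor
    · intro h
      obtain ⟨e, x', y', hl, h1, h2⟩ := hadj' _ _ h
      obtain rfl := hg _ hl.left_mem _ hx h1
      obtain rfl := hg _ hl.right_mem _ hy h2
      exact ⟨fun h' => h.ne (congrArg (fun v : N.vertexSet => g v) h'), e, hl⟩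
    · rintro ⟨-, e, hl⟩
      exact hadj e _ _ hl

/-- Contracting `F` and deleting `D` gives `G` if there is a map to the vertices of `G` whose
fibres are the classes of vertices that are identified, and under which the remaining edges
correspond to the edges of `G`. -/
theorem isCopyOf_contract {M : Graph α β} {F D : Set β} {G : SimpleGraph W} (f : α → W)
    (hF : ∀ e ∈ F, ∀ x y, M.IsLink e x y → f x = f y)
    (hfib : ∀ x ∈ M.vertexSet, ∀ y ∈ M.vertexSet, f x = f y →
      Relation.EqvGen (fun x y : α => ∃ e ∈ F, M.IsLink e x y) x y)
    (hsurj : ∀ w, ∃ x ∈ M.vertexSet, f x = w)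
    (hadj : ∀ e x y, e ∉ F → e ∉ D → M.IsLink e x y → G.Adj (f x) (f y))
    (hadj' : ∀ a b, G.Adj a b → ∃ e x y, e ∉ F ∧ e ∉ D ∧ M.IsLink e x y ∧ f x = a ∧ f y = b)
    (huniq : ∀ e e' x y x' y', e ∉ F → e ∉ D → e' ∉ F → e' ∉ D → M.IsLink e x y →
      M.IsLink e' x' y' → f x = f x' → f y = f y' → e = e') :
    IsCopyOf ((contract M F).deleteEdges D) G := by
  have hf : ∀ x y, (∃ e ∈ F, M.IsLink e x y) → f x = f y := by
    rintro x y ⟨e, he, hl⟩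
    exact hF e he x y hl
  refine isCopyOf_of_map (Quot.lift f hf) ?_ ?_ ?_ ?_ ?_
  · intro x hx y hy h
    rw [Graph.vertexSet_deleteEdges, contract_vertexSet] at hx hy
    obtain ⟨x, hx, rfl⟩ := hx
    obtain ⟨y, hy, rfl⟩ := hy
    exact Quot.eqvGen_sound (hfib x hx y hy h)
  · intro w
    obtain ⟨x, hx, rfl⟩ := hsurj w
    refine ⟨Quot.mk _ x, ?_, rfl⟩
    rw [Graph.vertexSet_deleteEdges, contract_vertexSet]
    exact ⟨x, hx, rfl⟩
  · intro e x y h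
    rw [Graph.deleteEdges_isLink, contract_isLink] at h
    obtain ⟨⟨heF, x, y, hl, rfl, rfl⟩, heD⟩ := h
    exact hadj e x y heF heD hl
  · intro a b h
    obtain ⟨e, x, y, heF, heD, hl, rfl, rfl⟩ := hadj' a b h
    refine ⟨e, Quot.mk _ x, Quot.mk _ y, ?_, rfl, rfl⟩
    rw [Graph.deleteEdges_isLink, contract_isLink]
    exact ⟨⟨heF, x, y, hl, rfl, rfl⟩, heD⟩
  · intro e e' a b h h'
    rw [Graph.deleteEdges_isLink, contract_isLink] at h h'
    obtain ⟨⟨heF, x, y, hl, hx, hy⟩, heD⟩ := h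
    obtain ⟨⟨heF', x', y', hl', hx', hy'⟩, heD'⟩ := h'
    refine huniq e e' x y x' y' heF heD heF' heD' hl hl' ?_ ?_
    · exact congrArg (Quot.lift f hf) (hx.trans hx'.symm)
    · exact congrArg (Quot.lift f hf) (hy.trans hy'.symm)

/-- If no two edges are parallel, no edge is deleted. -/
theorem IsParallelDeletion.eq_empty {M : Graph α β} {F Q : Set β}
    (hQ : IsParallelDeletion (contract M F) Q) (f : α → W)
    (hF : ∀ e ∈ F, ∀ x y, M.IsLink e x y → f x = f y)
    (huniq : ∀ e e' x y x' y', e ∉ F → e' ∉ F → M.IsLink e x y →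
      M.IsLink e' x' y' → f x = f x' → f y = f y' → e = e') : Q = ∅ := by
  have hf : ∀ x y, (∃ e ∈ F, M.IsLink e x y) → f x = f y := by
    rintro x y ⟨e, he, hl⟩
    exact hF e he x y hl
  refine Set.eq_empty_iff_forall_notMem.2 fun e he => ?_
  -- The survivor `e'` of the class of `e` has the same images under `f`, so it is `e` itself; but a
  -- survivor does not lie in `Q`.
  obtain ⟨e', ⟨⟨-, h2⟩, a, b, hl, hl'⟩, -⟩ := hQ.2 e (hQ.1 he)
  obtain ⟨heF, x, y, hl, hx, hy⟩ := contract_isLink.1 hl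
  obtain ⟨heF', x', y', hl', hx', hy'⟩ := contract_isLink.1 hl'
  have : e = e' := huniq e e' x y x' y' heF heF' hl hl'
    (congrArg (Quot.lift f hf) (hx.trans hx'.symm)) (congrArg (Quot.lift f hf) (hy.trans hy'.symm))
  exact h2 (this ▸ he)

end Contraction

/-! ### Cubic graphs made of rows of bricks -/

/-- A cubic graph whose edges are the edges of its rows (which are cycles: `v` has the row
neighbours `l v` and `r v`) and the edges `{v, z v}`.  The vertex `t v` lies opposite to `v` in the
hexagon through `v` and its row neighbours. -/
structure Brick {V : Type*} (H : SimpleGraph V) where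
  l : V → V
  r : V → V
  z : V → V
  t : V → V
  adj : ∀ u v, H.Adj u v ↔ v = l u ∨ v = r u ∨ v = z u
  lr : ∀ v, l v ≠ r v
  lz : ∀ v, z v ≠ l v
  rz : ∀ v, z v ≠ r v
  row_l : ∀ v, v = l (l v) ∨ v = r (l v)
  row_r : ∀ v, v = l (r v) ∨ v = r (r v)
  zz : ∀ v, z (z v) = v
  zl : ∀ v, z (l v) = l (t v) ∨ z (l v) = r (t v)
  zr : ∀ v, z (r v) = l (t v) ∨ z (r v) = r (t v)
  tri : ∀ v, z (l v) ≠ r v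
  row_inj : ∀ u v, (l u = l v ∧ r u = r v) ∨ (l u = r v ∧ r u = l v) → u = v

namespace Brick

variable {V : Type*} {H : SimpleGraph V} (B : Brick H)

/-- `v` is a row neighbour of `u`. -/
def Row (u v : V) : Prop := v = B.l u ∨ v = B.r u

theorem row_left (u : V) : B.Row u (B.l u) := Or.inl rfl

theorem row_right (u : V) : B.Row u (B.r u) := Or.inr rfl

theorem row_symm {u v : V} (h : B.Row u v) : B.Row v u := by
  rcases h with rfl | rfl
  · exact B.row_l u
  · exact B.row_r u

theorem row_comm {u v : V} : B.Row u v ↔ B.Row v u := ⟨B.row_symm, B.row_symm⟩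

theorem row_adj {u v : V} (h : B.Row u v) : H.Adj u v :=
  (B.adj u v).2 (h.elim Or.inl fun h => Or.inr (Or.inl h))

theorem z_adj (u : V) : H.Adj u (B.z u) := (B.adj u _).2 (Or.inr (Or.inr rfl))

theorem adj_iff {u v : V} : H.Adj u v ↔ B.Row u v ∨ v = B.z u := by
  rw [B.adj, Row, or_assoc]

theorem not_row_self (u : V) : ¬ B.Row u u := fun h => (B.row_adj h).ne rfl

theorem not_row_z (u : V) : ¬ B.Row u (B.z u) := by
  rintro (h | h)
  · exact B.lz u h
  · exact B.rz u h

theorem z_injective {u v : V} (h : B.z u = B.z v) : u = v := by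
  rw [← B.zz u, h, B.zz]

theorem z_row_t {u v : V} (h : B.Row u v) : B.Row (B.t u) (B.z v) := by
  rcases h with rfl | rfl
  · exact B.zl u
  · exact B.zr u

/-- Two different row neighbours are all row neighbours. -/
theorem row_of_two {u a b c : V} (hab : a ≠ b) (ha : B.Row u a) (hb : B.Row u b)
    (hc : B.Row u c) : c = a ∨ c = b := by
  rcases ha with rfl | rfl <;> rcases hb with rfl | rfl <;> rcases hc with rfl | rfl <;> simp_all

/-- This is `row_inj` freed from the distinction between left and right. It excludes rows of length
four. -/
theorem eq_of_rows {u v a b : V} (hab : a ≠ b) (ha : B.Row u a) (hb : B.Row u b)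
    (ha' : B.Row v a) (hb' : B.Row v b) : u = v := by
  apply B.row_inj
  rcases ha with rfl | rfl <;> rcases hb with rfl | rfl <;> rcases ha' with h | h <;>
    rcases hb' with h' | h' <;> simp_all

/-- Applying `z` twice carries the row neighbours of `u` to those of `t (t u)`. As `z` is an
involution, `u` and `t (t u)` share both row neighbours and therefore coincide. -/
theorem tt (u : V) : B.t (B.t u) = u := by
  refine B.eq_of_rows (B.lr u) ?_ ?_ (B.row_left u) (B.row_right u)
  · have h := B.z_row_t (B.z_row_t (B.row_left u))
    rwa [B.zz] at h
  · have h := B.z_row_t (B.z_row_t (B.row_right u))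
    rwa [B.zz] at h

/-- No two row neighbours of a vertex are joined by a further edge. -/
theorem z_ne_of_row {u a b : V} (ha : B.Row u a) (hb : B.Row u b) : B.z a ≠ b := by
  rcases ha with rfl | rfl <;> rcases hb with rfl | rfl
  · exact fun h => (B.z_adj (B.l u)).ne h.symm
  · exact B.tri u
  · exact fun h => B.tri u (by rw [← h, B.zz])
  · exact fun h => (B.z_adj (B.r u)).ne h.symm

theorem t_ne (u : V) : B.t u ≠ u := by
  intro h
  have h1 := B.z_row_t (B.row_left u)
  rw [h] at h1
  exact B.z_ne_of_row (B.row_left u) h1 rfl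

theorem not_row_t (u : V) : ¬ B.Row u (B.t u) := by
  intro h
  have h1 := B.z_row_t (B.row_symm h)
  rw [B.tt] at h1
  exact B.not_row_z u h1

/-- The hexagon through `x` and its row neighbours, given by its set of edges. -/
def hex (x : V) : Set (Sym2 V) :=
  {e | ∃ v, B.Row x v ∧ (e = s(x, v) ∨ e = s(B.t x, B.z v) ∨ e = s(v, B.z v))}

theorem hex_t (x : V) : B.hex (B.t x) = B.hex x := by
  have key : ∀ x, B.hex x ⊆ B.hex (B.t x) := by
    rintro x e ⟨v, hv, h⟩
    refine ⟨B.z v, B.z_row_t hv, ?_⟩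
    rw [B.tt, B.zz]
    rcases h with h | h | h
    · exact Or.inr (Or.inl h)
    · exact Or.inl h
    · exact Or.inr (Or.inr (h.trans Sym2.eq_swap))
  refine Set.Subset.antisymm ?_ (key x)
  have := key (B.t x)
  rwa [B.tt] at this

/-- The only row edges of a hexagon are the four at its two centres; the other two edges belong to
the matching `z`. -/
theorem row_mem_hex {u v x : V} (h : B.Row u v) :
    s(u, v) ∈ B.hex x ↔ (x = u ∨ B.t x = u) ∨ (x = v ∨ B.t x = v) := by
  constructor
  · rintro ⟨w, hw, h' | h' | h'⟩
    · rcases Sym2.eq_iff.1 h' with ⟨rfl, rfl⟩ | ⟨rfl, rfl⟩ <;> simp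
    · rcases Sym2.eq_iff.1 h' with ⟨rfl, rfl⟩ | ⟨rfl, rfl⟩ <;> simp
    · rcases Sym2.eq_iff.1 h' with ⟨rfl, rfl⟩ | ⟨rfl, rfl⟩
      · exact absurd h (B.not_row_z u)
      · exact absurd (B.row_symm h) (B.not_row_z v)
  · have key : ∀ u v, B.Row u v → (x = u ∨ B.t x = u) → s(u, v) ∈ B.hex x := by
      rintro u v h (rfl | rfl)
      · exact ⟨v, h, Or.inl rfl⟩
      · rw [← B.hex_t]; exact ⟨v, h, Or.inl rfl⟩
    rintro (h' | h')
    · exact key u v h h'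
    · rw [Sym2.eq_swap]; exact key v u (B.row_symm h) h'

theorem z_mem_hex {v x : V} : s(v, B.z v) ∈ B.hex x ↔ B.Row x v ∨ B.Row (B.t x) v := by
  constructor
  · rintro ⟨w, hw, h' | h' | h'⟩
    · rcases Sym2.eq_iff.1 h' with ⟨rfl, rfl⟩ | ⟨rfl, h⟩
      · exact absurd hw (B.not_row_z _)
      · exact absurd (B.row_symm (h ▸ hw)) (B.not_row_z _)
    · have hw' := B.z_row_t hw
      rcases Sym2.eq_iff.1 h' with ⟨rfl, h⟩ | ⟨rfl, h⟩
      · exact absurd (h ▸ hw') (B.not_row_z _)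
      · exact absurd (h ▸ B.row_symm hw') (B.not_row_z _)
    · rcases Sym2.eq_iff.1 h' with ⟨rfl, h⟩ | ⟨rfl, h⟩
      · exact Or.inl hw
      · exact Or.inr (B.z_row_t hw)
  · have key : ∀ x, B.Row x v → s(v, B.z v) ∈ B.hex x := fun x h => ⟨v, h, Or.inr (Or.inr rfl)⟩
    rintro (h | h)
    · exact key x h
    · rw [← B.hex_t]; exact key _ h

/-- Two edges of a row that meet at `v` only lie in the hexagon of `v`. -/
theorem eq_of_two_row {u v w x : V} (huw : u ≠ w) (hu : B.Row v u) (hw : B.Row v w)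
    (h1 : s(v, u) ∈ B.hex x) (h2 : s(v, w) ∈ B.hex x) : x = v ∨ B.t x = v := by
  rw [B.row_mem_hex hu] at h1
  rw [B.row_mem_hex hw] at h2
  rcases h1 with h1 | h1
  · exact h1
  rcases h2 with h2 | h2
  · exact h2
  -- If `t u = w`, then `z v` is a row neighbour of `w`, as `v` is, and the three vertices form a
  -- forbidden triangle.
  have key : ∀ u w, B.Row v u → B.Row v w → B.t u ≠ w := by
    rintro u w hu hw rfl
    exact B.z_ne_of_row (B.row_symm hw) (B.z_row_t (B.row_symm hu)) rfl
  rcases h1 with rfl | rfl <;> rcases h2 with h2 | h2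
  · exact absurd h2 huw
  · exact absurd h2 (key _ _ hu hw)
  · subst h2
    exact absurd rfl (key _ _ hw hu)
  · exact absurd h2 huw

/-- Of the two hexagons at the row edge `{v, w}`, the one centred at `v` does not contain the
matching edge at `v`, so only the one centred at `w` is left. -/
theorem eq_of_row_z {v w x : V} (hw : B.Row v w)
    (h1 : s(v, w) ∈ B.hex x) (h2 : s(v, B.z v) ∈ B.hex x) : x = w ∨ B.t x = w := by
  rw [B.row_mem_hex hw] at h1
  rw [B.z_mem_hex] at h2
  rcases h1 with h1 | h1
  · exfalso
    rcases h1 with rfl | rfl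
    · rcases h2 with h2 | h2
      · exact B.not_row_self _ h2
      · exact B.not_row_t _ (B.row_symm h2)
    · rcases h2 with h2 | h2
      · exact B.not_row_t _ h2
      · exact B.not_row_self _ h2
  · exact h1

theorem hex_eq_of {x v : V} (h : x = v ∨ B.t x = v) : B.hex x = B.hex v := by
  rcases h with rfl | rfl
  · rfl
  · rw [B.hex_t]

/-- A hexagon contains both row edges at `y` only if `y` is one of its centres. Cells can therefore
be handled as orbits of `t`. -/
theorem hex_eq_iff {x y : V} : B.hex x = B.hex y ↔ y = x ∨ y = B.t x := by
  constructor
  · intro h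
    have h1 : s(y, B.l y) ∈ B.hex x := h ▸ ⟨B.l y, B.row_left y, Or.inl rfl⟩
    have h2 : s(y, B.r y) ∈ B.hex x := h ▸ ⟨B.r y, B.row_right y, Or.inl rfl⟩
    rcases B.eq_of_two_row (B.lr y) (B.row_left y) (B.row_right y) h1 h2 with h | h
    · exact Or.inl h.symm
    · exact Or.inr h.symm
  · rintro (rfl | rfl)
    · rfl
    · rw [B.hex_t]

theorem isHexagon_hex (x : V) : IsHexagon H (B.hex x) := by
  have hl := B.row_left x
  have hr := B.row_right x
  have hzl := B.z_row_t hl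
  have hzr := B.z_row_t hr
  refine ⟨![x, B.l x, B.z (B.l x), B.t x, B.z (B.r x), B.r x], ?_, ?_, ?_⟩
  -- One inequality for each of the fifteen pairs among the six vertices; `e8` and `e9` rest on the
  -- absence of triangles, `e14` on the injectivity of `z`.
  · have e1 : x ≠ B.l x := (B.row_adj hl).ne
    have e2 : x ≠ B.r x := (B.row_adj hr).ne
    have e3 : x ≠ B.z (B.l x) := fun h => B.not_row_z (B.l x) (by rw [← h]; exact B.row_symm hl)
    have e4 : x ≠ B.z (B.r x) := fun h => B.not_row_z (B.r x) (by rw [← h]; exact B.row_symm hr)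
    have e5 : x ≠ B.t x := (B.t_ne x).symm
    have e6 : B.l x ≠ B.z (B.l x) := (B.z_adj _).ne
    have e7 : B.r x ≠ B.z (B.r x) := (B.z_adj _).ne
    have e8 : B.l x ≠ B.z (B.r x) := (B.z_ne_of_row hr hl).symm
    have e9 : B.r x ≠ B.z (B.l x) := (B.z_ne_of_row hl hr).symm
    have e10 : B.l x ≠ B.t x := fun h => B.not_row_t _ (h ▸ hl)
    have e11 : B.r x ≠ B.t x := fun h => B.not_row_t _ (h ▸ hr)
    have e12 : B.z (B.l x) ≠ B.t x := (B.row_adj hzl).ne.symm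
    have e13 : B.z (B.r x) ≠ B.t x := (B.row_adj hzr).ne.symm
    have e14 : B.z (B.l x) ≠ B.z (B.r x) := fun h => B.lr x (B.z_injective h)
    have e15 := B.lr x
    intro i j h
    fin_cases i <;> fin_cases j <;> first
      | rfl | exact absurd h e1 | exact absurd h e2 | exact absurd h e3 | exact absurd h e4 | exact absurd h e5 | exact absurd h e6 | exact absurd h e7
      | exact absurd h e8 | exact absurd h e9 | exact absurd h e10 | exact absurd h e11 | exact absurd h e12 | exact absurd h e13 | exact absurd h e14 | exact absurd h e15
      | exact absurd h.symm e1 | exact absurd h.symm e2 | exact absurd h.symm e3 | exact absurd h.symm e4 | exact absurd h.symm e5 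
      | exact absurd h.symm e6 | exact absurd h.symm e7 | exact absurd h.symm e8 | exact absurd h.symm e9 | exact absurd h.symm e10 
      | exact absurd h.symm e11 | exact absurd h.symm e12 | exact absurd h.symm e13 | exact absurd h.symm e14 | exact absurd h.symm e15
  · intro i
    fin_cases i
    · exact B.row_adj hl
    · exact B.z_adj _
    · exact (B.row_adj hzl).symm
    · exact B.row_adj hzr
    · exact (B.z_adj _).symm
    · exact (B.row_adj hr).symm
  · ext e
    constructor
    · rintro ⟨v, rfl | rfl, rfl | rfl | rfl⟩
      · exact ⟨0, rfl⟩
      · exact ⟨2, Sym2.eq_swap⟩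
      · exact ⟨1, rfl⟩
      · exact ⟨5, Sym2.eq_swap⟩
      · exact ⟨3, rfl⟩
      · exact ⟨4, Sym2.eq_swap⟩
    · rintro ⟨i, rfl⟩
      fin_cases i
      · exact ⟨_, hl, Or.inl rfl⟩
      · exact ⟨_, hl, Or.inr (Or.inr rfl)⟩
      · exact ⟨_, hl, Or.inr (Or.inl Sym2.eq_swap)⟩
      · exact ⟨_, hr, Or.inr (Or.inl rfl)⟩
      · exact ⟨_, hr, Or.inr (Or.inr Sym2.eq_swap)⟩
      · exact ⟨_, hr, Or.inl Sym2.eq_swap⟩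

/-- A 2-path of two row edges lies only in the hexagon centred at its middle vertex. A 2-path of one
row edge and one matching edge lies only in the hexagon centred at the outer end of its row edge. -/
theorem isCellCollection : IsCellCollection H (Set.range B.hex) := by
  refine ⟨?_, ?_⟩
  · rintro _ ⟨x, rfl⟩
    exact B.isHexagon_hex x
  · intro u v w huv hvw huw
    have key : ∀ x, s(v, u) ∈ B.hex x → s(v, w) ∈ B.hex x →
        (∀ y, s(v, u) ∈ B.hex y → s(v, w) ∈ B.hex y → y = x ∨ B.t y = x) →
        ∃! c, c ∈ Set.range B.hex ∧ s(u, v) ∈ c ∧ s(v, w) ∈ c := by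
      intro x h1 h2 h3
      refine ⟨B.hex x, ⟨⟨x, rfl⟩, by rwa [Sym2.eq_swap], h2⟩, ?_⟩
      rintro _ ⟨⟨y, rfl⟩, h4, h5⟩
      rw [Sym2.eq_swap] at h4
      exact B.hex_eq_of (h3 y h4 h5)
    rcases B.adj_iff.1 huv.symm with hu | rfl <;> rcases B.adj_iff.1 hvw with hw | rfl
    · exact key v ⟨u, hu, Or.inl rfl⟩ ⟨w, hw, Or.inl rfl⟩ fun y => B.eq_of_two_row huw hu hw
    · exact key u ((B.row_mem_hex hu).2 (Or.inr (Or.inl rfl)))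
        (B.z_mem_hex.2 (Or.inl (B.row_symm hu))) fun y => B.eq_of_row_z hu
    · exact key w (B.z_mem_hex.2 (Or.inl (B.row_symm hw)))
        ((B.row_mem_hex hw).2 (Or.inr (Or.inl rfl))) fun y h1 h2 => B.eq_of_row_z hw h2 h1
    · exact absurd rfl huw

/-- The dual edge of `e` joins the hexagons of `x` and `y`. -/
def DualLink (e : Sym2 V) (x y : V) : Prop :=
  (B.Row x y ∧ e = s(x, y)) ∨ ∃ v, e = s(v, B.z v) ∧ B.Row v x ∧ B.Row v y ∧ x ≠ y

theorem dualLink_row {u v : V} (h : B.Row u v) : B.DualLink s(u, v) u v := Or.inl ⟨h, rfl⟩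

theorem dualLink_z (v : V) : B.DualLink s(v, B.z v) (B.l v) (B.r v) :=
  Or.inr ⟨v, rfl, B.row_left v, B.row_right v, B.lr v⟩

theorem DualLink.symm {B : Brick H} {e : Sym2 V} {x y : V} (h : B.DualLink e x y) :
    B.DualLink e y x := by
  rcases h with ⟨h, rfl⟩ | ⟨v, rfl, h1, h2, h3⟩
  · exact Or.inl ⟨B.row_symm h, Sym2.eq_swap⟩
  · exact Or.inr ⟨v, rfl, h2, h1, h3.symm⟩

theorem DualLink.mem_iff {B : Brick H} {e : Sym2 V} {x y w : V} (h : B.DualLink e x y) :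
    e ∈ B.hex w ↔ B.hex w = B.hex x ∨ B.hex w = B.hex y := by
  rw [B.hex_eq_iff, B.hex_eq_iff]
  have ht : ∀ a b, a = B.t b ↔ B.t a = b :=
    fun a b => ⟨fun h => by rw [h, B.tt], fun h => by rw [← h, B.tt]⟩
  rcases h with ⟨h, rfl⟩ | ⟨v, rfl, h1, h2, h3⟩
  · rw [B.row_mem_hex h]
    simp only [eq_comm]
  · rw [B.z_mem_hex, B.row_comm, B.row_comm (u := B.t w)]
    constructor
    · rintro (h | h)
      · rcases B.row_of_two h3 h1 h2 h with rfl | rfl <;> simp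
      · rcases B.row_of_two h3 h1 h2 h with rfl | rfl <;> simp
    · rintro ((rfl | rfl) | (rfl | rfl)) <;> simp [*]

/-- An edge lies in exactly the cells at the two ends of its dual edge. Once one pair of ends is
known from `DualLink`, any other link with the same name is this pair or its reverse. -/
theorem dual_isLink {e : Sym2 V} {c d : Set (Sym2 V)} (he : e ∈ H.edgeSet) :
    (dual (Set.range B.hex)).IsLink e c d ↔
      ∃ x y, B.DualLink e x y ∧ B.hex x = c ∧ B.hex y = d := by
  have hex : ∃ x y, B.DualLink e x y := by
    induction e with | h u v =>
    rcases B.adj_iff.1 he with h | h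
    · exact ⟨u, v, B.dualLink_row h⟩
    · have h : v = B.z u := h
      exact ⟨_, _, h ▸ B.dualLink_z u⟩
  obtain ⟨x, y, hxy⟩ := hex
  constructor
  · rintro ⟨⟨a, rfl⟩, ⟨b, rfl⟩, h⟩
    have ha := hxy.mem_iff.1 ((h _ ⟨a, rfl⟩).2 (Or.inl rfl))
    have hb := hxy.mem_iff.1 ((h _ ⟨b, rfl⟩).2 (Or.inr rfl))
    have hx := (h _ ⟨x, rfl⟩).1 (hxy.mem_iff.2 (Or.inl rfl))
    have hy := (h _ ⟨y, rfl⟩).1 (hxy.mem_iff.2 (Or.inr rfl))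
    rcases ha with ha | ha
    · refine ⟨x, y, hxy, ha.symm, ?_⟩
      rcases hy with hy | hy
      · rcases hb with hb | hb
        · rw [hy, ha, ← hb]
        · exact hb.symm
      · exact hy
    · refine ⟨y, x, hxy.symm, ha.symm, ?_⟩
      rcases hx with hx | hx
      · rcases hb with hb | hb
        · exact hb.symm
        · rw [hx, ha, ← hb]
      · exact hx
  · rintro ⟨a, b, hab, rfl, rfl⟩
    refine ⟨⟨a, rfl⟩, ⟨b, rfl⟩, ?_⟩
    rintro _ ⟨w, rfl⟩
    exact hab.mem_iff

theorem dual_edge_mem {e : Sym2 V} {c d : Set (Sym2 V)}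
    (h : (dual (Set.range B.hex)).IsLink e c d) : e ∈ H.edgeSet := by
  obtain ⟨⟨x, rfl⟩, -, h⟩ := h
  obtain ⟨v, hv, h' | h' | h'⟩ := (h _ ⟨x, rfl⟩).2 (Or.inl rfl)
  · rw [h']; exact B.row_adj hv
  · rw [h']; exact B.row_adj (B.z_row_t hv)
  · rw [h']; exact B.z_adj v

theorem dual_isLink' {e : Sym2 V} {c d : Set (Sym2 V)} :
    (dual (Set.range B.hex)).IsLink e c d ↔
      e ∈ H.edgeSet ∧ ∃ x y, B.DualLink e x y ∧ B.hex x = c ∧ B.hex y = d :=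
  ⟨fun h => ⟨B.dual_edge_mem h, (B.dual_isLink (B.dual_edge_mem h)).1 h⟩,
    fun h => (B.dual_isLink h.1).2 h.2⟩

end Brick

end HexTiling

/-! ### Recognizing contraction and dual of a brick graph by maps on its vertices -/

namespace HexTiling

/-- Under `f`, the edges `e` with ends `x` and `y` such that `L e x y` become the edges of `G`. -/
structure Realizes {β V W : Type*} (L : β → V → V → Prop) (f : V → W) (G : SimpleGraph W) :
    Prop where
  surj : Function.Surjective f
  adj : ∀ e x y, L e x y → G.Adj (f x) (f y)
  lift : ∀ a b, G.Adj a b → ∃ e x y, L e x y ∧ f x = a ∧ f y = b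
  uniq : ∀ e e' x y x' y', L e x y → L e' x' y' → f x = f x' → f y = f y' → e = e'

namespace Brick

variable {V W W' : Type*} {H : SimpleGraph V} (B : Brick H)

theorem DualLink.mem_edgeSet {B : Brick H} {e : Sym2 V} {x y : V} (h : B.DualLink e x y) :
    e ∈ H.edgeSet := by
  rcases h with ⟨h, rfl⟩ | ⟨v, rfl, -⟩
  · exact B.row_adj h
  · exact B.z_adj v

/-- Here `φ` names the vertices of the contraction, and `ψ` the cells. The uniqueness contained in
`h1` means that no two remaining edges are parallel, so the only admissible `Q` is empty and nothing
has to be contracted in the dual. -/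
theorem yields_of_realizes [Nonempty V] {P : Set (Sym2 V)} {G : SimpleGraph W}
    {G' : SimpleGraph W'} (hP : P ⊆ H.edgeSet) (φ : V → W) (ψ : V → W')
    (hφP : ∀ u v, s(u, v) ∈ P → φ u = φ v)
    (hφ : ∀ u v, φ u = φ v → v = u ∨ s(u, v) ∈ P)
    (hψt : ∀ x, ψ (B.t x) = ψ x) (hψ : ∀ x y, ψ x = ψ y → y = x ∨ y = B.t x)
    (h1 : Realizes (fun e x y => e = s(x, y) ∧ H.Adj x y ∧ e ∉ P) φ G)
    (h2 : Realizes (fun e x y => B.DualLink e x y ∧ e ∉ P) ψ G') : Yields H P G G' := by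
  have huniq : ∀ e e' x y x' y', e ∉ P → e' ∉ P → (Graph.ofSimpleGraph H).IsLink e x y →
      (Graph.ofSimpleGraph H).IsLink e' x' y' → φ x = φ x' → φ y = φ y' → e = e' := by
    rintro e e' x y x' y' he he' ⟨rfl, hl⟩ ⟨rfl, hl'⟩ hx hy
    exact h1.uniq _ _ x y x' y' ⟨rfl, hl, he⟩ ⟨rfl, hl', he'⟩ hx hy
  have hF : ∀ e ∈ P, ∀ x y, (Graph.ofSimpleGraph H).IsLink e x y → φ x = φ y := by
    rintro e he x y ⟨rfl, -⟩
    exact hφP x y he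
  refine ⟨hP, ?_, _, B.isCellCollection, ?_⟩
  · intro Q hQ
    obtain rfl := hQ.eq_empty φ hF huniq
    refine isCopyOf_contract φ hF ?_ ?_ ?_ ?_ ?_
    · intro x _ y _ h
      rcases hφ x y h with rfl | h
      · exact Relation.EqvGen.refl _
      · exact Relation.EqvGen.rel _ _ ⟨_, h, rfl, hP h⟩
    · intro w
      obtain ⟨x, rfl⟩ := h1.surj w
      exact ⟨x, Set.mem_univ _, rfl⟩
    · rintro e x y he - ⟨rfl, hl⟩
      exact h1.adj _ x y ⟨rfl, hl, he⟩
    · intro a b h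
      obtain ⟨e, x, y, ⟨rfl, hl, he⟩, rfl, rfl⟩ := h1.lift a b h
      exact ⟨_, x, y, he, Set.notMem_empty _, ⟨rfl, hl⟩, rfl, rfl⟩
    · exact fun e e' x y x' y' he _ he' _ => huniq e e' x y x' y' he he'
  · intro Q hQ
    obtain rfl := hQ.eq_empty φ hF huniq
    have hfac : ψ.FactorsThrough B.hex := by
      intro x y h
      rcases B.hex_eq_iff.1 h with rfl | rfl
      · rfl
      · exact (hψt x).symm
    obtain ⟨v₀⟩ := ‹Nonempty V›
    -- The vertices of the dual are sets of edges. `ψ` descends to them because it agrees on the two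
    -- centres of a cell; the value on sets that are not cells is an arbitrary default.
    set f : Set (Sym2 V) → W' := Function.extend B.hex ψ fun _ => ψ v₀ with hf
    have hfx : ∀ x, f (B.hex x) = ψ x := fun x => hfac.extend_apply _ x
    have key : IsCopyOf ((contract ((dual (Set.range B.hex)).deleteEdges P) ∅).deleteEdges ∅) G' := by
      refine isCopyOf_contract f ?_ ?_ ?_ ?_ ?_ ?_
      · intro e he
        exact absurd he (Set.notMem_empty _)
      · rintro _ ⟨x, rfl⟩ _ ⟨y, rfl⟩ h
        rw [hfx, hfx] at h
        rw [B.hex_eq_iff.2 (hψ x y h)]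
        exact Relation.EqvGen.refl _
      · intro w
        obtain ⟨x, rfl⟩ := h2.surj w
        exact ⟨B.hex x, ⟨x, rfl⟩, hfx x⟩
      · intro e c d _ _ h
        obtain ⟨h, he⟩ := Graph.deleteEdges_isLink _ _ _ _ _ ▸ h
        obtain ⟨-, x, y, hd, rfl, rfl⟩ := B.dual_isLink'.1 h
        rw [hfx, hfx]
        exact h2.adj e x y ⟨hd, he⟩
      · intro a b h
        obtain ⟨e, x, y, ⟨hd, he⟩, rfl, rfl⟩ := h2.lift a b h
        refine ⟨e, B.hex x, B.hex y, Set.notMem_empty _, Set.notMem_empty _, ?_, hfx x, hfx y⟩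
        rw [Graph.deleteEdges_isLink]
        exact ⟨B.dual_isLink'.2 ⟨hd.mem_edgeSet, x, y, hd, rfl, rfl⟩, he⟩
      · intro e e' c d c' d' _ _ _ _ h h' hc hd
        obtain ⟨h, he⟩ := Graph.deleteEdges_isLink _ _ _ _ _ ▸ h
        obtain ⟨h', he'⟩ := Graph.deleteEdges_isLink _ _ _ _ _ ▸ h'
        obtain ⟨-, x, y, hl, rfl, rfl⟩ := B.dual_isLink'.1 h
        obtain ⟨-, x', y', hl', rfl, rfl⟩ := B.dual_isLink'.1 h'
        rw [hfx, hfx] at hc hd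
        exact h2.uniq e e' x y x' y' ⟨hl, he⟩ ⟨hl', he'⟩ hc hd
    rwa [Graph.deleteEdges_empty] at key

/-- The edges `{v, a v}`. -/
def pairs (a : V → V) : Set (Sym2 V) := {e | ∃ v, e = s(v, a v)}

theorem mem_pairs_iff {a : V → V} (haa : ∀ v, a (a v) = v) {u v : V} :
    s(u, v) ∈ pairs a ↔ v = a u := by
  constructor
  · rintro ⟨w, h⟩
    rcases Sym2.eq_iff.1 h with ⟨rfl, rfl⟩ | ⟨rfl, rfl⟩
    · rfl
    · rw [haa]
  · rintro rfl
    exact ⟨u, rfl⟩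

theorem isPerfectMatching_pairs {H : SimpleGraph V} {a : V → V} (haa : ∀ v, a (a v) = v)
    (hadj : ∀ v, H.Adj v (a v)) : IsPerfectMatching H (pairs a) := by
  have key : ∀ u v, v ∈ s(u, a u) → s(u, a u) = s(v, a v) := by
    intro u v h
    rcases Sym2.mem_iff.1 h with rfl | rfl
    · rfl
    · rw [haa, Sym2.eq_swap]
  refine ⟨?_, ?_, fun v => ⟨s(v, a v), ⟨v, rfl⟩, Sym2.mem_mk_left _ _⟩⟩
  · rintro e ⟨v, rfl⟩
    exact hadj v
  · rintro e ⟨u, rfl⟩ f ⟨w, rfl⟩ hne v ⟨h, h'⟩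
    exact hne ((key u v h).trans (key w v h').symm)

/-- A perfect matching `pairs a` that consists of every other edge of the rows; `b v` is the
other row neighbour of `v`. -/
structure RowMatching (a b : V → V) : Prop where
  ab : ∀ v, (a v = B.l v ∧ b v = B.r v) ∨ (a v = B.r v ∧ b v = B.l v)
  aa : ∀ v, a (a v) = v
  bb : ∀ v, b (b v) = v

namespace RowMatching

variable {B} {a b : V → V} (M : B.RowMatching a b)
include M

theorem row_iff {u v : V} : B.Row u v ↔ v = a u ∨ v = b u := by
  unfold Row
  rcases M.ab u with ⟨h1, h2⟩ | ⟨h1, h2⟩ <;> rw [h1, h2]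
  exact or_comm

theorem a_ne_b (u : V) : a u ≠ b u := by
  rcases M.ab u with ⟨h1, h2⟩ | ⟨h1, h2⟩ <;> rw [h1, h2]
  · exact B.lr u
  · exact (B.lr u).symm

theorem isPerfectMatching : IsPerfectMatching H (pairs a) :=
  isPerfectMatching_pairs M.aa fun v => B.row_adj (M.row_iff.2 (Or.inl rfl))

/-- From the class `{v, a v}` four edges leave, to `b v`, `z v`, `b (a v)` and `z (a v)`. The last
four hypotheses, applied at `v` and at `a v`, separate all six pairs of them. -/
theorem realizes_primal {G : SimpleGraph W} (φ : V → W) (hs : Function.Surjective φ)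
    (hφ : ∀ u v, φ u = φ v → v = u ∨ v = a u)
    (hb : ∀ v, G.Adj (φ v) (φ (b v))) (hz : ∀ v, G.Adj (φ v) (φ (B.z v)))
    (hlift : ∀ p q, G.Adj p q →
      ∃ u v, (v = b u ∨ v = B.z u) ∧ ((φ u = p ∧ φ v = q) ∨ (φ u = q ∧ φ v = p)))
    (hbz : ∀ v, φ (b v) ≠ φ (B.z v)) (hbb : ∀ v, φ (b v) ≠ φ (b (a v)))
    (hbaz : ∀ v, φ (b v) ≠ φ (B.z (a v))) (hzz : ∀ v, φ (B.z v) ≠ φ (B.z (a v))) :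
    Realizes (fun e x y => e = s(x, y) ∧ H.Adj x y ∧ e ∉ pairs a) φ G := by
  have hL : ∀ {e x y}, (e = s(x, y) ∧ H.Adj x y ∧ e ∉ pairs a) ↔
      e = s(x, y) ∧ (y = b x ∨ y = B.z x) := by
    intro e x y
    refine and_congr_right ?_
    rintro rfl
    rw [mem_pairs_iff M.aa, B.adj_iff, M.row_iff]
    constructor
    · rintro ⟨(h | h) | h, h'⟩
      · exact absurd h h'
      · exact Or.inl h
      · exact Or.inr h
    · rintro (h | h)
      · exact ⟨Or.inl (Or.inr h), by rw [h]; exact (M.a_ne_b x).symm⟩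
      · refine ⟨Or.inr h, fun h' => ?_⟩
        exact B.not_row_z x (M.row_iff.2 (Or.inl (h ▸ h')))
  have hsymm : ∀ x y, (y = b x ∨ y = B.z x) → (x = b y ∨ x = B.z y) := by
    rintro x y (rfl | rfl)
    · exact Or.inl (M.bb x).symm
    · exact Or.inr (B.zz x).symm
  refine ⟨hs, ?_, ?_, ?_⟩
  · intro e x y h
    rcases (hL.1 h).2 with rfl | rfl
    · exact hb x
    · exact hz x
  · intro p q h
    obtain ⟨u, v, huv, ⟨rfl, rfl⟩ | ⟨rfl, rfl⟩⟩ := hlift p q h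
    · exact ⟨s(u, v), u, v, hL.2 ⟨rfl, huv⟩, rfl, rfl⟩
    · exact ⟨s(v, u), v, u, hL.2 ⟨rfl, hsymm u v huv⟩, rfl, rfl⟩
  · intro e e' x y x' y' h h' hx hy
    obtain ⟨rfl, k⟩ := hL.1 h
    obtain ⟨rfl, k'⟩ := hL.1 h'
    have hbaz' : ∀ v, φ (B.z v) ≠ φ (b (a v)) := fun v h => hbaz (a v) (by rw [M.aa, h])
    rcases hφ x x' hx with rfl | rfl <;> rcases k with rfl | rfl <;> rcases k' with rfl | rfl
    · rfl
    · exact absurd hy (hbz _)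
    · exact absurd hy.symm (hbz _)
    · rfl
    · exact absurd hy (hbb _)
    · exact absurd hy (hbaz _)
    · exact absurd hy (hbaz' _)
    · exact absurd hy (hzz _)

/-- After deletion, the hexagon with centres `v` and `t v` keeps four dual edges: two across the
unmatched row edges at its centres, leading to `b v` and `b (t v)`, and two across the matching
edges at `a v` and `b v`, leading to `b (a v)` and `a (b v)`. The predicate `p` holds at one centre
at least, and it suffices to separate the six pairs there. -/
theorem realizes_dual {G : SimpleGraph W} (ψ : V → W) (hs : Function.Surjective ψ)
    (hψt : ∀ x, ψ (B.t x) = ψ x) (hψ : ∀ x y, ψ x = ψ y → y = x ∨ y = B.t x)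
    (p : V → Prop) (hp : ∀ v, p v ∨ p (B.t v))
    (hb : ∀ v, p v → G.Adj (ψ v) (ψ (b v))) (hbt : ∀ v, p v → G.Adj (ψ v) (ψ (b (B.t v))))
    (hba : ∀ v, p v → G.Adj (ψ v) (ψ (b (a v)))) (hab : ∀ v, p v → G.Adj (ψ v) (ψ (a (b v))))
    (hlift : ∀ p q, G.Adj p q →
      ∃ u v, (v = b u ∨ v = b (a u)) ∧ ((ψ u = p ∧ ψ v = q) ∨ (ψ u = q ∧ ψ v = p)))
    (hbb : ∀ v, p v → ψ (b v) ≠ ψ (b (B.t v))) (hbba : ∀ v, p v → ψ (b v) ≠ ψ (b (a v)))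
    (hbab : ∀ v, p v → ψ (b v) ≠ ψ (a (b v)))
    (hbtba : ∀ v, p v → ψ (b (B.t v)) ≠ ψ (b (a v)))
    (hbtab : ∀ v, p v → ψ (b (B.t v)) ≠ ψ (a (b v)))
    (hbaab : ∀ v, p v → ψ (b (a v)) ≠ ψ (a (b v))) :
    Realizes (fun e x y => B.DualLink e x y ∧ e ∉ pairs a) ψ G := by
  -- If `v` lies between `x` and `y` in a row, then `v` is one of the two row neighbours of `x`, and
  -- `y` is the vertex that follows.
  have hother : ∀ {x y v}, B.Row v x → B.Row v y → x ≠ y →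
      (v = a x ∧ y = b (a x)) ∨ (v = b x ∧ y = a (b x)) := by
    intro x y v h1 h2 h3
    rcases M.row_iff.1 (B.row_symm h1) with rfl | rfl
    · refine Or.inl ⟨rfl, ?_⟩
      rcases M.row_iff.1 h2 with rfl | rfl
      · rw [M.aa] at h3; exact absurd rfl h3
      · rfl
    · refine Or.inr ⟨rfl, ?_⟩
      rcases M.row_iff.1 h2 with rfl | rfl
      · rfl
      · rw [M.bb] at h3; exact absurd rfl h3
  have hL : ∀ {e x y}, (B.DualLink e x y ∧ e ∉ pairs a) ↔ (e = s(x, b x) ∧ y = b x) ∨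
      ∃ v, e = s(v, B.z v) ∧ B.Row v x ∧ B.Row v y ∧ x ≠ y := by
    intro e x y
    constructor
    · rintro ⟨⟨h, rfl⟩ | h, he⟩
      · rw [mem_pairs_iff M.aa] at he
        rcases M.row_iff.1 h with h | rfl
        · exact absurd h he
        · exact Or.inl ⟨rfl, rfl⟩
      · exact Or.inr h
    · rintro (⟨rfl, rfl⟩ | ⟨v, rfl, h⟩)
      · refine ⟨Or.inl ⟨M.row_iff.2 (Or.inr rfl), rfl⟩, ?_⟩
        rw [mem_pairs_iff M.aa]
        exact (M.a_ne_b x).symm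
      · refine ⟨Or.inr ⟨v, rfl, h⟩, ?_⟩
        rw [mem_pairs_iff M.aa]
        exact fun h' => B.not_row_z v (M.row_iff.2 (Or.inl h'))
  -- The same dual edge, described from the other end of the matching edge `{v, z v}` and by the
  -- other centres of the two hexagons. This transfers every claim from a centre where `p` fails to
  -- one where it holds.
  have htr : ∀ {v y}, B.Row v y → B.Row (B.z v) (B.t y) :=
    fun h => B.row_symm (B.z_row_t (B.row_symm h))
  have htne : ∀ {x y}, x ≠ y → B.t x ≠ B.t y := fun {x y} h h' => h (by rw [← B.tt x, h', B.tt])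
  have hd : ∀ x v y, B.Row v x → B.Row v y → x ≠ y → ψ (b x) ≠ ψ y := by
    intro x v y h1 h2 h3
    rcases hp x with hx | hx
    · rcases hother h1 h2 h3 with ⟨-, rfl⟩ | ⟨-, rfl⟩
      · exact hbba x hx
      · exact hbab x hx
    · rw [← hψt y]
      rcases hother (htr h1) (htr h2) (htne h3) with ⟨-, h⟩ | ⟨-, h⟩ <;> rw [h]
      · have := hbtba _ hx
        rwa [B.tt] at this
      · have := hbtab _ hx
        rwa [B.tt] at this
  have hbb' : ∀ x, ψ (b x) ≠ ψ (b (B.t x)) := by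
    intro x
    rcases hp x with hx | hx
    · exact hbb x hx
    · have := (hbb _ hx).symm
      rwa [B.tt] at this
  have hzz' : ∀ x v v' y y', p x → B.Row v x → B.Row v y → x ≠ y → B.Row v' x → B.Row v' y' →
      x ≠ y' → ψ y = ψ y' → v = v' := by
    intro x v v' y y' hx h1 h2 h3 h4 h5 h6 h
    rcases hother h1 h2 h3 with ⟨rfl, rfl⟩ | ⟨rfl, rfl⟩ <;>
      rcases hother h4 h5 h6 with ⟨rfl, rfl⟩ | ⟨rfl, rfl⟩
    · rfl
    · exact absurd h (hbaab x hx)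
    · exact absurd h.symm (hbaab x hx)
    · rfl
  have hzz : ∀ x v v' y y', B.Row v x → B.Row v y → x ≠ y → B.Row v' x → B.Row v' y' → x ≠ y' →
      ψ y = ψ y' → v = v' := by
    intro x v v' y y' h1 h2 h3 h4 h5 h6 h
    rcases hp x with hx | hx
    · exact hzz' x v v' y y' hx h1 h2 h3 h4 h5 h6 h
    · exact B.z_injective (hzz' _ _ _ _ _ hx (htr h1) (htr h2) (htne h3) (htr h4) (htr h5)
        (htne h6) (by rw [hψt, hψt, h]))
  refine ⟨hs, ?_, ?_, ?_⟩
  · intro e x y h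
    rcases hL.1 h with ⟨rfl, rfl⟩ | ⟨v, rfl, h1, h2, h3⟩
    · rcases hp x with hx | hx
      · exact hb x hx
      · have := hbt _ hx
        rwa [hψt, B.tt] at this
    · rcases hp x with hx | hx
      · rcases hother h1 h2 h3 with ⟨-, rfl⟩ | ⟨-, rfl⟩
        · exact hba x hx
        · exact hab x hx
      · rw [← hψt x, ← hψt y]
        rcases hother (htr h1) (htr h2) (htne h3) with ⟨-, h⟩ | ⟨-, h⟩ <;> rw [h]
        · exact hba _ hx
        · exact hab _ hx
  · intro p q h
    have key : ∀ u v, (v = b u ∨ v = b (a u)) →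
        ∃ e, (B.DualLink e u v ∧ e ∉ pairs a) ∧ (B.DualLink e v u ∧ e ∉ pairs a) := by
      rintro u v huv
      suffices ∃ e, B.DualLink e u v ∧ e ∉ pairs a by
        obtain ⟨e, h, he⟩ := this
        exact ⟨e, ⟨h, he⟩, h.symm, he⟩
      rcases huv with rfl | rfl
      · exact ⟨_, hL.2 (Or.inl ⟨rfl, rfl⟩)⟩
      · refine ⟨_, hL.2 (Or.inr ⟨a u, rfl, M.row_iff.2 (Or.inl (M.aa u).symm),
          M.row_iff.2 (Or.inr rfl), fun h' => M.a_ne_b (a u) ?_⟩)⟩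
        rw [← h', M.aa]
    obtain ⟨u, v, huv, ⟨rfl, rfl⟩ | ⟨rfl, rfl⟩⟩ := hlift p q h
    · obtain ⟨e, he, -⟩ := key u v huv
      exact ⟨e, u, v, he, rfl, rfl⟩
    · obtain ⟨e, -, he⟩ := key u v huv
      exact ⟨e, v, u, he, rfl, rfl⟩
  · intro e e' x y x' y' h h' hx hy
    rcases hψ x x' hx with rfl | rfl <;> rcases hL.1 h with ⟨rfl, rfl⟩ | ⟨v, rfl, h1, h2, h3⟩ <;>
      rcases hL.1 h' with ⟨rfl, rfl⟩ | ⟨v', rfl, h1', h2', h3'⟩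
    · rfl
    · exact absurd hy (hd _ _ _ h1' h2' h3')
    · exact absurd hy.symm (hd _ _ _ h1 h2 h3)
    · rw [hzz _ _ _ _ _ h1 h2 h3 h1' h2' h3' hy]
    · exact absurd hy (hbb' x)
    · have h4 := htr h1'
      have h5 := htne h3'
      rw [B.tt] at h4 h5
      exact absurd (hy.trans (hψt y').symm) (hd _ _ _ h4 (htr h2') h5)
    · exact absurd (hy.symm.trans (hψt y).symm) (hd _ _ _ (htr h1) (htr h2) (htne h3))
    · have h4 := htr h1'
      have h5 := htne h3'
      rw [B.tt] at h4 h5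
      rw [hzz _ _ _ _ _ h1 h2 h3 h4 (htr h2') h5 (hy.trans (hψt y').symm), B.zz, Sym2.eq_swap]

end RowMatching

theorem isPerfectMatching_z : IsPerfectMatching H (pairs B.z) :=
  isPerfectMatching_pairs B.zz B.z_adj

/-- `σ` exchanges the vertices in a fibre of `φ`; it will be `z`. Parallel row edges would start
either at the same vertex, which `hlr` excludes, or at the two vertices of a fibre, which `hσ`
excludes. -/
theorem realizes_rows {G : SimpleGraph W} (σ : V → V) (φ : V → W) (hs : Function.Surjective φ)
    (hφ : ∀ u v, φ u = φ v → v = u ∨ v = σ u)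
    (hl : ∀ v, G.Adj (φ v) (φ (B.l v))) (hr : ∀ v, G.Adj (φ v) (φ (B.r v)))
    (hlift : ∀ p q, G.Adj p q →
      ∃ u v, B.Row u v ∧ ((φ u = p ∧ φ v = q) ∨ (φ u = q ∧ φ v = p)))
    (hlr : ∀ v, φ (B.l v) ≠ φ (B.r v))
    (hσ : ∀ u v w, B.Row u v → B.Row (σ u) w → φ v ≠ φ w) :
    Realizes (fun e x y => e = s(x, y) ∧ B.Row x y) φ G := by
  refine ⟨hs, ?_, ?_, ?_⟩
  · rintro e x y ⟨rfl, rfl | rfl⟩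
    · exact hl x
    · exact hr x
  · intro p q h
    obtain ⟨u, v, huv, ⟨rfl, rfl⟩ | ⟨rfl, rfl⟩⟩ := hlift p q h
    · exact ⟨_, u, v, ⟨rfl, huv⟩, rfl, rfl⟩
    · exact ⟨_, v, u, ⟨rfl, B.row_symm huv⟩, rfl, rfl⟩
  · rintro e e' x y x' y' ⟨rfl, h⟩ ⟨rfl, h'⟩ hx hy
    rcases hφ x x' hx with rfl | rfl
    · rcases h with rfl | rfl <;> rcases h' with rfl | rfl
      · rfl
      · exact absurd hy (hlr _)
      · exact absurd hy.symm (hlr _)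
      · rfl
    · exact absurd hy (hσ x y y' h h')

/-- If `n` is an automorphism of the rows that takes `t` to `z`, then contracting all edges
`{v, z v}` gives, and dually gives, the same graph. -/
theorem yields_z [Nonempty V] {G : SimpleGraph W} (φ : V → W)
    (hφz : ∀ v, φ (B.z v) = φ v) (hφ : ∀ u v, φ u = φ v → v = u ∨ v = B.z u)
    (h1 : Realizes (fun e x y => e = s(x, y) ∧ B.Row x y) φ G)
    (n : V → V) (hn : Function.Bijective n) (hrow : ∀ u v, B.Row u v → B.Row (n u) (n v))
    (hnt : ∀ v, n (B.t v) = B.z (n v)) : Yields H (pairs B.z) G G := by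
  -- The row neighbours of `u` have two different images, which exhaust the row neighbours of `n u`.
  have hrow' : ∀ u v, B.Row (n u) (n v) → B.Row u v := by
    intro u v h
    rcases B.row_of_two (fun h => B.lr u (hn.1 h)) (hrow u _ (B.row_left u))
      (hrow u _ (B.row_right u)) h with h | h
    · exact hn.1 h ▸ B.row_left u
    · exact hn.1 h ▸ B.row_right u
  refine B.yields_of_realizes (fun e ⟨v, he⟩ => he ▸ B.z_adj v) φ (φ ∘ n) ?_ ?_ ?_ ?_ ?_ ?_
  · intro u v h
    rw [(mem_pairs_iff B.zz).1 h, hφz]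
  · intro u v h
    rw [mem_pairs_iff B.zz]
    exact hφ u v h
  · intro x
    simp only [Function.comp, hnt, hφz]
  · intro x y h
    rcases hφ _ _ h with h | h
    · exact Or.inl (hn.1 h)
    · exact Or.inr (hn.1 (h.trans (hnt x).symm))
  · convert h1 using 4 with e x y
    refine ⟨?_, ?_⟩
    · rintro ⟨rfl, h, he⟩
      rw [mem_pairs_iff B.zz] at he
      exact ⟨rfl, (B.adj_iff.1 h).resolve_right he⟩
    · rintro ⟨rfl, h⟩
      rw [mem_pairs_iff B.zz]
      exact ⟨rfl, B.row_adj h, fun h' => B.not_row_z x (h' ▸ h)⟩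
  · have hL : ∀ {e x y}, (B.DualLink e x y ∧ e ∉ pairs B.z) ↔ e = s(x, y) ∧ B.Row x y := by
      intro e x y
      constructor
      · rintro ⟨⟨h, rfl⟩ | ⟨v, rfl, -⟩, he⟩
        · exact ⟨rfl, h⟩
        · exact absurd ⟨v, rfl⟩ he
      · rintro ⟨rfl, h⟩
        refine ⟨Or.inl ⟨h, rfl⟩, ?_⟩
        rw [mem_pairs_iff B.zz]
        exact fun h' => B.not_row_z x (h' ▸ h)
    refine ⟨h1.surj.comp hn.2, ?_, ?_, ?_⟩
    · intro e x y h
      exact h1.adj _ _ _ ⟨rfl, hrow x y (hL.1 h).2⟩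
    · intro p q h
      obtain ⟨e, x, y, ⟨rfl, k⟩, rfl, rfl⟩ := h1.lift p q h
      obtain ⟨x, rfl⟩ := hn.2 x
      obtain ⟨y, rfl⟩ := hn.2 y
      exact ⟨s(x, y), x, y, hL.2 ⟨rfl, hrow' x y k⟩, rfl, rfl⟩
    · intro e e' x y x' y' h h' hx hy
      obtain ⟨rfl, k⟩ := hL.1 h
      obtain ⟨rfl, k'⟩ := hL.1 h'
      have := h1.uniq _ _ _ _ _ _ ⟨rfl, hrow x y k⟩ ⟨rfl, hrow x' y' k'⟩ hx hy
      exact Sym2.map.injective hn.1 (by simpa using this)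

end Brick

/-! ### Replacing the resulting graphs by isomorphic ones -/

theorem IsCopyOf.trans_iso {α β W W' : Type*} {M : Graph α β} {G : SimpleGraph W}
    {G' : SimpleGraph W'} (h : IsCopyOf M G) (e : G ≃g G') : IsCopyOf M G' :=
  ⟨h.1, h.2.map fun f => f.trans e⟩

theorem Yields.trans_iso {V W₁ W₂ W₃ W₄ : Type*} {H : SimpleGraph V} {P : Set (Sym2 V)}
    {G₁ : SimpleGraph W₁} {G₂ : SimpleGraph W₂} {G₃ : SimpleGraph W₃} {G₄ : SimpleGraph W₄}
    (h : Yields H P G₁ G₂) (e : G₁ ≃g G₃) (e' : G₂ ≃g G₄) : Yields H P G₃ G₄ := by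
  obtain ⟨hP, h1, C, hC, h2⟩ := h
  exact ⟨hP, fun Q hQ => (h1 Q hQ).trans_iso e, C, hC, fun Q hQ => (h2 Q hQ).trans_iso e'⟩

end HexTiling

namespace HexTiling

/-! ### The seam of a closed hexagonal cylinder -/

/-- How the last row of a hexagonal cylinder is glued to the first row: going up from column `c`
of row `m` one arrives in column `up c` of row `0`. -/
structure Seam (k m : ℕ) where
  up : ℕ → ℕ
  down : ℕ → ℕ
  up_lt : ∀ c, c < 2 * k → up c < 2 * k
  down_lt : ∀ c, c < 2 * k → down c < 2 * k
  down_up : ∀ c, c < 2 * k → down (up c) = c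
  up_down : ∀ c, c < 2 * k → up (down c) = c
  parity : ∀ c, c < 2 * k → (up c + c + m) % 2 = 1
  step : ∀ c, c + 1 < 2 * k → up (c + 1) = up c + 1 ∨ up c = up (c + 1) + 1 ∨
    (up c = 0 ∧ up (c + 1) = 2 * k - 1) ∨ (up (c + 1) = 0 ∧ up c = 2 * k - 1)
  step_zero : up 0 = up (2 * k - 1) + 1 ∨ up (2 * k - 1) = up 0 + 1 ∨
    (up 0 = 0 ∧ up (2 * k - 1) = 2 * k - 1) ∨ (up (2 * k - 1) = 0 ∧ up 0 = 2 * k - 1)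

namespace Seam

variable {k m : ℕ} (S : Seam k m)

/-- The graph with the edges between `(0, 2j)` and the column that the seam joins to it. -/
def graph : SimpleGraph (cylV k m) :=
  graphOn (cylV k m) fun u v =>
    cylE k u v ∨ (u.1 = 0 ∧ Even u.2 ∧ v.1 = m ∧ v.2 = S.down u.2)

def left (v : cylV k m) : cylV k m :=
  ⟨(v.1.1, if v.1.2 = 0 then 2 * k - 1 else v.1.2 - 1), by
    obtain ⟨⟨i, c⟩, h1, h2⟩ := v
    refine ⟨h1, ?_⟩
    dsimp only at *
    split_ifs <;> omega⟩

def right (v : cylV k m) : cylV k m :=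
  ⟨(v.1.1, if v.1.2 + 1 = 2 * k then 0 else v.1.2 + 1), by
    obtain ⟨⟨i, c⟩, h1, h2⟩ := v
    refine ⟨h1, ?_⟩
    dsimp only at *
    split_ifs <;> omega⟩

def above (v : cylV k m) : cylV k m :=
  ⟨(if v.1.1 < m then v.1.1 + 1 else 0, if v.1.1 < m then v.1.2 else S.up v.1.2), by
    obtain ⟨⟨i, c⟩, h1, h2⟩ := v
    have := S.up_lt c h2
    dsimp only at *
    constructor <;> dsimp only <;> split_ifs <;> omega⟩

def below (v : cylV k m) : cylV k m :=
  ⟨(if 0 < v.1.1 then v.1.1 - 1 else m, if 0 < v.1.1 then v.1.2 else S.down v.1.2), by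
    obtain ⟨⟨i, c⟩, h1, h2⟩ := v
    have := S.down_lt c h2
    dsimp only at *
    constructor <;> dsimp only <;> split_ifs <;> omega⟩

def IsOdd (v : cylV k m) : Prop := (v.1.1 + v.1.2) % 2 = 1

instance (v : cylV k m) : Decidable (IsOdd v) := inferInstanceAs (Decidable (_ = _))

def vert (v : cylV k m) : cylV k m := if IsOdd v then S.above v else S.below v

/-- The row neighbours of `v` have the other parity, so their vertical edges point to the side on
which `v` has none. The hexagon centred at `v` lies on that side, with its second centre straight
across. -/
def opp (v : cylV k m) : cylV k m := if IsOdd v then S.below v else S.above v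

theorem left_right (v : cylV k m) : left (right v) = v := by
  obtain ⟨⟨i, c⟩, hv⟩ := v
  have h2 : c < 2 * k := hv.2
  simp only [left, right, Subtype.ext_iff, Prod.ext_iff, true_and]
  by_cases hc : c + 1 = 2 * k
  · simp only [hc, if_true]
    omega
  · simp [hc]

theorem right_left (v : cylV k m) : right (left v) = v := by
  obtain ⟨⟨i, c⟩, hv⟩ := v
  have h2 : c < 2 * k := hv.2
  simp only [left, right, Subtype.ext_iff, Prod.ext_iff, true_and]
  by_cases hc : c = 0 <;> simp only [hc, if_true, if_false] <;> split_ifs <;> omega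

theorem above_below (v : cylV k m) : S.above (S.below v) = v := by
  obtain ⟨⟨i, c⟩, hv⟩ := v
  have h1 : i ≤ m := hv.1
  have := S.up_down c hv.2
  simp only [above, below, Subtype.ext_iff, Prod.ext_iff]
  by_cases hi : 0 < i <;> simp only [hi, if_true, if_false] <;> split_ifs <;> omega

theorem below_above (v : cylV k m) : S.below (S.above v) = v := by
  obtain ⟨⟨i, c⟩, hv⟩ := v
  have h1 : i ≤ m := hv.1
  have := S.down_up c hv.2
  simp only [above, below, Subtype.ext_iff, Prod.ext_iff]
  by_cases hi : i < m <;> simp only [hi, if_true, if_false] <;> split_ifs <;> omega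

theorem isOdd_left (v : cylV k m) : IsOdd (left v) ↔ ¬ IsOdd v := by
  obtain ⟨⟨i, c⟩, hv⟩ := v
  have h2 : c < 2 * k := hv.2
  simp only [left, IsOdd]
  split_ifs <;> omega

theorem isOdd_right (v : cylV k m) : IsOdd (right v) ↔ ¬ IsOdd v := by
  have h := isOdd_left (right v)
  rw [left_right] at h
  tauto

theorem isOdd_above (v : cylV k m) : IsOdd (S.above v) ↔ ¬ IsOdd v := by
  obtain ⟨⟨i, c⟩, hv⟩ := v
  have h1 : i ≤ m := hv.1
  have := S.parity c hv.2
  simp only [above, IsOdd]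
  split_ifs <;> omega

theorem isOdd_below (v : cylV k m) : IsOdd (S.below v) ↔ ¬ IsOdd v := by
  have h := S.isOdd_above (S.below v)
  rw [S.above_below] at h
  tauto

/-- Inside the cylinder going up commutes with going right. Only the seam can exchange right and
left, when it is a reflection. -/
theorem above_right (v : cylV k m) :
    S.above (right v) = right (S.above v) ∨ S.above (right v) = left (S.above v) := by
  obtain ⟨⟨i, c⟩, hv⟩ := v
  have h2 : c < 2 * k := hv.2
  have e1 := S.step c
  have e2 := S.step_zero
  have e3 := S.up_lt c h2
  have e4 := S.up_lt (c + 1)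
  have e5 := S.up_lt 0
  simp only [above, right, left, Subtype.ext_iff, Prod.ext_iff]
  by_cases hi : i < m
  · simp [hi]
  · simp only [hi, if_false, true_and]
    by_cases hc : c + 1 = 2 * k
    · obtain rfl : c = 2 * k - 1 := by omega
      simp only [hc, if_true]
      split_ifs <;> omega
    · simp only [hc, if_false]
      split_ifs <;> omega

theorem above_left (v : cylV k m) :
    S.above (left v) = right (S.above v) ∨ S.above (left v) = left (S.above v) := by
  have h := S.above_right (left v)
  rw [right_left] at h
  rcases h with h | h
  · right; rw [h, left_right]
  · left; rw [h, right_left]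

theorem row_iff (u v : cylV k m) :
    v = left u ∨ v = right u ↔
      ((v.1.1 = u.1.1 ∧ v.1.2 = u.1.2 + 1) ∨ (v.1.1 = u.1.1 ∧ u.1.2 = 0 ∧ v.1.2 = 2 * k - 1)) ∨
      ((u.1.1 = v.1.1 ∧ u.1.2 = v.1.2 + 1) ∨ (u.1.1 = v.1.1 ∧ v.1.2 = 0 ∧ u.1.2 = 2 * k - 1)) := by
  obtain ⟨⟨i, c⟩, hu⟩ := u
  obtain ⟨⟨i', c'⟩, hv⟩ := v
  have h2 : c < 2 * k := hu.2
  have h2' : c' < 2 * k := hv.2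
  simp only [left, right, Subtype.ext_iff, Prod.ext_iff]
  split_ifs <;> omega

theorem vert_iff (u v : cylV k m) :
    v = S.vert u ↔
      ((v.1.1 = u.1.1 + 1 ∧ v.1.2 = u.1.2 ∧ (u.1.1 + u.1.2) % 2 = 1) ∨
        (u.1.1 = 0 ∧ u.1.2 % 2 = 0 ∧ v.1.1 = m ∧ v.1.2 = S.down u.1.2)) ∨
      ((u.1.1 = v.1.1 + 1 ∧ u.1.2 = v.1.2 ∧ (v.1.1 + v.1.2) % 2 = 1) ∨
        (v.1.1 = 0 ∧ v.1.2 % 2 = 0 ∧ u.1.1 = m ∧ u.1.2 = S.down v.1.2)) := by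
  obtain ⟨⟨i, c⟩, hu⟩ := u
  obtain ⟨⟨i', c'⟩, hv⟩ := v
  have h1 : i ≤ m := hu.1
  have h2 : c < 2 * k := hu.2
  have h1' : i' ≤ m := hv.1
  have h2' : c' < 2 * k := hv.2
  have e1 := S.parity c h2
  have e2 : c = S.down c' ↔ S.up c = c' :=
    ⟨fun h => h ▸ S.up_down c' h2', fun h => h ▸ (S.down_up c h2).symm⟩
  simp only [vert, above, below, IsOdd, apply_ite Subtype.val, Subtype.ext_iff, Prod.ext_iff, e2,
    apply_ite Prod.fst, apply_ite Prod.snd]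
  split_ifs <;> omega

theorem isOdd_vert (v : cylV k m) : IsOdd (S.vert v) ↔ ¬ IsOdd v := by
  unfold vert
  split_ifs
  · exact S.isOdd_above v
  · exact S.isOdd_below v

theorem graph_adj (u v : cylV k m) :
    S.graph.Adj u v ↔ v = left u ∨ v = right u ∨ v = S.vert u := by
  have h1 : left u ≠ u := fun h => iff_not_self (h ▸ isOdd_left u)
  have h2 : right u ≠ u := fun h => iff_not_self (h ▸ isOdd_right u)
  have h3 : S.vert u ≠ u := fun h => iff_not_self (h ▸ S.isOdd_vert u)
  have key : S.graph.Adj u v ↔ u ≠ v ∧ (v = left u ∨ v = right u ∨ v = S.vert u) := by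
    rw [← or_assoc, row_iff, vert_iff]
    simp only [graph, graphOn, SimpleGraph.fromRel_adj, cylE, Nat.even_iff, Nat.odd_iff]
    refine and_congr_right fun _ => ?_
    exact iff_of_eq (by ac_rfl)
  rw [key]
  refine and_iff_right_of_imp ?_
  rintro (rfl | rfl | rfl)
  · exact h1.symm
  · exact h2.symm
  · exact h3.symm

theorem left_injective : Function.Injective (left : cylV k m → cylV k m) :=
  fun u v h => by rw [← right_left u, h, right_left]

theorem above_injective : Function.Injective S.above :=
  fun u v h => by rw [← S.below_above u, h, S.below_above]

theorem left_ne_right (hk : 2 ≤ k) (v : cylV k m) : left v ≠ right v := by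
  have h2 : v.1.2 < 2 * k := v.2.2
  simp only [left, right, ne_eq, Subtype.ext_iff, Prod.ext_iff]
  split_ifs <;> omega

/-- The two vertices are four steps apart on a cycle of `2 * k ≥ 6` vertices. -/
theorem right_right_ne (hk : 3 ≤ k) (v : cylV k m) : right (right v) ≠ left (left v) := by
  have h2 : v.1.2 < 2 * k := v.2.2
  simp only [left, right, ne_eq, Subtype.ext_iff, Prod.ext_iff, true_and]
  by_cases h0 : v.1.2 = 0
  · simp only [h0, if_true]
    split_ifs <;> omega
  · by_cases h1 : v.1.2 + 1 = 2 * k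
    · simp only [h0, h1, if_true, if_false]
      split_ifs <;> omega
    · simp only [h0, h1, if_false]
      split_ifs <;> omega

theorem row_above (hk : 2 ≤ k) (v : cylV k m) :
    (left (S.above v) = S.above (left v) ∨ left (S.above v) = S.above (right v)) ∧
      (right (S.above v) = S.above (left v) ∨ right (S.above v) = S.above (right v)) := by
  have h := fun h => left_ne_right hk v (S.above_injective h)
  have h' := left_ne_right hk (S.above v)
  rcases S.above_left v with h1 | h1 <;> rcases S.above_right v with h2 | h2 <;>
    rw [h1, h2] at h ⊢ <;> simp at h ⊢

theorem row_below (hk : 2 ≤ k) (v : cylV k m) :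
    (S.below (left v) = left (S.below v) ∨ S.below (left v) = right (S.below v)) ∧
      (S.below (right v) = left (S.below v) ∨ S.below (right v) = right (S.below v)) := by
  have h := S.row_above hk (S.below v)
  rw [S.above_below] at h
  rcases h with ⟨h1 | h1, h2 | h2⟩ <;> rw [h1, h2] <;> simp [S.below_above]

theorem vert_vert (v : cylV k m) : S.vert (S.vert v) = v := by
  by_cases h : IsOdd v
  · have h' : ¬ IsOdd (S.above v) := by rw [isOdd_above]; exact not_not.2 h
    simp only [vert, h, h', if_true, if_false, S.below_above]
  · have h' : IsOdd (S.below v) := by rw [isOdd_below]; exact h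
    simp only [vert, h, h', if_true, if_false, S.above_below]

/-- The bricks of a closed hexagonal cylinder. -/
def brick (hk : 3 ≤ k) (hz : ∀ v, S.vert v ≠ left v ∧ S.vert v ≠ right v) : Brick S.graph where
  l := left
  r := right
  z := S.vert
  t := S.opp
  adj := S.graph_adj
  lr := left_ne_right (by omega)
  lz v := (hz v).1
  rz v := (hz v).2
  row_l v := Or.inr (right_left v).symm
  row_r v := Or.inl (left_right v).symm
  zz := S.vert_vert
  zl v := by
    by_cases h : IsOdd v
    · simp only [vert, opp, isOdd_left, h, not_true, if_true, if_false]
      exact (S.row_below (by omega) v).1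
    · simp only [vert, opp, isOdd_left, h, not_false_iff, if_true, if_false]
      exact (S.above_left v).symm
  zr v := by
    by_cases h : IsOdd v
    · simp only [vert, opp, isOdd_right, h, not_true, if_true, if_false]
      exact (S.row_below (by omega) v).2
    · simp only [vert, opp, isOdd_right, h, not_false_iff, if_true, if_false]
      exact (S.above_right v).symm
  -- A vertical edge changes the parity, but `left v` and `right v` have the same parity.
  tri v h := by
    have h1 := S.isOdd_vert (left v)
    rw [h, isOdd_right, isOdd_left] at h1
    tauto
  row_inj u v := by
    rintro (⟨h, -⟩ | ⟨h1, h2⟩)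
    · exact left_injective h
    · exfalso
      refine right_right_ne hk v ?_
      rw [← h1, right_left, ← h2, left_right]

end Seam
end HexTiling

/-! ### Contracting every other row edge of a closed cylinder -/

namespace HexTiling

/-- The cylinder grid, closed by the edges `{(j, 0), (g j, q - 1)}`. -/
def gridTwist (p q : ℕ) (g : ℕ → ℕ) : SimpleGraph (gridV p q) :=
  graphOn (gridV p q) fun u v =>
    gridE u v ∨ sideE p u v ∨ (u.2 = 0 ∧ v.1 = g u.1 ∧ v.2 = q - 1)

theorem graphOn_adj {α : Type*} {S : Set α} {E : α → α → Prop} {u v : S} :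
    (graphOn S E).Adj u v ↔ u ≠ v ∧ (E u v ∨ E v u) := Iff.rfl

/-- An adjacency of `graphOn S E` comes from a pair with `E`, in one of the two orders. -/
theorem exists_of_graphOn_adj {α V : Type*} {S : Set α} {E : α → α → Prop} {R : V → V → Prop}
    {f : V → S} (h : ∀ p q : S, p ≠ q → E p q → ∃ u v, R u v ∧
      ((f u = p ∧ f v = q) ∨ (f u = q ∧ f v = p))) (p q : S) (hpq : (graphOn S E).Adj p q) :
    ∃ u v, R u v ∧ ((f u = p ∧ f v = q) ∨ (f u = q ∧ f v = p)) := by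
  rcases hpq with ⟨hne, hE | hE⟩
  · exact h p q hne hE
  · obtain ⟨u, v, huv, h'⟩ := h q p hne.symm hE
    exact ⟨u, v, huv, h'.symm⟩

namespace Seam

variable {k m : ℕ} (S : Seam k m)

/-- The partner of `v` in the matching of the edges `{(i, 2j), (i, 2j + 1)}`. -/
def mate (v : cylV k m) : cylV k m := if v.1.2 % 2 = 0 then right v else left v

def other (v : cylV k m) : cylV k m := if v.1.2 % 2 = 0 then left v else right v

theorem mate_mate (v : cylV k m) : mate (mate v) = v := by
  have h2 : v.1.2 < 2 * k := v.2.2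
  by_cases h : v.1.2 % 2 = 0
  · have h' : ¬ (right v).1.2 % 2 = 0 := by simp only [right]; split_ifs <;> omega
    simp only [mate, h, h', if_true, if_false, left_right]
  · have h' : (left v).1.2 % 2 = 0 := by simp only [left]; split_ifs <;> omega
    simp only [mate, h, h', if_true, if_false, right_left]

theorem other_other (v : cylV k m) : other (other v) = v := by
  have h2 : v.1.2 < 2 * k := v.2.2
  by_cases h : v.1.2 % 2 = 0
  · have h' : ¬ (left v).1.2 % 2 = 0 := by simp only [left]; split_ifs <;> omega
    simp only [other, h, h', if_true, if_false, right_left]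
  · have h' : (right v).1.2 % 2 = 0 := by simp only [right]; split_ifs <;> omega
    simp only [other, h, h', if_true, if_false, left_right]

theorem rowMatching (hk : 3 ≤ k) (hz : ∀ v, S.vert v ≠ left v ∧ S.vert v ≠ right v) :
    (S.brick hk hz).RowMatching mate other where
  ab v := by
    by_cases h : v.1.2 % 2 = 0
    · right; simp only [mate, other, h, if_true]; exact ⟨rfl, rfl⟩
    · left; simp only [mate, other, h, if_false]; exact ⟨rfl, rfl⟩
  aa := mate_mate
  bb := other_other

theorem mate_val (v : cylV k m) :
    (mate v).1 = (v.1.1, if v.1.2 % 2 = 0 then v.1.2 + 1 else v.1.2 - 1) := by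
  have h2 : v.1.2 < 2 * k := v.2.2
  simp only [mate, left, right]
  split_ifs <;> simp only [Prod.ext_iff] <;> omega

theorem cylP_eq : cylP k m = Brick.pairs mate := by
  ext e
  constructor
  · rintro ⟨u, v, ⟨h1, h2, h3⟩, rfl⟩
    refine ⟨u, ?_⟩
    rw [Nat.even_iff] at h3
    have h : v = mate u := by
      simp only [Subtype.ext_iff, Prod.ext_iff, mate_val, h1, h2, h3, if_true, and_self]
    rw [h]
  · rintro ⟨u, rfl⟩
    by_cases h : u.1.2 % 2 = 0
    · refine ⟨u, mate u, ⟨?_, ?_, Nat.even_iff.2 h⟩, rfl⟩ <;> simp only [mate_val, h, if_true]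
    · refine ⟨mate u, u, ⟨?_, ?_, Nat.even_iff.2 ?_⟩, Sym2.eq_swap⟩ <;>
        simp only [mate_val, h, if_false] <;> omega

def pairIdx (v : cylV k m) : gridV k (m + 1) :=
  ⟨(v.1.2 / 2, v.1.1), by
    have h1 : v.1.1 ≤ m := v.2.1
    have h2 : v.1.2 < 2 * k := v.2.2
    constructor <;> dsimp only <;> omega⟩

/-- The centre of the hexagon around `v` that lies in the lower one of its two rows. -/
def low (v : cylV k m) : cylV k m := if IsOdd v then S.below v else v

/-- Rounding up makes the columns of hexagons run straight in the dual. A lower centre has even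
column `2 * j` in an even row and odd column `2 * j - 1` in an odd row; both get the index `j`, and
consecutive ones are separated by an unmatched row edge between the columns `2 * j - 1` and `2 * j`.
The column `2 * k - 1` would round up to `k`, which means `0`. -/
def hexIdx (v : cylV k m) : gridV k (m + 1) :=
  ⟨(if (S.low v).1.2 + 1 = 2 * k then 0 else ((S.low v).1.2 + 1) / 2, (S.low v).1.1), by
    have h1 : (S.low v).1.1 ≤ m := (S.low v).2.1
    have h2 : (S.low v).1.2 < 2 * k := (S.low v).2.2
    constructor <;> dsimp only
    · split_ifs <;> omega
    · omega⟩

/-- No two edges become parallel when the matching is contracted, or deleted in the dual. -/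
structure Separated : Prop where
  left : ∀ v, S.vert v ≠ left v
  right : ∀ v, S.vert v ≠ right v
  other_vert : ∀ v, pairIdx (other v) ≠ pairIdx (S.vert v)
  other_vert_mate : ∀ v, pairIdx (other v) ≠ pairIdx (S.vert (mate v))
  vert_vert_mate : ∀ v, pairIdx (S.vert v) ≠ pairIdx (S.vert (mate v))
  other_opp : ∀ v, ¬ IsOdd v → S.hexIdx (other v) ≠ S.hexIdx (other (S.opp v))
  other_mate : ∀ v, ¬ IsOdd v → S.hexIdx (other v) ≠ S.hexIdx (other (mate v))
  mate_other : ∀ v, ¬ IsOdd v → S.hexIdx (other v) ≠ S.hexIdx (mate (other v))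
  opp_other_mate : ∀ v, ¬ IsOdd v → S.hexIdx (other (S.opp v)) ≠ S.hexIdx (other (mate v))
  opp_mate_other : ∀ v, ¬ IsOdd v → S.hexIdx (other (S.opp v)) ≠ S.hexIdx (mate (other v))

theorem isOdd_mate (v : cylV k m) : IsOdd (mate v) ↔ ¬ IsOdd v := by
  unfold mate
  split_ifs
  · exact isOdd_right v
  · exact isOdd_left v

theorem isOdd_other (v : cylV k m) : IsOdd (other v) ↔ ¬ IsOdd v := by
  unfold other
  split_ifs
  · exact isOdd_left v
  · exact isOdd_right v

theorem isOdd_opp (v : cylV k m) : IsOdd (S.opp v) ↔ ¬ IsOdd v := by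
  unfold opp
  split_ifs
  · exact S.isOdd_below v
  · exact S.isOdd_above v

theorem low_of_not_isOdd {v : cylV k m} (h : ¬ IsOdd v) : S.low v = v := if_neg h

theorem low_of_isOdd {v : cylV k m} (h : IsOdd v) : S.low v = S.below v := if_pos h

theorem not_isOdd_low (v : cylV k m) : ¬ IsOdd (S.low v) := by
  by_cases h : IsOdd v
  · rw [S.low_of_isOdd h, isOdd_below]; exact not_not.2 h
  · rwa [S.low_of_not_isOdd h]

theorem low_opp (v : cylV k m) : S.low (S.opp v) = S.low v := by
  by_cases h : IsOdd v
  · rw [S.low_of_isOdd h, S.low_of_not_isOdd (by rw [isOdd_opp]; exact not_not.2 h), opp, if_pos h]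
  · rw [S.low_of_not_isOdd h, S.low_of_isOdd (by rwa [isOdd_opp]), opp, if_neg h, below_above]

theorem low_eq (v : cylV k m) : S.low v = v ∨ S.low v = S.opp v := by
  by_cases h : IsOdd v
  · rw [S.low_of_isOdd h, opp, if_pos h]; exact Or.inr rfl
  · rw [S.low_of_not_isOdd h]; exact Or.inl rfl

theorem opp_opp (v : cylV k m) : S.opp (S.opp v) = v := by
  by_cases h : IsOdd v
  · have h' : ¬ IsOdd (S.below v) := by rw [isOdd_below]; exact not_not.2 h
    simp only [opp, h, h', if_true, if_false, S.above_below]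
  · have h' : IsOdd (S.above v) := by rw [isOdd_above]; exact h
    simp only [opp, h, h', if_true, if_false, S.below_above]

theorem hexIdx_opp (v : cylV k m) : S.hexIdx (S.opp v) = S.hexIdx v := by
  simp only [hexIdx, low_opp]

/-- The lower centre can be recovered from its index: its row determines the parity of its column,
and this undoes the halving. -/
theorem eq_or_eq_opp_of_hexIdx_eq (u v : cylV k m) (h : S.hexIdx u = S.hexIdx v) :
    v = u ∨ v = S.opp u := by
  have h1 : S.low u = S.low v := by
    have e1 := S.not_isOdd_low u
    have e2 := S.not_isOdd_low v
    have h2 : (S.low u).1.2 < 2 * k := (S.low u).2.2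
    have h3 : (S.low v).1.2 < 2 * k := (S.low v).2.2
    simp only [hexIdx, Subtype.ext_iff, Prod.ext_iff, IsOdd] at *
    split_ifs at h <;> omega
  rcases S.low_eq u with h2 | h2 <;> rcases S.low_eq v with h3 | h3 <;> rw [h2, h3] at h1
  · exact Or.inl h1.symm
  · exact Or.inr (by rw [h1, opp_opp])
  · exact Or.inr h1.symm
  · exact Or.inl (by rw [← opp_opp S u, h1, opp_opp])

theorem pairIdx_surjective : Function.Surjective (pairIdx : cylV k m → gridV k (m + 1)) := by
  rintro ⟨⟨j, i⟩, h1, h2⟩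
  have h1 : j < k := h1
  have h2 : i < m + 1 := h2
  exact ⟨⟨(i, 2 * j), ⟨by dsimp only; omega, by dsimp only; omega⟩⟩, by
    simp only [pairIdx, Subtype.ext_iff, Prod.ext_iff, and_true]; omega⟩

theorem hexIdx_val {v : cylV k m} (h : ¬ IsOdd v) :
    (S.hexIdx v).1 = (if v.1.2 + 1 = 2 * k then 0 else (v.1.2 + 1) / 2, v.1.1) := by
  simp only [hexIdx, S.low_of_not_isOdd h]

theorem hexIdx_val_of_isOdd {v : cylV k m} (h : IsOdd v) :
    (S.hexIdx v).1 = (if (S.below v).1.2 + 1 = 2 * k then 0 else ((S.below v).1.2 + 1) / 2,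
      (S.below v).1.1) := by
  simp only [hexIdx, S.low_of_isOdd h]

theorem hexIdx_surjective : Function.Surjective S.hexIdx := by
  rintro ⟨⟨j, i⟩, h⟩
  have h1 : j < k := h.1
  have h2 : i < m + 1 := h.2
  have h3 : (i, if i % 2 = 0 then 2 * j else if j = 0 then 2 * k - 1 else 2 * j - 1) ∈ cylV k m :=
    ⟨by dsimp only; omega, by dsimp only; split_ifs <;> omega⟩
  refine ⟨⟨_, h3⟩, ?_⟩
  rw [Subtype.ext_iff, hexIdx_val]
  · simp only [Prod.ext_iff, and_true]
    split_ifs <;> omega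
  · simp only [IsOdd]
    split_ifs <;> omega

theorem eq_or_eq_mate_of_pairIdx_eq (u v : cylV k m) (h : pairIdx u = pairIdx v) :
    v = u ∨ v = mate u := by
  simp only [pairIdx, Subtype.ext_iff, Prod.ext_iff, mate_val] at *
  split_ifs <;> omega

theorem pairIdx_mate (v : cylV k m) : pairIdx (mate v) = pairIdx v := by
  simp only [pairIdx, Subtype.ext_iff, Prod.ext_iff, mate_val, and_true]
  split_ifs <;> omega

theorem other_val (v : cylV k m) :
    (other v).1 = (v.1.1, if v.1.2 = 0 then 2 * k - 1 else if v.1.2 + 1 = 2 * k then 0 else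
      if v.1.2 % 2 = 0 then v.1.2 - 1 else v.1.2 + 1) := by
  have h2 : v.1.2 < 2 * k := v.2.2
  simp only [other, left, right]
  grind

/-- The column of the partner of the partner by the other matching. -/
theorem other_mate_val (v : cylV k m) :
    (other (mate v)).1 = (v.1.1, if v.1.2 % 2 = 0 then (if v.1.2 + 2 = 2 * k then 0 else v.1.2 + 2)
      else if v.1.2 = 1 then 2 * k - 1 else v.1.2 - 2) := by
  have h2 : v.1.2 < 2 * k := v.2.2
  simp only [other_val, mate_val, Prod.ext_iff, true_and]
  grind

theorem mate_other_val (v : cylV k m) :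
    (mate (other v)).1 = (v.1.1, if v.1.2 % 2 = 0 then (if v.1.2 = 0 then 2 * k - 2 else v.1.2 - 2)
      else if v.1.2 + 1 = 2 * k then 1 else v.1.2 + 2) := by
  have h2 : v.1.2 < 2 * k := v.2.2
  simp only [other_val, mate_val, Prod.ext_iff, true_and]
  grind

theorem pairIdx_other_ne (hk : 3 ≤ k) (v : cylV k m) :
    pairIdx (other v) ≠ pairIdx (other (mate v)) := by
  have h2 : v.1.2 < 2 * k := v.2.2
  simp only [pairIdx, ne_eq, Subtype.ext_iff, Prod.ext_iff, other_val v, other_mate_val, and_true]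
  grind

theorem not_isOdd_other_mate {v : cylV k m} (hv : ¬ IsOdd v) : ¬ IsOdd (other (mate v)) := by
  rw [isOdd_other, isOdd_mate]
  exact not_not.2 hv

theorem not_isOdd_mate_other {v : cylV k m} (hv : ¬ IsOdd v) : ¬ IsOdd (mate (other v)) := by
  rw [isOdd_mate, isOdd_other]
  exact not_not.2 hv

theorem hexIdx_mate_other_ne (hk : 3 ≤ k) (v : cylV k m) (hv : ¬ IsOdd v) :
    S.hexIdx (other (mate v)) ≠ S.hexIdx (mate (other v)) := by
  have h2 : v.1.2 < 2 * k := v.2.2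
  simp only [S.hexIdx_val (not_isOdd_other_mate hv), S.hexIdx_val (not_isOdd_mate_other hv), ne_eq,
    Subtype.ext_iff, Prod.ext_iff, other_mate_val, mate_other_val, and_true]
  split_ifs <;> omega

theorem gridTwist_pairIdx_other (hk : 3 ≤ k) (g : ℕ → ℕ) (v : cylV k m) :
    (gridTwist k (m + 1) g).Adj (pairIdx v) (pairIdx (other v)) := by
  have h2 : v.1.2 < 2 * k := v.2.2
  simp only [gridTwist, graphOn_adj, pairIdx, ne_eq, Subtype.ext_iff, Prod.ext_iff, other_val,
    gridE, sideE, and_true]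
  grind

/-- Vertical edges inside the cylinder keep the column. Those through the seam leave row `0` at the
even columns only, so `g` need only record where these go. -/
theorem gridTwist_pairIdx_vert (g : ℕ → ℕ) (hg : ∀ j, j < k → g j = S.down (2 * j) / 2)
    (v : cylV k m) (hv : pairIdx v ≠ pairIdx (S.vert v)) :
    (gridTwist k (m + 1) g).Adj (pairIdx v) (pairIdx (S.vert v)) := by
  refine ⟨hv, ?_⟩
  clear hv
  obtain ⟨⟨i, c⟩, hv⟩ := v
  have h1 : i ≤ m := hv.1
  have h2 : c < 2 * k := hv.2
  have e1 := S.parity c h2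
  have e2 := S.up_lt c h2
  have e3 := S.down_up c h2
  have e4 := S.up_down c h2
  have e5 := hg (S.up c / 2)
  have e6 := hg (c / 2)
  simp only [gridE, sideE, pairIdx, vert, IsOdd, above, below]
  by_cases h : (i + c) % 2 = 1
  · simp only [h, if_true]
    by_cases h' : i < m
    · simp only [h', if_true]
      exact Or.inl (Or.inl (Or.inr ⟨trivial, trivial⟩))
    · simp only [h', if_false]
      refine Or.inr (Or.inr (Or.inr ?_))
      -- The seam parity makes this column even, so halving it loses nothing.
      have e7 : 2 * (S.up c / 2) = S.up c := by omega
      refine ⟨trivial, ?_, ?_⟩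
      · rw [e5 (by omega), e7, e3]
      · omega
  · simp only [h, if_false]
    by_cases h' : 0 < i
    · simp only [h', if_true]
      refine Or.inr (Or.inl (Or.inr ⟨trivial, ?_⟩))
      omega
    · simp only [h', if_false]
      refine Or.inl (Or.inr (Or.inr ?_))
      have e7 : 2 * (c / 2) = c := by omega
      refine ⟨?_, ?_, ?_⟩
      · omega
      · rw [e6 (by omega), e7]
      · omega

theorem lift_pairIdx (hk : 3 ≤ k) (g : ℕ → ℕ) (hg : ∀ j, j < k → g j = S.down (2 * j) / 2)
    (p q : gridV k (m + 1)) (hne : p ≠ q)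
    (h : gridE p.1 q.1 ∨ sideE k p.1 q.1 ∨ (p.1.2 = 0 ∧ q.1.1 = g p.1.1 ∧ q.1.2 = m + 1 - 1)) :
    ∃ u v : cylV k m, (v = other u ∨ v = S.vert u) ∧
      ((pairIdx u = p ∧ pairIdx v = q) ∨ (pairIdx u = q ∧ pairIdx v = p)) := by
  obtain ⟨⟨j, i⟩, hp⟩ := p
  obtain ⟨⟨j', i'⟩, hq⟩ := q
  have h1 : j < k := hp.1
  have h2 : i < m + 1 := hp.2
  have h3 : j' < k := hq.1
  have h4 : i' < m + 1 := hq.2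
  rcases h with (⟨h5, h6⟩ | ⟨h5, h6⟩) | ⟨h5, h6, h7⟩ | ⟨h5, h6, h7⟩ <;> dsimp only at *
  · have hu : (i, 2 * j + 1) ∈ cylV k m := ⟨by dsimp only; omega, by dsimp only; omega⟩
    refine ⟨⟨_, hu⟩, _, Or.inl rfl, Or.inl ⟨?_, ?_⟩⟩ <;>
      simp only [pairIdx, Subtype.ext_iff, Prod.ext_iff, other_val] <;> grind
  -- The odd vertex of the matched pair, the one whose vertical edge goes up.
  · have hu : (i, if i % 2 = 0 then 2 * j + 1 else 2 * j) ∈ cylV k m :=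
      ⟨by dsimp only; omega, by dsimp only; split_ifs <;> omega⟩
    refine ⟨⟨_, hu⟩, _, Or.inr rfl, Or.inl ⟨?_, ?_⟩⟩ <;>
      simp only [pairIdx, Subtype.ext_iff, Prod.ext_iff, vert, IsOdd, above, below] <;> grind
  · have hu : (i, 2 * j) ∈ cylV k m := ⟨by dsimp only; omega, by dsimp only; omega⟩
    refine ⟨⟨_, hu⟩, _, Or.inl rfl, Or.inl ⟨?_, ?_⟩⟩ <;>
      simp only [pairIdx, Subtype.ext_iff, Prod.ext_iff, other_val] <;> grind
  · have hu : (i, 2 * j) ∈ cylV k m := ⟨by dsimp only; omega, by dsimp only; omega⟩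
    refine ⟨⟨_, hu⟩, _, Or.inr rfl, Or.inl ⟨?_, ?_⟩⟩ <;>
      simp only [pairIdx, Subtype.ext_iff, Prod.ext_iff, vert, IsOdd, above, below] <;> grind

/-- The column of the hexagon that is reached by going down from the `j`-th hexagon around the
first row. -/
def hexTwist (j : ℕ) : ℕ :=
  if S.down (if j = 0 then 2 * k - 1 else 2 * j - 1) + 1 = 2 * k then 0
    else (S.down (if j = 0 then 2 * k - 1 else 2 * j - 1) + 1) / 2

/-- The end `other v` is an odd vertex, whose hexagon lies below its row. Crossing the unmatched
edge therefore leads down, and the column changes only at the seam. -/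
theorem hexIdx_other_val {v : cylV k m} (hv : ¬ IsOdd v) :
    (S.hexIdx (other v)).1 = if 0 < v.1.1 then ((S.hexIdx v).1.1, v.1.1 - 1)
      else (S.hexTwist (S.hexIdx v).1.1, m) := by
  have h2 : v.1.2 < 2 * k := v.2.2
  rw [S.hexIdx_val_of_isOdd (by rwa [isOdd_other]), S.hexIdx_val hv]
  simp only [IsOdd] at hv
  simp only [below, other_val, hexTwist, Prod.ext_iff]
  by_cases h : 0 < v.1.1
  · simp only [h, if_true]
    grind
  · have h0 : v.1.1 = 0 := by omega
    have h3 : v.1.2 % 2 = 0 := by omega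
    have h4 : ¬ v.1.2 + 1 = 2 * k := by omega
    have h5 : 2 * ((v.1.2 + 1) / 2) = v.1.2 := by omega
    simp only [h0, lt_irrefl, if_false, h3, h4, if_true, h5]
    by_cases h6 : v.1.2 = 0
    · simp [h6]
    · have h7 : ¬ (v.1.2 + 1) / 2 = 0 := by omega
      simp [h6, h7]

theorem hexIdx_other_opp_val {v : cylV k m} (hv : ¬ IsOdd v) (hi : v.1.1 < m) :
    (S.hexIdx (other (S.opp v))).1 = ((S.hexIdx v).1.1, v.1.1 + 1) := by
  have h2 : v.1.2 < 2 * k := v.2.2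
  have h3 : ¬ IsOdd (other (S.opp v)) := by
    rw [isOdd_other, isOdd_opp]
    exact not_not.2 hv
  have h4 : (S.opp v).1 = (v.1.1 + 1, v.1.2) := by
    simp only [opp, if_neg hv, above, hi, if_true]
  rw [S.hexIdx_val h3, S.hexIdx_val hv]
  simp only [IsOdd] at hv
  simp only [other_val, h4, Prod.ext_iff]
  grind

/-- The direction of the step alternates from row to row, because the matching starts at even
columns, and lower centres have even columns only in even rows. -/
theorem hexIdx_other_mate_val {v : cylV k m} (hv : ¬ IsOdd v) :
    (S.hexIdx (other (mate v))).1 =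
      (if v.1.1 % 2 = 0 then (if (S.hexIdx v).1.1 + 1 = k then 0 else (S.hexIdx v).1.1 + 1)
        else if (S.hexIdx v).1.1 = 0 then k - 1 else (S.hexIdx v).1.1 - 1, v.1.1) := by
  have h2 : v.1.2 < 2 * k := v.2.2
  rw [S.hexIdx_val (not_isOdd_other_mate hv), S.hexIdx_val hv]
  simp only [IsOdd] at hv
  simp only [other_mate_val, Prod.ext_iff]
  grind

theorem hexIdx_mate_other_val {v : cylV k m} (hv : ¬ IsOdd v) :
    (S.hexIdx (mate (other v))).1 =
      (if v.1.1 % 2 = 1 then (if (S.hexIdx v).1.1 + 1 = k then 0 else (S.hexIdx v).1.1 + 1)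
        else if (S.hexIdx v).1.1 = 0 then k - 1 else (S.hexIdx v).1.1 - 1, v.1.1) := by
  have h2 : v.1.2 < 2 * k := v.2.2
  rw [S.hexIdx_val (not_isOdd_mate_other hv), S.hexIdx_val hv]
  simp only [IsOdd] at hv
  simp only [mate_other_val, Prod.ext_iff]
  grind

theorem exists_hexIdx_eq (a : gridV k (m + 1)) : ∃ v, ¬ IsOdd v ∧ S.hexIdx v = a := by
  obtain ⟨v, rfl⟩ := S.hexIdx_surjective a
  exact ⟨S.low v, S.not_isOdd_low v, by rcases S.low_eq v with h | h <;> rw [h]; exact S.hexIdx_opp v⟩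

theorem hexIdx_snd {v : cylV k m} (hv : ¬ IsOdd v) : (S.hexIdx v).1.2 = v.1.1 := by
  rw [S.hexIdx_val hv]

theorem gridTwist_adj_side {p q : ℕ} (hp : 3 ≤ p) (g : ℕ → ℕ) {a b : gridV p q}
    (h2 : b.1.2 = a.1.2) (h1 : b.1.1 = if a.1.1 + 1 = p then 0 else a.1.1 + 1) :
    (gridTwist p q g).Adj a b := by
  have h3 : a.1.1 < p := a.2.1
  refine ⟨fun h => ?_, ?_⟩
  · rw [h] at h1
    split_ifs at h1 <;> omega
  · simp only [gridE, sideE]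
    split_ifs at h1 <;> omega

theorem gridTwist_hexIdx_other (g : ℕ → ℕ) (hg : ∀ j, j < k → g j = S.hexTwist j)
    {v : cylV k m} (hv : ¬ IsOdd v) (hne : S.hexIdx v ≠ S.hexIdx (other v)) :
    (gridTwist k (m + 1) g).Adj (S.hexIdx v) (S.hexIdx (other v)) := by
  refine ⟨hne, ?_⟩
  have h1 := S.hexIdx_other_val hv
  have h2 := S.hexIdx_snd hv
  have h3 := hg _ (S.hexIdx v).2.1
  by_cases h : 0 < v.1.1
  · rw [if_pos h] at h1
    refine Or.inr (Or.inl (Or.inr ?_))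
    rw [h1]
    dsimp only
    omega
  · rw [if_neg h] at h1
    refine Or.inl (Or.inr (Or.inr ?_))
    rw [h1]
    dsimp only
    omega

theorem gridTwist_hexIdx_other_mate (hk : 3 ≤ k) (g : ℕ → ℕ) {v : cylV k m} (hv : ¬ IsOdd v) :
    (gridTwist k (m + 1) g).Adj (S.hexIdx v) (S.hexIdx (other (mate v))) := by
  have h1 := S.hexIdx_other_mate_val hv
  have h2 := S.hexIdx_snd hv
  have h3 : (S.hexIdx v).1.1 < k := (S.hexIdx v).2.1
  rw [Prod.ext_iff] at h1
  obtain ⟨h4, h5⟩ := h1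
  by_cases h : v.1.1 % 2 = 0
  · exact gridTwist_adj_side hk g (by rw [h5, h2]) (by rw [h4, if_pos h])
  · refine (gridTwist_adj_side hk g (by rw [h5, h2]) ?_).symm
    rw [h4, if_neg h]
    split_ifs <;> omega

theorem gridTwist_hexIdx_mate_other (hk : 3 ≤ k) (g : ℕ → ℕ) {v : cylV k m} (hv : ¬ IsOdd v) :
    (gridTwist k (m + 1) g).Adj (S.hexIdx v) (S.hexIdx (mate (other v))) := by
  have h := (S.gridTwist_hexIdx_other_mate hk g (not_isOdd_mate_other hv)).symm
  rwa [mate_mate, other_other] at h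

theorem lift_hexIdx (hk : 3 ≤ k) (g : ℕ → ℕ) (hg : ∀ j, j < k → g j = S.hexTwist j)
    (p q : gridV k (m + 1))
    (h : gridE p.1 q.1 ∨ sideE k p.1 q.1 ∨ (p.1.2 = 0 ∧ q.1.1 = g p.1.1 ∧ q.1.2 = m + 1 - 1)) :
    ∃ u v : cylV k m, (v = other u ∨ v = other (mate u)) ∧
      ((S.hexIdx u = p ∧ S.hexIdx v = q) ∨ (S.hexIdx u = q ∧ S.hexIdx v = p)) := by
  obtain ⟨u, hu, rfl⟩ := S.exists_hexIdx_eq p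
  obtain ⟨w, hw, rfl⟩ := S.exists_hexIdx_eq q
  have hu1 : (S.hexIdx u).1.1 < k := (S.hexIdx u).2.1
  have hw1 : (S.hexIdx w).1.1 < k := (S.hexIdx w).2.1
  have hu2 := S.hexIdx_snd hu
  have hw2 := S.hexIdx_snd hw
  have cu := S.hexIdx_other_mate_val hu
  have cw := S.hexIdx_other_mate_val hw
  have du := S.hexIdx_other_val hu
  have dw := S.hexIdx_other_val hw
  have hg' := hg _ hu1
  rcases h with (⟨h5, h6⟩ | ⟨h5, h6⟩) | ⟨h5, h6, h7⟩ | ⟨h5, h6, h7⟩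
  -- `other ∘ mate` moves to the right in even rows and to the left in odd rows, so in odd rows the
  -- edge is lifted from its other end.
  · by_cases hp : u.1.1 % 2 = 0
    · refine ⟨u, _, Or.inr rfl, Or.inl ⟨rfl, ?_⟩⟩
      rw [Subtype.ext_iff, cu, Prod.ext_iff]
      simp only
      grind
    · refine ⟨w, _, Or.inr rfl, Or.inr ⟨rfl, ?_⟩⟩
      rw [Subtype.ext_iff, cw, Prod.ext_iff]
      simp only
      grind
  · refine ⟨w, _, Or.inl rfl, Or.inr ⟨rfl, ?_⟩⟩
    rw [Subtype.ext_iff, dw, Prod.ext_iff]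
    rw [if_pos (by omega)]
    simp only
    omega
  · by_cases hp : u.1.1 % 2 = 0
    · refine ⟨w, _, Or.inr rfl, Or.inr ⟨rfl, ?_⟩⟩
      rw [Subtype.ext_iff, cw, Prod.ext_iff]
      simp only
      grind
    · refine ⟨u, _, Or.inr rfl, Or.inl ⟨rfl, ?_⟩⟩
      rw [Subtype.ext_iff, cu, Prod.ext_iff]
      simp only
      grind
  · refine ⟨u, _, Or.inl rfl, Or.inl ⟨rfl, ?_⟩⟩
    rw [Subtype.ext_iff, du, Prod.ext_iff]
    rw [if_neg (by omega)]
    simp only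
    omega

theorem nonempty_cylV (hk : 3 ≤ k) : Nonempty (cylV k m) :=
  ⟨⟨(0, 0), Nat.zero_le _, by dsimp only; omega⟩⟩

/-- Contracting the edges `{(i, 2j), (i, 2j + 1)}` of a closed hexagonal cylinder. -/
theorem yields (hk : 3 ≤ k) (D : S.Separated) (g g' : ℕ → ℕ)
    (hg : ∀ j, j < k → g j = S.down (2 * j) / 2) (hg' : ∀ j, j < k → g' j = S.hexTwist j) :
    IsPerfectMatching S.graph (cylP k m) ∧
      Yields S.graph (cylP k m) (gridTwist k (m + 1) g) (gridTwist k (m + 1) g') := by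
  have hz : ∀ v, S.vert v ≠ left v ∧ S.vert v ≠ right v := fun v => ⟨D.left v, D.right v⟩
  have M := S.rowMatching hk hz
  have := nonempty_cylV (m := m) hk
  set B := S.brick hk hz
  have e2 : ∀ v, S.hexIdx v ≠ S.hexIdx (other v) := by
    intro v h
    have hr : B.Row v (other v) := M.row_iff.2 (Or.inr rfl)
    rcases S.eq_or_eq_opp_of_hexIdx_eq _ _ h with h | h
    · exact B.not_row_self v (by rwa [h] at hr)
    · exact B.not_row_t v (by rw [h] at hr; exact hr)
  have e3 : ∀ v, pairIdx v ≠ pairIdx (S.vert v) := by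
    intro v h
    have hr : ¬ B.Row v (S.vert v) := B.not_row_z v
    rcases eq_or_eq_mate_of_pairIdx_eq _ _ h with h | h
    · exact (B.z_adj v).ne h.symm
    · exact hr (M.row_iff.2 (Or.inl h))
  rw [cylP_eq]
  refine ⟨M.isPerfectMatching, B.yields_of_realizes M.isPerfectMatching.1 pairIdx S.hexIdx ?_ ?_
    S.hexIdx_opp S.eq_or_eq_opp_of_hexIdx_eq ?_ ?_⟩
  · intro u v h
    rw [(Brick.mem_pairs_iff mate_mate).1 h, pairIdx_mate]
  · intro u v h
    rw [Brick.mem_pairs_iff mate_mate]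
    exact eq_or_eq_mate_of_pairIdx_eq u v h
  · exact M.realizes_primal pairIdx pairIdx_surjective eq_or_eq_mate_of_pairIdx_eq
      (gridTwist_pairIdx_other hk g) (fun v => S.gridTwist_pairIdx_vert g hg v (e3 v))
      (exists_of_graphOn_adj (R := fun u v => v = other u ∨ v = S.vert u) (S.lift_pairIdx hk g hg))
      D.other_vert (pairIdx_other_ne hk) D.other_vert_mate D.vert_vert_mate
  · refine M.realizes_dual S.hexIdx S.hexIdx_surjective S.hexIdx_opp S.eq_or_eq_opp_of_hexIdx_eq
      (fun v => ¬ IsOdd v) ?_ (fun v hv => S.gridTwist_hexIdx_other g' hg' hv (e2 v)) ?_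
      (fun v => S.gridTwist_hexIdx_other_mate hk g') (fun v => S.gridTwist_hexIdx_mate_other hk g')
      (exists_of_graphOn_adj (R := fun u v => v = other u ∨ v = other (mate u))
        fun p q _ => S.lift_hexIdx hk g' hg' p q)
      D.other_opp D.other_mate D.mate_other D.opp_other_mate D.opp_mate_other
      (S.hexIdx_mate_other_ne hk)
    · intro v
      by_cases hv : IsOdd v
      · exact Or.inr fun h => (S.isOdd_opp v).1 h hv
      · exact Or.inl hv
    -- The edge at the upper centre is the downward edge of the hexagon above, read backwards.
    · intro v hv
      have hw : ¬ IsOdd (other (S.opp v)) := by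
        rw [isOdd_other, isOdd_opp]
        exact not_not.2 hv
      have h := S.gridTwist_hexIdx_other g' hg' hw (e2 _)
      rw [other_other, S.hexIdx_opp] at h
      exact h.symm

end Seam
end HexTiling

/-! ### Gluing by translations and reflections: the families `r`, `a` and `b` -/

namespace HexTiling

theorem mod_eq_ite {a k : ℕ} (h : a < 2 * k) : a % k = if a < k then a else a - k := by
  split_ifs with h'
  · exact Nat.mod_eq_of_lt h'
  · rw [Nat.mod_eq_sub_mod (by omega), Nat.mod_eq_of_lt (by omega)]

theorem graphOn_congr {α : Type*} {S : Set α} {E E' : α → α → Prop}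
    (h : ∀ u v : S, E u v ↔ E' u v) : graphOn S E = graphOn S E' := by
  ext u v
  rw [graphOn_adj, graphOn_adj, h, h]

/-- A bijection that maps generating pairs to adjacent pairs in both directions. -/
def graphOnIso {α β : Type*} {S : Set α} {T : Set β} {E : α → α → Prop}
    {E' : β → β → Prop} (f : S → T) (g : T → S) (hgf : ∀ u, g (f u) = u) (hfg : ∀ u, f (g u) = u)
    (h : ∀ u v : S, E u v → E' (f u) (f v) ∨ E' (f v) (f u))
    (h' : ∀ u v : T, E' u v → E (g u) (g v) ∨ E (g v) (g u)) :
    graphOn S E ≃g graphOn T E' := by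
  refine ⟨⟨f, g, hgf, hfg⟩, ?_⟩
  intro u v
  have hne : f u ≠ f v ↔ u ≠ v := not_congr ⟨fun h => by rw [← hgf u, h, hgf], fun h => h ▸ rfl⟩
  simp only [Equiv.coe_fn_mk, graphOn_adj, hne]
  refine and_congr_right fun _ => ⟨?_, ?_⟩
  · rintro (h1 | h1) <;> have h2 := h' _ _ h1 <;> rw [hgf, hgf] at h2
    · exact h2
    · exact h2.symm
  · rintro (h1 | h1) <;> have h2 := h _ _ h1
    · exact h2
    · exact h2.symm

theorem nonempty_graphOn_iso {α β : Type*} {S : Set α} {T : Set β} {E : α → α → Prop}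
    {E' : β → β → Prop} (f : S → T) (g : T → S) (hgf : ∀ u, g (f u) = u) (hfg : ∀ u, f (g u) = u)
    (h : ∀ u v : S, E u v → E' (f u) (f v) ∨ E' (f v) (f u))
    (h' : ∀ u v : T, E' u v → E (g u) (g v) ∨ E (g v) (g u)) :
    Nonempty (graphOn S E ≃g graphOn T E') :=
  ⟨graphOnIso f g hgf hfg h h'⟩

theorem gridTwist_congr {p q : ℕ} {g g' : ℕ → ℕ} (h : ∀ j, j < p → g j = g' j) :
    gridTwist p q g = gridTwist p q g' :=
  graphOn_congr fun u v => by rw [h u.1.1 u.2.1]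

/-- The reflection `j ↦ u - j` modulo `p`. -/
def reflect (p u j : ℕ) : ℕ := if j ≤ u then u - j else u + p - j

theorem gridTwist_reflect_eq_kleinK0 (p q : ℕ) :
    gridTwist p q (reflect p (p - 1)) = kleinK0 p q :=
  gridTwist_congr (g' := fun j => p - j - 1) fun j hj => by
    simp only [reflect]
    split_ifs <;> omega

theorem gridTwist_reflect_eq_kleinK2 (p q : ℕ) : gridTwist p q (reflect p 0) = kleinK2 p q :=
  gridTwist_congr (g' := fun j => (p - j) % p) fun j hj => by
    simp only [reflect]
    rw [mod_eq_ite (by omega)]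
    split_ifs <;> omega

def gridRotate (p q s : ℕ) (hs : s < p) (a : gridV p q) : gridV p q :=
  ⟨(if a.1.1 + s < p then a.1.1 + s else a.1.1 + s - p, a.1.2), by
    have h : a.1.1 < p := a.2.1
    exact ⟨by dsimp only; split_ifs <;> omega, a.2.2⟩⟩

theorem gridRotate_gridRotate {p q s s' : ℕ} (hs : s < p) (hs' : s' < p)
    (h : s + s' = 0 ∨ s + s' = p) (a : gridV p q) :
    gridRotate p q s hs (gridRotate p q s' hs' a) = a := by
  have h2 : a.1.1 < p := a.2.1
  simp only [gridRotate, Subtype.ext_iff, Prod.ext_iff, and_true]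
  grind

/-- Conjugating `j ↦ u - j` by the rotation `j ↦ j + s` gives `j ↦ u + 2 * s - j`. Since `u` and `s`
are less than `p`, reducing `u + 2 * s` modulo `p` subtracts `p` at most twice. -/
theorem gridRotate_edge {p q s u u' : ℕ} (hs : s < p) (hu : u < p) (hu' : u' < p)
    (h : u' = u + 2 * s ∨ u' + p = u + 2 * s ∨ u' + 2 * p = u + 2 * s) (a b : gridV p q)
    (hE : gridE a.1 b.1 ∨ sideE p a.1 b.1 ∨ (a.1.2 = 0 ∧ b.1.1 = reflect p u a.1.1 ∧
      b.1.2 = q - 1)) :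
    (fun a b => gridE a b ∨ sideE p a b ∨ (a.2 = 0 ∧ b.1 = reflect p u' a.1 ∧
      b.2 = q - 1)) (gridRotate p q s hs a).1 (gridRotate p q s hs b).1 ∨
    (fun a b => gridE a b ∨ sideE p a b ∨ (a.2 = 0 ∧ b.1 = reflect p u' a.1 ∧
      b.2 = q - 1)) (gridRotate p q s hs b).1 (gridRotate p q s hs a).1 := by
  obtain ⟨⟨j, i⟩, ha⟩ := a
  obtain ⟨⟨j', i'⟩, hb⟩ := b
  have h1 : j < p := ha.1
  have h2 : j' < p := hb.1
  simp only [gridE, sideE, gridRotate] at hE ⊢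
  have h3 : ∀ x, (x + s < p ∧ (if x + s < p then x + s else x + s - p) = x + s) ∨
      (p ≤ x + s ∧ (if x + s < p then x + s else x + s - p) = x + s - p) := by
    intro x
    split_ifs <;> omega
  have h4 := h3 j
  have h5 := h3 j'
  clear h3 ha hb
  generalize (if j + s < p then j + s else j + s - p) = x at *
  generalize (if j' + s < p then j' + s else j' + s - p) = x' at *
  rcases hE with (⟨rfl, rfl⟩ | ⟨rfl, rfl⟩) | ⟨rfl, rfl, rfl⟩ | ⟨rfl, h6, rfl⟩
  · clear h
    by_cases h7 : j + 1 + s = p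
    · refine Or.inr (Or.inr (Or.inl ⟨?_, ?_, rfl⟩)) <;> omega
    · refine Or.inl (Or.inl (Or.inl ⟨?_, rfl⟩))
      omega
  · refine Or.inl (Or.inl (Or.inr ⟨?_, rfl⟩))
    clear h
    omega
  · clear h
    by_cases h7 : s = 0
    · refine Or.inl (Or.inr (Or.inl ⟨?_, ?_, rfl⟩)) <;> omega
    · refine Or.inr (Or.inl (Or.inl ⟨?_, rfl⟩))
      omega
  · refine Or.inl (Or.inr (Or.inr ⟨rfl, ?_, rfl⟩))
    unfold reflect at *
    by_cases h7 : j ≤ u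
    · rw [if_pos h7] at h6
      by_cases h8 : x ≤ u'
      · rw [if_pos h8]
        omega
      · rw [if_neg h8]
        omega
    · rw [if_neg h7] at h6
      by_cases h8 : x ≤ u'
      · rw [if_pos h8]
        omega
      · rw [if_neg h8]
        omega

theorem nonempty_gridTwist_reflect_iso {p q u u' : ℕ} (s : ℕ) (hs : s < p) (hu : u < p)
    (hu' : u' < p) (h : u' = u + 2 * s ∨ u' + p = u + 2 * s ∨ u' + 2 * p = u + 2 * s) :
    Nonempty (gridTwist p q (reflect p u) ≃g gridTwist p q (reflect p u')) := by
  have ht : (if s = 0 then 0 else p - s) < p := by split_ifs <;> omega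
  refine nonempty_graphOn_iso (gridRotate p q s hs) (gridRotate p q _ ht)
    (gridRotate_gridRotate ht hs ?_) (gridRotate_gridRotate hs ht ?_)
    (gridRotate_edge hs hu hu' h) (gridRotate_edge ht hu' hu ?_) <;> split_ifs <;> omega

namespace Seam

/-- Gluing by the translation by `s`. -/
def translation (k m s : ℕ) (hs : s < 2 * k) (hm : (s + m) % 2 = 1) : Seam k m where
  up c := if s ≤ c then c - s else c + 2 * k - s
  down c := if c + s < 2 * k then c + s else c + s - 2 * k
  up_lt c hc := by split_ifs <;> omega
  down_lt c hc := by split_ifs <;> omega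
  down_up c hc := by split_ifs <;> omega
  up_down c hc := by split_ifs <;> omega
  parity c hc := by split_ifs <;> omega
  step c hc := by split_ifs <;> omega
  step_zero := by split_ifs <;> omega

/-- Gluing by the reflection `c ↦ t - c`. -/
def reflection (k m t : ℕ) (ht : t < 2 * k) (hm : (t + m) % 2 = 1) : Seam k m where
  up := reflect (2 * k) t
  down := reflect (2 * k) t
  up_lt c hc := by simp only [reflect]; split_ifs <;> omega
  down_lt c hc := by simp only [reflect]; split_ifs <;> omega
  down_up c hc := by simp only [reflect]; split_ifs <;> omega
  up_down c hc := by simp only [reflect]; split_ifs <;> omega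
  parity c hc := by simp only [reflect]; split_ifs <;> omega
  step c hc := by simp only [reflect]; split_ifs <;> omega
  step_zero := by simp only [reflect]; split_ifs <;> omega

variable {k m : ℕ} (S : Seam k m)

theorem vert_fst (v : cylV k m) : (S.vert v).1.1 =
    if (v.1.1 + v.1.2) % 2 = 1 then (if v.1.1 < m then v.1.1 + 1 else 0)
      else if 0 < v.1.1 then v.1.1 - 1 else m := by
  by_cases h : IsOdd v
  · rw [vert, if_pos h, if_pos (show (v.1.1 + v.1.2) % 2 = 1 from h)]
    rfl
  · rw [vert, if_neg h, if_neg (show ¬ (v.1.1 + v.1.2) % 2 = 1 from h)]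
    rfl

theorem opp_fst (v : cylV k m) : (S.opp v).1.1 =
    if (v.1.1 + v.1.2) % 2 = 1 then (if 0 < v.1.1 then v.1.1 - 1 else m)
      else if v.1.1 < m then v.1.1 + 1 else 0 := by
  by_cases h : IsOdd v
  · rw [opp, if_pos h, if_pos (show (v.1.1 + v.1.2) % 2 = 1 from h)]
    rfl
  · rw [opp, if_neg h, if_neg (show ¬ (v.1.1 + v.1.2) % 2 = 1 from h)]
    rfl

theorem other_fst (v : cylV k m) : (other v).1.1 = v.1.1 := by rw [other_val]

theorem mate_fst (v : cylV k m) : (mate v).1.1 = v.1.1 := by rw [mate_val]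

theorem hexIdx_other_snd {v : cylV k m} (hv : ¬ IsOdd v) :
    (S.hexIdx (other v)).1.2 = if 0 < v.1.1 then v.1.1 - 1 else m := by
  rw [S.hexIdx_other_val hv]
  split_ifs <;> rfl

theorem hexIdx_other_opp_snd {v : cylV k m} (hv : ¬ IsOdd v) :
    (S.hexIdx (other (S.opp v))).1.2 = if v.1.1 < m then v.1.1 + 1 else 0 := by
  rw [S.hexIdx_snd (by rw [isOdd_other, isOdd_opp]; exact not_not.2 hv), other_fst, opp_fst]
  exact if_neg hv

/-- The parts of `Separated` that hold as soon as there are two rows, and that hold always. -/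
theorem separated_of_one_le (hm : 1 ≤ m)
    (h1 : ∀ v, pairIdx (S.vert v) ≠ pairIdx (S.vert (mate v)))
    (h2 : ∀ v, ¬ IsOdd v → S.hexIdx (other v) ≠ S.hexIdx (other (S.opp v))) : S.Separated := by
  have hv : ∀ v, (S.vert v).1.1 ≠ v.1.1 := by
    intro v
    have h3 : v.1.1 ≤ m := v.2.1
    rw [vert_fst]
    split_ifs <;> omega
  have hd : ∀ v, ¬ IsOdd v → (S.hexIdx (other v)).1.2 ≠ v.1.1 := by
    intro v hv
    have h3 : v.1.1 ≤ m := v.2.1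
    rw [S.hexIdx_other_snd hv]
    split_ifs <;> omega
  have hu : ∀ v, ¬ IsOdd v → (S.hexIdx (other (S.opp v))).1.2 ≠ v.1.1 := by
    intro v hv
    have h3 : v.1.1 ≤ m := v.2.1
    rw [S.hexIdx_other_opp_snd hv]
    split_ifs <;> omega
  have a1 : ∀ v, ¬ IsOdd v → (S.hexIdx (other (mate v))).1.2 = v.1.1 := fun v hv => by
    rw [S.hexIdx_snd (not_isOdd_other_mate hv), other_fst, mate_fst]
  have a2 : ∀ v, ¬ IsOdd v → (S.hexIdx (mate (other v))).1.2 = v.1.1 := fun v hv => by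
    rw [S.hexIdx_snd (not_isOdd_mate_other hv), mate_fst, other_fst]
  refine ⟨fun v h => hv v ?_, fun v h => hv v ?_, fun v h => hv v ?_, fun v h => hv (mate v) ?_,
    h1, h2, fun v hv h => hd v hv ?_, fun v hv h => hd v hv ?_, fun v hv h => hu v hv ?_,
    fun v hv h => hu v hv ?_⟩
  · rw [h]; rfl
  · rw [h]; rfl
  · exact ((other_fst v).symm.trans (congrArg (fun w => w.1.2) h)).symm
  · rw [mate_fst]
    exact ((other_fst v).symm.trans (congrArg (fun w => w.1.2) h)).symm
  · rw [h, a1 v hv]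
  · rw [h, a2 v hv]
  · rw [h, a1 v hv]
  · rw [h, a2 v hv]

/-- With at least three rows, the rows above and below a given row are different, so the two
vertical directions cannot lead to the same vertex. -/
theorem separated_of_two_le (hm : 2 ≤ m) : S.Separated := by
  refine S.separated_of_one_le (by omega) (fun v h => ?_) (fun v hv h => ?_)
  · have h3 : v.1.1 ≤ m := v.2.1
    have h4 : (S.vert v).1.1 = (S.vert (mate v)).1.1 := congrArg (fun w => w.1.2) h
    rw [vert_fst, vert_fst, mate_val] at h4
    split_ifs at h4 <;> omega
  · have h3 : v.1.1 ≤ m := v.2.1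
    have h4 := congrArg (fun w => w.1.2) h
    rw [S.hexIdx_other_snd hv, S.hexIdx_other_opp_snd hv] at h4
    split_ifs at h4 <;> omega

/-- A translation moves odd and even columns alike, so the dual inherits the twist of the
contraction. -/
theorem hexTwist_translation {s r : ℕ} (hs : s < 2 * k) (hm : (s + m) % 2 = 1) (hr : r = s / 2)
    (j : ℕ) (hj : j < k) : (translation k m s hs hm).hexTwist j = (j + r) % k := by
  rw [mod_eq_ite (by omega)]
  simp only [hexTwist, translation]
  grind

/-- Rounding up after reflecting the odd column `2 * j - 1` gives half of `t - (2 * j - 1) + 1 = t +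
2 - 2 * j`. The shift by one against the even columns is what makes the two types of Klein bottle
grids change places under duality. -/
theorem hexTwist_reflection {t : ℕ} (ht : t + 2 < 2 * k) (hm : (t + m) % 2 = 1) (j : ℕ)
    (hj : j < k) :
    (reflection k m t (by omega) hm).hexTwist j = reflect k (t / 2 + 1) j := by
  simp only [hexTwist, reflection, reflect]
  grind

/-- With two rows both vertical directions lead to the same row. One of them passes through the seam
and is displaced by `r` columns, which is not a multiple of `k`. -/
theorem separated_translation_one {r : ℕ} (hr : 0 < r) (hrk : r < k) :
    (translation k 1 (2 * r) (by omega) (by omega)).Separated := by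
  refine separated_of_one_le _ le_rfl ?_ ?_
  · rintro ⟨⟨i, c⟩, hv⟩
    have h1 : i ≤ 1 := hv.1
    have h2 : c < 2 * k := hv.2
    simp only [pairIdx, vert, IsOdd, above, below, mate_val, translation, ne_eq, Subtype.ext_iff,
      Prod.ext_iff]
    grind
  · intro v hv h
    rw [Subtype.ext_iff, hexIdx_other_val _ hv] at h
    by_cases h1 : v.1.1 < 1
    · rw [hexIdx_other_opp_val _ hv h1, if_neg (by omega)] at h
      have h2 := congrArg Prod.fst h
      have hlt : (hexIdx (translation k 1 (2 * r) (by omega) (by omega)) v).1.1 < k :=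
        (hexIdx _ v).2.1
      have h3 := hexTwist_translation (k := k) (m := 1) (s := 2 * r) (r := r) (by omega) (by omega)
        (by omega) _ hlt
      simp only at h2
      rw [h3] at h2
      generalize (hexIdx (translation k 1 (2 * r) (by omega) (by omega)) v).1.1 = j at *
      rw [mod_eq_ite (by omega)] at h2
      split_ifs at h2 <;> omega
    · obtain ⟨⟨i, c⟩, hm⟩ := v
      have h0 : i ≤ 1 := hm.1
      have h2 : c < 2 * k := hm.2
      have h3 : i = 1 := by dsimp only at h1; omega
      subst h3
      have h4 : c % 2 = 1 := by simp only [IsOdd] at hv; omega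
      rw [hexIdx_val _ hv, hexIdx_val, other_val] at h
      · simp only [opp, IsOdd, above, translation, Prod.ext_iff] at h
        grind
      · rw [isOdd_other, isOdd_opp]
        exact not_not.2 hv

/-- With a single row both graphs are circulant: the neighbours of `j` are `j ± 1` and `j ± r`
modulo `k`. The bounds keep these four apart, as `r` is not `±1` and `2 * r` is not `0` modulo `k`.
-/
theorem separated_translation_zero {r : ℕ} (hr : 2 ≤ r) (hrk : 2 * r + 3 ≤ k) :
    (translation k 0 (2 * r + 1) (by omega) (by omega)).Separated := by
  have hT := fun j hj => hexTwist_translation (k := k) (m := 0) (s := 2 * r + 1) (r := r)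
    (by omega) (by omega) (by omega) j hj
  set S := translation k 0 (2 * r + 1) (by omega) (by omega) with hS
  have b1 : ∀ v, ¬ IsOdd v → (S.hexIdx (other v)).1.1 = ((S.hexIdx v).1.1 + r) % k := by
    intro v hv
    have h1 : v.1.1 ≤ 0 := v.2.1
    rw [S.hexIdx_other_val hv, if_neg (by omega)]
    exact hT _ (S.hexIdx v).2.1
  have b2 : ∀ v, ¬ IsOdd v →
      (S.hexIdx v).1.1 = ((S.hexIdx (other (S.opp v))).1.1 + r) % k := by
    intro v hv
    rw [← b1, other_other, hexIdx_opp]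
    rw [isOdd_other, isOdd_opp]
    exact not_not.2 hv
  have b3 : ∀ v, ¬ IsOdd v → (S.hexIdx (other (mate v))).1.1 =
      if (S.hexIdx v).1.1 + 1 = k then 0 else (S.hexIdx v).1.1 + 1 := by
    intro v hv
    have h1 : v.1.1 ≤ 0 := v.2.1
    rw [S.hexIdx_other_mate_val hv]
    simp only
    rw [if_pos (by omega)]
  have b4 : ∀ v, ¬ IsOdd v → (S.hexIdx (mate (other v))).1.1 =
      if (S.hexIdx v).1.1 = 0 then k - 1 else (S.hexIdx v).1.1 - 1 := by
    intro v hv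
    have h1 : v.1.1 ≤ 0 := v.2.1
    rw [S.hexIdx_mate_other_val hv]
    simp only
    rw [if_neg (by omega)]
  have hlt : ∀ v, (S.hexIdx v).1.1 < k := fun v => (S.hexIdx v).2.1
  refine ⟨?_, ?_, ?_, ?_, ?_, ?_, ?_, ?_, ?_, ?_⟩
  iterate 5
    rintro ⟨⟨i, c⟩, hv⟩
    have h1 : i ≤ 0 := hv.1
    have h2 : c < 2 * k := hv.2
    clear b1 b2 b3 b4 hlt hT
    simp only [left, right, pairIdx, vert, IsOdd, above, below, mate_val, other_val, hS,
      translation, ne_eq, Subtype.ext_iff, Prod.ext_iff]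
    grind
  all_goals
    intro v hv h
    replace h := congrArg (fun w => w.1.1) h
    have e1 := b1 v hv
    have e2 := b2 v hv
    have e3 := b3 v hv
    have e4 := b4 v hv
    have l0 := hlt v
    have l1 := hlt (other (S.opp v))
    rw [mod_eq_ite (by omega)] at e1 e2
    clear b1 b2 b3 b4 hlt hT
    grind

end Seam

theorem hexR_eq {k m s r : ℕ} (hr : 2 * r ≤ k) (hs : s < 2 * k) (hm : (s + m) % 2 = 1)
    (hsr : r = s / 2) : hexR k m r = (Seam.translation k m s hs hm).graph := by
  refine graphOn_congr fun u v => or_congr_right ?_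
  obtain ⟨⟨i, c⟩, hu⟩ := u
  obtain ⟨⟨i', c'⟩, hv⟩ := v
  have h2 : c < 2 * k := hu.2
  simp only [cylZ, cylX, Prod.ext_iff, Seam.translation, Nat.even_iff]
  constructor
  · rintro ⟨j, hj, ⟨rfl, rfl⟩, rfl, rfl⟩
    rw [mod_eq_ite (a := j + r) (k := k) (by omega)]
    grind
  · rintro ⟨rfl, h3, rfl, rfl⟩
    refine ⟨c / 2, by omega, ⟨rfl, by omega⟩, rfl, ?_⟩
    rw [mod_eq_ite (a := c / 2 + r) (k := k) (by omega)]
    grind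

/-- The vertex `z_0` is joined to `x_1`, whose column is `2` for odd `m` and `3` for even `m`; this
is the constant of the reflection. The edges listed separately are those for which the index does
not wrap around. -/
theorem hexA_eq {k m t : ℕ} (hk : 3 ≤ k) (hm : (t + m) % 2 = 1) (ht : t = 2 ∨ t = 3) :
    hexA k m = (Seam.reflection k m t (by omega) hm).graph := by
  refine graphOn_congr fun u v => or_congr_right ?_
  obtain ⟨⟨i, c⟩, hu⟩ := u
  obtain ⟨⟨i', c'⟩, hv⟩ := v
  have h2 : c < 2 * k := hu.2
  simp only [cylZ, cylX, Prod.ext_iff, Seam.reflection, reflect, Nat.even_iff]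
  constructor
  · rintro (⟨⟨rfl, rfl⟩, rfl, rfl⟩ | ⟨⟨rfl, rfl⟩, rfl, rfl⟩ | ⟨j, h3, h4, ⟨rfl, rfl⟩, rfl, rfl⟩)
    · grind
    · grind
    · grind
  · rintro ⟨rfl, h3, rfl, rfl⟩
    by_cases h4 : c = 0
    · subst h4
      left
      grind
    · by_cases h5 : c = 2
      · subst h5
        right; left
        grind
      · right; right
        refine ⟨c / 2, by omega, by omega, ⟨rfl, by omega⟩, rfl, ?_⟩
        grind

theorem hexB_eq {k m : ℕ} (hk : 3 ≤ k) (hm : (0 + m) % 2 = 1) :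
    hexB k m = (Seam.reflection k m 0 (by omega) hm).graph := by
  refine graphOn_congr fun u v => or_congr_right ?_
  obtain ⟨⟨i, c⟩, hu⟩ := u
  obtain ⟨⟨i', c'⟩, hv⟩ := v
  have h2 : c < 2 * k := hu.2
  simp only [cylZ, cylX, Prod.ext_iff, Seam.reflection, reflect, Nat.even_iff]
  constructor
  · rintro (⟨⟨rfl, rfl⟩, rfl, rfl⟩ | ⟨j, h3, h4, ⟨rfl, rfl⟩, rfl, rfl⟩)
    · grind
    · grind
  · rintro ⟨rfl, h3, rfl, rfl⟩
    by_cases h4 : c = 0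
    · subst h4
      left
      grind
    · right
      refine ⟨c / 2, by omega, by omega, ⟨rfl, by omega⟩, rfl, ?_⟩
      grind

theorem yields_hexR {k m r : ℕ} (h : HexRRange k m r) :
    IsPerfectMatching (hexR k m r) (cylP k m) ∧
      Yields (hexR k m r) (cylP k m) (torusT k (m + 1) r) (torusT k (m + 1) r) := by
  obtain ⟨s, hs, hm, hsr, hr, hk, D⟩ : ∃ (s : ℕ) (hs : s < 2 * k) (hm : (s + m) % 2 = 1),
      r = s / 2 ∧ 2 * r ≤ k ∧ 3 ≤ k ∧ (Seam.translation k m s hs hm).Separated := by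
    rcases h with ⟨h1, h2, h3⟩ | ⟨rfl, h2, h3, h4⟩ | ⟨rfl, h2, h3⟩
    -- The columns of the `x_j` are even for odd `m` and odd for even `m`, so the seam shifts by `2
    -- * r` or by `2 * r + 1`.
    · exact ⟨2 * r + (1 - m % 2), by omega, by omega, by omega, by omega, h2,
        Seam.separated_of_two_le _ h1⟩
    · exact ⟨2 * r, by omega, by omega, by omega, by omega, by omega,
        Seam.separated_translation_one (by omega) (by omega)⟩
    · exact ⟨2 * r + 1, by omega, by omega, by omega, by omega, by omega,
        Seam.separated_translation_zero h2 h3⟩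
  rw [hexR_eq hr hs hm hsr]
  refine Seam.yields _ hk D (fun j => (j + r) % k) (fun j => (j + r) % k) (fun j hj => ?_)
    (fun j hj => (Seam.hexTwist_translation hs hm hsr j hj).symm)
  rw [mod_eq_ite (by omega)]
  simp only [Seam.translation]
  split_ifs <;> omega

theorem yields_reflection {k m t : ℕ} (hk : 3 ≤ k) (hm2 : 2 ≤ m) (ht : t + 2 < 2 * k)
    (hm : (t + m) % 2 = 1) :
    IsPerfectMatching (Seam.reflection k m t (by omega) hm).graph (cylP k m) ∧
      Yields (Seam.reflection k m t (by omega) hm).graph (cylP k m)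
        (gridTwist k (m + 1) (reflect k (t / 2))) (gridTwist k (m + 1) (reflect k (t / 2 + 1))) := by
  refine Seam.yields _ hk (Seam.separated_of_two_le _ hm2) _ _ (fun j hj => ?_)
    (fun j hj => (Seam.hexTwist_reflection ht hm j hj).symm)
  simp only [Seam.reflection, reflect]
  split_ifs <;> omega

theorem yields_hexA {k m : ℕ} (hk : 3 ≤ k) (hm : 2 ≤ m) :
    IsPerfectMatching (hexA k m) (cylP k m) ∧
      Yields (hexA k m) (cylP k m) (gridTwist k (m + 1) (reflect k 1))
        (gridTwist k (m + 1) (reflect k (2 % k))) := by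
  have hm2 : m % 2 = 0 ∨ m % 2 = 1 := by omega
  have key : ∀ t (ht : t = 2 ∨ t = 3), (t + m) % 2 = 1 → _ := fun t ht hm' => by
    have h := yields_reflection (t := t) hk hm (by omega) hm'
    rw [← hexA_eq hk hm' ht] at h
    exact h
  rw [Nat.mod_eq_of_lt (by omega)]
  rcases hm2 with h | h
  · exact key 3 (Or.inr rfl) (by omega)
  · exact key 2 (Or.inl rfl) (by omega)

theorem yields_hexA_even {k m : ℕ} (hk : 3 ≤ k) (hm : 2 ≤ m) :
    IsPerfectMatching (hexA k m) (cylP k m) ∧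
      Yields (hexA k m) (cylP k m) (kleinK0 k (m + 1)) (kleinK2 k (m + 1)) := by
  obtain ⟨h1, h2⟩ := yields_hexA hk hm
  rw [Nat.mod_eq_of_lt (by omega)] at h2
  -- Rotating by `k - 1` lowers the constant of the reflection by two modulo `k`: from `1` to `k -
  -- 1`, and below from `2` to `0`.
  obtain ⟨e⟩ := nonempty_gridTwist_reflect_iso (p := k) (q := m + 1) (u := 1) (u' := k - 1)
    (k - 1) (by omega) (by omega) (by omega) (by omega)
  obtain ⟨e'⟩ := nonempty_gridTwist_reflect_iso (p := k) (q := m + 1) (u := 2) (u' := 0)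
    (k - 1) (by omega) (by omega) (by omega) (by omega)
  rw [gridTwist_reflect_eq_kleinK0] at e
  rw [gridTwist_reflect_eq_kleinK2] at e'
  exact ⟨h1, h2.trans_iso e e'⟩

theorem yields_hexA_odd {k m : ℕ} (hk : 3 ≤ k) (hm : 2 ≤ m) (hk2 : Odd k) :
    IsPerfectMatching (hexA k m) (cylP k m) ∧
      Yields (hexA k m) (cylP k m) (kleinK1 k (m + 1)) (kleinK1 k (m + 1)) := by
  obtain ⟨h1, h2⟩ := yields_hexA hk hm
  rw [Nat.mod_eq_of_lt (by omega)] at h2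
  rw [Nat.odd_iff] at hk2
  obtain ⟨e⟩ := nonempty_gridTwist_reflect_iso (p := k) (q := m + 1) (u := 1) (u' := k - 1)
    (k - 1) (by omega) (by omega) (by omega) (by omega)
  -- For odd `k` the constants `2` and `k - 1` have the same parity, so the dual is the same Klein
  -- bottle grid.
  obtain ⟨e'⟩ := nonempty_gridTwist_reflect_iso (p := k) (q := m + 1) (u := 2) (u' := k - 1)
    ((k - 3) / 2) (by omega) (by omega) (by omega) (by omega)
  rw [gridTwist_reflect_eq_kleinK0] at e e'
  exact ⟨h1, h2.trans_iso e e'⟩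

theorem yields_hexB {k m : ℕ} (hk : 3 ≤ k) (hm : 2 ≤ m) (hm2 : Odd m) :
    IsPerfectMatching (hexB k m) (cylP k m) ∧
      Yields (hexB k m) (cylP k m) (kleinK2 k (m + 1)) (kleinK0 k (m + 1)) := by
  have h0 : (0 + m) % 2 = 1 := by
    rw [Nat.odd_iff] at hm2
    omega
  obtain ⟨h1, h2⟩ := yields_reflection (t := 0) hk hm (by omega) h0
  rw [← hexB_eq hk h0] at h1 h2
  obtain ⟨e⟩ := nonempty_gridTwist_reflect_iso (p := k) (q := m + 1) (u := 1) (u' := k - 1)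
    (k - 1) (by omega) (by omega) (by omega) (by omega)
  rw [gridTwist_reflect_eq_kleinK0] at e
  rw [Nat.zero_div, Nat.zero_add, gridTwist_reflect_eq_kleinK2] at h2
  exact ⟨h1, h2.trans_iso (SimpleGraph.Iso.refl) e⟩

end HexTiling

namespace HexTiling

/-! ### Hexagonal tilings of the Klein bottle -/

/-- Parameters of a hexagonal tiling of the Klein bottle with the vertices `(i, c)`, `i < R`,
`c < k`, in which the row `i` closes up with the row `u - i`, and of a set of row edges: up to
column `l` the edges from an even column to the next column, and afterwards those from an odd
column. -/
structure KleinShape where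
  R : ℕ
  k : ℕ
  u : ℕ
  l : ℕ
  R_even : R % 2 = 0
  four_le : 4 ≤ R
  u_lt : u < R
  parity : (u + k) % 2 = 1
  six_le : 6 ≤ k
  l_even : l % 2 = 0
  l_le : (k % 2 = 1 ∧ l + 3 ≤ k) ∨ (k % 2 = 0 ∧ l = k)

namespace KleinShape

variable (S : KleinShape)

abbrev V := gridV S.R S.k

def graph : SimpleGraph S.V :=
  graphOn S.V fun u v => kleinHexE S.R u v ∨ (u.2 = 0 ∧ v.1 = reflect S.R S.u u.1 ∧ v.2 = S.k - 1)

variable {S}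

def left (v : S.V) : S.V :=
  ⟨(if v.1.2 = 0 then reflect S.R S.u v.1.1 else v.1.1, if v.1.2 = 0 then S.k - 1 else v.1.2 - 1), by
    have h1 : v.1.1 < S.R := v.2.1
    have h2 : v.1.2 < S.k := v.2.2
    have h3 := S.u_lt
    constructor <;> simp only [reflect] <;> split_ifs <;> omega⟩

def right (v : S.V) : S.V :=
  ⟨(if v.1.2 + 1 = S.k then reflect S.R S.u v.1.1 else v.1.1,
    if v.1.2 + 1 = S.k then 0 else v.1.2 + 1), by
    have h1 : v.1.1 < S.R := v.2.1
    have h2 : v.1.2 < S.k := v.2.2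
    have h3 := S.u_lt
    constructor <;> simp only [reflect] <;> split_ifs <;> omega⟩

def above (v : S.V) : S.V :=
  ⟨(if v.1.1 + 1 = S.R then 0 else v.1.1 + 1, v.1.2), by
    have h1 : v.1.1 < S.R := v.2.1
    exact ⟨by dsimp only; split_ifs <;> omega, v.2.2⟩⟩

def below (v : S.V) : S.V :=
  ⟨(if v.1.1 = 0 then S.R - 1 else v.1.1 - 1, v.1.2), by
    have h1 : v.1.1 < S.R := v.2.1
    exact ⟨by dsimp only; split_ifs <;> omega, v.2.2⟩⟩

def IsOdd (v : S.V) : Prop := (v.1.1 + v.1.2) % 2 = 1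

instance (v : S.V) : Decidable (IsOdd v) := inferInstanceAs (Decidable (_ = _))

def vert (v : S.V) : S.V := if IsOdd v then below v else above v

def opp (v : S.V) : S.V := if IsOdd v then above v else below v

theorem reflect_reflect {p u i : ℕ} (hu : u < p) (hi : i < p) : reflect p u (reflect p u i) = i := by
  simp only [reflect]
  split_ifs <;> omega

theorem left_right (v : S.V) : left (right v) = v := by
  have h1 : v.1.1 < S.R := v.2.1
  have h2 : v.1.2 < S.k := v.2.2
  have h3 := reflect_reflect S.u_lt h1
  by_cases h : v.1.2 + 1 = S.k
  · simp only [left, right, h, if_true, h3, Subtype.ext_iff, Prod.ext_iff, true_and]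
    omega
  · simp [left, right, h]

theorem right_left (v : S.V) : right (left v) = v := by
  have h1 : v.1.1 < S.R := v.2.1
  have h2 : v.1.2 < S.k := v.2.2
  have h3 := reflect_reflect S.u_lt h1
  by_cases h : v.1.2 = 0
  · have h4 : S.k - 1 + 1 = S.k := by omega
    simp only [left, right, h, if_true, h3, h4, Subtype.ext_iff]
    exact Prod.ext rfl h.symm
  · have h4 : v.1.2 - 1 + 1 = v.1.2 := by omega
    have h5 : ¬ v.1.2 = S.k := by omega
    simp only [left, right, h, h4, h5, if_false]

theorem above_below (v : S.V) : above (below v) = v := by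
  have h1 : v.1.1 < S.R := v.2.1
  have h3 := S.four_le
  simp only [above, below, Subtype.ext_iff, Prod.ext_iff, and_true]
  grind

theorem below_above (v : S.V) : below (above v) = v := by
  have h1 : v.1.1 < S.R := v.2.1
  have h3 := S.four_le
  simp only [above, below, Subtype.ext_iff, Prod.ext_iff, and_true]
  grind

theorem isOdd_above (v : S.V) : IsOdd (above v) ↔ ¬ IsOdd v := by
  have h1 : v.1.1 < S.R := v.2.1
  have h3 := S.R_even
  simp only [above, IsOdd]
  split_ifs <;> omega

theorem isOdd_below (v : S.V) : IsOdd (below v) ↔ ¬ IsOdd v := by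
  rw [← not_iff_not, ← isOdd_above, above_below, not_not]

theorem isOdd_vert (v : S.V) : IsOdd (vert v) ↔ ¬ IsOdd v := by
  unfold vert
  split_ifs
  · exact isOdd_below v
  · exact isOdd_above v

theorem isOdd_opp (v : S.V) : IsOdd (opp v) ↔ ¬ IsOdd v := by
  unfold opp
  split_ifs
  · exact isOdd_above v
  · exact isOdd_below v

theorem vert_vert (v : S.V) : vert (vert v) = v := by
  by_cases h : IsOdd v
  · have h' : ¬ IsOdd (below v) := by rw [isOdd_below]; exact not_not.2 h
    simp only [vert, h, h', if_true, if_false, above_below]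
  · have h' : IsOdd (above v) := by rw [isOdd_above]; exact h
    simp only [vert, h, h', if_true, if_false, below_above]

/-- Going through the seam exchanges up and down. Vertices of different parity on its two sides
would have their vertical edges on the same side of the row, so the parity has to be kept there. The
field `parity` of `KleinShape` says this. -/
theorem isOdd_left (v : S.V) : IsOdd (left v) ↔ if v.1.2 = 0 then IsOdd v else ¬ IsOdd v := by
  have h1 : v.1.1 < S.R := v.2.1
  have h2 : v.1.2 < S.k := v.2.2
  have h3 := S.R_even
  have h4 := S.parity
  have h5 := S.u_lt
  have h6 := S.six_le
  by_cases h : v.1.2 = 0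
  · simp only [left, IsOdd, h, if_true, reflect]
    split_ifs <;> omega
  · simp only [left, IsOdd, h, if_false]
    omega

theorem isOdd_right (v : S.V) :
    IsOdd (right v) ↔ if v.1.2 + 1 = S.k then IsOdd v else ¬ IsOdd v := by
  have h := isOdd_left (right v)
  rw [left_right] at h
  by_cases h1 : v.1.2 + 1 = S.k
  · rw [if_pos (by simp only [right, h1, if_true])] at h
    rw [if_pos h1, h]
  · rw [if_neg (by simp only [right, h1, if_false]; omega)] at h
    rw [if_neg h1, h, not_not]

theorem reflect_succ {p u i : ℕ} (hu : u < p) (hi : i < p) :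
    reflect p u (if i + 1 = p then 0 else i + 1) =
      if reflect p u i = 0 then p - 1 else reflect p u i - 1 := by
  simp only [reflect]
  grind

theorem reflect_pred {p u i : ℕ} (hu : u < p) (hi : i < p) :
    reflect p u (if i = 0 then p - 1 else i - 1) =
      if reflect p u i + 1 = p then 0 else reflect p u i + 1 := by
  simp only [reflect]
  grind

/-- This closes the hexagon. Away from the seam a row step changes the parity, so `opp` at `v` and
`vert` at `left v` point the same way; at the seam the parity is kept, but the reflection turns up
into down. -/
theorem left_opp (v : S.V) : left (opp v) = vert (left v) := by
  have h := isOdd_left v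
  have h1 := reflect_succ S.u_lt v.2.1
  have h2 := reflect_pred S.u_lt v.2.1
  by_cases h0 : v.1.2 = 0
  · rw [if_pos h0] at h
    by_cases hv : IsOdd v
    · simp only [opp, vert, h, hv, if_true]
      simp only [left, above, below, h0, if_true, h1]
    · simp only [opp, vert, h, hv, if_false]
      simp only [left, above, below, h0, if_true, h2]
  · rw [if_neg h0] at h
    by_cases hv : IsOdd v
    · simp only [opp, vert, h, hv, if_true, not_true, if_false]
      simp only [left, above, h0, if_false]
    · simp only [opp, vert, h, hv, if_true, not_false_iff, if_false]
      simp only [left, below, h0, if_false]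

theorem opp_opp (v : S.V) : opp (opp v) = v := by
  by_cases h : IsOdd v
  · have h' : ¬ IsOdd (above v) := by rw [isOdd_above]; exact not_not.2 h
    simp only [opp, h, h', if_true, if_false, below_above]
  · have h' : IsOdd (below v) := by rw [isOdd_below]; exact h
    simp only [opp, h, h', if_true, if_false, above_below]

theorem right_opp (v : S.V) : right (opp v) = vert (right v) := by
  have h := left_opp (opp (right (opp v)))
  have h' := left_opp (right v)
  rw [opp_opp, left_right] at h
  have h1 := isOdd_right v
  have h2 := reflect_succ S.u_lt v.2.1
  have h3 := reflect_pred S.u_lt v.2.1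
  by_cases h0 : v.1.2 + 1 = S.k
  · rw [if_pos h0] at h1
    by_cases hv : IsOdd v
    · simp only [opp, vert, h1, hv, if_true]
      simp only [right, above, below, h0, if_true, h2]
    · simp only [opp, vert, h1, hv, if_false]
      simp only [right, above, below, h0, if_true, h3]
  · rw [if_neg h0] at h1
    by_cases hv : IsOdd v
    · simp only [opp, vert, h1, hv, if_true, not_true, if_false]
      simp only [right, above, h0, if_false]
    · simp only [opp, vert, h1, hv, if_true, not_false_iff, if_false]
      simp only [right, below, h0, if_false]

theorem eq_left_iff (a b : S.V) : b = left a ↔ (a.1.1 = b.1.1 ∧ a.1.2 = b.1.2 + 1) ∨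
    (a.1.2 = 0 ∧ b.1.1 = reflect S.R S.u a.1.1 ∧ b.1.2 = S.k - 1) := by
  by_cases h : a.1.2 = 0
  · simp only [left, Subtype.ext_iff, Prod.ext_iff, h, if_true, true_and]
    omega
  · simp only [left, Subtype.ext_iff, Prod.ext_iff, h, if_false, false_and, or_false]
    omega

theorem row_iff (a b : S.V) : b = left a ∨ b = right a ↔
    ((b.1.1 = a.1.1 ∧ b.1.2 = a.1.2 + 1) ∨
      (a.1.2 = 0 ∧ b.1.1 = reflect S.R S.u a.1.1 ∧ b.1.2 = S.k - 1)) ∨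
    ((a.1.1 = b.1.1 ∧ a.1.2 = b.1.2 + 1) ∨
      (b.1.2 = 0 ∧ a.1.1 = reflect S.R S.u b.1.1 ∧ a.1.2 = S.k - 1)) := by
  have h : b = right a ↔ a = left b :=
    ⟨fun h => by rw [h, left_right], fun h => by rw [h, right_left]⟩
  rw [h, eq_left_iff, eq_left_iff]
  tauto

theorem vert_iff (a b : S.V) : b = vert a ↔
    ((b.1.1 = a.1.1 + 1 ∧ b.1.2 = a.1.2 ∧ (a.1.1 + a.1.2) % 2 = 0) ∨
      (a.1.1 = 0 ∧ b.1.1 = S.R - 1 ∧ b.1.2 = a.1.2 ∧ a.1.2 % 2 = 1)) ∨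
    ((a.1.1 = b.1.1 + 1 ∧ a.1.2 = b.1.2 ∧ (b.1.1 + b.1.2) % 2 = 0) ∨
      (b.1.1 = 0 ∧ a.1.1 = S.R - 1 ∧ a.1.2 = b.1.2 ∧ b.1.2 % 2 = 1)) := by
  have h1 : a.1.1 < S.R := a.2.1
  have h3 : b.1.1 < S.R := b.2.1
  have h5 := S.R_even
  have h6 := S.four_le
  by_cases h : (a.1.1 + a.1.2) % 2 = 1
  · rw [vert, if_pos (show IsOdd a from h)]
    simp only [below, Subtype.ext_iff, Prod.ext_iff]
    split_ifs <;> omega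
  · rw [vert, if_neg (show ¬ IsOdd a from h)]
    simp only [above, Subtype.ext_iff, Prod.ext_iff]
    split_ifs <;> omega

theorem vert_snd (v : S.V) : (vert v).1.2 = v.1.2 := by
  unfold vert
  split_ifs <;> rfl

theorem left_snd_ne (v : S.V) : (left v).1.2 ≠ v.1.2 := by
  have h2 : v.1.2 < S.k := v.2.2
  have h6 := S.six_le
  simp only [left]
  split_ifs <;> omega

theorem right_snd_ne (v : S.V) : (right v).1.2 ≠ v.1.2 := by
  have h2 : v.1.2 < S.k := v.2.2
  have h6 := S.six_le
  simp only [right]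
  split_ifs <;> omega

theorem left_snd_ne_right_snd (v : S.V) : (left v).1.2 ≠ (right v).1.2 := by
  have h2 : v.1.2 < S.k := v.2.2
  have h6 := S.six_le
  simp only [left, right]
  split_ifs <;> omega

theorem graph_adj (a b : S.V) : S.graph.Adj a b ↔ b = left a ∨ b = right a ∨ b = vert a := by
  have key : S.graph.Adj a b ↔ a ≠ b ∧ (b = left a ∨ b = right a ∨ b = vert a) := by
    rw [← or_assoc, row_iff, vert_iff, graph, graphOn_adj]
    simp only [kleinHexE, Nat.even_iff, Nat.odd_iff]
    refine and_congr_right fun _ => ?_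
    exact iff_of_eq (by ac_rfl)
  rw [key]
  refine and_iff_right_of_imp ?_
  rintro (rfl | rfl | rfl) h
  · exact left_snd_ne a (by rw [← h])
  · exact right_snd_ne a (by rw [← h])
  · exact iff_not_self (a := IsOdd a) (by rw [← isOdd_vert, ← h])

/-- The two columns differ by four modulo `S.k ≥ 6`. -/
theorem right_right_snd_ne (v : S.V) : (right (right v)).1.2 ≠ (left (left v)).1.2 := by
  have h2 : v.1.2 < S.k := v.2.2
  have h6 := S.six_le
  simp only [left, right]
  grind

/-- The bricks of a hexagonal tiling of the Klein bottle. -/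
def brick (S : KleinShape) : Brick S.graph where
  l := left
  r := right
  z := vert
  t := opp
  adj := graph_adj
  lr v h := left_snd_ne_right_snd v (by rw [h])
  lz v h := left_snd_ne v (by rw [← h, vert_snd])
  rz v h := right_snd_ne v (by rw [← h, vert_snd])
  row_l v := Or.inr (right_left v).symm
  row_r v := Or.inl (left_right v).symm
  zz := vert_vert
  zl v := Or.inl (left_opp v).symm
  zr v := Or.inr (right_opp v).symm
  tri v h := left_snd_ne_right_snd v (by rw [← h, vert_snd])
  row_inj a b := by
    rintro (⟨h, -⟩ | ⟨h1, h2⟩)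
    · rw [← right_left a, h, right_left]
    · have h3 : right (right b) = a := by rw [← h1, right_left]
      have h4 : left (left b) = a := by rw [← h2, left_right]
      exact absurd (by rw [h3, h4]) (right_right_snd_ne b)

end KleinShape
end HexTiling

/-! ### Contractions in which parallel edges have to be deleted -/

namespace HexTiling

section Contraction

variable {α β W : Type*} {M : Graph α β} {F Q : Set β} {f : α → W}

/-- A deleted edge is parallel to an edge that is not deleted. -/
theorem IsParallelDeletion.exists_parallel (hQ : IsParallelDeletion (contract M F) Q)
    (hF : ∀ e ∈ F, ∀ x y, M.IsLink e x y → f x = f y) {e : β} {x y : α} (heF : e ∉ F)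
    (hl : M.IsLink e x y) :
    ∃ e' x' y', e' ∉ F ∧ e' ∉ Q ∧ M.IsLink e' x' y' ∧ f x = f x' ∧ f y = f y' := by
  have hf : ∀ x y, (∃ e ∈ F, M.IsLink e x y) → f x = f y := by
    rintro x y ⟨e, he, hl⟩
    exact hF e he x y hl
  have hc : (contract M F).IsLink e (Quot.mk _ x) (Quot.mk _ y) :=
    contract_isLink.2 ⟨heF, x, y, hl, rfl, rfl⟩
  obtain ⟨e', ⟨⟨-, h2⟩, a, b, h3, h4⟩, -⟩ := hQ.2 e hc.edge_mem
  obtain ⟨heF', x', y', hl', hx', hy'⟩ := contract_isLink.1 h4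
  rcases hc.eq_and_eq_or_eq_and_eq h3 with ⟨ha, hb⟩ | ⟨ha, hb⟩
  · exact ⟨e', x', y', heF', h2, hl', congrArg (Quot.lift f hf) (ha.trans hx'.symm),
      congrArg (Quot.lift f hf) (hb.trans hy'.symm)⟩
  · exact ⟨e', y', x', heF', h2, hl'.symm, congrArg (Quot.lift f hf) (ha.trans hy'.symm),
      congrArg (Quot.lift f hf) (hb.trans hx'.symm)⟩

/-- Parallel edges that are not deleted are equal. -/
theorem IsParallelDeletion.eq_of_parallel (hQ : IsParallelDeletion (contract M F) Q)
    (hfib : ∀ x ∈ M.vertexSet, ∀ y ∈ M.vertexSet, f x = f y →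
      Relation.EqvGen (fun x y : α => ∃ e ∈ F, M.IsLink e x y) x y) {e e' : β} {x y x' y' : α}
    (heF : e ∉ F) (heF' : e' ∉ F) (he : e ∉ Q) (he' : e' ∉ Q) (hl : M.IsLink e x y)
    (hl' : M.IsLink e' x' y') (hx : f x = f x') (hy : f y = f y') : e = e' := by
  have hc : (contract M F).IsLink e (Quot.mk _ x) (Quot.mk _ y) :=
    contract_isLink.2 ⟨heF, x, y, hl, rfl, rfl⟩
  have hc' : (contract M F).IsLink e' (Quot.mk _ x) (Quot.mk _ y) :=
    contract_isLink.2 ⟨heF', x', y', hl',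
      Quot.eqvGen_sound (hfib _ hl'.left_mem _ hl.left_mem hx.symm),
      Quot.eqvGen_sound (hfib _ hl'.right_mem _ hl.right_mem hy.symm)⟩
  obtain ⟨g, -, hg⟩ := hQ.2 e hc.edge_mem
  rw [hg e ⟨⟨hc.edge_mem, he⟩, _, _, hc, hc⟩, hg e' ⟨⟨hc'.edge_mem, he'⟩, _, _, hc, hc'⟩]

/-- The choice of `Q` does not matter: where an edge of `G` lifts to a deleted edge, a parallel
survivor lifts it too, and survivors of a class are unique. Hence `Q` does not occur in the
hypotheses on edges. -/
theorem IsParallelDeletion.isCopyOf {G : SimpleGraph W}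
    (hQ : IsParallelDeletion (contract M F) Q)
    (hF : ∀ e ∈ F, ∀ x y, M.IsLink e x y → f x = f y)
    (hfib : ∀ x ∈ M.vertexSet, ∀ y ∈ M.vertexSet, f x = f y →
      Relation.EqvGen (fun x y : α => ∃ e ∈ F, M.IsLink e x y) x y)
    (hsurj : ∀ w, ∃ x ∈ M.vertexSet, f x = w)
    (hadj : ∀ e x y, e ∉ F → M.IsLink e x y → G.Adj (f x) (f y))
    (hlift : ∀ a b, G.Adj a b → ∃ e x y, e ∉ F ∧ M.IsLink e x y ∧ f x = a ∧ f y = b) :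
    IsCopyOf ((contract M F).deleteEdges Q) G := by
  refine isCopyOf_contract f hF hfib hsurj (fun e x y h _ => hadj e x y h) ?_ ?_
  · intro a b h
    obtain ⟨e, x, y, heF, hl, rfl, rfl⟩ := hlift a b h
    obtain ⟨e', x', y', heF', he', hl', hx, hy⟩ := hQ.exists_parallel hF heF hl
    exact ⟨e', x', y', heF', he', hl', hx.symm, hy.symm⟩
  · intro e e' x y x' y' heF he heF' he' hl hl' hx hy
    exact hQ.eq_of_parallel hfib heF heF' he he' hl hl' hx hy

end Contraction

theorem _root_.Relation.EqvGen.map {α β : Type*} {r : α → α → Prop} {s : β → β → Prop} (f : α → β)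
    (h : ∀ a b, r a b → Relation.EqvGen s (f a) (f b)) {a b : α} (hab : Relation.EqvGen r a b) :
    Relation.EqvGen s (f a) (f b) := by
  induction hab with
  | rel a b hr => exact h a b hr
  | refl a => exact Relation.EqvGen.refl _
  | symm a b _ ih => exact ih.symm
  | trans a b c _ _ ih ih' => exact ih.trans _ _ _ ih'

namespace Brick

variable {V W W' : Type*} {H : SimpleGraph V} (B : Brick H)

/-- The version of `Brick.yields_of_realizes` for contractions with parallel edges. -/
theorem yields_of_parallel [Nonempty V] {P : Set (Sym2 V)} {G : SimpleGraph W}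
    {G' : SimpleGraph W'} (hP : P ⊆ H.edgeSet) (φ : V → W)
    (hφP : ∀ u v, s(u, v) ∈ P → φ u = φ v)
    (hφ : ∀ u v, φ u = φ v → Relation.EqvGen (fun a b => s(a, b) ∈ P) u v)
    (hs : Function.Surjective φ)
    (hadj : ∀ u v, H.Adj u v → s(u, v) ∉ P → G.Adj (φ u) (φ v))
    (hlift : ∀ a b, G.Adj a b → ∃ u v, H.Adj u v ∧ s(u, v) ∉ P ∧ φ u = a ∧ φ v = b)
    (hdual : ∀ Q : Set (Sym2 V), Q ⊆ H.edgeSet \ P →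
      (∀ u v, s(u, v) ∈ Q → ∃ u' v', H.Adj u' v' ∧ s(u', v') ∉ P ∧ s(u', v') ∉ Q ∧
        φ u = φ u' ∧ φ v = φ v') →
      (∀ u v u' v', H.Adj u v → H.Adj u' v' → s(u, v) ∉ P → s(u', v') ∉ P → s(u, v) ∉ Q →
        s(u', v') ∉ Q → φ u = φ u' → φ v = φ v' → s(u, v) = s(u', v')) →
      ∃ ψ : V → W', (∀ x, ψ (B.t x) = ψ x) ∧ (∀ e x y, B.DualLink e x y → e ∈ Q → ψ x = ψ y) ∧
        (∀ x y, ψ x = ψ y →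
          Relation.EqvGen (fun a b => b = B.t a ∨ ∃ e ∈ Q, B.DualLink e a b) x y) ∧
        Realizes (fun e x y => B.DualLink e x y ∧ e ∉ P ∧ e ∉ Q) ψ G') : Yields H P G G' := by
  have hF : ∀ e ∈ P, ∀ x y, (Graph.ofSimpleGraph H).IsLink e x y → φ x = φ y := by
    rintro e he x y ⟨rfl, -⟩
    exact hφP x y he
  have hfib : ∀ x ∈ (Graph.ofSimpleGraph H).vertexSet, ∀ y ∈ (Graph.ofSimpleGraph H).vertexSet,
      φ x = φ y →
      Relation.EqvGen (fun x y : V => ∃ e ∈ P, (Graph.ofSimpleGraph H).IsLink e x y) x y :=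
    fun x _ y _ h => (hφ x y h).mono fun a b h => ⟨_, h, rfl, hP h⟩
  refine ⟨hP, ?_, _, B.isCellCollection, ?_⟩
  · intro Q hQ
    refine hQ.isCopyOf hF hfib (fun w => ?_) ?_ ?_
    · obtain ⟨x, rfl⟩ := hs w
      exact ⟨x, Set.mem_univ _, rfl⟩
    · rintro e x y he ⟨rfl, hl⟩
      exact hadj x y hl he
    · intro a b h
      obtain ⟨x, y, hl, he, rfl, rfl⟩ := hlift a b h
      exact ⟨_, x, y, he, ⟨rfl, hl⟩, rfl, rfl⟩
  · intro Q hQ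
    have hQP : Q ⊆ H.edgeSet \ P := by
      intro e he
      obtain ⟨a, b, hl⟩ := Graph.exists_isLink_of_mem_edgeSet (hQ.1 he)
      obtain ⟨heP, x, y, ⟨rfl, h⟩, -⟩ := contract_isLink.1 hl
      exact ⟨h, heP⟩
    obtain ⟨ψ, hψt, hψQ, hψ, h2⟩ := hdual Q hQP
      (by
        intro u v h
        obtain ⟨e', x', y', h1, h2, ⟨rfl, h3⟩, h4, h5⟩ :=
          hQ.exists_parallel hF (hQP h).2 (x := u) (y := v) ⟨rfl, (hQP h).1⟩
        exact ⟨x', y', h3, h1, h2, h4, h5⟩)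
      (fun u v u' v' h1 h2 h3 h4 h5 h6 h7 h8 =>
        hQ.eq_of_parallel hfib h3 h4 h5 h6 ⟨rfl, h1⟩ ⟨rfl, h2⟩ h7 h8)
    have hfac : ψ.FactorsThrough B.hex := by
      intro x y h
      rcases B.hex_eq_iff.1 h with rfl | rfl
      · rfl
      · exact (hψt x).symm
    obtain ⟨v₀⟩ := ‹Nonempty V›
    set f : Set (Sym2 V) → W' := Function.extend B.hex ψ fun _ => ψ v₀ with hf
    have hfx : ∀ x, f (B.hex x) = ψ x := fun x => hfac.extend_apply _ x
    have hlink : ∀ {e x y}, B.DualLink e x y → e ∉ P →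
        ((dual (Set.range B.hex)).deleteEdges P).IsLink e (B.hex x) (B.hex y) := by
      intro e x y hd he
      rw [Graph.deleteEdges_isLink]
      exact ⟨B.dual_isLink'.2 ⟨hd.mem_edgeSet, x, y, hd, rfl, rfl⟩, he⟩
    rw [← Graph.deleteEdges_empty (G := contract _ Q)]
    refine isCopyOf_contract f ?_ ?_ ?_ ?_ ?_ ?_
    · intro e he c d h
      obtain ⟨h, -⟩ := Graph.deleteEdges_isLink _ _ _ _ _ ▸ h
      obtain ⟨-, x, y, hd, rfl, rfl⟩ := B.dual_isLink'.1 h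
      rw [hfx, hfx]
      exact hψQ e x y hd he
    -- A chain of vertices linked by `t` or by dual edges from `Q` becomes a chain of cells; the
    -- links by `t` disappear, since both centres give the same cell.
    · rintro _ ⟨x, rfl⟩ _ ⟨y, rfl⟩ h
      rw [hfx, hfx] at h
      refine (hψ x y h).map B.hex ?_
      rintro a b (rfl | ⟨e, he, hd⟩)
      · rw [B.hex_t]
        exact Relation.EqvGen.refl _
      · exact Relation.EqvGen.rel _ _ ⟨e, he, hlink hd (hQP he).2⟩
    · intro w
      obtain ⟨x, rfl⟩ := h2.surj w
      exact ⟨B.hex x, ⟨x, rfl⟩, hfx x⟩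
    · intro e c d he _ h
      obtain ⟨h, heP⟩ := Graph.deleteEdges_isLink _ _ _ _ _ ▸ h
      obtain ⟨-, x, y, hd, rfl, rfl⟩ := B.dual_isLink'.1 h
      rw [hfx, hfx]
      exact h2.adj e x y ⟨hd, heP, he⟩
    · intro a b h
      obtain ⟨e, x, y, ⟨hd, heP, he⟩, rfl, rfl⟩ := h2.lift a b h
      exact ⟨e, B.hex x, B.hex y, he, Set.notMem_empty _, hlink hd heP, hfx x, hfx y⟩
    · intro e e' c d c' d' he _ he' _ h h' hc hd
      obtain ⟨h, heP⟩ := Graph.deleteEdges_isLink _ _ _ _ _ ▸ h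
      obtain ⟨h', heP'⟩ := Graph.deleteEdges_isLink _ _ _ _ _ ▸ h'
      obtain ⟨-, x, y, hl, rfl, rfl⟩ := B.dual_isLink'.1 h
      obtain ⟨-, x', y', hl', rfl, rfl⟩ := B.dual_isLink'.1 h'
      rw [hfx, hfx] at hc hd
      exact h2.uniq e e' x y x' y' ⟨hl, heP, he⟩ ⟨hl', heP', he'⟩ hc hd

end Brick

/-- `Realizes` for a graph `G` whose edges are the pairs `{p, n p}` and `{p, m p}`, if the
edges are parametrized accordingly. -/
theorem Realizes.of_steps {β V W : Type*} {L : β → V → V → Prop} {f : V → W} {G : SimpleGraph W}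
    (hs : Function.Surjective f) (hL : ∀ e x y, L e x y → L e y x) {n m : W → W}
    (hG : ∀ a b, G.Adj a b ↔ b = n a ∨ a = n b ∨ b = m a ∨ a = m b) (en em : W → β)
    (h : ∀ e x y, L e x y → ∃ p, (e = en p ∧ s(f x, f y) = s(p, n p)) ∨
      (e = em p ∧ s(f x, f y) = s(p, m p)))
    (hn : ∀ p, ∃ x y, L (en p) x y ∧ f x = p ∧ f y = n p)
    (hm : ∀ p, ∃ x y, L (em p) x y ∧ f x = p ∧ f y = m p)
    (hnn : ∀ p p', s(p, n p) = s(p', n p') → p = p')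
    (hmm : ∀ p p', s(p, m p) = s(p', m p') → p = p')
    (hnm : ∀ p p', s(p, n p) ≠ s(p', m p')) : Realizes L f G := by
  refine ⟨hs, ?_, ?_, ?_⟩
  · intro e x y hl
    rw [← SimpleGraph.mem_edgeSet]
    obtain ⟨p, ⟨-, h⟩ | ⟨-, h⟩⟩ := h e x y hl <;> rw [h, SimpleGraph.mem_edgeSet, hG] <;> tauto
  · intro a b hab
    rcases (hG a b).1 hab with rfl | rfl | rfl | rfl
    · obtain ⟨x, y, h1, h2, h3⟩ := hn a
      exact ⟨_, x, y, h1, h2, h3⟩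
    · obtain ⟨x, y, h1, h2, h3⟩ := hn b
      exact ⟨_, y, x, hL _ _ _ h1, h3, h2⟩
    · obtain ⟨x, y, h1, h2, h3⟩ := hm a
      exact ⟨_, x, y, h1, h2, h3⟩
    · obtain ⟨x, y, h1, h2, h3⟩ := hm b
      exact ⟨_, y, x, hL _ _ _ h1, h3, h2⟩
  · intro e e' x y x' y' hl hl' hx hy
    have hxy : s(f x, f y) = s(f x', f y') := by rw [hx, hy]
    obtain ⟨p, ⟨rfl, h1⟩ | ⟨rfl, h1⟩⟩ := h e x y hl <;>
      obtain ⟨p', ⟨rfl, h2⟩ | ⟨rfl, h2⟩⟩ := h e' x' y' hl' <;> rw [h1, h2] at hxy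
    · rw [hnn p p' hxy]
    · exact absurd hxy (hnm p p')
    · exact absurd hxy.symm (hnm p' p)
    · rw [hmm p p' hxy]

end HexTiling

/-! ### Grids closed by a reflection, and the contraction of Klein bottle tilings -/

namespace HexTiling

def gridUp {p q : ℕ} (a : gridV p q) : gridV p q :=
  ⟨(if a.1.1 + 1 = p then 0 else a.1.1 + 1, a.1.2), by
    have h : a.1.1 < p := a.2.1
    exact ⟨by dsimp only; split_ifs <;> omega, a.2.2⟩⟩

def gridDown {p q : ℕ} (a : gridV p q) : gridV p q :=
  ⟨(if a.1.1 = 0 then p - 1 else a.1.1 - 1, a.1.2), by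
    have h : a.1.1 < p := a.2.1
    exact ⟨by dsimp only; split_ifs <;> omega, a.2.2⟩⟩

/-- The right neighbour in the grid closed by the reflection `j ↦ u - j`. -/
def gridNext {p q : ℕ} (u : ℕ) (hu : u < p) (a : gridV p q) : gridV p q :=
  ⟨(if a.1.2 + 1 = q then reflect p u a.1.1 else a.1.1,
    if a.1.2 + 1 = q then 0 else a.1.2 + 1), by
    have h : a.1.1 < p := a.2.1
    have h' : a.1.2 < q := a.2.2
    constructor <;> simp only [reflect] <;> split_ifs <;> omega⟩

theorem gridUp_gridDown {p q : ℕ} (a : gridV p q) : gridUp (gridDown a) = a := by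
  have h : a.1.1 < p := a.2.1
  simp only [gridUp, gridDown, Subtype.ext_iff, Prod.ext_iff, and_true]
  grind

theorem gridDown_gridUp {p q : ℕ} (a : gridV p q) : gridDown (gridUp a) = a := by
  have h : a.1.1 < p := a.2.1
  simp only [gridUp, gridDown, Subtype.ext_iff, Prod.ext_iff, and_true]
  grind

theorem eq_gridUp_iff {p q : ℕ} (a b : gridV p q) : b = gridUp a ↔ a = gridDown b :=
  ⟨fun h => by rw [h, gridDown_gridUp], fun h => by rw [h, gridUp_gridDown]⟩

theorem eq_gridUp_iff' {p q : ℕ} (hp : 2 ≤ p) (a b : gridV p q) : b = gridUp a ↔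
    (b.1.1 = a.1.1 + 1 ∧ b.1.2 = a.1.2) ∨ (b.1.1 = 0 ∧ a.1.1 = p - 1 ∧ a.1.2 = b.1.2) := by
  have h : a.1.1 < p := a.2.1
  have h' : b.1.1 < p := b.2.1
  simp only [gridUp, Subtype.ext_iff, Prod.ext_iff]
  split_ifs <;> omega

theorem eq_gridNext_iff {p q u : ℕ} (hu : u < p) (a b : gridV p q) : b = gridNext u hu a ↔
    (b.1.1 = a.1.1 ∧ b.1.2 = a.1.2 + 1) ∨
      (b.1.2 = 0 ∧ a.1.1 = reflect p u b.1.1 ∧ a.1.2 = q - 1) := by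
  have h : a.1.2 < q := a.2.2
  have h' : b.1.2 < q := b.2.2
  have h5 : b.1.1 = reflect p u a.1.1 ↔ a.1.1 = reflect p u b.1.1 :=
    ⟨fun h => by rw [h, KleinShape.reflect_reflect hu a.2.1],
      fun h => by rw [h, KleinShape.reflect_reflect hu b.2.1]⟩
  by_cases h6 : a.1.2 + 1 = q
  · simp only [gridNext, Subtype.ext_iff, Prod.ext_iff, h6, if_true, h5]
    omega
  · simp only [gridNext, Subtype.ext_iff, Prod.ext_iff, h6, if_false]
    omega

theorem gridNext_injective {p q u : ℕ} (hu : u < p) :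
    Function.Injective (gridNext u hu : gridV p q → gridV p q) := by
  intro a b h
  rcases (eq_gridNext_iff hu a _).1 rfl with h1 | h1 <;>
    rcases (eq_gridNext_iff hu b _).1 rfl with h2 | h2 <;>
    rw [h] at h1 <;> rw [Subtype.ext_iff, Prod.ext_iff] <;> omega

theorem gridUp_fst_ne {p q : ℕ} (hp : 2 ≤ p) (a : gridV p q) : (gridUp a).1.1 ≠ a.1.1 := by
  have h : a.1.1 < p := a.2.1
  simp only [gridUp]
  split_ifs <;> omega

theorem gridUp_ne {p q : ℕ} (hp : 2 ≤ p) (a : gridV p q) : gridUp a ≠ a :=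
  fun h => gridUp_fst_ne hp a (by rw [h])

theorem gridNext_snd_ne {p q u : ℕ} (hq : 2 ≤ q) (hu : u < p) (a : gridV p q) :
    (gridNext u hu a).1.2 ≠ a.1.2 := by
  have h : a.1.2 < q := a.2.2
  simp only [gridNext]
  split_ifs <;> omega

theorem gridNext_gridNext_snd_ne {p q u : ℕ} (hq : 3 ≤ q) (hu : u < p) (a : gridV p q) :
    (gridNext u hu (gridNext u hu a)).1.2 ≠ a.1.2 := by
  have h : a.1.2 < q := a.2.2
  simp only [gridNext]
  split_ifs <;> omega

theorem gridUp_gridUp_ne {p q : ℕ} (hp : 3 ≤ p) (a : gridV p q) : gridUp (gridUp a) ≠ a := by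
  have h : a.1.1 < p := a.2.1
  simp only [gridUp, ne_eq, Subtype.ext_iff, Prod.ext_iff, and_true]
  split_ifs <;> omega

theorem gridTwist_reflect_adj_iff {p q u : ℕ} (hp : 2 ≤ p) (hq : 2 ≤ q) (hu : u < p)
    (a b : gridV p q) : (gridTwist p q (reflect p u)).Adj a b ↔
      b = gridDown a ∨ a = gridDown b ∨ b = gridNext u hu a ∨ a = gridNext u hu b := by
  have key : (gridTwist p q (reflect p u)).Adj a b ↔ a ≠ b ∧
      (b = gridDown a ∨ a = gridDown b ∨ b = gridNext u hu a ∨ a = gridNext u hu b) := by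
    rw [← eq_gridUp_iff, ← eq_gridUp_iff, eq_gridUp_iff' hp, eq_gridUp_iff' hp, eq_gridNext_iff,
      eq_gridNext_iff, gridTwist, graphOn_adj]
    refine and_congr_right fun _ => ?_
    simp only [gridE, sideE]
    constructor
    · rintro (((h | h) | h | h) | (h | h) | h | h) <;> simp [h]
    · rintro ((h | h) | (h | h) | (h | h) | h | h) <;> simp [h]
  rw [key]
  refine and_iff_right_of_imp ?_
  rintro (h | h | h | h) rfl
  · exact gridUp_ne hp a ((eq_gridUp_iff _ _).2 h).symm
  · exact gridUp_ne hp a ((eq_gridUp_iff _ _).2 h).symm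
  · exact gridNext_snd_ne hq hu a (by rw [← h])
  · exact gridNext_snd_ne hq hu a (by rw [← h])

/-- Each edge of the grid is a step down from one vertex or a step to the next column from one
vertex, and in only one way: steps down keep the column, the other steps change it, and as `p` and
`q` are at least three, two steps of the same kind never lead back. -/
theorem realizes_gridTwist {β V : Type*} {L : β → V → V → Prop} {p q u : ℕ} (hp : 3 ≤ p)
    (hq : 3 ≤ q) (hu : u < p) {f : V → gridV p q} (hs : Function.Surjective f)
    (hL : ∀ e x y, L e x y → L e y x) (en em : gridV p q → β)
    (h : ∀ e x y, L e x y → ∃ p, (e = en p ∧ s(f x, f y) = s(p, gridDown p)) ∨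
      (e = em p ∧ s(f x, f y) = s(p, gridNext u hu p)))
    (hn : ∀ p, ∃ x y, L (en p) x y ∧ f x = p ∧ f y = gridDown p)
    (hm : ∀ p, ∃ x y, L (em p) x y ∧ f x = p ∧ f y = gridNext u hu p) :
    Realizes L f (gridTwist p q (reflect p u)) := by
  have hd : ∀ a : gridV p q, (gridDown a).1.2 = a.1.2 := fun _ => rfl
  refine Realizes.of_steps hs hL (gridTwist_reflect_adj_iff (by omega) (by omega) hu) en em h hn hm
    ?_ ?_ ?_
  · intro a b hab
    rcases Sym2.eq_iff.1 hab with ⟨h, -⟩ | ⟨h1, h2⟩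
    · exact h
    · exfalso
      rw [← eq_gridUp_iff] at h1
      rw [eq_comm, ← eq_gridUp_iff] at h2
      exact gridUp_gridUp_ne hp a (by rw [← h1, ← h2])
  · intro a b hab
    rcases Sym2.eq_iff.1 hab with ⟨h, -⟩ | ⟨h1, h2⟩
    · exact h
    · exact absurd (by rw [h2, ← h1]) (gridNext_gridNext_snd_ne hq hu a)
  · intro a b hab
    rcases Sym2.eq_iff.1 hab with ⟨h1, h2⟩ | ⟨h1, h2⟩
    · exact gridNext_snd_ne (by omega) hu b (by rw [← h2, hd, h1])
    · exact gridNext_snd_ne (by omega) hu b (by rw [← h1, ← h2, hd])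

namespace KleinShape

variable {S : KleinShape}

def q (S : KleinShape) : ℕ := S.k / 2

/-- The reflection that closes the dual grid. -/
def w (S : KleinShape) : ℕ := if S.u = 0 then S.R - 1 else S.u - 1

theorem w_lt : S.w < S.R := by
  have := S.u_lt
  have := S.four_le
  unfold w
  split_ifs <;> omega

def P (S : KleinShape) : Set (Sym2 S.V) :=
  pairsOn S.V fun u v => v.1 = u.1 ∧ v.2 = u.2 + 1 ∧
    ((u.2 ≤ S.l ∧ Even u.2) ∨ (S.l + 1 ≤ u.2 ∧ Odd u.2))

/-- The edge from `v` to its left neighbour does not belong to `P`. -/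
def Cut (v : S.V) : Prop :=
  (v.1.2 % 2 = 0 ∧ v.1.2 ≤ S.l) ∨ (v.1.2 % 2 = 1 ∧ S.l + 3 ≤ v.1.2)

theorem mem_P_iff {a b : S.V} :
    s(a, b) ∈ S.P ↔ (b = left a ∧ ¬ Cut a) ∨ (a = left b ∧ ¬ Cut b) := by
  have key : ∀ a b : S.V, (b.1.1 = a.1.1 ∧ b.1.2 = a.1.2 + 1 ∧
      ((a.1.2 ≤ S.l ∧ Even a.1.2) ∨ (S.l + 1 ≤ a.1.2 ∧ Odd a.1.2))) ↔ a = left b ∧ ¬ Cut b := by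
    intro a b
    have h := S.l_even
    rw [eq_left_iff, Cut, Nat.even_iff, Nat.odd_iff]
    generalize reflect S.R S.u b.1.1 = x
    have h' : b.1.2 < S.k := b.2.2
    omega
  constructor
  · rintro ⟨u, v, h, he⟩
    rcases Sym2.eq_iff.1 he with ⟨rfl, rfl⟩ | ⟨rfl, rfl⟩
    · exact Or.inr ((key _ _).1 h)
    · exact Or.inl ((key _ _).1 h)
  · rintro (h | h)
    · exact ⟨b, a, (key _ _).2 h, Sym2.eq_swap⟩
    · exact ⟨a, b, (key _ _).2 h, rfl⟩

theorem vert_notMem_P (v : S.V) : s(v, vert v) ∉ S.P := by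
  rw [mem_P_iff]
  rintro (⟨h, -⟩ | ⟨h, -⟩)
  · exact left_snd_ne v (by rw [← h, vert_snd])
  · exact left_snd_ne (vert v) (by rw [← h, vert_snd])

theorem left_mem_P {v : S.V} : s(v, left v) ∈ S.P ↔ ¬ Cut v := by
  rw [mem_P_iff]
  constructor
  · rintro (⟨-, h⟩ | ⟨h, -⟩)
    · exact h
    -- Here `v = left (left v)`, which is impossible in a cycle of at least six columns.
    · exfalso
      have h1 := right_right_snd_ne v
      have h2 : v.1.2 < S.k := v.2.2
      have h6 := S.six_le
      have h3 := congrArg (fun x => x.1.2) h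
      simp only [left] at h3
      split_ifs at h3 <;> omega
  · exact fun h => Or.inl ⟨rfl, h⟩

/-- The edges outside `P`. -/
theorem adj_cases {a b : S.V} (h : S.graph.Adj a b) (hP : s(a, b) ∉ S.P) :
    (Cut a ∧ b = left a) ∨ (Cut b ∧ a = left b) ∨ b = vert a := by
  rcases (graph_adj a b).1 h with rfl | rfl | rfl
  · rw [left_mem_P, not_not] at hP
    exact Or.inl ⟨hP, rfl⟩
  · refine Or.inr (Or.inl ⟨?_, (left_right a).symm⟩)
    rw [Sym2.eq_swap] at hP
    have h := left_mem_P (v := right a)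
    rw [left_right] at h
    rwa [h, not_not] at hP
  · exact Or.inr (Or.inr rfl)

/-- The vertex of the contracted graph. -/
def node (v : S.V) : gridV S.R S.q :=
  ⟨(v.1.1, if v.1.2 ≤ S.l + 1 then v.1.2 / 2 else (v.1.2 - 1) / 2), by
    have h2 : v.1.2 < S.k := v.2.2
    have h3 := S.l_le
    refine ⟨v.2.1, ?_⟩
    simp only [q]
    split_ifs <;> omega⟩

theorem node_left {v : S.V} (h : Cut v) : node v = gridNext S.u S.u_lt (node (left v)) := by
  have h2 : v.1.2 < S.k := v.2.2
  have h3 := S.l_le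
  have h4 := S.l_even
  have h5 := S.six_le
  rw [eq_gridNext_iff]
  unfold Cut at h
  by_cases h6 : v.1.2 = 0
  · right
    simp only [node, left, h6, q, if_true]
    refine ⟨by simp, trivial, ?_⟩
    split_ifs <;> omega
  · left
    simp only [node, left, h6, q, if_false, true_and]
    split_ifs <;> omega

theorem node_above (v : S.V) : node (above v) = gridUp (node v) := rfl

theorem node_below (v : S.V) : node (below v) = gridDown (node v) := rfl

/-- The vertex of a class whose edge to the left lies outside `P`. -/
def first (a : gridV S.R S.q) : S.V :=
  ⟨(a.1.1, if a.1.2 ≤ S.l / 2 then 2 * a.1.2 else 2 * a.1.2 + 1), by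
    have h2 : a.1.2 < S.k / 2 := a.2.2
    refine ⟨a.2.1, ?_⟩
    dsimp only
    split_ifs <;> omega⟩

theorem node_first (a : gridV S.R S.q) : node (first a) = a := by
  have h4 := S.l_even
  simp only [node, first, Subtype.ext_iff, Prod.ext_iff, true_and]
  split_ifs <;> omega

theorem cut_first (a : gridV S.R S.q) : Cut (first a) := by
  have h4 := S.l_even
  simp only [Cut, first]
  split_ifs <;> omega

theorem first_node {v : S.V} (h : Cut v) : first (node v) = v := by
  have h4 := S.l_even
  unfold Cut at h
  simp only [node, first, Subtype.ext_iff, Prod.ext_iff, true_and]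
  split_ifs <;> omega

/-- A vertex of a class from which the vertical edge goes up. -/
def rising (a : gridV S.R S.q) : S.V :=
  ⟨(a.1.1, if a.1.2 ≤ S.l / 2 then 2 * a.1.2 + a.1.1 % 2 else 2 * a.1.2 + 2 - a.1.1 % 2), by
    have h2 : a.1.2 < S.k / 2 := a.2.2
    have h3 := S.l_le
    refine ⟨a.2.1, ?_⟩
    dsimp only
    split_ifs <;> omega⟩

theorem node_rising (a : gridV S.R S.q) : node (rising a) = a := by
  have h4 := S.l_even
  simp only [node, rising, Subtype.ext_iff, Prod.ext_iff, true_and]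
  split_ifs <;> omega

theorem not_isOdd_rising (a : gridV S.R S.q) : ¬ IsOdd (rising a) := by
  simp only [IsOdd, rising]
  split_ifs <;> omega

/-- The vertex of a class that is joined to the others by `P`. -/
def centre (a : gridV S.R S.q) : S.V :=
  ⟨(a.1.1, 2 * a.1.2 + 1), by
    have h2 : a.1.2 < S.k / 2 := a.2.2
    refine ⟨a.2.1, ?_⟩
    dsimp only
    omega⟩

/-- A class has the columns `2 * j` and `2 * j + 1`, or `2 * j + 1` and `2 * j + 2`, or, where the
pattern of `P` switches, all three. The column `2 * j + 1` always belongs to it, and the others are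
joined to this one by a single edge of `P`. -/
theorem eqvGen_centre (v : S.V) :
    Relation.EqvGen (fun a b => s(a, b) ∈ S.P) v (centre (node v)) := by
  have h4 := S.l_even
  have h3 := S.l_le
  have h2 : v.1.2 < S.k := v.2.2
  have h : v = centre (node v) ∨ (v = left (centre (node v)) ∧ ¬ Cut (centre (node v))) ∨
      (centre (node v) = left v ∧ ¬ Cut v) := by
    rw [eq_left_iff, eq_left_iff]
    simp only [Cut, centre, node, Subtype.ext_iff, Prod.ext_iff, true_and]
    split_ifs <;> omega
  rcases h with h | h | h
  · rw [← h]
    exact Relation.EqvGen.refl _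
  · exact Relation.EqvGen.rel _ _ (mem_P_iff.2 (Or.inr h))
  · exact Relation.EqvGen.rel _ _ (mem_P_iff.2 (Or.inl h))

theorem node_eq_of_mem_P {a b : S.V} (h : s(a, b) ∈ S.P) : node a = node b := by
  have key : ∀ v : S.V, ¬ Cut v → node (left v) = node v := by
    intro v hv
    have h4 := S.l_even
    have h2 : v.1.2 < S.k := v.2.2
    unfold Cut at hv
    have h6 : ¬ v.1.2 = 0 := by omega
    simp only [node, left, h6, Subtype.ext_iff, Prod.ext_iff, if_false, true_and]
    split_ifs <;> omega
  rcases mem_P_iff.1 h with ⟨rfl, h1⟩ | ⟨rfl, h1⟩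
  · exact (key a h1).symm
  · exact key b h1

theorem three_le_q : 3 ≤ S.q := by
  have := S.six_le
  unfold q
  omega

/-- Edges outside `P` with the same ends are equal, except at the column `l + 1`. -/
theorem parallel_cases {a b a' b' : S.V} (h : S.graph.Adj a b) (h' : S.graph.Adj a' b')
    (hP : s(a, b) ∉ S.P) (hP' : s(a', b') ∉ S.P) (ha : node a = node a') (hb : node b = node b') :
    (a = a' ∧ b = b') ∨ (b = vert a ∧ b' = vert a' ∧ (IsOdd a ↔ IsOdd a') ∧ a.1.1 = a'.1.1 ∧
      ((a.1.2 = S.l ∧ a'.1.2 = S.l + 2) ∨ (a.1.2 = S.l + 2 ∧ a'.1.2 = S.l))) := by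
  have hq := S.three_le_q
  have hR := S.four_le
  have hsnd : ∀ x : S.V, (node (vert x)).1.2 = (node x).1.2 := fun x => by
    simp only [node, vert_snd]
  rcases adj_cases h hP with ⟨h1, rfl⟩ | ⟨h1, rfl⟩ | rfl <;>
    rcases adj_cases h' hP' with ⟨h2, rfl⟩ | ⟨h2, rfl⟩ | rfl
  · left
    rw [← first_node h1, ha, first_node h2]
    exact ⟨rfl, rfl⟩
  · exfalso
    have e1 := node_left h1
    have e2 := node_left h2
    rw [hb, e2, ← ha] at e1
    exact gridNext_gridNext_snd_ne hq S.u_lt (node a) (by rw [← e1])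
  · exfalso
    have e1 := node_left h1
    exact gridNext_snd_ne (by omega) S.u_lt (node (left a)) (by rw [← e1, hb, hsnd, ha])
  · exfalso
    have e1 := node_left h1
    have e2 := node_left h2
    rw [ha, e2, ← hb] at e1
    exact gridNext_gridNext_snd_ne hq S.u_lt (node b) (by rw [← e1])
  · left
    rw [← first_node h1, hb, first_node h2]
    exact ⟨rfl, rfl⟩
  · exfalso
    have e1 := node_left h1
    exact gridNext_snd_ne (by omega) S.u_lt (node (left b)) (by rw [← e1, ha, hb, hsnd])
  · exfalso
    have e1 := node_left h2
    exact gridNext_snd_ne (by omega) S.u_lt (node (left a')) (by rw [← e1, ← ha, ← hb, hsnd])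
  · exfalso
    have e1 := node_left h2
    exact gridNext_snd_ne (by omega) S.u_lt (node (left b')) (by rw [← e1, ← ha, ← hb, hsnd])
  -- Two vertical edges from the same class to the same class both go up or both go down, since the
  -- rows above and below differ. Their columns then have equal parity, and within a class this
  -- leaves equal columns or the pair `l`, `l + 2`.
  · have hrow : a.1.1 = a'.1.1 := congrArg (fun x => x.1.1) ha
    have hpar : IsOdd a ↔ IsOdd a' := by
      by_cases o1 : IsOdd a <;> by_cases o2 : IsOdd a'
      · simp only [o1, o2]
      · exfalso
        rw [vert, if_pos o1, vert, if_neg o2, node_below, node_above, ha, eq_comm] at hb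
        have h5 := congrArg gridUp hb
        rw [gridUp_gridDown] at h5
        exact gridUp_gridUp_ne (by omega) _ h5
      · exfalso
        rw [vert, if_neg o1, vert, if_pos o2, node_below, node_above, ha] at hb
        have h5 := congrArg gridUp hb
        rw [gridUp_gridDown] at h5
        exact gridUp_gridUp_ne (by omega) _ h5
      · simp only [o1, o2]
    have hcol : a.1.2 = a'.1.2 ∨
        ((a.1.2 = S.l ∧ a'.1.2 = S.l + 2) ∨ (a.1.2 = S.l + 2 ∧ a'.1.2 = S.l)) := by
      have h4 := S.l_even
      have hc : (node a).1.2 = (node a').1.2 := by rw [ha]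
      simp only [node] at hc
      unfold IsOdd at hpar
      split_ifs at hc <;> omega
    rcases hcol with hcol | hcol
    · left
      have : a = a' := Subtype.ext (Prod.ext hrow hcol)
      exact ⟨this, by rw [this]⟩
    · exact Or.inr ⟨rfl, rfl, hpar, hrow, hcol⟩

end KleinShape
end HexTiling

namespace HexTiling
namespace KleinShape

variable {S : KleinShape}

theorem adj_node {a b : S.V} (h : S.graph.Adj a b) (hP : s(a, b) ∉ S.P) :
    (gridTwist S.R S.q (reflect S.R S.u)).Adj (node a) (node b) := by
  have hq := S.three_le_q
  have hR := S.four_le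
  rw [gridTwist_reflect_adj_iff (by omega) (by omega) S.u_lt]
  rcases adj_cases h hP with ⟨h1, rfl⟩ | ⟨h1, rfl⟩ | rfl
  · exact Or.inr (Or.inr (Or.inr (node_left h1)))
  · exact Or.inr (Or.inr (Or.inl (node_left h1)))
  · unfold vert
    split_ifs
    · exact Or.inl rfl
    · right; left
      rw [node_above, gridDown_gridUp]

theorem exists_adj_node {a b : gridV S.R S.q}
    (h : (gridTwist S.R S.q (reflect S.R S.u)).Adj a b) :
    ∃ u v, S.graph.Adj u v ∧ s(u, v) ∉ S.P ∧ node u = a ∧ node v = b := by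
  have hq := S.three_le_q
  have hR := S.four_le
  rw [gridTwist_reflect_adj_iff (by omega) (by omega) S.u_lt] at h
  have h1 : ∀ a : gridV S.R S.q, ∃ u v, S.graph.Adj u v ∧ s(u, v) ∉ S.P ∧ node u = a ∧
      node v = gridUp a := by
    intro a
    refine ⟨rising a, vert (rising a), (graph_adj _ _).2 (Or.inr (Or.inr rfl)), vert_notMem_P _,
      node_rising a, ?_⟩
    rw [vert, if_neg (not_isOdd_rising a), node_above, node_rising]
  have h2 : ∀ a : gridV S.R S.q, ∃ u v, S.graph.Adj u v ∧ s(u, v) ∉ S.P ∧ node u = a ∧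
      node v = gridNext S.u S.u_lt a := by
    intro a
    -- The step from `a` to the next class is the row edge that enters that class from the left, at
    -- its first vertex.
    refine ⟨left (first (gridNext S.u S.u_lt a)), first (gridNext S.u S.u_lt a),
      ((graph_adj _ _).2 (Or.inl rfl)).symm, ?_, ?_, node_first _⟩
    · rw [Sym2.eq_swap, left_mem_P, not_not]
      exact cut_first _
    · apply gridNext_injective S.u_lt
      rw [← node_left (cut_first _), node_first]
  have hswap : ∀ {a b : gridV S.R S.q}, (∃ u v, S.graph.Adj u v ∧ s(u, v) ∉ S.P ∧ node u = a ∧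
      node v = b) → ∃ u v, S.graph.Adj u v ∧ s(u, v) ∉ S.P ∧ node u = b ∧ node v = a := by
    rintro a b ⟨u, v, h1, h2, h3, h4⟩
    exact ⟨v, u, h1.symm, by rwa [Sym2.eq_swap], h4, h3⟩
  rcases h with h | h | rfl | rfl
  · rw [← eq_gridUp_iff] at h
    exact h ▸ hswap (h1 b)
  · rw [← eq_gridUp_iff] at h
    exact h ▸ h1 a
  · exact h2 a
  · exact hswap (h2 b)

/-! The dual graph: a hexagon has the row of the odd one of its two centres.  The hexagons of
column `l + 1` are merged with those to the left or to the right, as `s` prescribes. -/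

section Dual

variable (s : ℕ → Prop) [DecidablePred s]

/-- The dual columns are bounded by vertical edges of the classes: up to `l`, centres in the columns
`2 * j - 1` and `2 * j` belong to `j`; after the switch, those in `2 * j` and `2 * j + 1`. The
hexagon centred in column `l + 1` lies between two parallel edges and joins the side whose edge is
deleted. The value `S.q` stands for column `0` reached through the seam. -/
def cellCol (S : KleinShape) (i c : ℕ) : ℕ :=
  if c ≤ S.l then (c + 1) / 2 else if c = S.l + 1 then (if s i then S.l / 2 else S.l / 2 + 1)
    else c / 2

/-- The odd centre is the lower of the two, because the vertical edge of an odd vertex goes down and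
its hexagon lies above it. -/
def cellRow (v : S.V) : ℕ := if IsOdd v then v.1.1 else (below v).1.1

/-- The cell with row `i` and column `c`, where column `q` is glued to column `0`. -/
def cellAt (S : KleinShape) (i c : ℕ) : ℕ × ℕ :=
  (if cellCol s S i c = S.q then reflect S.R S.w i else i,
    if cellCol s S i c = S.q then 0 else cellCol s S i c)

theorem cellRow_lt (v : S.V) : cellRow v < S.R := by
  unfold cellRow
  split_ifs
  · exact v.2.1
  · exact (below v).2.1

theorem reflect_lt {p u i : ℕ} (hu : u < p) (hi : i < p) : reflect p u i < p := by
  simp only [reflect]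
  split_ifs <;> omega

theorem cellCol_le (i : ℕ) {c : ℕ} (hc : c < S.k) : cellCol s S i c ≤ S.q := by
  have h3 := S.l_le
  unfold cellCol q
  split_ifs <;> omega

def cell (v : S.V) : gridV S.R S.q :=
  ⟨cellAt s S (cellRow v) v.1.2, by
    have h1 := cellRow_lt v
    have h2 := reflect_lt S.w_lt h1
    have h3 := cellCol_le s (cellRow v) v.2.2
    have h4 := S.three_le_q
    constructor <;> simp only [cellAt] <;> split_ifs <;> omega⟩

theorem cellRow_opp (v : S.V) : cellRow (opp v) = cellRow v := by
  by_cases h : IsOdd v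
  · have h' : ¬ IsOdd (above v) := by rw [isOdd_above]; exact not_not.2 h
    simp only [cellRow, opp, h, if_true, h', if_false, below_above]
  · have h' : IsOdd (below v) := by rw [isOdd_below]; exact h
    simp only [cellRow, opp, h, if_false, h', if_true]

theorem opp_snd (v : S.V) : (opp v).1.2 = v.1.2 := by
  unfold opp
  split_ifs <;> rfl

theorem cell_opp (v : S.V) : cell s (opp v) = cell s v := by
  simp only [cell, cellRow_opp, opp_snd]

theorem pred_reflect {i : ℕ} (hi : i < S.R) :
    (if reflect S.R S.u i = 0 then S.R - 1 else reflect S.R S.u i - 1) = reflect S.R S.w i := by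
  have h1 := S.u_lt
  unfold reflect w
  grind

theorem reflect_w_reflect {i : ℕ} (hi : i < S.R) :
    reflect S.R S.w (reflect S.R S.u i) = if i = 0 then S.R - 1 else i - 1 := by
  have h1 := S.u_lt
  unfold reflect w
  grind

theorem cellRow_of_isOdd {v : S.V} (h : IsOdd v) : cellRow v = v.1.1 := if_pos h

theorem cellRow_of_not_isOdd {v : S.V} (h : ¬ IsOdd v) :
    cellRow v = if v.1.1 = 0 then S.R - 1 else v.1.1 - 1 := if_neg h

theorem cellRow_left (v : S.V) : cellRow (left v) =
    if v.1.2 = 0 then (if IsOdd v then reflect S.R S.u v.1.1 else reflect S.R S.w v.1.1)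
    else if IsOdd v then (if v.1.1 = 0 then S.R - 1 else v.1.1 - 1) else v.1.1 := by
  have h1 := isOdd_left v
  by_cases h : v.1.2 = 0 <;> by_cases hv : IsOdd v <;>
    simp only [h, hv, if_true, if_false, not_true, not_false_iff, iff_true, iff_false] at h1 ⊢
  · rw [cellRow_of_isOdd h1]
    simp only [left, h, if_true]
  · rw [cellRow_of_not_isOdd h1]
    simp only [left, h, if_true]
    exact pred_reflect v.2.1
  · rw [cellRow_of_not_isOdd h1]
    simp only [left, h, if_false]
  · rw [cellRow_of_isOdd h1]
    simp only [left, h, if_false]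

theorem cellRow_right (v : S.V) : cellRow (right v) =
    if v.1.2 + 1 = S.k then (if IsOdd v then reflect S.R S.u v.1.1 else reflect S.R S.w v.1.1)
    else if IsOdd v then (if v.1.1 = 0 then S.R - 1 else v.1.1 - 1) else v.1.1 := by
  have h1 := isOdd_right v
  by_cases h : v.1.2 + 1 = S.k <;> by_cases hv : IsOdd v <;>
    simp only [h, hv, if_true, if_false, not_true, not_false_iff, iff_true, iff_false] at h1 ⊢
  · rw [cellRow_of_isOdd h1]
    simp only [right, h, if_true]
  · rw [cellRow_of_not_isOdd h1]
    simp only [right, h, if_true]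
    exact pred_reflect v.2.1
  · rw [cellRow_of_not_isOdd h1]
    simp only [right, h, if_false]
  · rw [cellRow_of_isOdd h1]
    simp only [right, h, if_false]

theorem cellAt_of_ne {i c : ℕ} (h : cellCol s S i c ≠ S.q) :
    cellAt s S i c = (i, cellCol s S i c) := by
  simp only [cellAt, h, if_false]

theorem cellAt_last (i : ℕ) : cellAt s S i (S.k - 1) = (reflect S.R S.w i, 0) := by
  have h3 := S.l_le
  have h4 := S.l_even
  have h5 := S.six_le
  have h : cellCol s S i (S.k - 1) = S.q := by
    unfold cellCol q
    split_ifs <;> omega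
  simp only [cellAt, h, if_true]

theorem left_snd (v : S.V) : (left v).1.2 = if v.1.2 = 0 then S.k - 1 else v.1.2 - 1 := rfl

theorem right_snd (v : S.V) : (right v).1.2 = if v.1.2 + 1 = S.k then 0 else v.1.2 + 1 := rfl

/-- The two cells at a row edge outside `P`. -/
theorem cell_of_cut {v : S.V} (h : Cut v) :
    (cell s v = node v ∧ cell s (left v) = gridDown (node v)) ∨
      (cell s v = gridDown (node v) ∧ cell s (left v) = node v) := by
  have h1 : v.1.1 < S.R := v.2.1
  have h2 : v.1.2 < S.k := v.2.2
  have h3 := S.l_le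
  have h4 := S.l_even
  have h5 := S.six_le
  have hr1 := reflect_w_reflect h1
  have hr2 := reflect_reflect S.w_lt h1
  unfold Cut at h
  have hc : ∀ i, cellCol s S i v.1.2 = (node v).1.2 ∧ cellCol s S i v.1.2 ≠ S.q := by
    intro i
    simp only [cellCol, node, q]
    split_ifs <;> omega
  have hc' : v.1.2 ≠ 0 → ∀ i, cellCol s S i (v.1.2 - 1) = (node v).1.2 ∧
      cellCol s S i (v.1.2 - 1) ≠ S.q := by
    intro h0 i
    simp only [cellCol, node, q]
    split_ifs <;> omega
  have hd : (gridDown (node v)).1 = (if v.1.1 = 0 then S.R - 1 else v.1.1 - 1, (node v).1.2) := rfl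
  have hn : (node v).1 = (v.1.1, (node v).1.2) := rfl
  have e1 : (cell s v).1 = (cellRow v, (node v).1.2) := by
    rw [← (hc (cellRow v)).1]
    exact cellAt_of_ne s (hc (cellRow v)).2
  have e2 : (cell s (left v)).1 =
      (if IsOdd v then (if v.1.1 = 0 then S.R - 1 else v.1.1 - 1) else v.1.1, (node v).1.2) := by
    by_cases h0 : v.1.2 = 0
    · have h6 : (node v).1.2 = 0 := by
        simp only [node, h0]
        split_ifs <;> omega
      rw [h6]
      have h7 : (cell s (left v)).1 = cellAt s S (cellRow (left v)) (left v).1.2 := rfl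
      rw [h7, left_snd, if_pos h0, cellAt_last, cellRow_left, if_pos h0]
      by_cases hv : IsOdd v
      · simp only [hv, if_true, hr1]
      · simp only [hv, if_false, hr2]
    · have h7 : (cell s (left v)).1 = cellAt s S (cellRow (left v)) (left v).1.2 := rfl
      rw [h7, left_snd, if_neg h0, cellAt_of_ne s (hc' h0 _).2, (hc' h0 _).1, cellRow_left,
        if_neg h0]
  -- The row edge separates a hexagon above the row from one below. If `v` is odd, its own hexagon
  -- is the upper one; if `v` is even, the upper one is that of `left v`.
  by_cases hv : IsOdd v
  · left
    rw [cellRow_of_isOdd hv] at e1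
    rw [if_pos hv] at e2
    exact ⟨Subtype.ext (e1.trans hn.symm), Subtype.ext (e2.trans hd.symm)⟩
  · right
    rw [cellRow_of_not_isOdd hv] at e1
    rw [if_neg hv] at e2
    exact ⟨Subtype.ext (e1.trans hd.symm), Subtype.ext (e2.trans hn.symm)⟩

/-- The cells to the left and to the right of a vertical edge. -/
theorem cell_left_val {v : S.V} (hv : ¬ IsOdd v) : (cell s (left v)).1 =
    if v.1.2 = 0 then (v.1.1, 0) else cellAt s S v.1.1 (v.1.2 - 1) := by
  have h7 : (cell s (left v)).1 = cellAt s S (cellRow (left v)) (left v).1.2 := rfl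
  rw [h7, left_snd, cellRow_left, if_neg hv, if_neg hv]
  split_ifs
  · rw [cellAt_last, reflect_reflect S.w_lt v.2.1]
  · rfl

theorem cell_right_val {v : S.V} (hv : ¬ IsOdd v) : (cell s (right v)).1 =
    if v.1.2 + 1 = S.k then (reflect S.R S.w v.1.1, 0) else cellAt s S v.1.1 (v.1.2 + 1) := by
  have h7 : (cell s (right v)).1 = cellAt s S (cellRow (right v)) (right v).1.2 := rfl
  rw [h7, right_snd, cellRow_right, if_neg hv, if_neg hv]
  split_ifs
  · have h : cellCol s S (reflect S.R S.w v.1.1) 0 = 0 := by simp [cellCol]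
    have hq := S.three_le_q
    rw [cellAt_of_ne s (by rw [h]; omega), h]
  · rfl

/-- The vertical edge at `v` is contracted in the dual. -/
def Merged (v : S.V) : Prop :=
  v.1.1 % 2 = 0 ∧ S.l + 3 ≤ S.k ∧
    ((v.1.2 = S.l ∧ s v.1.1) ∨ (v.1.2 = S.l + 2 ∧ ¬ s v.1.1))

/-- One of the two hexagons at the deleted edge is centred in column `l + 1`, and `s` places it in
the dual column of the other. -/
theorem cell_left_eq_right {v : S.V} (h : Merged s v) : cell s (left v) = cell s (right v) := by
  obtain ⟨h1, h2, h3⟩ := h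
  have h4 := S.l_even
  have h5 := S.l_le
  have hv : ¬ IsOdd v := by
    unfold IsOdd
    omega
  rw [Subtype.ext_iff, cell_left_val s hv, cell_right_val s hv]
  rcases h3 with ⟨h3, hs⟩ | ⟨h3, hs⟩
  · have h6 : cellCol s S v.1.1 (v.1.2 + 1) = S.l / 2 := by
      rw [h3]
      simp [cellCol, hs]
    rw [if_neg (by omega : ¬ v.1.2 + 1 = S.k),
      cellAt_of_ne s (i := v.1.1) (c := v.1.2 + 1) (by unfold q; omega), h6]
    by_cases h0 : v.1.2 = 0
    · rw [if_pos h0]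
      simp only [Prod.ext_iff, true_and]
      omega
    · have h7 : cellCol s S v.1.1 (v.1.2 - 1) = S.l / 2 := by
        simp only [cellCol]
        split_ifs <;> omega
      rw [if_neg h0, cellAt_of_ne s (by unfold q; omega), h7]
  · have h7 : cellCol s S v.1.1 (v.1.2 - 1) = S.l / 2 + 1 := by
      rw [h3]
      simp [cellCol, hs]
    rw [if_neg (by omega : ¬ v.1.2 = 0)]
    by_cases h0 : v.1.2 + 1 = S.k
    · rw [if_pos h0, cellAt, if_pos, if_pos] <;> rw [h7] <;> unfold q <;> omega
    · have h6 : cellCol s S v.1.1 (v.1.2 + 1) = S.l / 2 + 1 := by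
        simp only [cellCol]
        split_ifs <;> omega
      rw [if_neg h0, cellAt, cellAt, h6, h7]

/-- Every vertical edge that is kept separates two consecutive dual columns, because merging across
the deleted edges leaves exactly `S.q` cells in a row. -/
theorem cell_right_eq_next {v : S.V} (hv : ¬ IsOdd v) (h : ¬ Merged s v) :
    cell s (right v) = gridNext S.w S.w_lt (cell s (left v)) := by
  have h2 : v.1.2 < S.k := v.2.2
  have h4 := S.l_even
  have h5 := S.l_le
  have h6 := S.six_le
  have hq := S.three_le_q
  have hl := cell_left_val s hv
  have hr := cell_right_val s hv
  unfold Merged at h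
  have h7 : ∃ J, J < S.q ∧ (cell s (left v)).1 = (v.1.1, J) ∧
      (if J + 1 = S.q then (cell s (right v)).1 = (reflect S.R S.w v.1.1, 0)
        else (cell s (right v)).1 = (v.1.1, J + 1)) := by
    -- `J` is the dual column to the left of the edge. The first and the last column are treated
    -- apart, since there one of the two hexagons is centred behind the seam.
    have key : ∃ J, J < S.q ∧ (v.1.2 = 0 → J = 0) ∧
        (v.1.2 ≠ 0 → cellCol s S v.1.1 (v.1.2 - 1) = J) ∧
        (v.1.2 + 1 = S.k → J + 1 = S.q) ∧
        (v.1.2 + 1 ≠ S.k → cellCol s S v.1.1 (v.1.2 + 1) = J + 1) := by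
      unfold IsOdd at hv
      refine ⟨if v.1.2 = 0 then 0 else cellCol s S v.1.1 (v.1.2 - 1), ?_⟩
      simp only [cellCol, q]
      refine ⟨?_, ?_, ?_, ?_, ?_⟩ <;> grind
    obtain ⟨J, k1, k2, k3, k4, k5⟩ := key
    refine ⟨J, k1, ?_, ?_⟩
    · rw [hl]
      by_cases h0 : v.1.2 = 0
      · rw [if_pos h0, k2 h0]
      · rw [if_neg h0, cellAt_of_ne s (by rw [k3 h0]; omega), k3 h0]
    · rw [hr]
      by_cases h0 : v.1.2 + 1 = S.k
      · rw [if_pos h0, if_pos (k4 h0)]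
      · rw [if_neg h0]
        have h8 := k5 h0
        by_cases h9 : J + 1 = S.q
        · rw [if_pos h9, cellAt, if_pos (by omega), if_pos (by omega)]
        · rw [if_neg h9, cellAt_of_ne s (by omega), h8]
  obtain ⟨J, h8, h9, h10⟩ := h7
  rw [Subtype.ext_iff]
  simp only [gridNext, h9]
  split_ifs at h10 ⊢ <;> exact h10

/-- The vertical edge to the right of a cell. -/
def riser (a : gridV S.R S.q) : S.V :=
  ⟨(a.1.1, if a.1.2 < S.l / 2 ∨ (a.1.2 = S.l / 2 ∧ ¬ s a.1.1) then 2 * a.1.2 + a.1.1 % 2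
    else 2 * a.1.2 + 2 - a.1.1 % 2), by
    have h2 : a.1.2 < S.k / 2 := a.2.2
    have h3 := S.l_le
    refine ⟨a.2.1, ?_⟩
    dsimp only
    split_ifs <;> omega⟩

theorem not_isOdd_riser (a : gridV S.R S.q) : ¬ IsOdd (riser s a) := by
  simp only [IsOdd, riser]
  split_ifs <;> omega

theorem not_merged_riser (a : gridV S.R S.q) : ¬ Merged s (riser s a) := by
  have h4 := S.l_even
  simp only [Merged, riser]
  grind

theorem cell_left_riser (a : gridV S.R S.q) : cell s (left (riser s a)) = a := by
  have h2 : a.1.2 < S.q := a.2.2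
  have h4 := S.l_even
  have h5 := S.l_le
  rw [Subtype.ext_iff, cell_left_val s (not_isOdd_riser s a)]
  by_cases h0 : (riser s a).1.2 = 0
  · rw [if_pos h0]
    refine Prod.ext rfl ?_
    simp only [riser] at h0
    simp only
    split_ifs at h0 <;> omega
  · rw [if_neg h0]
    have h6 : cellCol s S (riser s a).1.1 ((riser s a).1.2 - 1) = a.1.2 := by
      simp only [riser, cellCol] at h0 ⊢
      grind
    rw [cellAt_of_ne s (by omega), h6]
    rfl

theorem riser_cell_left {v : S.V} (hv : ¬ IsOdd v) (h : ¬ Merged s v) :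
    riser s (cell s (left v)) = v := by
  have h2 : v.1.2 < S.k := v.2.2
  have h4 := S.l_even
  have h5 := S.l_le
  have h6 := S.six_le
  have hl := cell_left_val s hv
  have h7 : cellCol s S v.1.1 (v.1.2 - 1) ≠ S.q := by
    unfold Merged at h
    simp only [cellCol, q, IsOdd] at hv ⊢
    grind
  have h8 : (cell s (left v)).1 = (v.1.1, if v.1.2 = 0 then 0 else cellCol s S v.1.1 (v.1.2 - 1)) := by
    rw [hl, cellAt_of_ne s h7]
    split_ifs <;> rfl
  rw [Subtype.ext_iff]
  simp only [riser, h8]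
  refine Prod.ext rfl ?_
  unfold Merged at h
  simp only [cellCol, IsOdd] at hv ⊢
  grind

/-- The odd centre of a hexagon of the cell outside column `l + 1`. -/
def base (a : gridV S.R S.q) : S.V :=
  ⟨(if a.1.2 = 0 ∧ a.1.1 % 2 = 0 then reflect S.R S.w a.1.1 else a.1.1,
    if a.1.1 % 2 = 1 then 2 * a.1.2 else if a.1.2 = 0 then S.k - 1 else
      if a.1.2 ≤ S.l / 2 then 2 * a.1.2 - 1 else 2 * a.1.2 + 1), by
    have h1 := reflect_lt S.w_lt a.2.1
    have h1' : a.1.1 < S.R := a.2.1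
    have h2 : a.1.2 < S.k / 2 := a.2.2
    have h3 := S.l_le
    have h6 := S.six_le
    constructor <;> dsimp only <;> split_ifs <;> omega⟩

/-- In an even row the odd centre of the cell in column `0` lies behind the seam, in column `S.k -
1` of the reflected row. This congruence shows that the vertex there is indeed odd. -/
theorem reflect_w_parity {i : ℕ} (hi : i < S.R) : (reflect S.R S.w i + S.k + i) % 2 = 0 := by
  have h1 := S.R_even
  have h2 := S.u_lt
  have h3 := S.parity
  simp only [reflect, w]
  split_ifs <;> omega

theorem isOdd_base (a : gridV S.R S.q) : IsOdd (base a) := by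
  have h1 := reflect_w_parity a.2.1
  have h6 := S.six_le
  simp only [IsOdd, base]
  split_ifs <;> omega

theorem cell_base (a : gridV S.R S.q) : cell s (base a) = a := by
  have h2 : a.1.2 < S.q := a.2.2
  have h5 := S.l_le
  have h4 := S.l_even
  have h7 : (cell s (base a)).1 = cellAt s S (cellRow (base a)) (base a).1.2 := rfl
  rw [Subtype.ext_iff, h7, cellRow_of_isOdd (isOdd_base a)]
  by_cases h0 : a.1.2 = 0 ∧ a.1.1 % 2 = 0
  · have h8 : (base a).1.2 = S.k - 1 := by
      simp only [base, h0]
      simp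
    rw [h8, cellAt_last]
    simp only [base, if_pos h0]
    rw [reflect_reflect S.w_lt a.2.1]
    exact Prod.ext rfl h0.1.symm
  · have h8 : (base a).1.1 = a.1.1 := if_neg h0
    have h9 : cellCol s S (base a).1.1 (base a).1.2 = a.1.2 := by
      simp only [cellCol, base]
      grind
    rw [cellAt_of_ne s (by omega), h9, h8]

theorem base_cell {v : S.V} (hv : IsOdd v) (h : v.1.2 ≠ S.l + 1) : base (cell s v) = v := by
  have h1 : v.1.1 < S.R := v.2.1
  have h2 : v.1.2 < S.k := v.2.2
  have h5 := S.l_le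
  have h4 := S.l_even
  have h6 := S.six_le
  have h7 : (cell s v).1 = cellAt s S (cellRow v) v.1.2 := rfl
  rw [cellRow_of_isOdd hv] at h7
  have h8 := reflect_w_parity h1
  have h9 := reflect_reflect S.w_lt h1
  rw [Subtype.ext_iff]
  simp only [base, h7, cellAt]
  unfold IsOdd at hv
  generalize reflect S.R S.w v.1.1 = x at *
  by_cases h10 : cellCol s S v.1.1 v.1.2 = S.q
  · simp only [h10, if_true, true_and]
    have h11 : v.1.2 = S.k - 1 := by
      simp only [cellCol, q] at h10
      split_ifs at h10 <;> omega
    rw [if_pos (by omega), if_neg (by omega)]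
    exact Prod.ext h9 h11.symm
  · simp only [h10, if_false]
    rw [Prod.ext_iff]
    simp only [cellCol, q] at *
    constructor
    · refine if_neg fun h11 => ?_
      split_ifs at h11 <;> omega
    · split_ifs at * <;> omega

end Dual

end KleinShape
end HexTiling

/-! ### The deleted edges, the dual, and the families `c` and `f` -/

namespace HexTiling
namespace KleinShape

variable {S : KleinShape}

/-- The two kinds of dual edges. -/
theorem dualLink_cases (s : ℕ → Prop) [DecidablePred s] {e : Sym2 S.V} {x y : S.V}
    (h : S.brick.DualLink e x y) :
    (∃ v, e = s(v, left v) ∧ s(x, y) = s(v, left v)) ∨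
    ∃ v, ¬ IsOdd v ∧ e = s(v, vert v) ∧
      s(cell s x, cell s y) = s(cell s (left v), cell s (right v)) := by
  have hrow : ∀ {v x y : S.V}, S.brick.Row v x → S.brick.Row v y → x ≠ y →
      s(x, y) = s(left v, right v) := by
    rintro v x y (rfl | rfl) (rfl | rfl) hne
    · exact absurd rfl hne
    · rfl
    · exact Sym2.eq_swap
    · exact absurd rfl hne
  have hcell : ∀ {v x y : S.V}, S.brick.Row v x → S.brick.Row v y → x ≠ y →
      s(cell s x, cell s y) = s(cell s (left v), cell s (right v)) := fun h1 h2 h3 =>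
    congrArg (Sym2.map (cell s)) (hrow h1 h2 h3)
  rcases h with ⟨rfl | rfl, rfl⟩ | ⟨v, rfl, h1, h2, h3⟩
  · exact Or.inl ⟨x, rfl, rfl⟩
  · refine Or.inl ⟨right x, ?_, ?_⟩ <;> rw [left_right] <;> exact Sym2.eq_swap
  · right
    by_cases hv : IsOdd v
    · have h4 := S.brick.z_row_t (S.brick.row_symm h1)
      have h5 := S.brick.z_row_t (S.brick.row_symm h2)
      refine ⟨vert v, by rw [isOdd_vert]; exact not_not.2 hv, ?_, ?_⟩
      · rw [vert_vert]
        exact Sym2.eq_swap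
      · rw [← cell_opp s x, ← cell_opp s y]
        refine hcell (S.brick.row_symm h4) (S.brick.row_symm h5) fun h => h3 ?_
        rw [← opp_opp x]
        exact (congrArg opp h).trans (opp_opp y)
    · exact ⟨v, hv, rfl, hcell h1 h2 h3⟩

theorem P_subset : S.P ⊆ S.graph.edgeSet := by
  intro e he
  induction e with | h a b =>
  rw [SimpleGraph.mem_edgeSet]
  rcases mem_P_iff.1 he with ⟨rfl, -⟩ | ⟨rfl, -⟩
  · exact (graph_adj _ _).2 (Or.inl rfl)
  · exact ((graph_adj _ _).2 (Or.inl rfl)).symm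

theorem vert_ne_left (v v' : S.V) : s(v, left v) ≠ s(v', vert v') := by
  intro h
  rcases Sym2.eq_iff.1 h with ⟨rfl, h⟩ | ⟨rfl, h⟩
  · exact left_snd_ne v (by rw [h, vert_snd])
  · exact left_snd_ne (vert v') (by rw [h, vert_snd])

theorem eq_of_vert_eq {v v' : S.V} (hv : ¬ IsOdd v) (hv' : ¬ IsOdd v')
    (h : s(v, vert v) = s(v', vert v')) : v = v' := by
  rcases Sym2.eq_iff.1 h with ⟨h, -⟩ | ⟨rfl, -⟩
  · exact h
  · exact absurd ((isOdd_vert v').2 hv') hv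

/-- What a set of deleted parallel edges looks like. -/
structure Deletion (Q : Set (Sym2 S.V)) (s : ℕ → Prop) : Prop where
  exists_merged : ∀ e ∈ Q, ∃ v, ¬ IsOdd v ∧ e = s(v, vert v) ∧ Merged s v
  mem : ∀ v, ¬ IsOdd v → Merged s v → s(v, vert v) ∈ Q

/-- By `parallel_cases`, only the vertical edges in the columns `l` and `l + 2` that rise from the
same even row are parallel, and one of each such pair is deleted. So `Q` is determined by the
predicate telling in which rows it is the edge in column `l`. If the pattern of `P` does not switch,
`Q` is empty and the predicate is irrelevant. -/
theorem exists_deletion {Q : Set (Sym2 S.V)} (hQ : Q ⊆ S.graph.edgeSet \ S.P)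
    (h1 : ∀ u v, s(u, v) ∈ Q → ∃ u' v', S.graph.Adj u' v' ∧ s(u', v') ∉ S.P ∧ s(u', v') ∉ Q ∧
        node u = node u' ∧ node v = node v')
    (h2 : ∀ u v u' v', S.graph.Adj u v → S.graph.Adj u' v' → s(u, v) ∉ S.P → s(u', v') ∉ S.P →
      s(u, v) ∉ Q → s(u', v') ∉ Q → node u = node u' → node v = node v' → s(u, v) = s(u', v')) :
    ∃ s, Deletion Q s := by
  have hl := S.l_even
  refine ⟨fun i => ∃ v : S.V, ¬ IsOdd v ∧ v.1 = (i, S.l) ∧ s(v, vert v) ∈ Q, ?_, ?_⟩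
  · have key : ∀ a b, s(a, b) ∈ Q → b = vert a ∧ ∃ a', s(a', vert a') ∉ Q ∧
        (IsOdd a ↔ IsOdd a') ∧ a.1.1 = a'.1.1 ∧
        ((a.1.2 = S.l ∧ a'.1.2 = S.l + 2) ∨ (a.1.2 = S.l + 2 ∧ a'.1.2 = S.l)) := by
      intro a b he
      obtain ⟨a', b', h3, h4, h5, h6, h7⟩ := h1 a b he
      rcases parallel_cases (a := a) (b := b) (hQ he).1 h3 (hQ he).2 h4 h6 h7 with ⟨rfl, rfl⟩ | ⟨rfl, rfl, h⟩
      · exact absurd he h5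
      · exact ⟨rfl, a', h5, h⟩
    have key2 : ∀ a, ¬ IsOdd a → s(a, vert a) ∈ Q →
        Merged (fun i => ∃ v : S.V, ¬ IsOdd v ∧ v.1 = (i, S.l) ∧ s(v, vert v) ∈ Q) a := by
      intro a ha he
      obtain ⟨-, a', h3, h4, h5, h6⟩ := key a _ he
      have l1 : a.1.2 < S.k := a.2.2
      have l2 : a'.1.2 < S.k := a'.2.2
      have ha' := ha
      unfold IsOdd at ha'
      refine ⟨by omega, by omega, ?_⟩
      rcases h6 with ⟨h6, h7⟩ | ⟨h6, h7⟩
      · exact Or.inl ⟨h6, a, ha, Prod.ext rfl h6, he⟩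
      · refine Or.inr ⟨h6, ?_⟩
        rintro ⟨v, -, h9, h10⟩
        have : v = a' := Subtype.ext (h9.trans (Prod.ext h5 h7.symm))
        exact h3 (this ▸ h10)
    intro e he
    induction e with | h a b =>
    obtain ⟨rfl, -⟩ := key a b he
    by_cases ha : IsOdd a
    · have hv : ¬ IsOdd (vert a) := by
        rw [isOdd_vert]
        exact not_not.2 ha
      have h3 : s(a, vert a) = s(vert a, vert (vert a)) := by
        rw [vert_vert]
        exact Sym2.eq_swap
      exact ⟨_, hv, h3, key2 _ hv (h3 ▸ he)⟩
    · exact ⟨a, ha, rfl, key2 a ha he⟩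
  · rintro v hv ⟨h3, h4, ⟨h5, v', -, h6, h7⟩ | ⟨h5, h6⟩⟩
    · have : v' = v := Subtype.ext (h6.trans (Prod.ext rfl h5.symm))
      exact this ▸ h7
    -- Otherwise both edges of the pair would survive, although survivors are never parallel.
    · by_contra h7
      have hm : (v.1.1, S.l) ∈ gridV S.R S.k := ⟨v.2.1, by dsimp only; omega⟩
      have h8 : ¬ IsOdd (⟨_, hm⟩ : S.V) := by
        unfold IsOdd
        dsimp only
        omega
      have h9 : node (⟨_, hm⟩ : S.V) = node v := by
        simp only [node, h5, Subtype.ext_iff, Prod.ext_iff, true_and]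
        split_ifs <;> omega
      have hadj : ∀ v : S.V, S.graph.Adj v (vert v) := fun v =>
        (graph_adj _ _).2 (Or.inr (Or.inr rfl))
      have h10 := h2 _ _ v _ (hadj _) (hadj v) (vert_notMem_P _) (vert_notMem_P _)
        (fun h => h6 ⟨_, h8, rfl, h⟩) h7 h9
        (by rw [vert, if_neg h8, vert, if_neg hv, node_above, node_above, h9])
      have h11 := congrArg (fun x : S.V => x.1.2) (eq_of_vert_eq h8 hv h10)
      dsimp only at h11
      omega

section

variable {Q : Set (Sym2 S.V)} {s : ℕ → Prop} [DecidablePred s] (D : Deletion Q s)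
include D

theorem Deletion.cell_eq {e : Sym2 S.V} {x y : S.V} (hd : S.brick.DualLink e x y) (he : e ∈ Q) :
    cell s x = cell s y := by
  obtain ⟨v, hv, rfl, hm⟩ := D.exists_merged e he
  rcases dualLink_cases s hd with ⟨v', h1, -⟩ | ⟨v', hv', h1, h2⟩
  · exact absurd h1.symm (vert_ne_left _ _)
  · obtain rfl := eq_of_vert_eq hv hv' h1
    rw [cell_left_eq_right s hm] at h2
    rcases Sym2.eq_iff.1 h2 with ⟨h3, h4⟩ | ⟨h3, h4⟩ <;> rw [h3, h4]

/-- Outside column `l + 1` each cell has only one hexagon, the one centred at `base`. A hexagon of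
column `l + 1` is linked by the deleted edge on its left or on its right to such a hexagon. -/
theorem Deletion.eqvGen_base (x : S.V) :
    Relation.EqvGen (fun a b => b = opp a ∨ ∃ e ∈ Q, S.brick.DualLink e a b) x
      (base (cell s x)) := by
  have h1 : ∀ x : S.V, x.1.2 ≠ S.l + 1 →
      Relation.EqvGen (fun a b => b = opp a ∨ ∃ e ∈ Q, S.brick.DualLink e a b) x
        (base (cell s x)) := by
    intro x hx
    by_cases ho : IsOdd x
    · rw [base_cell s ho hx]
      exact Relation.EqvGen.refl _
    · rw [← cell_opp, base_cell s ((isOdd_opp x).2 ho) (by rwa [opp_snd])]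
      exact Relation.EqvGen.rel _ _ (Or.inl rfl)
  have h2 : ∀ v : S.V, ¬ IsOdd v → Merged s v →
      Relation.EqvGen (fun a b => b = opp a ∨ ∃ e ∈ Q, S.brick.DualLink e a b)
        (left v) (right v) := fun v hv hm =>
    Relation.EqvGen.rel _ _ (Or.inr ⟨_, D.mem v hv hm, S.brick.dualLink_z v⟩)
  have h3 : ∀ x : S.V, x.1.2 = S.l + 1 → IsOdd x →
      Relation.EqvGen (fun a b => b = opp a ∨ ∃ e ∈ Q, S.brick.DualLink e a b) x
        (base (cell s x)) := by
    intro x hx ho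
    have l0 : x.1.2 < S.k := x.2.2
    have l1 := S.l_even
    have l2 := S.l_le
    have ho' := ho
    unfold IsOdd at ho'
    by_cases hs : s x.1.1
    · have e1 : (left x).1 = (x.1.1, S.l) := by
        have h0 : ¬ x.1.2 = 0 := by omega
        simp only [left, h0, if_false, Prod.ext_iff, true_and]
        omega
      have hm : Merged s (left x) := by
        unfold Merged
        rw [e1]
        exact ⟨by dsimp only; omega, by omega, Or.inl ⟨rfl, hs⟩⟩
      have hv : ¬ IsOdd (left x) := by
        unfold IsOdd
        rw [e1]
        dsimp only
        omega
      have h4 := h2 _ hv hm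
      have h5 := cell_left_eq_right s hm
      rw [right_left] at h4 h5
      rw [← h5]
      refine h4.symm.trans _ _ _ (h1 _ ?_)
      rw [left_snd, e1]
      dsimp only
      split_ifs <;> omega
    · have e1 : (right x).1 = (x.1.1, S.l + 2) := by
        have h0 : ¬ x.1.2 + 1 = S.k := by omega
        simp only [right, h0, if_false, Prod.ext_iff, true_and]
        omega
      have hm : Merged s (right x) := by
        unfold Merged
        rw [e1]
        exact ⟨by dsimp only; omega, by omega, Or.inr ⟨rfl, hs⟩⟩
      have hv : ¬ IsOdd (right x) := by
        unfold IsOdd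
        rw [e1]
        dsimp only
        omega
      have h4 := h2 _ hv hm
      have h5 := cell_left_eq_right s hm
      rw [left_right] at h4 h5
      rw [h5]
      refine h4.trans _ _ _ (h1 _ ?_)
      rw [right_snd, e1]
      dsimp only
      split_ifs <;> omega
  by_cases hx : x.1.2 = S.l + 1
  · by_cases ho : IsOdd x
    · exact h3 x hx ho
    · have h4 := h3 (opp x) (by rwa [opp_snd]) ((isOdd_opp x).2 ho)
      rw [cell_opp] at h4
      exact Relation.EqvGen.trans _ _ _ (Relation.EqvGen.rel _ _ (Or.inl rfl)) h4
  · exact h1 x hx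

/-- The dual edges of the row edges outside `P` are the steps down of the dual grid, and the dual
edges of the surviving vertical edges are its steps to the next column. -/
theorem Deletion.realizes :
    Realizes (fun e x y => S.brick.DualLink e x y ∧ e ∉ S.P ∧ e ∉ Q) (cell s)
      (gridTwist S.R S.q (reflect S.R S.w)) := by
  have hR := S.four_le
  refine realizes_gridTwist (by omega) S.three_le_q S.w_lt (fun a => ⟨base a, cell_base s a⟩)
    (fun e x y h => ⟨h.1.symm, h.2⟩) (fun a => s(first a, left (first a)))
    (fun a => s(riser s a, vert (riser s a))) ?_ ?_ ?_
  · rintro e x y ⟨hd, hP, hQ⟩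
    rcases dualLink_cases s hd with ⟨v, rfl, h1⟩ | ⟨v, hv, rfl, h1⟩
    · rw [left_mem_P, not_not] at hP
      refine ⟨node v, Or.inl ⟨by rw [first_node hP], ?_⟩⟩
      have h2 := congrArg (Sym2.map (cell s)) h1
      simp only [Sym2.map_mk] at h2
      rw [h2]
      rcases cell_of_cut s hP with ⟨h3, h4⟩ | ⟨h3, h4⟩ <;> rw [h3, h4]
      exact Sym2.eq_swap
    · have hm : ¬ Merged s v := fun hm => hQ (D.mem v hv hm)
      exact ⟨cell s (left v), Or.inr ⟨by rw [riser_cell_left s hv hm],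
        by rw [h1, cell_right_eq_next s hv hm]⟩⟩
  · intro a
    have hc := cut_first a
    have hP : s(first a, left (first a)) ∉ S.P := by
      rw [left_mem_P, not_not]
      exact hc
    have hQ : s(first a, left (first a)) ∉ Q := by
      intro h
      obtain ⟨v, -, h, -⟩ := D.exists_merged _ h
      exact vert_ne_left _ _ h
    have hd : S.brick.DualLink s(first a, left (first a)) (first a) (left (first a)) :=
      S.brick.dualLink_row (S.brick.row_left _)
    have h := cell_of_cut s hc
    rw [node_first] at h
    rcases h with ⟨h1, h2⟩ | ⟨h1, h2⟩
    · exact ⟨_, _, ⟨hd, hP, hQ⟩, h1, h2⟩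
    · exact ⟨_, _, ⟨hd.symm, hP, hQ⟩, h2, h1⟩
  · intro a
    have hv := not_isOdd_riser s a
    refine ⟨left (riser s a), right (riser s a), ⟨S.brick.dualLink_z _, vert_notMem_P _, ?_⟩,
      cell_left_riser s a, ?_⟩
    · intro h
      obtain ⟨v, hv', h, hm⟩ := D.exists_merged _ h
      obtain rfl := eq_of_vert_eq hv hv' h
      exact not_merged_riser s a hm
    · rw [cell_right_eq_next s hv (not_merged_riser s a), cell_left_riser]

end

theorem yields (S : KleinShape) : Yields S.graph S.P (gridTwist S.R S.q (reflect S.R S.u))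
    (gridTwist S.R S.q (reflect S.R S.w)) := by
  have hR := S.four_le
  have hk := S.six_le
  have : Nonempty S.V := ⟨⟨(0, 0), by dsimp only; omega, by dsimp only; omega⟩⟩
  refine S.brick.yields_of_parallel P_subset node (fun u v => node_eq_of_mem_P) ?_
    (fun a => ⟨first a, node_first a⟩) (fun u v => adj_node) (fun a b => exists_adj_node) ?_
  · intro u v h
    refine (eqvGen_centre u).trans _ _ _ ?_
    rw [h]
    exact (eqvGen_centre v).symm
  · intro Q hQ h1 h2
    classical
    obtain ⟨s, D⟩ := exists_deletion hQ h1 h2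
    refine ⟨cell s, cell_opp s, fun e x y => D.cell_eq, fun x y h => ?_, D.realizes⟩
    refine (D.eqvGen_base x).trans _ _ _ ?_
    rw [h]
    exact (D.eqvGen_base y).symm

end KleinShape

/-- With `l = k` every column comes before the switch, so `P` is the plain matching. -/
def kleinShapeC (k m : ℕ) (hm : 1 ≤ m) (hk : 6 ≤ k) (hk2 : Even k) : KleinShape where
  R := 2 * m + 2
  k := k
  u := 2 * m + 1
  l := k
  R_even := by omega
  four_le := by omega
  u_lt := by omega
  parity := by rw [Nat.even_iff] at hk2; omega
  six_le := hk
  l_even := Nat.even_iff.1 hk2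
  l_le := Or.inr ⟨Nat.even_iff.1 hk2, rfl⟩

def kleinShapeF (k m l : ℕ) (hk : 7 ≤ k) (hk2 : Odd k) (hl : Even l) (hlk : l + 3 ≤ k) :
    KleinShape where
  R := 2 * m + 4
  k := k
  u := 0
  l := l
  R_even := by omega
  four_le := by omega
  u_lt := by omega
  parity := by rw [Nat.odd_iff] at hk2; omega
  six_le := by omega
  l_even := Nat.even_iff.1 hl
  l_le := Or.inl ⟨Nat.odd_iff.1 hk2, hlk⟩

theorem yields_hexCKlein {k m : ℕ} (hm : 1 ≤ m) (hk : 6 ≤ k) (hk2 : Even k) :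
    Yields (hexCKlein k m) (hexCKleinP k m) (kleinK0 (2 * m + 2) (k / 2))
      (kleinK2 (2 * m + 2) (k / 2)) := by
  have h := (kleinShapeC k m hm hk hk2).yields
  have e1 : (kleinShapeC k m hm hk hk2).graph = hexCKlein k m := by
    refine graphOn_congr fun u v => or_congr_right ?_
    have h1 : u.1.1 < 2 * m + 2 := u.2.1
    have h2 : reflect (2 * m + 2) (2 * m + 1) u.1.1 = 2 * m + 1 - u.1.1 := by
      unfold reflect
      rw [if_pos (by omega)]
    exact iff_of_eq (by rw [← h2]; rfl)
  have e2 : (kleinShapeC k m hm hk hk2).P = hexCKleinP k m := by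
    ext e
    refine exists_congr fun u => exists_congr fun v => and_congr_left fun _ => ?_
    have h1 : u.1.2 < k := u.2.2
    have h2 : (kleinShapeC k m hm hk hk2).l = k := rfl
    unfold brickP
    rw [h2]
    refine and_congr_right fun _ => and_congr_right fun _ => ⟨?_, ?_⟩
    · rintro (h | h)
      · exact h.2
      · omega
    · exact fun h => Or.inl ⟨by omega, h⟩
  have e3 : (kleinShapeC k m hm hk hk2).w = 2 * m := rfl
  rw [e1, e2, e3] at h
  -- Rotating by one row raises the constant from `2 * m` to `2 * m + 2`, which is zero modulo the
  -- number of rows.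
  obtain ⟨e⟩ := nonempty_gridTwist_reflect_iso (p := 2 * m + 2) (q := k / 2) (u := 2 * m) (u' := 0)
    1 (by omega) (by omega) (by omega) (by omega)
  rw [gridTwist_reflect_eq_kleinK2] at e
  rw [← gridTwist_reflect_eq_kleinK0]
  exact h.trans_iso SimpleGraph.Iso.refl e

theorem yields_hexFKlein {k m l : ℕ} (hk : 7 ≤ k) (hk2 : Odd k) (hl : Even l) (hlk : l + 3 ≤ k) :
    Yields (hexFKlein k m) (hexFKleinP k m l) (kleinK2 (2 * m + 4) ((k - 1) / 2))
      (kleinK0 (2 * m + 4) ((k - 1) / 2)) := by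
  have h := (kleinShapeF k m l hk hk2 hl hlk).yields
  have e1 : (kleinShapeF k m l hk hk2 hl hlk).graph = hexFKlein k m := by
    refine graphOn_congr fun u v => or_congr_right ?_
    have h1 : u.1.1 < 2 * m + 4 := u.2.1
    have h2 : reflect (2 * m + 4) 0 u.1.1 = (2 * m + 4 - u.1.1) % (2 * m + 4) := by
      rw [mod_eq_ite (by omega)]
      unfold reflect
      split_ifs <;> omega
    exact iff_of_eq (by rw [← h2]; rfl)
  have e2 : (kleinShapeF k m l hk hk2 hl hlk).P = hexFKleinP k m l := rfl
  have e3 : (k - 1) / 2 = (kleinShapeF k m l hk hk2 hl hlk).q := by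
    rw [Nat.odd_iff] at hk2
    simp only [kleinShapeF, KleinShape.q]
    omega
  rw [e1, e2] at h
  rw [← gridTwist_reflect_eq_kleinK0, ← gridTwist_reflect_eq_kleinK2, e3]
  exact h

theorem isPerfectMatching_hexCKleinP {k m : ℕ} (hm : 1 ≤ m) (hk : 6 ≤ k) (hk2 : Even k) :
    IsPerfectMatching (hexCKlein k m) (hexCKleinP k m) := by
  rw [Nat.even_iff] at hk2
  refine ⟨(yields_hexCKlein hm hk (Nat.even_iff.2 hk2)).1, ?_, ?_⟩
  · rintro _ ⟨a, b, ⟨h1, h2, h3⟩, rfl⟩ _ ⟨c, d, ⟨h4, h5, h6⟩, rfl⟩ hne v ⟨hv, hv'⟩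
    rw [Nat.even_iff] at h3 h6
    have h7 : a = c := by
      rw [Subtype.ext_iff, Prod.ext_iff]
      rcases Sym2.mem_iff.1 hv with rfl | rfl <;> rcases Sym2.mem_iff.1 hv' with rfl | rfl <;> omega
    have h8 : b = d := by
      subst h7
      rw [Subtype.ext_iff, Prod.ext_iff]
      omega
    exact hne (by rw [h7, h8])
  · rintro ⟨⟨i, c⟩, hv⟩
    have h2 : c < k := hv.2
    by_cases hc : c % 2 = 0
    · have hw : (i, c + 1) ∈ gridV (2 * m + 2) k := ⟨hv.1, by dsimp only; omega⟩
      exact ⟨s(⟨_, hv⟩, ⟨_, hw⟩), ⟨⟨_, hv⟩, ⟨_, hw⟩, ⟨rfl, rfl, Nat.even_iff.2 hc⟩, rfl⟩, Sym2.mem_mk_left _ _⟩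
    · have hw : (i, c - 1) ∈ gridV (2 * m + 2) k := ⟨hv.1, by dsimp only; omega⟩
      refine ⟨s(⟨_, hw⟩, ⟨_, hv⟩), ⟨⟨_, hw⟩, ⟨_, hv⟩, ⟨rfl, ?_, Nat.even_iff.2 ?_⟩, rfl⟩,
        Sym2.mem_mk_right _ _⟩ <;> dsimp only <;> omega

/-- Where the pattern switches from even to odd columns, a vertex of column `l + 1` is an end of two
edges. -/
theorem not_isMatching_hexFKleinP {k m l : ℕ} (hl : Even l) (hlk : l + 3 ≤ k) :
    ¬ IsMatching (hexFKleinP k m l) := by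
  intro h
  have h1 : (0, l) ∈ gridV (2 * m + 4) k := ⟨by dsimp only; omega, by dsimp only; omega⟩
  have h2 : (0, l + 1) ∈ gridV (2 * m + 4) k := ⟨by dsimp only; omega, by dsimp only; omega⟩
  have h3 : (0, l + 2) ∈ gridV (2 * m + 4) k := ⟨by dsimp only; omega, by dsimp only; omega⟩
  refine h s(⟨_, h1⟩, ⟨_, h2⟩) ⟨⟨_, h1⟩, ⟨_, h2⟩, ⟨rfl, rfl, Or.inl ⟨le_rfl, hl⟩⟩, rfl⟩
    s(⟨_, h2⟩, ⟨_, h3⟩) ⟨⟨_, h2⟩, ⟨_, h3⟩, ⟨rfl, rfl, Or.inr ⟨le_rfl, hl.add_one⟩⟩, rfl⟩ ?_ ⟨_, h2⟩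
    ⟨Sym2.mem_mk_right _ _, Sym2.mem_mk_left _ _⟩
  intro h4
  rcases Sym2.eq_iff.1 h4 with ⟨h5, -⟩ | ⟨h5, -⟩ <;>
    have h6 := congrArg (fun x => x.1.2) h5 <;> dsimp only at h6 <;> omega

end HexTiling

/-! ### Cutting open the cylinders with antipodally closed ends -/

namespace HexTiling

/-- The cylinder is cut into the columns below `k` and the others, and the second half is turned
over and placed on the first. The antipodal edges become vertical: those of the `x_i` join the rows
`m` and `m + 1`, those of the `z_i` the rows `0` and `2 * m + 1`. The two cuts join the row `i` to
the row `2 * m + 1 - i`. The columns are reversed because vertical edges start at odd vertices in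
the cylinder and at even ones in the Klein bottle form. -/
theorem nonempty_hexC_iso {k m : ℕ} (hk : 6 ≤ k) (hk2 : Even k) :
    Nonempty (hexC k m ≃g hexCKlein k m) := by
  rw [Nat.even_iff] at hk2
  refine nonempty_graphOn_iso
    (fun v => ⟨(if v.1.2 < k then v.1.1 else 2 * m + 1 - v.1.1,
      if v.1.2 < k then k - 1 - v.1.2 else 2 * k - 1 - v.1.2), ?_⟩)
    (fun v => ⟨(if v.1.1 ≤ m then v.1.1 else 2 * m + 1 - v.1.1,
      if v.1.1 ≤ m then k - 1 - v.1.2 else 2 * k - 1 - v.1.2), ?_⟩) ?_ ?_ ?_ ?_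
  · have h1 : v.1.1 ≤ m := v.2.1
    have h2 : v.1.2 < 2 * k := v.2.2
    constructor <;> dsimp only <;> split_ifs <;> omega
  · have h1 : v.1.1 < 2 * m + 2 := v.2.1
    have h2 : v.1.2 < k := v.2.2
    constructor <;> dsimp only <;> split_ifs <;> omega
  · rintro ⟨⟨i, c⟩, hv⟩
    have h1 : i ≤ m := hv.1
    have h2 : c < 2 * k := hv.2
    simp only [Subtype.ext_iff, Prod.ext_iff]
    split_ifs <;> omega
  · rintro ⟨⟨i, c⟩, hv⟩
    have h1 : i < 2 * m + 2 := hv.1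
    have h2 : c < k := hv.2
    simp only [Subtype.ext_iff, Prod.ext_iff]
    split_ifs <;> omega
  · rintro ⟨⟨i, c⟩, hu⟩ ⟨⟨i', c'⟩, hv⟩ h
    have h1 : i ≤ m := hu.1
    have h2 : c < 2 * k := hu.2
    have h3 : i' ≤ m := hv.1
    have h4 : c' < 2 * k := hv.2
    simp only [kleinHexE, cylE, cylZ, cylX, Prod.ext_iff, Nat.even_iff, Nat.odd_iff] at h ⊢
    clear hu hv
    rcases h with (⟨rfl, rfl⟩ | ⟨rfl, rfl, rfl⟩ | ⟨rfl, rfl, h⟩) |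
      ⟨j, hj, ⟨⟨rfl, rfl⟩, rfl, rfl⟩ | ⟨⟨rfl, h5⟩, rfl, h6⟩⟩
    · by_cases h5 : c + 1 < k
      · rw [if_pos (by omega : c < k), if_pos (by omega : c < k), if_pos h5, if_pos h5]
        exact Or.inr (Or.inl (Or.inl ⟨rfl, by omega⟩))
      · by_cases h6 : c < k
        · rw [if_pos h6, if_pos h6, if_neg h5, if_neg h5]
          exact Or.inl (Or.inr ⟨by omega, rfl, by omega⟩)
        · rw [if_neg h6, if_neg h6, if_neg h5, if_neg h5]
          exact Or.inr (Or.inl (Or.inl ⟨rfl, by omega⟩))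
    · rw [if_pos (by omega : 0 < k), if_pos (by omega : 0 < k), if_neg (by omega : ¬ 2 * k - 1 < k),
        if_neg (by omega : ¬ 2 * k - 1 < k)]
      exact Or.inr (Or.inr ⟨by omega, by omega, by omega⟩)
    · by_cases h5 : c' < k
      · simp only [h5, if_true]
        exact Or.inl (Or.inl (Or.inr (Or.inl ⟨trivial, trivial, by omega⟩)))
      · simp only [h5, if_false]
        exact Or.inr (Or.inl (Or.inr (Or.inl ⟨by omega, trivial, by omega⟩)))
    · rw [if_pos (by omega : 2 * j < k), if_pos (by omega : 2 * j < k),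
        if_neg (by omega : ¬ 2 * (j + k / 2) < k), if_neg (by omega : ¬ 2 * (j + k / 2) < k)]
      exact Or.inl (Or.inl (Or.inr (Or.inr ⟨rfl, by omega, by omega, by omega⟩)))
    · have h7 : c < k ∧ (i' + c) % 2 = 1 ∧ c' = c + k := by
        clear h1 h2 h3 h4
        split_ifs at h5 h6 <;> omega
      obtain ⟨h7, h8, rfl⟩ := h7
      rw [if_pos h7, if_pos h7, if_neg (by omega), if_neg (by omega)]
      exact Or.inl (Or.inl (Or.inr (Or.inl ⟨by omega, by omega, by omega⟩)))
  · rintro ⟨⟨i, c⟩, hu⟩ ⟨⟨i', c'⟩, hv⟩ h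
    have h1 : i < 2 * m + 2 := hu.1
    have h2 : c < k := hu.2
    have h3 : i' < 2 * m + 2 := hv.1
    have h4 : c' < k := hv.2
    simp only [kleinHexE, cylE, cylZ, cylX, Prod.ext_iff, Nat.even_iff, Nat.odd_iff] at h ⊢
    clear hu hv
    rcases h with (⟨rfl, rfl⟩ | ⟨rfl, rfl, h⟩ | ⟨rfl, rfl, rfl, h⟩) | ⟨rfl, rfl, rfl⟩
    · have key : ∀ {A B C D : Prop}, A ∨ C → (A ∨ B) ∨ (C ∨ D) := by tauto
      refine key ?_
      split_ifs <;> omega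
    · by_cases h5 : i = m
      · subst h5
        refine Or.inl (Or.inr ⟨(k - 1 - c') / 2, by omega, Or.inr ?_⟩)
        split_ifs <;> omega
      · by_cases h6 : i + 1 ≤ m
        · rw [if_pos h6, if_pos h6, if_pos (by omega : i ≤ m), if_pos (by omega : i ≤ m)]
          exact Or.inl (Or.inl (Or.inr (Or.inr ⟨rfl, rfl, by omega⟩)))
        · rw [if_neg h6, if_neg h6, if_neg (by omega : ¬ i ≤ m), if_neg (by omega : ¬ i ≤ m)]
          exact Or.inr (Or.inl (Or.inr (Or.inr ⟨by omega, rfl, by omega⟩)))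
    · refine Or.inl (Or.inr ⟨(k - 1 - c') / 2, by omega, Or.inl ?_⟩)
      split_ifs <;> omega
    · by_cases h5 : i ≤ m
      · rw [if_pos h5, if_pos h5, if_neg (by omega), if_neg (by omega)]
        exact Or.inl (Or.inl (Or.inl ⟨by omega, by omega⟩))
      · rw [if_neg h5, if_neg h5, if_pos (by omega), if_pos (by omega)]
        exact Or.inr (Or.inl (Or.inr (Or.inl ⟨by omega, by omega, by omega⟩)))

/-- The vertices of `H_{k,m,f}` as vertices of its Klein bottle form. -/
def toKleinF (k m : ℕ) : (ℕ × ℕ) ⊕ (ℕ ⊕ ℕ) → ℕ × ℕ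
  | .inl u => (if u.2 < k then u.1 + 1 else 2 * m + 3 - u.1, if u.2 < k then u.2 else u.2 - k)
  | .inr (.inl j) => (0, j)
  | .inr (.inr j) =>
    (m + 2, if m % 2 = 1 then j else if j + 1 = k then 0 else j + 1)

def ofKleinF (k m : ℕ) (v : ℕ × ℕ) : (ℕ × ℕ) ⊕ (ℕ ⊕ ℕ) :=
  if v.1 = 0 then .inr (.inl v.2) else
    if v.1 = m + 2 then .inr (.inr (if m % 2 = 1 then v.2 else if v.2 = 0 then k - 1 else v.2 - 1))
    else .inl (if v.1 ≤ m + 1 then v.1 - 1 else 2 * m + 3 - v.1,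
      if v.1 ≤ m + 1 then v.2 else v.2 + k)

theorem toKleinF_mem {k m : ℕ} (hk : 7 ≤ k) {a : (ℕ × ℕ) ⊕ (ℕ ⊕ ℕ)} (ha : a ∈ hexFV k m) :
    toKleinF k m a ∈ gridV (2 * m + 4) k := by
  rcases ha with ⟨⟨i, c⟩, ⟨h1, h2⟩, rfl⟩ | ⟨j, hj, rfl | rfl⟩
  · dsimp only at h1 h2
    constructor <;> simp only [toKleinF] <;> split_ifs <;> omega
  · constructor <;> simp only [toKleinF] <;> omega
  · constructor <;> simp only [toKleinF]
    · omega
    · split_ifs <;> omega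

theorem ofKleinF_mem {k m : ℕ} {v : ℕ × ℕ} (hv : v ∈ gridV (2 * m + 4) k) :
    ofKleinF k m v ∈ hexFV k m := by
  obtain ⟨i, c⟩ := v
  have h1 : i < 2 * m + 4 := hv.1
  have h2 : c < k := hv.2
  unfold ofKleinF
  dsimp only
  by_cases h3 : i = 0
  · rw [if_pos h3]
    exact Or.inr ⟨c, h2, Or.inl rfl⟩
  · rw [if_neg h3]
    by_cases h4 : i = m + 2
    · rw [if_pos h4]
      exact Or.inr ⟨_, by split_ifs <;> omega, Or.inr rfl⟩
    · rw [if_neg h4]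
      refine Or.inl ⟨_, ⟨?_, ?_⟩, rfl⟩ <;> dsimp only <;> split_ifs <;> omega

theorem ofKleinF_toKleinF {k m : ℕ} {a : (ℕ × ℕ) ⊕ (ℕ ⊕ ℕ)} (ha : a ∈ hexFV k m) :
    ofKleinF k m (toKleinF k m a) = a := by
  rcases ha with ⟨⟨i, c⟩, ⟨h1, h2⟩, rfl⟩ | ⟨j, hj, rfl | rfl⟩
  · dsimp only at h1 h2
    by_cases h3 : c < k
    · have h4 : ¬ i = m + 1 := by omega
      have h5 : i ≤ m := h1
      simp [ofKleinF, toKleinF, h3, h4, h5]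
    · have h4 : ¬ 2 * m + 3 - i = 0 := by omega
      have h5 : ¬ 2 * m + 3 - i = m + 2 := by omega
      have h6 : ¬ 2 * m + 3 - i ≤ m + 1 := by omega
      simp only [ofKleinF, toKleinF, h3, h4, h5, h6, if_false, Sum.inl.injEq, Prod.ext_iff]
      omega
  · simp [ofKleinF, toKleinF]
  · simp only [ofKleinF, toKleinF, Nat.add_eq_zero_iff, OfNat.ofNat_ne_zero, and_false, if_false,
      if_true, Sum.inr.injEq]
    by_cases h1 : m % 2 = 1
    · simp only [h1, if_true]
    · by_cases h2 : j + 1 = k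
      · simp only [h1, h2, if_false, if_true]
        omega
      · simp only [h1, h2, if_false, Nat.add_eq_zero_iff, one_ne_zero, and_false,
          Nat.add_sub_cancel]

theorem toKleinF_ofKleinF {k m : ℕ} {v : ℕ × ℕ} (hv : v ∈ gridV (2 * m + 4) k) :
    toKleinF k m (ofKleinF k m v) = v := by
  obtain ⟨i, c⟩ := v
  have h1 : i < 2 * m + 4 := hv.1
  have h2 : c < k := hv.2
  unfold ofKleinF
  dsimp only
  by_cases h3 : i = 0
  · rw [if_pos h3, h3, toKleinF]
  · rw [if_neg h3]
    by_cases h4 : i = m + 2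
    · rw [if_pos h4, toKleinF, h4, Prod.ext_iff]
      refine ⟨rfl, ?_⟩
      dsimp only
      split_ifs <;> omega
    · rw [if_neg h4, toKleinF, Prod.ext_iff]
      constructor <;> dsimp only <;> split_ifs <;> omega

/-- For odd `k` the columns `c` and `c + k` have different parity, so just one of two antipodal
boundary vertices is a `z_i`, and direct antipodal edges are impossible. The cycle of the `w_j` is
inserted instead as row `0`, and that of the `v_j` as row `m + 2`: `w_j` is joined to the even one
of the columns `j` and `j + k`. These are the two rows that the reflection `i ↦ -i` fixes, so they
close up by themselves. For even `m` the `x_i` have odd columns, whence the shift of the `v_j` by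
one. -/
theorem nonempty_hexF_iso {k m : ℕ} (hk : 7 ≤ k) (hk2 : Odd k) :
    Nonempty (hexF k m ≃g hexFKlein k m) := by
  rw [Nat.odd_iff] at hk2
  refine nonempty_graphOn_iso (fun a => ⟨toKleinF k m a, toKleinF_mem hk a.2⟩)
    (fun v => ⟨ofKleinF k m v, ofKleinF_mem v.2⟩)
    (fun a => Subtype.ext (ofKleinF_toKleinF a.2)) (fun v => Subtype.ext (toKleinF_ofKleinF v.2))
    ?_ ?_
  · rintro ⟨a, ha⟩ ⟨b, hb⟩ h
    dsimp only at h ⊢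
    simp only [kleinHexE, Nat.even_iff, Nat.odd_iff]
    have hmod : ∀ {i}, i < k → (i + 1) % k = if i + 1 = k then 0 else i + 1 := by
      intro i hi
      split_ifs with h
      · rw [h, Nat.mod_self]
      · exact Nat.mod_eq_of_lt (by omega)
    have hmod' : ∀ {i}, i < 2 * m + 4 →
        (2 * m + 4 - i) % (2 * m + 4) = if i = 0 then 0 else 2 * m + 4 - i := by
      intro i hi
      split_ifs with h
      · rw [h, Nat.sub_zero, Nat.mod_self]
      · exact Nat.mod_eq_of_lt (by omega)
    have hu := (toKleinF_mem hk ha).1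
    have hv := (toKleinF_mem hk hb).1
    rw [hmod' hu, hmod' hv]
    clear hmod'
    rcases h with ⟨⟨i, c⟩, ⟨i', c'⟩, h, rfl, rfl⟩ | ⟨i, hi, rfl, rfl⟩ | ⟨i, hi, rfl, rfl⟩ |
      ⟨i, hi, rfl, rfl⟩ | ⟨i, hi, rfl, rfl⟩ | ⟨i, hi, rfl, rfl⟩ | ⟨i, hi, rfl, rfl⟩
    · obtain ⟨⟨x, y⟩, ⟨h1, h2⟩, h5⟩ | ⟨j, hj, h5 | h5⟩ := ha
      · rw [Sum.inl.injEq, Prod.mk.injEq] at h5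
        obtain ⟨rfl, rfl⟩ := h5
        obtain ⟨⟨x', y'⟩, ⟨h3, h4⟩, h5⟩ | ⟨j, hj, h5 | h5⟩ := hb
        · rw [Sum.inl.injEq, Prod.mk.injEq] at h5
          obtain ⟨rfl, rfl⟩ := h5
          simp only [cylE, Nat.odd_iff] at h
          dsimp only at h1 h2 h3 h4
          clear hu hv hmod
          simp only [toKleinF]
          rcases h with ⟨rfl, rfl⟩ | ⟨rfl, rfl, rfl⟩ | ⟨rfl, rfl, h⟩ <;> grind
        · cases h5
        · cases h5
      · cases h5
      · cases h5
    · rw [hmod hi] at *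
      clear hu hv hmod
      simp only [toKleinF]
      grind
    · rw [hmod hi] at *
      clear hu hv hmod
      simp only [toKleinF]
      grind
    · clear hu hv hmod
      simp only [toKleinF, cylZ]
      grind
    · clear hu hv hmod ha hb
      -- The parity of `m` decides whether the `x_i` have even or odd columns; in the latter case
      -- the last `x_i` of this list already lies in the second half of the cylinder.
      by_cases h7 : m % 2 = 1
      · simp only [toKleinF, cylX, h7, if_true, (by omega : 2 * i < k)]
        exact Or.inl (Or.inl (Or.inr (Or.inl ⟨trivial, trivial, by omega⟩)))
      · by_cases h8 : 2 * i + 1 = k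
        · simp only [toKleinF, cylX, h7, h8, if_true, if_false, lt_irrefl]
          exact Or.inr (Or.inl (Or.inr (Or.inl ⟨by omega, by omega, by omega⟩)))
        · simp only [toKleinF, cylX, h7, h8, if_true, if_false, (by omega : 2 * i + 1 < k)]
          exact Or.inl (Or.inl (Or.inr (Or.inl ⟨trivial, trivial, by omega⟩)))
    · clear hu hv hmod
      simp only [toKleinF, cylZ]
      grind
    · clear hu hv hmod
      simp only [toKleinF, cylX]
      grind
  · rintro ⟨⟨i, c⟩, hu⟩ ⟨⟨i', c'⟩, hv⟩ h
    have h1 : i < 2 * m + 4 := hu.1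
    have h2 : c < k := hu.2
    have h3 : i' < 2 * m + 4 := hv.1
    have h4 : c' < k := hv.2
    have hmod : ∀ {i}, i < k → (i + 1) % k = if i + 1 = k then 0 else i + 1 := by
      intro i hi
      split_ifs with h
      · rw [h, Nat.mod_self]
      · exact Nat.mod_eq_of_lt (by omega)
    have o0 : ∀ c, ofKleinF k m (0, c) = .inr (.inl c) := fun c => rfl
    have o2 : ∀ c, ofKleinF k m (m + 2, c) =
        .inr (.inr (if m % 2 = 1 then c else if c = 0 then k - 1 else c - 1)) := by
      intro c
      simp [ofKleinF]
    have o1 : ∀ i c, 1 ≤ i → i ≤ m + 1 → ofKleinF k m (i, c) = .inl (i - 1, c) := by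
      intro i c h h'
      have e1 : ¬ i = 0 := by omega
      have e2 : ¬ i = m + 2 := by omega
      simp [ofKleinF, e1, e2, h']
    have o3 : ∀ i c, m + 3 ≤ i → ofKleinF k m (i, c) = .inl (2 * m + 3 - i, c + k) := by
      intro i c h
      have e1 : ¬ i = 0 := by omega
      have e2 : ¬ i = m + 2 := by omega
      have e3 : ¬ i ≤ m + 1 := by omega
      simp [ofKleinF, e1, e2, e3]
    simp only [kleinHexE, Nat.even_iff, Nat.odd_iff] at h
    dsimp only
    rcases h with (⟨rfl, rfl⟩ | ⟨rfl, rfl, h⟩ | ⟨rfl, rfl, rfl, h⟩) | ⟨rfl, rfl, rfl⟩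
    · rcases (by omega : i' = 0 ∨ (1 ≤ i' ∧ i' ≤ m + 1) ∨ i' = m + 2 ∨ m + 3 ≤ i') with
        rfl | ⟨h5, h6⟩ | rfl | h5
      · rw [o0, o0]
        refine Or.inl (Or.inr (Or.inl ⟨c, h2, rfl, ?_⟩))
        rw [hmod h2, if_neg (by omega)]
      · rw [o1 _ _ h5 h6, o1 _ _ h5 h6]
        exact Or.inl (Or.inl ⟨(i' - 1, c), (i' - 1, c + 1), Or.inl ⟨rfl, rfl⟩, rfl, rfl⟩)
      · rw [o2, o2]
        refine Or.inl (Or.inr (Or.inr (Or.inl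
          ⟨if m % 2 = 1 then c else if c = 0 then k - 1 else c - 1, ?_, rfl, ?_⟩)))
        · split_ifs <;> omega
        · rw [hmod (by split_ifs <;> omega)]
          congr 2
          grind
      · rw [o3 _ _ h5, o3 _ _ h5]
        exact Or.inl (Or.inl ⟨(2 * m + 3 - i', c + k), (2 * m + 3 - i', c + 1 + k),
          Or.inl ⟨rfl, by dsimp only; omega⟩, rfl, rfl⟩)
    · rcases (by omega : i = 0 ∨ (1 ≤ i ∧ i ≤ m) ∨ i = m + 1 ∨ i = m + 2 ∨ m + 3 ≤ i) with
        rfl | ⟨h5, h6⟩ | rfl | rfl | h5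
      · rw [o0, o1 _ _ (by omega) (by omega)]
        refine Or.inr (Or.inr (Or.inr (Or.inr (Or.inl ⟨c' / 2, by omega, ?_, ?_⟩))))
        · simp only [cylZ, Sum.inl.injEq, Prod.ext_iff, true_and]
          omega
        · congr 2
          omega
      · rw [o1 _ _ h5 (by omega), o1 _ _ (by omega) (by omega)]
        refine Or.inl (Or.inl ⟨(i - 1, c'), (i + 1 - 1, c'),
          Or.inr (Or.inr ⟨?_, rfl, Nat.odd_iff.2 ?_⟩), rfl, rfl⟩) <;>
          dsimp only <;> omega
      · rw [o1 _ _ (by omega) (by omega), o2]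
        by_cases h7 : m % 2 = 1
        · refine Or.inl (Or.inr (Or.inr (Or.inr (Or.inr (Or.inl ⟨c' / 2, by omega, ?_, ?_⟩)))))
          · simp only [cylX, h7, if_true, Sum.inl.injEq, Prod.ext_iff]
            omega
          · rw [if_pos h7]
            congr 2
            omega
        · refine Or.inl (Or.inr (Or.inr (Or.inr (Or.inr (Or.inl ⟨c' / 2, by omega, ?_, ?_⟩)))))
          · simp only [cylX, h7, if_false, Sum.inl.injEq, Prod.ext_iff]
            omega
          · rw [if_neg h7, if_neg (by omega)]
            congr 2
            omega
      · rw [o2, o3 _ _ (by omega)]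
        by_cases h7 : m % 2 = 1
        · refine Or.inr (Or.inr (Or.inr (Or.inr (Or.inr (Or.inr (Or.inr
            ⟨(c' - 1) / 2, by omega, ?_, ?_⟩))))))
          · simp only [cylX, h7, if_true, Sum.inl.injEq, Prod.ext_iff]
            omega
          · rw [if_pos h7]
            congr 2
            omega
        · by_cases h8 : c' = 0
          · refine Or.inr (Or.inr (Or.inr (Or.inr (Or.inr (Or.inl
              ⟨(k - 1) / 2, by omega, ?_, ?_⟩)))))
            · simp only [cylX, h7, if_false, Sum.inl.injEq, Prod.ext_iff]
              omega
            · rw [if_neg h7, if_pos h8]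
              congr 2
              omega
          · refine Or.inr (Or.inr (Or.inr (Or.inr (Or.inr (Or.inr (Or.inr
              ⟨(c' - 2) / 2, by omega, ?_, ?_⟩))))))
            · simp only [cylX, h7, if_false, Sum.inl.injEq, Prod.ext_iff]
              omega
            · rw [if_neg h7, if_neg h8]
              congr 2
              omega
      · rw [o3 _ _ h5, o3 _ _ (by omega)]
        refine Or.inr (Or.inl ⟨(2 * m + 3 - (i + 1), c' + k), (2 * m + 3 - i, c' + k),
          Or.inr (Or.inr ⟨?_, rfl, Nat.odd_iff.2 ?_⟩), rfl, rfl⟩) <;>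
          dsimp only <;> omega
    · rw [o0, o3 _ _ (by omega)]
      refine Or.inr (Or.inr (Or.inr (Or.inr (Or.inr (Or.inr (Or.inl
        ⟨(c' - 1) / 2, by omega, ?_, ?_⟩))))))
      · simp only [cylZ, Sum.inl.injEq, Prod.ext_iff]
        omega
      · congr 2
        omega
    · rcases (by omega : i = 0 ∨ (1 ≤ i ∧ i ≤ m + 1) ∨ i = m + 2 ∨ m + 3 ≤ i) with
        rfl | ⟨h5, h6⟩ | rfl | h5
      · rw [Nat.sub_zero, Nat.mod_self, o0, o0]
        refine Or.inr (Or.inr (Or.inl ⟨k - 1, h4, rfl, ?_⟩))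
        rw [hmod h4, if_pos (by omega)]
      · rw [Nat.mod_eq_of_lt (by omega), o1 _ _ h5 h6, o3 _ _ (by omega)]
        refine Or.inl (Or.inl ⟨_, _, Or.inr (Or.inl ⟨?_, rfl, ?_⟩), rfl, rfl⟩) <;>
          dsimp only <;> omega
      · rw [Nat.mod_eq_of_lt (by omega), (by omega : 2 * m + 4 - (m + 2) = m + 2), o2, o2]
        refine Or.inr (Or.inr (Or.inr (Or.inl
          ⟨if m % 2 = 1 then k - 1 else if k - 1 = 0 then k - 1 else k - 1 - 1, ?_, rfl, ?_⟩)))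
        · split_ifs <;> omega
        · rw [hmod (by split_ifs <;> omega)]
          congr 2
          split_ifs <;> omega
      · rw [Nat.mod_eq_of_lt (by omega), o3 _ _ h5, o1 _ _ (by omega) (by omega)]
        refine Or.inr (Or.inl ⟨_, _, Or.inl ⟨?_, ?_⟩, rfl, rfl⟩) <;>
          dsimp only <;> omega

end HexTiling

namespace HexTiling

/-! ### Locally grid graphs as quotients of the square lattice -/

/-- The four unit vectors, in cyclic order. -/
def unitStep : Fin 4 → ℤ × ℤ := ![(1, 0), (0, 1), (-1, 0), (0, -1)]

/-- `π` is a covering of `G` by the square lattice. -/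
structure GridCover {W : Type*} (G : SimpleGraph W) (π : ℤ × ℤ → W) : Prop where
  surj : Function.Surjective π
  adj : ∀ x w, G.Adj (π x) w ↔ ∃ i, w = π (x + unitStep i)

/-- The displacements between vertices of the lattice that have to stay different in a locally grid
graph. -/
def IsShort (d : ℤ × ℤ) : Prop :=
  |d.1| + |d.2| ≤ 4 ∨ (|d.1| + |d.2| = 5 ∧ 2 ≤ |d.1| ∧ 2 ≤ |d.2|)

instance (d : ℤ × ℤ) : Decidable (IsShort d) := inferInstanceAs (Decidable (_ ∨ _))

/-- A property of lattice points that holds somewhere and is inherited by neighbours holds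
everywhere. -/
theorem lattice_induction {C : ℤ × ℤ → Prop} (x₀ : ℤ × ℤ) (h0 : C x₀)
    (hs : ∀ x i, C x → C (x + unitStep i)) (x : ℤ × ℤ) : C x := by
  have h1 : ∀ a : ℤ, C (a, x₀.2) := by
    intro a
    induction a using Int.inductionOn' (b := x₀.1) with
    | zero => exact h0
    | succ a _ ih => simpa [unitStep] using hs _ 0 ih
    | pred a _ ih => simpa [unitStep, sub_eq_add_neg] using hs _ 2 ih
  obtain ⟨a, b⟩ := x
  induction b using Int.inductionOn' (b := x₀.2) with
  | zero => exact h1 a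
  | succ b _ ih => simpa [unitStep] using hs _ 1 ih
  | pred b _ ih => simpa [unitStep, sub_eq_add_neg] using hs _ 3 ih

namespace GridCover

variable {W : Type*} {G : SimpleGraph W} {π : ℤ × ℤ → W} (h : GridCover G π)
include h

theorem connected : G.Connected := by
  have : Nonempty W := ⟨π 0⟩
  have key : ∀ w, G.Reachable (π 0) w := by
    intro w
    obtain ⟨x, rfl⟩ := h.surj w
    refine lattice_induction (C := fun x => G.Reachable (π 0) (π x)) 0 (.refl _) ?_ x
    intro x i hx
    exact hx.trans ((h.adj _ _).2 ⟨i, rfl⟩).reachable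
  exact ⟨fun u v => (key u).symm.trans (key v)⟩

/-- The `x_i` are the images of the unit vectors, the `y_i` those of the sums of two consecutive
ones. Any unwanted equality or adjacency would identify two lattice points with a short
displacement, and a finite check shows that the points are not equal. The displacements of length
five come from adjacencies between two of the `y_i`: they are `(±2, ±2)` plus a unit vector, with
both coordinates at least two in absolute value. -/
theorem isLocallyGrid (hinj : ∀ x d, IsShort d → π (x + d) = π x → d = 0) :
    IsLocallyGrid G := by
  refine ⟨h.connected, fun v => ?_⟩
  obtain ⟨x, rfl⟩ := h.surj v
  have key : ∀ d d', IsShort (d' - d) → π (x + d) = π (x + d') → d' = d := by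
    intro d d' hd he
    refine sub_eq_zero.1 (hinj (x + d) (d' - d) hd ?_)
    rw [he]
    congr 1
    abel
  have key0 : ∀ d, IsShort d → π (x + d) = π x → d = 0 := hinj x
  have hadj : ∀ d w, G.Adj (π (x + d)) w ↔ ∃ i, w = π (x + (d + unitStep i)) := by
    intro d w
    rw [h.adj]
    simp only [add_assoc]
  -- A common neighbour is reached by two lattice paths of length two. Their end points differ by a
  -- displacement of length at most four, so they coincide in the lattice.
  have inter : ∀ i j w, w ∈ G.neighborSet (π (x + unitStep i)) ∩ G.neighborSet (π (x + unitStep j)) →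
      ∃ s, w = π (x + (unitStep i + unitStep s)) ∧ ∃ t, unitStep i + unitStep s = unitStep j + unitStep t := by
    rintro i j w ⟨h1, h2⟩
    obtain ⟨s, rfl⟩ := (hadj _ _).1 h1
    obtain ⟨t, h3⟩ := (hadj _ _).1 h2
    refine ⟨s, rfl, t, (key _ _ ?_ h3.symm)⟩
    clear h1 h2 h3
    decide +revert
  refine ⟨fun i => π (x + unitStep i), fun i => π (x + (unitStep i + unitStep (i + 1))), ?_, ?_, ?_, ?_, ?_, ?_, ?_, ?_,
    ?_⟩
  · intro i j hij
    have := key _ _ (by clear hij; decide +revert) hij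
    clear hij
    decide +revert
  · ext w
    rw [SimpleGraph.mem_neighborSet, h.adj]
    exact ⟨fun ⟨i, h⟩ => ⟨i, h.symm⟩, fun ⟨i, h⟩ => ⟨i, h.symm⟩⟩
  · intro i j hij
    have := key _ _ (by clear hij; decide +revert) hij
    clear hij
    decide +revert
  · intro i
    refine ⟨fun hi => ?_, ?_⟩
    · have := key0 _ (by clear hi; decide +revert) hi
      clear hi
      revert this
      decide +revert
    · ext w
      constructor
      · intro hw
        obtain ⟨s, rfl, t, hst⟩ := inter _ _ _ hw
        have : unitStep i + unitStep s = 0 ∨ unitStep i + unitStep s = unitStep i + unitStep (i + 1) := by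
          clear hw
          decide +revert
        rcases this with h | h <;> rw [h]
        · exact Or.inl (by rw [add_zero])
        · exact Or.inr rfl
      · rintro (rfl | rfl)
        · have h2 : ∀ i, unitStep i + unitStep (i + 2) = 0 := by decide
          refine ⟨(hadj _ _).2 ⟨i + 2, ?_⟩, (hadj _ _).2 ⟨i + 1 + 2, ?_⟩⟩ <;>
            rw [h2, add_zero]
        · exact ⟨(hadj _ _).2 ⟨i + 1, rfl⟩, (hadj _ _).2 ⟨i, by rw [add_comm (unitStep (i + 1))]⟩⟩
  · intro i
    ext w
    constructor
    · intro hw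
      obtain ⟨s, rfl, t, hst⟩ := inter _ _ _ hw
      have : unitStep i + unitStep s = 0 := by
        clear hw
        decide +revert
      rw [this, add_zero]
      rfl
    · rintro rfl
      have h2 : ∀ i, unitStep i + unitStep (i + 2) = 0 := by decide
      refine ⟨(hadj _ _).2 ⟨i + 2, ?_⟩, (hadj _ _).2 ⟨i + 2 + 2, ?_⟩⟩ <;>
        rw [h2, add_zero]
  · intro i j hij
    obtain ⟨s, hs⟩ := (hadj _ _).1 hij
    have := key _ _ (by clear hs hij; decide +revert) hs
    clear hs hij
    revert this
    decide +revert
  · intro i j hij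
    obtain ⟨s, hs⟩ := (hadj _ _).1 hij
    have := key _ _ (by clear hs hij; decide +revert) hs
    clear hs hij
    revert this
    decide +revert
  · intro i hi
    obtain ⟨s, hs⟩ := (h.adj _ _).1 hi
    have := key _ _ (by clear hs hi; decide +revert) hs
    clear hs hi
    revert this
    decide +revert
  · intro i j hij
    obtain ⟨s, hs⟩ := (hadj _ _).1 hij
    have := key _ _ (by clear hs hij; decide +revert) hs
    clear hs hij
    revert this
    decide +revert

end GridCover

end HexTiling

/-! ### Covering a twisted grid by strips of the square lattice -/

namespace HexTiling

/-- The four neighbours of `u`. Leaving the last column forwards leads to the preimage `c` under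
`g`, leaving the first column backwards to the image under `g`; injectivity of `g` makes `c` the
only possibility. -/
theorem twist_edge_iff {p q : ℕ} (hp : 2 ≤ p) {g : ℕ → ℕ}
    (hg : ∀ j, j < p → ∀ j', j' < p → g j = g j' → j = j') (u v : gridV p q) {c : ℕ} (hc : c < p)
    (hcu : g c = u.1.1) :
    ((gridE u.1 v.1 ∨ sideE p u.1 v.1 ∨ (u.1.2 = 0 ∧ v.1.1 = g u.1.1 ∧ v.1.2 = q - 1)) ∨
      (gridE v.1 u.1 ∨ sideE p v.1 u.1 ∨ (v.1.2 = 0 ∧ u.1.1 = g v.1.1 ∧ u.1.2 = q - 1))) ↔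
    (v.1.1 = (if u.1.1 + 1 = p then 0 else u.1.1 + 1) ∧ v.1.2 = u.1.2) ∨
    (v.1.1 = (if u.1.2 + 1 = q then c else u.1.1) ∧
      v.1.2 = if u.1.2 + 1 = q then 0 else u.1.2 + 1) ∨
    (v.1.1 = (if u.1.1 = 0 then p - 1 else u.1.1 - 1) ∧ v.1.2 = u.1.2) ∨
    (v.1.1 = (if u.1.2 = 0 then g u.1.1 else u.1.1) ∧
      v.1.2 = if u.1.2 = 0 then q - 1 else u.1.2 - 1) := by
  have h1 : u.1.1 < p := u.2.1
  have h2 : u.1.2 < q := u.2.2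
  have h3 : v.1.1 < p := v.2.1
  have h4 : v.1.2 < q := v.2.2
  have h5 : u.1.1 = g v.1.1 ↔ v.1.1 = c := by
    rw [← hcu]
    exact ⟨fun h => (hg _ hc _ h3 h).symm, fun h => by rw [h]⟩
  simp only [gridE, sideE, h5]
  generalize g u.1.1 = d
  clear h5 hcu hg
  constructor
  · rintro (((h | h) | h | h) | (h | h) | h | h)
    · refine Or.inl ⟨?_, by omega⟩
      split_ifs <;> omega
    · refine Or.inr (Or.inl ⟨?_, ?_⟩) <;> split_ifs <;> omega
    · refine Or.inr (Or.inr (Or.inl ⟨?_, by omega⟩))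
      split_ifs <;> omega
    · refine Or.inr (Or.inr (Or.inr ⟨?_, ?_⟩)) <;> split_ifs <;> omega
    · refine Or.inr (Or.inr (Or.inl ⟨?_, by omega⟩))
      split_ifs <;> omega
    · refine Or.inr (Or.inr (Or.inr ⟨?_, ?_⟩)) <;> split_ifs <;> omega
    · refine Or.inl ⟨?_, by omega⟩
      split_ifs <;> omega
    · refine Or.inr (Or.inl ⟨?_, ?_⟩) <;> split_ifs <;> omega
  · rintro (⟨h, h'⟩ | ⟨h, h'⟩ | ⟨h, h'⟩ | ⟨h, h'⟩) <;> split_ifs at h h' with h6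
    · exact Or.inr (Or.inr (Or.inl (by omega)))
    · exact Or.inl (Or.inl (Or.inl (by omega)))
    · exact Or.inr (Or.inr (Or.inr (by omega)))
    · exact Or.inl (Or.inl (Or.inr (by omega)))
    · exact Or.inl (Or.inr (Or.inl (by omega)))
    · exact Or.inr (Or.inl (Or.inl (by omega)))
    · exact Or.inl (Or.inr (Or.inr (by omega)))
    · exact Or.inr (Or.inl (Or.inr (by omega)))

theorem exists_unitStep_iff {C : ℤ × ℤ → Prop} {a b : ℤ} : (∃ i, C ((a, b) + unitStep i)) ↔
    C (a + 1, b) ∨ C (a, b + 1) ∨ C (a - 1, b) ∨ C (a, b - 1) := by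
  simp [Fin.exists_fin_succ, unitStep, sub_eq_add_neg]

theorem int_succ_mod {p n : ℤ} (hp : 0 < p) :
    (n + 1) % p = if n % p + 1 = p then 0 else n % p + 1 := by
  have h1 := Int.emod_nonneg n hp.ne'
  have h2 := Int.emod_lt_of_pos n hp
  rw [← Int.emod_add_emod n p 1]
  split_ifs with h
  · rw [h, Int.emod_self]
  · exact Int.emod_eq_of_lt (by omega) (by omega)

theorem int_pred_mod {p n : ℤ} (hp : 0 < p) :
    (n - 1) % p = if n % p = 0 then p - 1 else n % p - 1 := by
  have h1 := Int.emod_nonneg n hp.ne'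
  have h2 := Int.emod_lt_of_pos n hp
  rw [← Int.emod_sub_emod n p 1]
  split_ifs with h
  · rw [h, ← Int.add_emod_right, Int.emod_eq_of_lt (by omega) (by omega)]
    ring
  · exact Int.emod_eq_of_lt (by omega) (by omega)

theorem int_succ_div {q b : ℤ} (hq : 0 < q) :
    (b + 1) / q = if b % q + 1 = q then b / q + 1 else b / q := by
  have h1 := Int.emod_nonneg b hq.ne'
  have h2 := Int.emod_lt_of_pos b hq
  have h3 := Int.mul_ediv_add_emod b q
  split_ifs with h
  · rw [← h3, show q * (b / q) + b % q + 1 = (b / q + 1) * q by linear_combination h]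
    rw [Int.mul_ediv_cancel _ hq.ne', h3]
  · nth_rewrite 1 [← h3]
    rw [add_assoc, add_comm, Int.add_mul_ediv_left _ _ hq.ne', Int.ediv_eq_zero_of_lt (by omega)
      (by omega), zero_add]

theorem int_pred_div {q b : ℤ} (hq : 0 < q) :
    (b - 1) / q = if b % q = 0 then b / q - 1 else b / q := by
  have h := int_succ_div (b := b - 1) hq
  have h' := int_succ_mod (n := b - 1) hq
  have h1 := Int.emod_nonneg (b - 1) hq.ne'
  rw [sub_add_cancel] at h h'
  split_ifs at h h' ⊢ <;> omega

/-- The map from the square lattice to the grid whose fundamental domains are the strips of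
breadth `q`, the `s`-th of which is placed on the grid by `F s`. -/
def stripMap (p q : ℕ) (hp : 0 < p) (hq : 0 < q) (F : ℤ → ℤ → ℤ) (x : ℤ × ℤ) : gridV p q :=
  ⟨((F (x.2 / q) x.1 % p).toNat, (x.2 % q).toNat), by
    have h1 := Int.emod_lt_of_pos (F (x.2 / q) x.1) (by omega : (0 : ℤ) < p)
    have h2 := Int.emod_lt_of_pos x.2 (by omega : (0 : ℤ) < q)
    constructor <;> dsimp only <;> omega⟩

section

variable {p q : ℕ} {hp : 0 < p} {hq : 0 < q} {F : ℤ → ℤ → ℤ}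

theorem stripMap_fst (x : ℤ × ℤ) :
    ((stripMap p q hp hq F x).1.1 : ℤ) = F (x.2 / q) x.1 % p :=
  Int.toNat_of_nonneg (Int.emod_nonneg _ (by omega))

theorem stripMap_snd (x : ℤ × ℤ) : ((stripMap p q hp hq F x).1.2 : ℤ) = x.2 % q :=
  Int.toNat_of_nonneg (Int.emod_nonneg _ (by omega))

theorem eq_stripMap_iff (w : gridV p q) (x : ℤ × ℤ) : w = stripMap p q hp hq F x ↔
    (w.1.1 : ℤ) = F (x.2 / q) x.1 % p ∧ (w.1.2 : ℤ) = x.2 % q := by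
  rw [← stripMap_fst (hp := hp) (hq := hq), ← stripMap_snd (hp := hp) (F := F), Nat.cast_inj,
    Nat.cast_inj, Subtype.ext_iff, Prod.ext_iff]

/-- Inside a strip the map is the rotation or reflection given by `F s`, and `hFg` says that passing
from the strip `s` to the strip `s - 1` is an edge of the seam. The last hypothesis is needed
because a simple graph has no loops. -/
theorem gridCover_stripMap (hp2 : 2 ≤ p) {g : ℕ → ℕ}
    (hg : ∀ j, j < p → ∀ j', j' < p → g j = g j' → j = j') (h0 : ∀ a, F 0 a = a)
    (hF : ∀ s, (∀ a, F s (a + 1) = F s a + 1) ∨ ∀ a, F s (a + 1) = F s a - 1)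
    (hFg : ∀ s a, g (F s a % p).toNat = (F (s - 1) a % p).toNat)
    (hne : ∀ x i, stripMap p q hp hq F (x + unitStep i) ≠ stripMap p q hp hq F x) :
    GridCover (gridTwist p q g) (stripMap p q hp hq F) := by
  have hp' : (0 : ℤ) < p := by omega
  have hq' : (0 : ℤ) < q := by omega
  refine ⟨?_, ?_⟩
  · rintro ⟨⟨i, j⟩, h1, h2⟩
    dsimp only at h1 h2
    refine ⟨((i : ℤ), (j : ℤ)), ?_⟩
    simp only [stripMap, Subtype.ext_iff, Prod.ext_iff]
    rw [Int.ediv_eq_zero_of_lt (by omega) (by omega), h0, Int.emod_eq_of_lt (by omega) (by omega),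
      Int.emod_eq_of_lt (by omega) (by omega)]
    exact ⟨rfl, rfl⟩
  · rintro ⟨a, b⟩ w
    have hadj : (gridTwist p q g).Adj (stripMap p q hp hq F (a, b)) w ↔
        stripMap p q hp hq F (a, b) ≠ w ∧ ∃ i, w = stripMap p q hp hq F ((a, b) + unitStep i) := by
      rw [gridTwist, graphOn_adj]
      refine and_congr_right fun _ => ?_
      have hc := hFg (b / q + 1) a
      rw [add_sub_cancel_right] at hc
      have hc' : (F (b / q + 1) a % p).toNat < p := by
        have := Int.emod_lt_of_pos (F (b / q + 1) a) hp'
        omega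
      rw [twist_edge_iff hp2 hg _ w hc' hc]
      have hd : g (stripMap p q hp hq F (a, b)).1.1 = (F (b / q - 1) a % p).toNat := hFg _ _
      rw [hd]
      have e1 : ((stripMap p q hp hq F (a, b)).1.1 : ℤ) = F (b / q) a % p := stripMap_fst _
      have e2 : ((stripMap p q hp hq F (a, b)).1.2 : ℤ) = b % q := stripMap_snd _
      have f1 := Int.emod_nonneg (F (b / q + 1) a) hp'.ne'
      have f2 := Int.emod_nonneg (F (b / q - 1) a) hp'.ne'
      have f3 := Int.emod_nonneg (F (b / q) a) hp'.ne'
      have f4 := Int.emod_nonneg b hq'.ne'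
      rw [exists_unitStep_iff (C := fun x => w = stripMap p q hp hq F x)]
      simp only [eq_stripMap_iff, int_succ_mod hq', int_pred_mod hq', int_succ_div hq',
        int_pred_div hq']
      have e3 : ((stripMap p q hp hq F (a, b)).1.2 + 1 = q) ↔ (b % q + 1 = q) := by omega
      have e4 : ((stripMap p q hp hq F (a, b)).1.2 = 0) ↔ (b % q = 0) := by omega
      have hv1 : (w.1.1 = (if (stripMap p q hp hq F (a, b)).1.2 + 1 = q then
          (F (b / q + 1) a % p).toNat else (stripMap p q hp hq F (a, b)).1.1) ∧
          w.1.2 = (if (stripMap p q hp hq F (a, b)).1.2 + 1 = q then 0 else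
            (stripMap p q hp hq F (a, b)).1.2 + 1)) ↔
          ((w.1.1 : ℤ) = F (if b % q + 1 = q then b / q + 1 else b / q) a % p ∧
          (w.1.2 : ℤ) = if b % q + 1 = q then 0 else b % q + 1) := by
        simp only [e3]
        split_ifs <;> omega
      have hv2 : (w.1.1 = (if (stripMap p q hp hq F (a, b)).1.2 = 0 then
          (F (b / q - 1) a % p).toNat else (stripMap p q hp hq F (a, b)).1.1) ∧
          w.1.2 = (if (stripMap p q hp hq F (a, b)).1.2 = 0 then q - 1 else
            (stripMap p q hp hq F (a, b)).1.2 - 1)) ↔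
          ((w.1.1 : ℤ) = F (if b % q = 0 then b / q - 1 else b / q) a % p ∧
          (w.1.2 : ℤ) = if b % q = 0 then (q : ℤ) - 1 else b % q - 1) := by
        simp only [e4]
        split_ifs <;> omega
      rw [hv1, hv2]
      have he2 : w.1.2 = (stripMap p q hp hq F (a, b)).1.2 ↔ (w.1.2 : ℤ) = b % q := by omega
      have hu1 : (w.1.1 = (if (stripMap p q hp hq F (a, b)).1.1 + 1 = p then 0 else
          (stripMap p q hp hq F (a, b)).1.1 + 1)) ↔
          (w.1.1 : ℤ) = (F (b / q) a + 1) % p := by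
        rw [int_succ_mod hp']
        split_ifs <;> omega
      have hu2 : (w.1.1 = (if (stripMap p q hp hq F (a, b)).1.1 = 0 then p - 1 else
          (stripMap p q hp hq F (a, b)).1.1 - 1)) ↔
          (w.1.1 : ℤ) = (F (b / q) a - 1) % p := by
        rw [int_pred_mod hp']
        split_ifs <;> omega
      rw [hu1, hu2, he2]
      rcases hF (b / q) with h | h
      · have h' := h (a - 1)
        rw [sub_add_cancel] at h'
        rw [h a, (by omega : F (b / q) (a - 1) = F (b / q) a - 1)]
      -- In a reflected strip the two horizontal directions are exchanged.
      · have h' := h (a - 1)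
        rw [sub_add_cancel] at h'
        rw [h a, (by omega : F (b / q) (a - 1) = F (b / q) a + 1)]
        exact iff_of_eq (by ac_rfl)
    rw [hadj, and_iff_right_of_imp]
    rintro ⟨i, rfl⟩
    exact (hne _ i).symm

end

end HexTiling

/-! ### Which twisted torus and Klein bottle grids are locally grid -/

namespace HexTiling

/-- Points with the same image agree in the second coordinate modulo `q`, so only displacements `(d,
q * n)` matter, where `n` counts the strips crossed. -/
theorem isLocallyGrid_of_strips {p q : ℕ} (hp2 : 2 ≤ p) (hq : 0 < q) {g : ℕ → ℕ} (F : ℤ → ℤ → ℤ)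
    (hg : ∀ j, j < p → ∀ j', j' < p → g j = g j' → j = j') (h0 : ∀ a, F 0 a = a)
    (hF : ∀ s, (∀ a, F s (a + 1) = F s a + 1) ∨ ∀ a, F s (a + 1) = F s a - 1)
    (hFg : ∀ s a, g (F s a % p).toNat = (F (s - 1) a % p).toNat)
    (hinj : ∀ s a d n : ℤ, IsShort (d, q * n) → (p : ℤ) ∣ F (s + n) (a + d) - F s a →
      d = 0 ∧ n = 0) : IsLocallyGrid (gridTwist p q g) := by
  have hp : 0 < p := by omega
  have hinj' : ∀ x d, IsShort d → stripMap p q hp hq F (x + d) = stripMap p q hp hq F x →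
      d = 0 := by
    rintro ⟨a, b⟩ ⟨d, e⟩ hs h
    rw [eq_stripMap_iff, stripMap_fst, stripMap_snd] at h
    obtain ⟨h1, h2⟩ := h
    obtain ⟨n, hn⟩ : (q : ℤ) ∣ e := by
      have := Int.ModEq.dvd h2.symm
      simpa using this
    subst hn
    have h3 : (((a, b) + (d, (q : ℤ) * n)).2) / (q : ℤ) = b / q + n := by
      simp only [Prod.mk_add_mk]
      rw [Int.add_mul_ediv_left _ _ (by omega)]
    rw [h3] at h1
    obtain ⟨rfl, rfl⟩ := hinj (b / q) a d n hs (Int.ModEq.dvd h1.symm)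
    simp
  refine (gridCover_stripMap (hp := hp) (hq := hq) hp2 hg h0 hF hFg ?_).isLocallyGrid hinj'
  intro x i h
  have := hinj' x _ (by clear h; decide +revert) h
  clear h
  revert this
  decide +revert

theorem toNat_emod {p : ℕ} {n : ℤ} {j : ℕ} (hj : j < p) (h : (p : ℤ) ∣ n - j) :
    (n % p).toNat = j := by
  have h1 : n % p = (j : ℤ) % p := (Int.modEq_iff_dvd.2 h).symm
  rw [h1, Int.emod_eq_of_lt (by omega) (by omega), Int.toNat_natCast]

/-- The covering group is generated by `(p, 0)` and `(δ, q)`, so `(d, q * n)` belongs to it if and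
only if `d ≡ δ * n` modulo `p`. For `q ≥ 2` shortness leaves few values of `n`, and for these the
size of `δ` contradicts the congruence. For `q = 1` the parameter condition is the claim itself. -/
theorem isLocallyGrid_torusT {p q δ : ℕ} (h : TorusRange p q δ) : IsLocallyGrid (torusT p q δ) := by
  obtain ⟨hp, hδ, h⟩ := h
  refine isLocallyGrid_of_strips (g := fun j => (j + δ) % p) (by omega) (by omega)
    (fun s a => a - δ * s) ?_ ?_ ?_ ?_ ?_
  · intro j hj j' hj'
    rw [mod_eq_ite (by omega), mod_eq_ite (by omega)]
    split_ifs <;> omega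
  · intro a
    ring
  · exact fun s => Or.inl fun a => by ring
  · intro s a
    have h1 := Int.emod_nonneg (a - δ * s) (by omega : (p : ℤ) ≠ 0)
    refine (toNat_emod (Nat.mod_lt _ (by omega)) ?_).symm
    push_cast
    rw [Int.toNat_of_nonneg h1]
    rw [Int.emod_add_emod, ← Int.modEq_iff_dvd]
    refine (Int.mod_modEq _ _).trans ?_
    rw [show a - δ * s + δ = a - δ * (s - 1) by ring]
  · intro s a d n hs ⟨m, hm⟩
    replace hm : d = δ * n + p * m := by linear_combination hm
    have key : n = 0 → d = 0 ∧ n = 0 := by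
      rintro rfl
      refine ⟨?_, rfl⟩
      refine Int.eq_zero_of_abs_lt_dvd (m := p) ⟨m, by linear_combination hm⟩ ?_
      rcases hs with hs | hs
      · simp at hs
        omega
      · simp at hs
    change |d| + |(q : ℤ) * n| ≤ 4 ∨
      (|d| + |(q : ℤ) * n| = 5 ∧ 2 ≤ |d| ∧ 2 ≤ |(q : ℤ) * n|) at hs
    have hd0 := abs_nonneg d
    have hpm : ∀ j : ℤ, d = j + p * m → |d - j| < p → d = j := fun j h1 h2 => by
      have := Int.eq_zero_of_abs_lt_dvd (m := p) (x := d - j) ⟨m, by linear_combination h1⟩ h2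
      omega
    have hqn : |(q : ℤ) * n| = q * |n| := by rw [abs_mul, Nat.abs_cast]
    rw [hqn] at hs
    rcases h with ⟨hq, hδq⟩ | ⟨rfl, hq⟩ | ⟨rfl, hq, hq2⟩ | ⟨rfl, hq⟩
    · refine key ?_
      by_contra hn
      have h1 := Int.one_le_abs hn
      have h2 : |n| ≤ 1 := by
        by_contra h2
        have : (4 : ℤ) * 2 ≤ q * |n| := by gcongr <;> omega
        omega
      have h3 : |n| = 1 := by omega
      rw [h3] at hs
      -- Only `(0, ±4)` with `q = 4` is left, and it would require `δ ≡ 0` modulo `p`; but `0 < δ`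
      -- and `2 * δ ≤ p`.
      obtain ⟨h4, rfl⟩ : |d| = 0 ∧ q = 4 := by omega
      have h5 := abs_eq_zero.1 h4
      rcases (abs_eq (by norm_num)).1 h3 with rfl | rfl
      · have := hpm (δ : ℤ) (by linear_combination hm) (by rw [abs_lt]; omega)
        omega
      · have := hpm (-δ : ℤ) (by linear_combination hm) (by rw [abs_lt]; omega)
        omega
    · refine key ?_
      by_contra hn
      push_cast at hs
      have h0 := Int.one_le_abs hn
      have h1 : |n| = 1 := by omega
      rw [h1] at hs
      have h2 : |d| ≤ 2 := by omega
      rw [abs_le] at h2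
      rcases (abs_eq (by norm_num)).1 h1 with rfl | rfl
      · have := hpm (δ : ℤ) (by linear_combination hm) (by rw [abs_lt]; omega)
        omega
      · have := hpm (-δ : ℤ) (by linear_combination hm) (by rw [abs_lt]; omega)
        omega
    · refine key ?_
      by_contra hn
      push_cast at hs
      have h0 := Int.one_le_abs hn
      -- If `n = ±1`, then `|d| ≤ 3` is smaller than `δ`. If `n = ±2`, then `d = 0` and `p` would
      -- divide `2 * δ`, which lies strictly between `0` and `p`.
      rcases (by omega : |n| = 1 ∨ |n| = 2) with h1 | h1 <;> rw [h1] at hs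
      · have h2 : |d| ≤ 3 := by omega
        rw [abs_le] at h2
        rcases (abs_eq (by norm_num)).1 h1 with rfl | rfl
        · have := hpm (δ : ℤ) (by linear_combination hm) (by rw [abs_lt]; omega)
          omega
        · have := hpm (-δ : ℤ) (by linear_combination hm) (by rw [abs_lt]; omega)
          omega
      · have h2 : d = 0 := abs_eq_zero.1 (by omega)
        rcases (abs_eq (by norm_num)).1 h1 with rfl | rfl
        · have := hpm (2 * δ : ℤ) (by linear_combination hm) (by rw [abs_lt]; omega)
          omega
        · have := hpm (-2 * δ : ℤ) (by linear_combination hm) (by rw [abs_lt]; omega)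
          omega
    · by_contra hne
      -- The congruence `d ≡ δ * n` is a relation with coefficients `d` and `-n`.
      refine hq d (-n) (by omega) ?_ ⟨m, by linear_combination hm⟩
      rw [abs_neg]
      simpa using hs

/-- Even strips are placed by the identity, odd ones by the reflection. For `q ≥ 5` a short
displacement over a multiple of `q` is horizontal, and `p ≥ 5` excludes it. For `q = 4` there are
also `(0, ±4)`, which would require `u - 2 * a ≡ 0` modulo `p`; this fails for even `p` and odd `u`,
by parity. -/
theorem isLocallyGrid_gridTwist_reflect {p q u : ℕ} (hp : 5 ≤ p) (hu : u < p)
    (hq : 5 ≤ q ∨ (q = 4 ∧ p % 2 = 0 ∧ u % 2 = 1)) :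
    IsLocallyGrid (gridTwist p q (reflect p u)) := by
  have hr : ∀ A : ℤ, reflect p u (A % p).toNat = ((u - A) % p).toNat := by
    intro A
    have h1 := Int.emod_nonneg A (by omega : (p : ℤ) ≠ 0)
    have h2 := Int.emod_lt_of_pos A (by omega : (0 : ℤ) < p)
    refine (toNat_emod ?_ ?_).symm
    · simp only [reflect]
      split_ifs <;> omega
    · have h3 := Int.mul_ediv_add_emod A p
      simp only [reflect]
      split_ifs with h
      · rw [Nat.cast_sub h, Int.toNat_of_nonneg h1]
        exact ⟨-(A / p), by linear_combination h3⟩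
      · rw [Nat.cast_sub (by omega), Int.toNat_of_nonneg h1, Nat.cast_add]
        exact ⟨-(A / p) - 1, by linear_combination h3⟩
  refine isLocallyGrid_of_strips (by omega) (by omega)
    (fun s a => if s % 2 = 0 then a else u - a) ?_ ?_ ?_ ?_ ?_
  · intro j hj j' hj'
    simp only [reflect]
    split_ifs <;> omega
  · intro a
    rfl
  · intro s
    by_cases hs : s % 2 = 0
    · exact Or.inl fun a => by simp only [hs, if_true]
    · exact Or.inr fun a => by simp only [hs, if_false]; ring
  · intro s a
    rw [hr]
    congr 2
    split_ifs <;> omega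
  · intro s a d n hs hdvd
    have hqn : |(q : ℤ) * n| = q * |n| := by rw [abs_mul, Nat.abs_cast]
    change |d| + |(q : ℤ) * n| ≤ 4 ∨
      (|d| + |(q : ℤ) * n| = 5 ∧ 2 ≤ |d| ∧ 2 ≤ |(q : ℤ) * n|) at hs
    rw [hqn] at hs
    obtain ⟨m, hm⟩ := hdvd
    have hd0 := abs_nonneg d
    by_cases hn : n = 0
    · subst hn
      refine ⟨?_, rfl⟩
      refine Int.eq_zero_of_abs_lt_dvd (m := p) ?_ ?_
      · rw [add_zero] at hm
        split_ifs at hm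
        · exact ⟨m, by linear_combination hm⟩
        · exact ⟨-m, by linear_combination -hm⟩
      · simp at hs
        omega
    · exfalso
      have h1 := Int.one_le_abs hn
      have h4 : (4 : ℤ) ≤ q := by omega
      have h5 : |n| ≤ 1 := by
        by_contra h5
        have : (4 : ℤ) * 2 ≤ q * |n| := by gcongr; omega
        omega
      rw [(by omega : |n| = 1), mul_one] at hs
      obtain ⟨rfl, hp2, hu2⟩ : q = 4 ∧ p % 2 = 0 ∧ u % 2 = 1 := by omega
      have h6 : d = 0 := abs_eq_zero.1 (by omega)
      subst h6
      have h7 : n % 2 = 1 := by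
        rcases abs_le.1 h5 with ⟨h, h'⟩
        omega
      have h8 : (2 : ℤ) ∣ p * m := Dvd.dvd.mul_right (by omega) m
      split_ifs at hm <;> omega

theorem isLocallyGrid_kleinK0 {p q : ℕ} (hp : 5 ≤ p) (hq : 4 ≤ q) (hp2 : Even p) :
    IsLocallyGrid (kleinK0 p q) := by
  rw [Nat.even_iff] at hp2
  rw [← gridTwist_reflect_eq_kleinK0]
  exact isLocallyGrid_gridTwist_reflect hp (by omega) (by omega)

theorem isLocallyGrid_kleinK1 {p q : ℕ} (hp : 5 ≤ p) (hq : 5 ≤ q) :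
    IsLocallyGrid (kleinK1 p q) := by
  change IsLocallyGrid (kleinK0 p q)
  rw [← gridTwist_reflect_eq_kleinK0]
  exact isLocallyGrid_gridTwist_reflect hp (by omega) (Or.inl hq)

theorem isLocallyGrid_kleinK2 {p q : ℕ} (hp : 5 ≤ p) (hq : 5 ≤ q) :
    IsLocallyGrid (kleinK2 p q) := by
  rw [← gridTwist_reflect_eq_kleinK2]
  exact isLocallyGrid_gridTwist_reflect hp (by omega) (Or.inl hq)

end HexTiling

namespace HexTiling

/-! ### Quotients of the hexagonal lattice -/

/-- `E` is a covering of `H` by the hexagonal lattice.  The edges of one of the three directions of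
this lattice are contracted to the points `x` of the square lattice; `E x false` and `E x true` are
the ends of such an edge, from which the edges in the directions `± A`, `± B` leave. -/
structure HexCover {V : Type*} (H : SimpleGraph V) (A B : Bool → ℤ × ℤ) (E : ℤ × ℤ → Bool → V) :
    Prop where
  surj : ∀ v, ∃ x c, E x c = v
  adj : ∀ x c w, H.Adj (E x c) w ↔
    w = E (x + A c) (!c) ∨ w = E (x + B c) (!c) ∨ w = E x (!c)
  negA : ∀ c, A (!c) = -A c
  negB : ∀ c, B (!c) = -B c
  inv_z : ∀ x c y d, E x c = E y d → E x (!c) = E y (!d)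
  inv_row : ∀ x c y d, E x c = E y d →
    (E (x + A c) (!c) = E (y + A d) (!d) ∧ E (x + B c) (!c) = E (y + B d) (!d)) ∨
    (E (x + A c) (!c) = E (y + B d) (!d) ∧ E (x + B c) (!c) = E (y + A d) (!d))
  neA : ∀ x c d, E (x + A c) d ≠ E x d
  neB : ∀ x c d, E (x + B c) d ≠ E x d
  neAB : ∀ x c d d', E (x + A c) d ≠ E (x + B c) d'
  neAB2 : ∀ x c d, E (x + A c + A c) d ≠ E (x + B c + B c) d

namespace HexCover

variable {V W : Type*} {H : SimpleGraph V} {A B : Bool → ℤ × ℤ} {E : ℤ × ℤ → Bool → V}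
  (S : HexCover H A B E)

include S in
theorem exists_section : ∃ f : V → (ℤ × ℤ) × Bool, ∀ v, E (f v).1 (f v).2 = v := by
  choose f g h using S.surj
  exact ⟨fun v => (f v, g v), h⟩

include S in
theorem addA (x : ℤ × ℤ) (c : Bool) : x + A c + A (!c) = x := by
  rw [S.negA, add_neg_cancel_right]

include S in
theorem addB (x : ℤ × ℤ) (c : Bool) : x + B c + B (!c) = x := by
  rw [S.negB, add_neg_cancel_right]

/-- Each vertex gets coordinates by choosing a lattice point above it. Covering transformations may
exchange the directions `A` and `B`, so left and right depend on this choice; by `inv_row` the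
unordered pair of row neighbours does not, and no axiom of `Brick` asks for more. -/
noncomputable def brick : Brick H :=
  let f := S.exists_section.choose
  have hf : ∀ v, E (f v).1 (f v).2 = v := S.exists_section.choose_spec
  have hz : ∀ x c, E (f (E x c)).1 (!(f (E x c)).2) = E x (!c) := fun x c =>
    S.inv_z _ _ _ _ (hf _)
  have hrow := fun x c => S.inv_row _ _ _ _ (hf (E x c))
  { l := fun v => E ((f v).1 + A (f v).2) (!(f v).2)
    r := fun v => E ((f v).1 + B (f v).2) (!(f v).2)
    z := fun v => E (f v).1 (!(f v).2)
    t := fun v => E ((f v).1 + A (f v).2 + B (f v).2) (!(f v).2)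
    adj := by
      intro u v
      rw [← S.adj, hf]
    lr := fun v => S.neAB _ _ _ _
    lz := fun v => (S.neA _ _ _).symm
    rz := fun v => (S.neB _ _ _).symm
    row_l := by
      intro v
      rcases hrow ((f v).1 + A (f v).2) (!(f v).2) with ⟨h, -⟩ | ⟨-, h⟩
      · refine Or.inl ?_
        rw [h, S.addA, Bool.not_not, hf]
      · refine Or.inr ?_
        rw [h, S.addA, Bool.not_not, hf]
    row_r := by
      intro v
      rcases hrow ((f v).1 + B (f v).2) (!(f v).2) with ⟨-, h⟩ | ⟨h, -⟩
      · refine Or.inr ?_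
        rw [h, S.addB, Bool.not_not, hf]
      · refine Or.inl ?_
        rw [h, S.addB, Bool.not_not, hf]
    zz := by
      intro v
      rw [hz, Bool.not_not, hf]
    zl := by
      intro v
      rw [hz, Bool.not_not]
      rcases hrow ((f v).1 + A (f v).2 + B (f v).2) (!(f v).2) with ⟨-, h⟩ | ⟨h, -⟩
      · refine Or.inr ?_
        rw [h, S.addB, Bool.not_not]
      · refine Or.inl ?_
        rw [h, S.addB, Bool.not_not]
    zr := by
      intro v
      rw [hz, Bool.not_not]
      rcases hrow ((f v).1 + A (f v).2 + B (f v).2) (!(f v).2) with ⟨h, -⟩ | ⟨-, h⟩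
      · refine Or.inl ?_
        rw [h, add_right_comm, S.addA, Bool.not_not]
      · refine Or.inr ?_
        rw [h, add_right_comm, S.addA, Bool.not_not]
    tri := by
      intro v
      rw [hz]
      exact S.neAB _ _ _ _
    row_inj := by
      -- Going back from the first common row neighbour, `E x c` is either `E y d` or the vertex two
      -- steps further along the row. In the second case, comparing the other neighbours would close
      -- the row after four steps, which `neAB2` excludes, or make the row turn back, which `neAB`
      -- excludes. The exchanged directions are treated at the same time.
      have key : ∀ (A B : Bool → ℤ × ℤ) (S : HexCover H A B E) (A' B' : Bool → ℤ × ℤ) (x y : ℤ × ℤ)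
          (c d : Bool) , (A' = A ∧ B' = B ∨ A' = B ∧ B' = A) →
          E (x + A' c) (!c) = E (y + A d) (!d) → E (x + B' c) (!c) = E (y + B d) (!d) →
          E x c = E y d := by
        intro A B S A' B' x y c d hAB h1 h2
        have h3 := S.inv_row _ _ _ _ h1
        have h4 : E x c = E y d ∨ E x c = E (y + A d + B (!d)) d := by
          rw [S.addA, Bool.not_not, Bool.not_not] at h3
          rcases hAB with ⟨rfl, rfl⟩ | ⟨rfl, rfl⟩
          · rw [S.addA] at h3
            rcases h3 with h3 | h3
            · exact Or.inl h3.1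
            · exact Or.inr h3.1
          · rw [S.addB] at h3
            rcases h3 with h3 | h3
            · exact Or.inr h3.2
            · exact Or.inl h3.2
        refine h4.resolve_right fun h4 => ?_
        have h5 := S.inv_row _ _ _ _ h4
        have h6 : y + A d + B (!d) + B d = y + A d := by
          rw [S.negB]; abel
        have h7 : E (y + B d) (!d) = E (y + A d + B (!d) + A d) (!d) ∨
            E (y + A d) (!d) = E (y + A d + B (!d) + A d) (!d) := by
          rw [h6] at h5
          rcases hAB with ⟨rfl, rfl⟩ | ⟨rfl, rfl⟩ <;> rw [h1, h2] at h5 <;> rcases h5 with h5 | h5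
          · exact Or.inr h5.1
          · exact Or.inl h5.2
          · exact Or.inl h5.1
          · exact Or.inr h5.2
        rcases h7 with h7 | h7
        · refine S.neAB2 (y + B (!d)) d (!d) ?_
          rw [add_right_comm _ (B (!d)), add_right_comm y, S.negB] at *
          convert h7.symm using 2 <;> abel
        · refine S.neAB (y + A d + B (!d)) d (!d) (!d) ?_
          rw [h6, h7]
      intro u v h
      rw [← hf u, ← hf v]
      rcases h with ⟨h1, h2⟩ | ⟨h1, h2⟩
      · exact key A B S A B _ _ _ _ (Or.inl ⟨rfl, rfl⟩) h1 h2
      · exact key A B S B A _ _ _ _ (Or.inr ⟨rfl, rfl⟩) h2 h1 }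

theorem brick_z (x : ℤ × ℤ) (c : Bool) : S.brick.z (E x c) = E x (!c) :=
  S.inv_z _ _ _ _ (S.exists_section.choose_spec _)

theorem brick_row (x : ℤ × ℤ) (c : Bool) (w : V) : S.brick.Row (E x c) w ↔
    w = E (x + A c) (!c) ∨ w = E (x + B c) (!c) := by
  have h := S.inv_row _ _ _ _ (S.exists_section.choose_spec (E x c))
  rcases h with ⟨h1, h2⟩ | ⟨h1, h2⟩ <;> rw [← h1, ← h2]
  · exact Iff.rfl
  · exact or_comm

theorem pairs_z : Brick.pairs S.brick.z = {e | ∃ x c, e = s(E x c, E x (!c))} := by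
  ext e
  constructor
  · rintro ⟨v, rfl⟩
    obtain ⟨x, c, rfl⟩ := S.surj v
    exact ⟨x, c, by rw [S.brick_z]⟩
  · rintro ⟨x, c, rfl⟩
    exact ⟨E x c, by rw [S.brick_z]⟩

include S in
-- The displacement `D` defines the map `E x c ↦ E (x + D c) (!c)`. By `hinv` and `hinv'` this map
-- and its inverse are compatible with the covering, and `hD` says that it carries opposite centres
-- of a hexagon to the two ends of a contracted edge. It therefore identifies the dual with the
-- contraction, as `Brick.yields_z` requires.
theorem yields {G : SimpleGraph W} {π : ℤ × ℤ → W} (hπ : GridCover G π) (φ : V → W)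
    (hφ : ∀ x c, φ (E x c) = π x)
    (hfib : ∀ x y c, π x = π y → E y c = E x c ∨ E y c = E x (!c))
    (hstep : ∀ i, ∃ c, A c = unitStep i ∨ B c = unitStep i)
    (hstep' : ∀ c, (∃ i, A c = unitStep i) ∧ ∃ i, B c = unitStep i)
    (hne : ∀ x c, π (x + A c) ≠ π (x + B c) ∧ π (x + A c) ≠ π (x + A (!c)) ∧
      π (x + A c) ≠ π (x + B (!c)) ∧ π (x + B c) ≠ π (x + B (!c)))
    (D : Bool → ℤ × ℤ) (hD : D true - D false = -(A false + B false))
    (hinv : ∀ x c y d, E x c = E y d → E (x + D c) (!c) = E (y + D d) (!d))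
    (hinv' : ∀ x c y d, E x c = E y d → E (x - D (!c)) (!c) = E (y - D (!d)) (!d)) :
    Yields H {e | ∃ x c, e = s(E x c, E x (!c))} G G := by
  have : Nonempty V := ⟨E 0 false⟩
  rw [← S.pairs_z]
  have hadj : ∀ x i, G.Adj (π x) (π (x + unitStep i)) := fun x i => (hπ.adj _ _).2 ⟨i, rfl⟩
  have hrow : ∀ u v, S.brick.Row u v → G.Adj (φ u) (φ v) := by
    intro u v h
    obtain ⟨x, c, rfl⟩ := S.surj u
    obtain ⟨⟨i, hi⟩, j, hj⟩ := hstep' c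
    rcases (S.brick_row _ _ _).1 h with rfl | rfl <;> rw [hφ, hφ]
    · rw [hi]; exact hadj _ _
    · rw [hj]; exact hadj _ _
  obtain ⟨f, hf⟩ := S.exists_section
  set n : V → V := fun v => E ((f v).1 + D (f v).2) (!(f v).2) with hn
  have hnE : ∀ x c, n (E x c) = E (x + D c) (!c) := fun x c => hinv _ _ _ _ (hf _)
  -- The condition passes to the other end because `A`, `B` and the left side all change sign with
  -- `c`.
  have hDD : ∀ c, D (!c) - D c = -(A c + B c) := by
    intro c
    cases c
    · exact hD
    · have h1 := S.negA false
      have h2 := S.negB false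
      simp only [Bool.not_false] at h1 h2
      rw [h1, h2, Bool.not_true, ← neg_sub, hD]
      abel
  refine S.brick.yields_z φ ?_ ?_ (S.brick.realizes_rows S.brick.z φ ?_ ?_ ?_ ?_ ?_ ?_ ?_) n ?_ ?_ ?_
  · intro v
    obtain ⟨x, c, rfl⟩ := S.surj v
    rw [S.brick_z, hφ, hφ]
  · intro u v h
    obtain ⟨x, c, rfl⟩ := S.surj u
    obtain ⟨y, d, rfl⟩ := S.surj v
    rw [hφ, hφ] at h
    rw [S.brick_z]
    rcases Bool.eq_or_eq_not d c with rfl | rfl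
    · exact hfib x y d h
    · have := hfib x y (!c) h
      rw [Bool.not_not] at this
      exact this.symm
  · intro w
    obtain ⟨x, rfl⟩ := hπ.surj w
    exact ⟨_, hφ x false⟩
  · intro u v h
    obtain ⟨x, c, rfl⟩ := S.surj u
    obtain ⟨y, d, rfl⟩ := S.surj v
    rw [hφ, hφ] at h
    rw [S.brick_z]
    rcases Bool.eq_or_eq_not d c with rfl | rfl
    · exact hfib x y d h
    · have := hfib x y (!c) h
      rw [Bool.not_not] at this
      exact this.symm
  · exact fun v => hrow _ _ (S.brick.row_left v)
  · exact fun v => hrow _ _ (S.brick.row_right v)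
  · intro p q h
    obtain ⟨x, rfl⟩ := hπ.surj p
    obtain ⟨i, rfl⟩ := (hπ.adj _ _).1 h
    obtain ⟨c, hc⟩ := hstep i
    refine ⟨E x c, E (x + unitStep i) (!c), ?_, Or.inl ⟨hφ _ _, hφ _ _⟩⟩
    rw [S.brick_row]
    rcases hc with hc | hc <;> rw [← hc]
    · exact Or.inl rfl
    · exact Or.inr rfl
  · intro v h
    obtain ⟨x, c, rfl⟩ := S.surj v
    rcases (S.brick_row _ _ _).1 (S.brick.row_left (E x c)) with h1 | h1 <;>
      rcases (S.brick_row _ _ _).1 (S.brick.row_right (E x c)) with h2 | h2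
    · exact S.brick.lr _ (h1.trans h2.symm)
    · rw [h1, h2, hφ, hφ] at h
      exact (hne x c).1 h
    · rw [h1, h2, hφ, hφ] at h
      exact (hne x c).1 h.symm
    · exact S.brick.lr _ (h1.trans h2.symm)
  · intro u v w h1 h2 h
    obtain ⟨x, c, rfl⟩ := S.surj u
    rw [S.brick_z] at h2
    have h3 := (hne x (!c)).2.2.1
    rw [Bool.not_not] at h3
    rcases (S.brick_row _ _ _).1 h1 with rfl | rfl <;>
      rcases (S.brick_row _ _ _).1 h2 with rfl | rfl <;> rw [hφ, hφ] at h
    · exact (hne x c).2.1 h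
    · exact (hne x c).2.2.1 h
    · exact h3 h.symm
    · exact (hne x c).2.2.2 h
  · have h1 : ∀ x c y d, E (x + D c) (!c) = E (y + D d) (!d) → E x c = E y d := by
      intro x c y d h
      have := hinv' _ _ _ _ h
      rwa [Bool.not_not, Bool.not_not, add_sub_cancel_right, add_sub_cancel_right] at this
    refine ⟨fun u v h => ?_, fun v => ?_⟩
    · obtain ⟨x, c, rfl⟩ := S.surj u
      obtain ⟨y, d, rfl⟩ := S.surj v
      rw [hnE, hnE] at h
      exact h1 _ _ _ _ h
    · obtain ⟨x, c, rfl⟩ := S.surj v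
      exact ⟨E (x - D (!c)) (!c), by rw [hnE, sub_add_cancel, Bool.not_not]⟩
  · intro u v h
    obtain ⟨x, c, rfl⟩ := S.surj u
    rcases (S.brick_row _ _ _).1 h with rfl | rfl <;> rw [hnE, hnE, S.brick_row, Bool.not_not]
    · refine Or.inr ?_
      congr 1
      rw [S.negB, add_assoc, add_assoc, add_right_inj, ← sub_eq_iff_eq_add', add_sub_assoc, hDD]
      abel
    · refine Or.inl ?_
      congr 1
      rw [S.negA, add_assoc, add_assoc, add_right_inj, ← sub_eq_iff_eq_add', add_sub_assoc, hDD]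
      abel
  · intro v
    change n (E ((S.exists_section.choose v).1 + A (S.exists_section.choose v).2 +
      B (S.exists_section.choose v).2) (!(S.exists_section.choose v).2)) = _
    conv_rhs => rw [← S.exists_section.choose_spec v]
    rw [hnE, hnE, S.brick_z, Bool.not_not]
    congr 1
    rw [add_assoc, add_assoc, add_right_inj, eq_add_of_sub_eq (hDD _)]
    abel

end HexCover

end HexTiling

namespace HexTiling

/-! ### The universal cover of `S_{p,q}` -/

/-- The translations (`false`) and the glide reflections (`true`) that generate, as covering
transformations, the universal cover of `S_{p,q}`. -/
def SRel (p q : ℤ) : Bool → ℤ × ℤ → ℤ × ℤ → Prop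
  | false, x, y => ∃ m n, y.1 = x.1 + (p * m - q * n) ∧ y.2 = x.2 + (-(p * m) - q * n)
  | true, x, y => ∃ m n, y.1 = x.2 + (p * m - q * n - q) ∧ y.2 = x.1 + (-(p * m) - q * n)

namespace SRel

variable {p q : ℤ} {s t : Bool} {x y z : ℤ × ℤ}

theorem refl (x : ℤ × ℤ) : SRel p q false x x := ⟨0, 0, by simp⟩

theorem symm (h : SRel p q s x y) : SRel p q s y x := by
  cases s
  · obtain ⟨m, n, h1, h2⟩ := h
    exact ⟨-m, -n, by linear_combination -h1, by linear_combination -h2⟩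
  · obtain ⟨m, n, h1, h2⟩ := h
    exact ⟨m, -n - 1, by linear_combination -h2, by linear_combination -h1⟩

theorem trans (h : SRel p q s x y) (h' : SRel p q t y z) : SRel p q (xor s t) x z := by
  cases s <;> cases t <;> obtain ⟨m, n, h1, h2⟩ := h <;> obtain ⟨m', n', h1', h2'⟩ := h'
  · exact ⟨m + m', n + n', by linear_combination h1 + h1', by linear_combination h2 + h2'⟩
  · exact ⟨m' - m, n + n', by linear_combination h2 + h1', by linear_combination h1 + h2'⟩
  · exact ⟨m + m', n + n', by linear_combination h1 + h1', by linear_combination h2 + h2'⟩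
  · exact ⟨m' - m, n + n' + 1, by linear_combination h2 + h1', by linear_combination h1 + h2'⟩

/-- The action of the covering transformations on displacements. -/
def turn : Bool → ℤ × ℤ → ℤ × ℤ
  | false, d => d
  | true, d => d.swap

theorem add (h : SRel p q s x y) (d : ℤ × ℤ) : SRel p q s (x + d) (y + turn s d) := by
  cases s <;> obtain ⟨m, n, h1, h2⟩ := h
  · exact ⟨m, n, by simp only [turn, Prod.fst_add]; linear_combination h1,
      by simp only [turn, Prod.snd_add]; linear_combination h2⟩
  · exact ⟨m, n, by simp only [turn, Prod.fst_add, Prod.snd_add, Prod.fst_swap]; linear_combination h1,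
      by simp only [turn, Prod.fst_add, Prod.snd_add, Prod.snd_swap]; linear_combination h2⟩

theorem mul_pos_of_pos {p m : ℤ} (hp : 0 < p) (h : 0 < p * m) : p ≤ p * m := by
  have : 0 < m := pos_of_mul_pos_right h hp.le
  nlinarith

/-- The `p × q` box is a fundamental domain. -/
theorem eq_of_mem_box (hx : 0 ≤ x.1 ∧ x.1 < p ∧ 0 ≤ x.2 ∧ x.2 < q)
    (hy : 0 ≤ y.1 ∧ y.1 < p ∧ 0 ≤ y.2 ∧ y.2 < q) (h : SRel p q s x y) : s = false ∧ x = y := by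
  obtain ⟨a1, a2, a3, a4⟩ := hx
  obtain ⟨b1, b2, b3, b4⟩ := hy
  have hp : 0 < p := by omega
  have hq : 0 < q := by omega
  cases s <;> obtain ⟨m, n, h1, h2⟩ := h
  · refine ⟨rfl, ?_⟩
    have key : p * m = 0 ∧ q * n = 0 := by
      rcases lt_trichotomy (p * m) 0 with hm | hm | hm
      · have := mul_pos_of_pos (m := -m) hp (by linarith)
        rw [mul_neg] at this
        rcases lt_trichotomy (q * n) 0 with hn | hn | hn
        · have := mul_pos_of_pos (m := -n) hq (by linarith)
          rw [mul_neg] at this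
          omega
        · omega
        · have := mul_pos_of_pos hq hn
          omega
      · refine ⟨hm, ?_⟩
        rcases lt_trichotomy (q * n) 0 with hn | hn | hn
        · have := mul_pos_of_pos (m := -n) hq (by linarith)
          rw [mul_neg] at this
          omega
        · exact hn
        · have := mul_pos_of_pos hq hn
          omega
      · have := mul_pos_of_pos hp hm
        rcases lt_trichotomy (q * n) 0 with hn | hn | hn
        · have := mul_pos_of_pos (m := -n) hq (by linarith)
          rw [mul_neg] at this
          omega
        · omega
        · have := mul_pos_of_pos hq hn
          omega
    rw [key.1, key.2] at h1 h2
    exact Prod.ext (by omega) (by omega)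
  · exfalso
    rcases le_or_gt 0 (q * n) with hn | hn
    · have := mul_pos_of_pos (m := m) hp (by omega)
      omega
    · have h3 := mul_pos_of_pos (m := -n) hq (by linarith)
      rw [mul_neg] at h3
      have := mul_pos_of_pos (m := m) hp (by omega)
      omega

/-- In terms of sum and difference of the coordinates, a translation adds multiples of `2 * q` to
the sum and of `2 * p` to the difference, and a glide reflection adds an odd multiple of `q` to the
sum. -/
theorem eq_zero_or_le {d : ℤ × ℤ} (hp : 0 < p) (hq : 0 < q) (h : SRel p q s x (x + d)) :
    d = 0 ∨ q ≤ |d.1 + d.2| ∨ 2 * p ≤ |d.1 - d.2| := by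
  have key : ∀ {p m : ℤ}, 0 < p → m ≠ 0 → p ≤ |p * m| := by
    intro p m hp hm
    rw [abs_mul, abs_of_pos hp]
    have := Int.one_le_abs hm
    nlinarith
  cases s <;> obtain ⟨m, n, h1, h2⟩ := h <;> simp only [Prod.fst_add, Prod.snd_add] at h1 h2
  · by_cases hn : n = 0
    · by_cases hm : m = 0
      · subst hn hm
        refine Or.inl (Prod.ext ?_ ?_)
        · change d.1 = 0
          linarith
        · change d.2 = 0
          linarith
      · refine Or.inr (Or.inr ?_)
        have := key (by omega : 0 < 2 * p) hm
        rwa [show d.1 - d.2 = 2 * p * m by linear_combination h1 - h2]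
    · refine Or.inr (Or.inl ?_)
      have := key (by omega : 0 < 2 * q) hn
      rw [show d.1 + d.2 = -(2 * q * n) by linear_combination h1 + h2, abs_neg]
      omega
  · refine Or.inr (Or.inl ?_)
    have := key hq (by omega : 2 * n + 1 ≠ 0)
    rwa [show d.1 + d.2 = -(q * (2 * n + 1)) by linear_combination h1 + h2, abs_neg]

end SRel

end HexTiling

/-! ### The closed brick wall whose contraction is `S_{p,q}` -/

namespace HexTiling

/-- The edges that close the `p × 2q` brick wall, if `p ≤ q`. -/
def hexSE₁ (p q : ℕ) (u v : ℕ × ℕ) : Prop :=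
  (u.2 = 0 ∧ v.1 = p - 1 ∧ v.2 = 2 * (q - p + u.1)) ∨
  (∃ i, i < p ∧ u.1 = 0 ∧ u.2 = 2 * i + 1 ∧ v.1 = i ∧ v.2 = 2 * q - 1) ∨
  (∃ i, p ≤ i ∧ u.1 = 0 ∧ u.2 = 2 * i + 1 ∧ v.1 = p - 1 ∧ v.2 = 2 * (i - p))

/-- The edges that close the `p × 2q` brick wall, if `q < p`. -/
def hexSE₂ (p q : ℕ) (u v : ℕ × ℕ) : Prop :=
  (u.1 < q ∧ u.2 = 0 ∧ v.1 = 0 ∧ v.2 = 2 * (q - 1 - u.1) + 1) ∨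
  (∃ i, i < q ∧ u.1 = p - 1 - i ∧ u.2 = 2 * q - 1 ∧ v.1 = p - 1 ∧ v.2 = 2 * i) ∨
  (u.1 + q < p ∧ u.2 = 2 * q - 1 ∧ v.1 = u.1 + q ∧ v.2 = 0)

/-- The edges of the brick wall and those that close it. -/
def hexSE (p q : ℕ) (u v : ℕ × ℕ) : Prop :=
  (v.1 = u.1 ∧ v.2 = u.2 + 1) ∨ (v.1 = u.1 + 1 ∧ v.2 = u.2 + 1 ∧ u.2 % 2 = 0) ∨
  (p ≤ q ∧ hexSE₁ p q u v) ∨ (q < p ∧ hexSE₂ p q u v)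

/-- The hexagonal tiling of the Klein bottle that is obtained from `S_{p,q}` by expanding each
vertex `(i, j)` to an edge `{(i, 2j), (i, 2j + 1)}`. -/
def hexS (p q : ℕ) : SimpleGraph (gridV p (2 * q)) := graphOn (gridV p (2 * q)) (hexSE p q)

namespace HexS

variable {p q : ℕ}

/-- The point of the lattice that represents a vertex of the grid. -/
def pos (p q : ℕ) (w : ℕ × ℕ) : ℤ × ℤ :=
  (w.1, if q < p then (q : ℤ) - 1 - w.2 else w.2)

def loc (p q : ℕ) (u : ℕ × ℕ) : ℤ × ℤ := pos p q (u.1, u.2 / 2)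

def stepA (c : Bool) : ℤ × ℤ := (if c then -1 else 1, 0)

/-- For `q < p` the second coordinate of `pos` is reversed, and with it the direction `B`. -/
def stepB (p q : ℕ) (c : Bool) : ℤ × ℤ := (0, if c = decide (q < p) then -1 else 1)

/-- The action of a covering transformation on the ends of the edges `{(i, 2j), (i, 2j + 1)}`. -/
def turnEnd (p q : ℕ) (s c : Bool) : Bool := if q < p then c else xor s c

/-- The point `x` of the lattice, with end `c`, represents the vertex `u`. -/
def Rep (p q : ℕ) (u : ℕ × ℕ) (x : ℤ × ℤ) (c : Bool) : Prop :=
  ∃ s, SRel p q s (loc p q u) x ∧ c = turnEnd p q s (u.2 % 2 = 1)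

theorem stepA_not (c : Bool) : stepA (!c) = -stepA c := by cases c <;> rfl

theorem stepB_not (c : Bool) : stepB p q (!c) = -stepB p q c := by
  unfold stepB
  cases c <;> cases decide (q < p) <;> rfl

theorem Rep.not {u v : ℕ × ℕ} {x : ℤ × ℤ} {c : Bool} (h : Rep p q u x c) (h1 : v.1 = u.1)
    (h2 : v.2 / 2 = u.2 / 2) (h3 : v.2 ≠ u.2) : Rep p q v x (!c) := by
  obtain ⟨s, hs, rfl⟩ := h
  refine ⟨s, ?_, ?_⟩
  · rwa [loc, h1, h2]
  · have : decide (v.2 % 2 = 1) = !decide (u.2 % 2 = 1) := by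
      rw [← decide_not, decide_eq_decide]
      omega
    rw [this]
    unfold turnEnd
    split_ifs <;> simp

/-- A glide reflection exchanges the coordinate axes and hence `A` and `B`. For `p ≤ q` the
directions at the end `false` are `(1, 0)` and `(0, -1)`, which turn into those at the end `true`;
so the ends are exchanged too. For `q < p` they are `(1, 0)` and `(0, 1)`, and the ends are kept. -/
theorem turn_step (s c : Bool) :
    (SRel.turn s (stepA c) = stepA (turnEnd p q s c) ∧
      SRel.turn s (stepB p q c) = stepB p q (turnEnd p q s c)) ∨
    (SRel.turn s (stepA c) = stepB p q (turnEnd p q s c) ∧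
      SRel.turn s (stepB p q c) = stepA (turnEnd p q s c)) := by
  by_cases h : q < p <;> cases s <;> cases c <;>
    simp [SRel.turn, stepA, stepB, turnEnd, h]

/-- In this and the next three lemmas the integers `m` and `n` name the covering transformation that
takes the position of `u` in the box to `x`. -/
theorem rep_le_false (hpq : p ≤ q) {u : ℕ × ℕ} {x : ℤ × ℤ} {c : Bool} (m n : ℤ)
    (h1 : x.1 = u.1 + (p * m - q * n)) (h2 : x.2 = (u.2 / 2 : ℕ) + (-(p * m) - q * n))
    (hc : u.2 % 2 = c.toNat) : Rep p q u x c := by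
  refine ⟨false, ⟨m, n, h1, ?_⟩, ?_⟩
  · rw [h2]
    simp [loc, pos, hpq.not_gt]
  · cases c <;> simp [turnEnd] <;> simpa using hc

theorem rep_le_true (hpq : p ≤ q) {u : ℕ × ℕ} {x : ℤ × ℤ} {c : Bool} (m n : ℤ)
    (h1 : x.1 = (u.2 / 2 : ℕ) + (p * m - q * n - q)) (h2 : x.2 = u.1 + (-(p * m) - q * n))
    (hc : u.2 % 2 = (!c).toNat) : Rep p q u x c := by
  refine ⟨true, ⟨m, n, ?_, h2⟩, ?_⟩
  · rw [h1]
    simp [loc, pos, hpq.not_gt]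
  · cases c <;> simp [turnEnd, hpq.not_gt] <;> simpa using hc

theorem rep_lt_false (hpq : q < p) {u : ℕ × ℕ} {x : ℤ × ℤ} {c : Bool} (m n : ℤ)
    (h1 : x.1 = u.1 + (p * m - q * n)) (h2 : x.2 = q - 1 - (u.2 / 2 : ℕ) + (-(p * m) - q * n))
    (hc : u.2 % 2 = c.toNat) : Rep p q u x c := by
  refine ⟨false, ⟨m, n, h1, ?_⟩, ?_⟩
  · rw [h2]
    simp [loc, pos, hpq]
  · cases c <;> simp [turnEnd] <;> simpa using hc

theorem rep_lt_true (hpq : q < p) {u : ℕ × ℕ} {x : ℤ × ℤ} {c : Bool} (m n : ℤ)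
    (h1 : x.1 = q - 1 - (u.2 / 2 : ℕ) + (p * m - q * n - q)) (h2 : x.2 = u.1 + (-(p * m) - q * n))
    (hc : u.2 % 2 = c.toNat) : Rep p q u x c := by
  refine ⟨true, ⟨m, n, ?_, h2⟩, ?_⟩
  · rw [h1]
    simp [loc, pos, hpq]
  · cases c <;> simp [turnEnd, hpq] <;> simpa using hc

theorem end_even (b : ℕ) : decide ((2 * b) % 2 = 1) = false := by simp

theorem end_odd (b : ℕ) : decide ((2 * b + 1) % 2 = 1) = true := by
  simp [Nat.add_mod]

theorem loc_of_le (hpq : p ≤ q) (u : ℕ × ℕ) : loc p q u = ((u.1 : ℤ), ((u.2 / 2 : ℕ) : ℤ)) := by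
  simp [loc, pos, hpq.not_gt]

theorem loc_of_lt (hpq : q < p) (u : ℕ × ℕ) :
    loc p q u = ((u.1 : ℤ), (q : ℤ) - 1 - ((u.2 / 2 : ℕ) : ℤ)) := by
  simp [loc, pos, hpq]

theorem stepB_of_le (hpq : p ≤ q) (c : Bool) : stepB p q c = (0, if c then 1 else -1) := by
  cases c <;> simp [stepB, hpq.not_gt]

theorem stepB_of_lt (hpq : q < p) (c : Bool) : stepB p q c = (0, if c then -1 else 1) := by
  cases c <;> simp [stepB, hpq]

/-- The vertices that an edge of the tiling joins. -/
def Link (p q : ℕ) (u v : ℕ × ℕ) : Prop := hexSE p q u v ∨ hexSE p q v u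

/-- From every vertex an edge leaves in direction `A`. -/
theorem exists_stepA_of_le (hpq : p ≤ q) (u : gridV p (2 * q)) : ∃ v ∈ gridV p (2 * q),
    Link p q u.1 v ∧
    Rep p q v (loc p q u.1 + stepA (u.1.2 % 2 = 1)) (!(u.1.2 % 2 = 1 : Bool)) := by
  obtain ⟨⟨a, d⟩, hu⟩ := u
  have h1 : a < p := hu.1
  have h2 : d < 2 * q := hu.2
  rw [loc_of_le hpq]
  rcases Nat.even_or_odd' d with ⟨b, rfl | rfl⟩
  · simp only [end_even, stepA, Bool.not_false]
    by_cases h3 : a + 1 < p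
    · refine ⟨(a + 1, 2 * b + 1), ⟨h3, by dsimp only; omega⟩,
        Or.inl (Or.inr (Or.inl ⟨rfl, rfl, by omega⟩)), rep_le_false hpq 0 0 ?_ ?_ ?_⟩ <;> simp <;> omega
    -- Leaving the last row, the columns from `q - p` on use closing edges of the first kind, which
    -- are glide reflections; the smaller columns use those of the third kind, the translation by
    -- `(p, -p)`.
    · by_cases h4 : q - p ≤ b
      · refine ⟨(b - (q - p), 0), ⟨by dsimp only; omega, by dsimp only; omega⟩,
          Or.inr (Or.inr (Or.inr (Or.inl ⟨hpq, Or.inl ⟨rfl, ?_, ?_⟩⟩))),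
          rep_le_true hpq 1 (-1) ?_ ?_ ?_⟩ <;> simp <;> omega
      · refine ⟨(0, 2 * (b + p) + 1), ⟨by dsimp only; omega, by dsimp only; omega⟩,
          Or.inr (Or.inr (Or.inr (Or.inl ⟨hpq, Or.inr (Or.inr ⟨b + p, ?_⟩)⟩))),
          rep_le_false hpq 1 0 ?_ ?_ ?_⟩ <;> simp <;> omega
  · simp only [end_odd, stepA, Bool.not_true]
    by_cases h3 : 0 < a
    · refine ⟨(a - 1, 2 * b), ⟨by dsimp only; omega, by dsimp only; omega⟩,
        Or.inr (Or.inr (Or.inl ⟨?_, ?_, ?_⟩)), rep_le_false hpq 0 0 ?_ ?_ ?_⟩ <;> simp <;> omega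
    · by_cases h4 : b < p
      · refine ⟨(b, 2 * q - 1), ⟨by dsimp only; omega, by dsimp only; omega⟩,
          Or.inl (Or.inr (Or.inr (Or.inl ⟨hpq, Or.inr (Or.inl ⟨b, ?_⟩)⟩))),
          rep_le_true hpq 0 0 ?_ ?_ ?_⟩ <;> simp <;> omega
      · refine ⟨(p - 1, 2 * (b - p)), ⟨by dsimp only; omega, by dsimp only; omega⟩,
          Or.inl (Or.inr (Or.inr (Or.inl ⟨hpq, Or.inr (Or.inr ⟨b, ?_⟩)⟩))),
          rep_le_false hpq (-1) 0 ?_ ?_ ?_⟩ <;> simp <;> omega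

theorem exists_stepA_of_lt (hpq : q < p) (u : gridV p (2 * q)) : ∃ v ∈ gridV p (2 * q),
    Link p q u.1 v ∧
    Rep p q v (loc p q u.1 + stepA (u.1.2 % 2 = 1)) (!(u.1.2 % 2 = 1 : Bool)) := by
  obtain ⟨⟨a, d⟩, hu⟩ := u
  have h1 : a < p := hu.1
  have h2 : d < 2 * q := hu.2
  rw [loc_of_lt hpq]
  rcases Nat.even_or_odd' d with ⟨b, rfl | rfl⟩
  · simp only [end_even, stepA, Bool.not_false]
    by_cases h3 : a + 1 < p
    · refine ⟨(a + 1, 2 * b + 1), ⟨h3, by dsimp only; omega⟩,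
        Or.inl (Or.inr (Or.inl ⟨rfl, rfl, by omega⟩)), rep_lt_false hpq 0 0 ?_ ?_ ?_⟩ <;> simp <;> omega
    · refine ⟨(p - 1 - b, 2 * q - 1), ⟨by dsimp only; omega, by dsimp only; omega⟩,
          Or.inr (Or.inr (Or.inr (Or.inr ⟨hpq, Or.inr (Or.inl ⟨b, ?_⟩)⟩))),
          rep_lt_true hpq 1 (-1) ?_ ?_ ?_⟩ <;> simp <;> omega
  · simp only [end_odd, stepA, Bool.not_true]
    by_cases h3 : 0 < a
    · refine ⟨(a - 1, 2 * b), ⟨by dsimp only; omega, by dsimp only; omega⟩,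
        Or.inr (Or.inr (Or.inl ⟨?_, ?_, ?_⟩)), rep_lt_false hpq 0 0 ?_ ?_ ?_⟩ <;> simp <;> omega
    · refine ⟨(q - 1 - b, 0), ⟨by dsimp only; omega, by dsimp only; omega⟩,
          Or.inr (Or.inr (Or.inr (Or.inr ⟨hpq, Or.inl ⟨?_, ?_, ?_, ?_⟩⟩))),
          rep_lt_true hpq 0 0 ?_ ?_ ?_⟩ <;> simp <;> omega

theorem exists_stepB_of_le (hpq : p ≤ q) (u : gridV p (2 * q)) : ∃ v ∈ gridV p (2 * q),
    Link p q u.1 v ∧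
    Rep p q v (loc p q u.1 + stepB p q (u.1.2 % 2 = 1)) (!(u.1.2 % 2 = 1 : Bool)) := by
  obtain ⟨⟨a, d⟩, hu⟩ := u
  have h1 : a < p := hu.1
  have h2 : d < 2 * q := hu.2
  rw [loc_of_le hpq]
  rcases Nat.even_or_odd' d with ⟨b, rfl | rfl⟩
  · simp only [end_even, stepB_of_le hpq, Bool.not_false]
    by_cases h3 : 0 < b
    · refine ⟨(a, 2 * b - 1), ⟨h1, by dsimp only; omega⟩,
        Or.inr (Or.inl ⟨rfl, ?_⟩), rep_le_false hpq 0 0 ?_ ?_ ?_⟩ <;> simp <;> omega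
    · refine ⟨(p - 1, 2 * (q - p + a)), ⟨by dsimp only; omega, by dsimp only; omega⟩,
          Or.inl (Or.inr (Or.inr (Or.inl ⟨hpq, Or.inl ⟨?_, ?_, ?_⟩⟩))),
          rep_le_true hpq 1 0 ?_ ?_ ?_⟩ <;> simp <;> omega
  · simp only [end_odd, stepB_of_le hpq, Bool.not_true]
    by_cases h3 : b + 1 < q
    · refine ⟨(a, 2 * b + 2), ⟨by dsimp only; omega, by dsimp only; omega⟩,
        Or.inl (Or.inl ⟨rfl, rfl⟩), rep_le_false hpq 0 0 ?_ ?_ ?_⟩ <;> simp <;> omega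
    · refine ⟨(0, 2 * a + 1), ⟨by dsimp only; omega, by dsimp only; omega⟩,
          Or.inr (Or.inr (Or.inr (Or.inl ⟨hpq, Or.inr (Or.inl ⟨a, ?_⟩)⟩))),
          rep_le_true hpq 0 (-1) ?_ ?_ ?_⟩ <;> simp <;> omega

theorem exists_stepB_of_lt (hpq : q < p) (u : gridV p (2 * q)) : ∃ v ∈ gridV p (2 * q),
    Link p q u.1 v ∧
    Rep p q v (loc p q u.1 + stepB p q (u.1.2 % 2 = 1)) (!(u.1.2 % 2 = 1 : Bool)) := by
  obtain ⟨⟨a, d⟩, hu⟩ := u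
  have h1 : a < p := hu.1
  have h2 : d < 2 * q := hu.2
  rw [loc_of_lt hpq]
  rcases Nat.even_or_odd' d with ⟨b, rfl | rfl⟩
  · simp only [end_even, stepB_of_lt hpq, Bool.not_false]
    by_cases h3 : 0 < b
    · refine ⟨(a, 2 * b - 1), ⟨h1, by dsimp only; omega⟩,
        Or.inr (Or.inl ⟨rfl, ?_⟩), rep_lt_false hpq 0 0 ?_ ?_ ?_⟩ <;> simp <;> omega
    · by_cases h4 : a < q
      · refine ⟨(0, 2 * (q - 1 - a) + 1), ⟨by dsimp only; omega, by dsimp only; omega⟩,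
          Or.inl (Or.inr (Or.inr (Or.inr ⟨hpq, Or.inl ⟨?_, ?_, ?_, ?_⟩⟩))),
          rep_lt_true hpq 0 (-1) ?_ ?_ ?_⟩ <;> simp <;> omega
      · refine ⟨(a - q, 2 * q - 1), ⟨by dsimp only; omega, by dsimp only; omega⟩,
          Or.inr (Or.inr (Or.inr (Or.inr ⟨hpq, Or.inr (Or.inr ⟨?_, ?_, ?_, ?_⟩)⟩))),
          rep_lt_false hpq 0 (-1) ?_ ?_ ?_⟩ <;> simp <;> omega
  · simp only [end_odd, stepB_of_lt hpq, Bool.not_true]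
    by_cases h3 : b + 1 < q
    · refine ⟨(a, 2 * b + 2), ⟨by dsimp only; omega, by dsimp only; omega⟩,
        Or.inl (Or.inl ⟨rfl, rfl⟩), rep_lt_false hpq 0 0 ?_ ?_ ?_⟩ <;> simp <;> omega
    · by_cases h4 : a + q < p
      · refine ⟨(a + q, 0), ⟨by dsimp only; omega, by dsimp only; omega⟩,
          Or.inl (Or.inr (Or.inr (Or.inr ⟨hpq, Or.inr (Or.inr ⟨?_, ?_, ?_, ?_⟩)⟩))),
          rep_lt_false hpq 0 1 ?_ ?_ ?_⟩ <;> simp <;> omega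
      · refine ⟨(p - 1, 2 * (p - 1 - a)), ⟨by dsimp only; omega, by dsimp only; omega⟩,
          Or.inl (Or.inr (Or.inr (Or.inr ⟨hpq, Or.inr (Or.inl ⟨p - 1 - a, ?_⟩)⟩))),
          rep_lt_true hpq 1 0 ?_ ?_ ?_⟩ <;> simp <;> omega

/-- Every edge joins the ends of one of the contracted edges, or leaves in direction `A` or `B`. -/
theorem rep_of_hexSE (u v : gridV p (2 * q)) (h : hexSE p q u.1 v.1) :
    (v.1.1 = u.1.1 ∧ v.1.2 / 2 = u.1.2 / 2 ∧ v.1.2 ≠ u.1.2) ∨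
    Rep p q v.1 (loc p q u.1 + stepA (u.1.2 % 2 = 1)) (!(u.1.2 % 2 = 1 : Bool)) ∨
    Rep p q v.1 (loc p q u.1 + stepB p q (u.1.2 % 2 = 1)) (!(u.1.2 % 2 = 1 : Bool)) := by
  obtain ⟨⟨a, d⟩, hu⟩ := u
  obtain ⟨⟨a', d'⟩, hv⟩ := v
  have h1 : a < p := hu.1
  have h2 : d < 2 * q := hu.2
  have h3 : a' < p := hv.1
  have h4 : d' < 2 * q := hv.2
  change hexSE p q (a, d) (a', d') at h
  change (a' = a ∧ d' / 2 = d / 2 ∧ d' ≠ d) ∨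
    Rep p q (a', d') (loc p q (a, d) + stepA (d % 2 = 1)) (!(d % 2 = 1 : Bool)) ∨
    Rep p q (a', d') (loc p q (a, d) + stepB p q (d % 2 = 1)) (!(d % 2 = 1 : Bool))
  clear hu hv
  rcases h with ⟨h5, h6⟩ | ⟨h5, h6, h7⟩ | ⟨hpq, h⟩ | ⟨hpq, h⟩
  · dsimp only at h5 h6
    subst h5 h6
    rcases Nat.even_or_odd' d with ⟨b, rfl | rfl⟩
    · exact Or.inl ⟨rfl, by omega, by omega⟩
    · refine Or.inr (Or.inr ?_)
      rcases le_or_gt p q with hpq | hpq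
      · rw [loc_of_le hpq]
        simp only [end_odd, stepB_of_le hpq, Bool.not_true]
        refine rep_le_false hpq 0 0 ?_ ?_ ?_ <;> simp <;> omega
      · rw [loc_of_lt hpq]
        simp only [end_odd, stepB_of_lt hpq, Bool.not_true]
        refine rep_lt_false hpq 0 0 ?_ ?_ ?_ <;> simp <;> omega
  · dsimp only at h5 h6 h7
    subst h5 h6
    obtain ⟨b, rfl⟩ : ∃ b, d = 2 * b := ⟨d / 2, by omega⟩
    refine Or.inr (Or.inl ?_)
    rcases le_or_gt p q with hpq | hpq
    · rw [loc_of_le hpq]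
      simp only [end_even, stepA, Bool.not_false]
      refine rep_le_false hpq 0 0 ?_ ?_ ?_ <;> simp <;> omega
    · rw [loc_of_lt hpq]
      simp only [end_even, stepA, Bool.not_false]
      refine rep_lt_false hpq 0 0 ?_ ?_ ?_ <;> simp <;> omega
  · rw [loc_of_le hpq]
    rcases h with ⟨h5, h6, h7⟩ | ⟨i, h5, h6, h7, h8, h9⟩ | ⟨i, h5, h6, h7, h8, h9⟩ <;>
      dsimp only at * <;> subst_vars
    · refine Or.inr (Or.inr ?_)
      rw [(end_even 0 : decide (0 % 2 = 1) = false), stepB_of_le hpq]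
      refine rep_le_true hpq 1 0 ?_ ?_ ?_ <;> simp <;> omega
    · refine Or.inr (Or.inl ?_)
      simp only [end_odd, stepA, Bool.not_true]
      refine rep_le_true hpq 0 0 ?_ ?_ ?_ <;> simp <;> omega
    · refine Or.inr (Or.inl ?_)
      simp only [end_odd, stepA, Bool.not_true]
      refine rep_le_false hpq (-1) 0 ?_ ?_ ?_ <;> simp <;> omega
  · rw [loc_of_lt hpq]
    have hd : decide ((2 * q - 1) % 2 = 1) = true := by
      rw [decide_eq_true_iff]
      omega
    rcases h with ⟨h5, h6, h7, h8⟩ | ⟨i, h5, h6, h7, h8, h9⟩ | ⟨h5, h6, h7, h8⟩ <;>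
      dsimp only at * <;> subst_vars
    · refine Or.inr (Or.inr ?_)
      rw [(end_even 0 : decide (0 % 2 = 1) = false), stepB_of_lt hpq]
      refine rep_lt_true hpq 0 (-1) ?_ ?_ ?_ <;> simp <;> omega
    · refine Or.inr (Or.inr ?_)
      simp only [hd, stepB_of_lt hpq, Bool.not_true]
      refine rep_lt_true hpq 1 0 ?_ ?_ ?_ <;> simp <;> omega
    · refine Or.inr (Or.inr ?_)
      simp only [hd, stepB_of_lt hpq, Bool.not_true]
      refine rep_lt_false hpq 0 1 ?_ ?_ ?_ <;> simp <;> omega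

end HexS

end HexTiling

/-! ### The projection of the hexagonal lattice to the brick wall -/

namespace HexTiling

namespace HexS

variable {p q : ℕ}

theorem turnEnd_not (s c : Bool) : turnEnd p q s (!c) = !turnEnd p q s c := by
  unfold turnEnd
  split_ifs <;> simp

theorem turnEnd_xor (s t c : Bool) : turnEnd p q (xor s t) c = turnEnd p q t (turnEnd p q s c) := by
  unfold turnEnd
  split_ifs
  · rfl
  · cases s <;> cases t <;> cases c <;> rfl

theorem turnEnd_turnEnd (s c : Bool) : turnEnd p q s (turnEnd p q s c) = c := by
  rw [← turnEnd_xor, Bool.xor_self]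
  unfold turnEnd
  split_ifs <;> simp

/-- Covering transformations carry neighbours to neighbours, so what is known at the position of a
vertex in the box holds at every point that represents the vertex. -/
theorem Rep.move {v : ℕ × ℕ} {y x d : ℤ × ℤ} {s e : Bool} (h : Rep p q v (y + d) (!e))
    (hs : SRel p q s y x) : Rep p q v (x + SRel.turn s d) (!turnEnd p q s e) := by
  obtain ⟨t, ht, he⟩ := h
  exact ⟨_, ht.trans (hs.add d), by rw [turnEnd_xor, ← he, turnEnd_not]⟩

theorem rep_self (u : ℕ × ℕ) : Rep p q u (loc p q u) (u.2 % 2 = 1) :=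
  ⟨false, SRel.refl _, by unfold turnEnd; split_ifs <;> simp⟩

theorem loc_mem {u : ℕ × ℕ} (hu : u ∈ gridV p (2 * q)) : 0 ≤ (loc p q u).1 ∧
    (loc p q u).1 < p ∧ 0 ≤ (loc p q u).2 ∧ (loc p q u).2 < q := by
  have h1 : u.1 < p := hu.1
  have h2 : u.2 < 2 * q := hu.2
  rcases le_or_gt p q with h | h
  · rw [loc_of_le h]
    dsimp only
    omega
  · rw [loc_of_lt h]
    dsimp only
    omega

theorem loc_eq_iff {u v : ℕ × ℕ} :
    loc p q u = loc p q v ↔ u.1 = v.1 ∧ u.2 / 2 = v.2 / 2 := by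
  rcases le_or_gt p q with h | h
  · rw [loc_of_le h, loc_of_le h, Prod.ext_iff]
    dsimp only
    omega
  · rw [loc_of_lt h, loc_of_lt h, Prod.ext_iff]
    dsimp only
    omega

theorem Rep.loc_eq {u v : ℕ × ℕ} (hu : u ∈ gridV p (2 * q)) (hv : v ∈ gridV p (2 * q))
    {x : ℤ × ℤ} {c d : Bool} (h : Rep p q u x c) (h' : Rep p q v x d) :
    loc p q u = loc p q v := by
  obtain ⟨s, hs, -⟩ := h
  obtain ⟨t, ht, -⟩ := h'
  exact (SRel.eq_of_mem_box (loc_mem hu) (loc_mem hv) (hs.trans ht.symm)).2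

/-- The box is a fundamental domain, so both vertices have the same position and are moved by
transformations of the same kind. As `turnEnd` is an involution, they are also the same end. -/
theorem Rep.unique {u v : ℕ × ℕ} (hu : u ∈ gridV p (2 * q)) (hv : v ∈ gridV p (2 * q))
    {x : ℤ × ℤ} {c : Bool} (h : Rep p q u x c) (h' : Rep p q v x c) : u = v := by
  have h1 := loc_eq_iff.1 (h.loc_eq hu hv h')
  obtain ⟨s, hs, rfl⟩ := h
  obtain ⟨t, ht, h2⟩ := h'
  have h3 := (SRel.eq_of_mem_box (loc_mem hu) (loc_mem hv) (hs.trans ht.symm)).1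
  obtain rfl : s = t := by simpa using h3
  have h4 := congrArg (turnEnd p q s) h2
  rw [turnEnd_turnEnd, turnEnd_turnEnd, decide_eq_decide] at h4
  exact Prod.ext h1.1 (by omega)

theorem exists_partner (u : gridV p (2 * q)) : ∃ v ∈ gridV p (2 * q), Link p q u.1 v ∧
    v.1 = u.1.1 ∧ v.2 / 2 = u.1.2 / 2 ∧ v.2 ≠ u.1.2 := by
  obtain ⟨⟨a, d⟩, hu⟩ := u
  have h1 : a < p := hu.1
  have h2 : d < 2 * q := hu.2
  rcases Nat.even_or_odd' d with ⟨b, rfl | rfl⟩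
  · exact ⟨(a, 2 * b + 1), ⟨h1, by dsimp only; omega⟩, Or.inl (Or.inl ⟨rfl, rfl⟩), rfl,
      by dsimp only; omega, by dsimp only; omega⟩
  · exact ⟨(a, 2 * b), ⟨h1, by dsimp only; omega⟩, Or.inr (Or.inl ⟨rfl, rfl⟩), rfl,
      by dsimp only; omega, by dsimp only; omega⟩

theorem exists_stepA (u : gridV p (2 * q)) : ∃ v ∈ gridV p (2 * q), Link p q u.1 v ∧
    Rep p q v (loc p q u.1 + stepA (u.1.2 % 2 = 1)) (!(u.1.2 % 2 = 1 : Bool)) := by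
  rcases le_or_gt p q with h | h
  · exact exists_stepA_of_le h u
  · exact exists_stepA_of_lt h u

theorem exists_stepB (u : gridV p (2 * q)) : ∃ v ∈ gridV p (2 * q), Link p q u.1 v ∧
    Rep p q v (loc p q u.1 + stepB p q (u.1.2 % 2 = 1)) (!(u.1.2 % 2 = 1 : Bool)) := by
  rcases le_or_gt p q with h | h
  · exact exists_stepB_of_le h u
  · exact exists_stepB_of_lt h u

/-- The edges that leave a vertex, in terms of any point that represents it. -/
theorem exists_steps {u : ℕ × ℕ} (hu : u ∈ gridV p (2 * q)) {x : ℤ × ℤ} {c : Bool}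
    (h : Rep p q u x c) :
    (∃ v ∈ gridV p (2 * q), Link p q u v ∧ Rep p q v (x + stepA c) (!c)) ∧
    ∃ v ∈ gridV p (2 * q), Link p q u v ∧ Rep p q v (x + stepB p q c) (!c) := by
  obtain ⟨s, hs, rfl⟩ := h
  obtain ⟨v, hv, hl, h⟩ := exists_stepA ⟨u, hu⟩
  obtain ⟨v', hv', hl', h'⟩ := exists_stepB ⟨u, hu⟩
  have k := h.move hs
  have k' := h'.move hs
  rcases turn_step (p := p) (q := q) s (u.2 % 2 = 1) with ⟨h1, h2⟩ | ⟨h1, h2⟩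
  · rw [h1] at k
    rw [h2] at k'
    exact ⟨⟨v, hv, hl, k⟩, v', hv', hl', k'⟩
  · rw [h1] at k
    rw [h2] at k'
    exact ⟨⟨v', hv', hl', k'⟩, v, hv, hl, k⟩

theorem exists_unitStep (i : Fin 4) : ∃ c, stepA c = unitStep i ∨ stepB p q c = unitStep i := by
  by_cases h : q < p <;> simp only [stepB, h, decide_true, decide_false] <;> revert i <;> decide

/-- The property holds at a corner of the box and spreads over the lattice, since each unit vector
is a direction `A` or `B` at one of the two ends. -/
theorem exists_rep (hp : 0 < p) (hq : 0 < q) (x : ℤ × ℤ) (c : Bool) :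
    ∃ u ∈ gridV p (2 * q), Rep p q u x c := by
  have key : ∀ c c' x, (∃ u ∈ gridV p (2 * q), Rep p q u x c) →
      ∃ u ∈ gridV p (2 * q), Rep p q u x c' := by
    rintro c c' x ⟨u, hu, h⟩
    rcases Bool.eq_or_eq_not c' c with rfl | rfl
    · exact ⟨u, hu, h⟩
    · obtain ⟨v, hv, -, h1, h2, h3⟩ := exists_partner ⟨u, hu⟩
      exact ⟨v, hv, h.not h1 h2 h3⟩
  refine key false c x (lattice_induction (C := fun x => ∃ u ∈ gridV p (2 * q), Rep p q u x false)
    (loc p q (0, 0)) ⟨(0, 0), ⟨hp, by dsimp only; omega⟩, rep_self (0, 0)⟩ ?_ x)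
  intro x i h
  obtain ⟨c, hc⟩ := exists_unitStep (p := p) (q := q) i
  obtain ⟨u, hu, h⟩ := key false c x h
  obtain ⟨⟨v, hv, -, k⟩, v', hv', -, k'⟩ := exists_steps hu h
  refine key (!c) _ _ ?_
  rcases hc with hc | hc <;> rw [← hc]
  · exact ⟨v, hv, k⟩
  · exact ⟨v', hv', k'⟩

section

variable (hp : 0 < p) (hq : 0 < q)

/-- The covering of the closed brick wall by the hexagonal lattice. -/
noncomputable def proj (x : ℤ × ℤ) (c : Bool) : gridV p (2 * q) :=
  ⟨(exists_rep hp hq x c).choose, (exists_rep hp hq x c).choose_spec.1⟩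

theorem rep_proj (x : ℤ × ℤ) (c : Bool) : Rep p q (proj hp hq x c).1 x c :=
  (exists_rep hp hq x c).choose_spec.2

theorem eq_proj {v : gridV p (2 * q)} {x : ℤ × ℤ} {c : Bool} (h : Rep p q v.1 x c) :
    v = proj hp hq x c :=
  Subtype.ext (h.unique v.2 (Subtype.prop _) (rep_proj hp hq x c))

/-- The vertex of `S_{p,q}` in which the edge at `v` is contracted. -/
def site (v : gridV p (2 * q)) : gridV p q :=
  ⟨(v.1.1, v.1.2 / 2), v.2.1, by
    have h : v.1.2 < 2 * q := v.2.2
    dsimp only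
    omega⟩

theorem site_eq_iff {u v : gridV p (2 * q)} : site u = site v ↔ loc p q u.1 = loc p q v.1 := by
  rw [loc_eq_iff, Subtype.ext_iff, Prod.ext_iff]
  rfl

theorem site_proj_eq (x : ℤ × ℤ) (c d : Bool) :
    site (proj hp hq x c) = site (proj hp hq x d) :=
  site_eq_iff.2 ((rep_proj hp hq x c).loc_eq (Subtype.prop _) (Subtype.prop _)
    (rep_proj hp hq x d))

theorem exists_sRel_of_site_eq {x y : ℤ × ℤ} {c d : Bool}
    (h : site (proj hp hq x c) = site (proj hp hq y d)) : ∃ s, SRel p q s x y := by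
  rw [site_eq_iff] at h
  obtain ⟨s, hs, -⟩ := rep_proj hp hq x c
  obtain ⟨t, ht, -⟩ := rep_proj hp hq y d
  rw [h] at hs
  exact ⟨_, hs.symm.trans ht⟩

/-- A nonzero displacement that is smaller than those of all covering transformations, measured
along both diagonals, leads to a different vertex. -/
theorem site_proj_ne {x : ℤ × ℤ} {d : ℤ × ℤ} {c c' : Bool} (hd : d ≠ 0) (h1 : |d.1 + d.2| < q)
    (h2 : |d.1 - d.2| < 2 * p) : site (proj hp hq (x + d) c) ≠ site (proj hp hq x c') := by
  intro h
  obtain ⟨s, hs⟩ := exists_sRel_of_site_eq hp hq h.symm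
  rcases hs.eq_zero_or_le (by omega) (by omega) with h | h | h
  · exact hd h
  · omega
  · omega

theorem proj_not (x : ℤ × ℤ) (c : Bool) {v : gridV p (2 * q)} (h1 : v.1.1 = (proj hp hq x c).1.1)
    (h2 : v.1.2 / 2 = (proj hp hq x c).1.2 / 2) (h3 : v.1.2 ≠ (proj hp hq x c).1.2) :
    v = proj hp hq x (!c) :=
  eq_proj hp hq ((rep_proj hp hq x c).not h1 h2 h3)

/-- A displacement that commutes with the covering transformations descends to the wall: its effect
can be computed at the position in the box. -/
theorem proj_add_eq {x y : ℤ × ℤ} {c d : Bool} {D : Bool → ℤ × ℤ}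
    (hD : ∀ s c, SRel.turn s (D c) = D (turnEnd p q s c))
    (h : proj hp hq x c = proj hp hq y d) :
    proj hp hq (x + D c) (!c) = proj hp hq (y + D d) (!d) := by
  have key : ∀ x c, proj hp hq (x + D c) (!c) = proj hp hq (loc p q (proj hp hq x c).1 +
      D ((proj hp hq x c).1.2 % 2 = 1)) (!((proj hp hq x c).1.2 % 2 = 1 : Bool)) := by
    intro x c
    symm
    obtain ⟨s, hs, hc⟩ := rep_proj hp hq x c
    have := (rep_proj hp hq (loc p q (proj hp hq x c).1 +
      D ((proj hp hq x c).1.2 % 2 = 1)) (!((proj hp hq x c).1.2 % 2 = 1 : Bool))).move hs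
    rw [hD, ← hc] at this
    exact eq_proj hp hq this
  rw [key x c, key y d, h]

theorem proj_step_eq {x y : ℤ × ℤ} {c d : Bool} (h : proj hp hq x c = proj hp hq y d) :
    (proj hp hq (x + stepA c) (!c) = proj hp hq (y + stepA d) (!d) ∧
      proj hp hq (x + stepB p q c) (!c) = proj hp hq (y + stepB p q d) (!d)) ∨
    (proj hp hq (x + stepA c) (!c) = proj hp hq (y + stepB p q d) (!d) ∧
      proj hp hq (x + stepB p q c) (!c) = proj hp hq (y + stepA d) (!d)) := by
  have key : ∀ x c e l, e = decide ((proj hp hq x c).1.2 % 2 = 1) → l = loc p q (proj hp hq x c).1 →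
      (proj hp hq (x + stepA c) (!c) = proj hp hq (l + stepA e) (!e) ∧
        proj hp hq (x + stepB p q c) (!c) = proj hp hq (l + stepB p q e) (!e)) ∨
      (proj hp hq (x + stepA c) (!c) = proj hp hq (l + stepB p q e) (!e) ∧
        proj hp hq (x + stepB p q c) (!c) = proj hp hq (l + stepA e) (!e)) := by
    rintro x c e l he rfl
    obtain ⟨s, hs, hc⟩ := rep_proj hp hq x c
    rw [← he] at hc
    have k1 := (rep_proj hp hq (loc p q (proj hp hq x c).1 + stepA e) (!e)).move hs
    have k2 := (rep_proj hp hq (loc p q (proj hp hq x c).1 + stepB p q e) (!e)).move hs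
    rcases turn_step (p := p) (q := q) s e with ⟨h1, h2⟩ | ⟨h1, h2⟩ <;>
      rw [h1, ← hc] at k1 <;> rw [h2, ← hc] at k2
    · exact Or.inl ⟨(eq_proj hp hq k1).symm, (eq_proj hp hq k2).symm⟩
    · exact Or.inr ⟨(eq_proj hp hq k2).symm, (eq_proj hp hq k1).symm⟩
  rcases key x c _ _ rfl rfl with ⟨h1, h2⟩ | ⟨h1, h2⟩ <;>
    rcases key y d _ _ (congrArg (fun v => decide (v.1.2 % 2 = 1)) h)
      (congrArg (fun v => loc p q v.1) h) with ⟨h3, h4⟩ | ⟨h3, h4⟩ <;> rw [h1, h2, h3, h4]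
  · exact Or.inl ⟨rfl, rfl⟩
  · exact Or.inr ⟨rfl, rfl⟩
  · exact Or.inr ⟨rfl, rfl⟩
  · exact Or.inl ⟨rfl, rfl⟩

end

end HexS

end HexTiling

namespace HexTiling

namespace HexS

variable {p q : ℕ}

theorem rep_of_link {u v : ℕ × ℕ} (hu : u ∈ gridV p (2 * q)) (hv : v ∈ gridV p (2 * q))
    (h : Link p q u v) :
    (v.1 = u.1 ∧ v.2 / 2 = u.2 / 2 ∧ v.2 ≠ u.2) ∨
    Rep p q v (loc p q u + stepA (u.2 % 2 = 1)) (!(u.2 % 2 = 1 : Bool)) ∨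
    Rep p q v (loc p q u + stepB p q (u.2 % 2 = 1)) (!(u.2 % 2 = 1 : Bool)) := by
  rcases h with h | h
  · exact rep_of_hexSE ⟨u, hu⟩ ⟨v, hv⟩ h
  -- The edge is known as seen from `v` and has to be seen from `u`: the displacement changes sign
  -- and is turned by the transformation that takes `u` to the neighbour of `v`.
  · have flip : ∀ {e e' : Bool} {d : ℤ × ℤ}, e = decide (u.2 % 2 = 1) →
        e' = decide (v.2 % 2 = 1) → Rep p q u (loc p q v + d) (!e') →
        ∃ t, Rep p q v (loc p q u + SRel.turn t (-d)) (!e) ∧ turnEnd p q t e = !e' := by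
      rintro e e' d rfl he ⟨t, ht, h⟩
      refine ⟨t, ⟨t, ?_, ?_⟩, h.symm⟩
      · have := ht.symm.add (-d)
        rwa [add_neg_cancel_right] at this
      · rw [← he, ← Bool.not_not e', h, turnEnd_not, turnEnd_turnEnd]
    rcases rep_of_hexSE ⟨v, hv⟩ ⟨u, hu⟩ h with ⟨h1, h2, h3⟩ | h | h
    · exact Or.inl ⟨h1.symm, h2.symm, h3.symm⟩
    all_goals
      obtain ⟨t, h1, h2⟩ := flip rfl rfl h
      have h3 := turnEnd_turnEnd (p := p) (q := q) t (decide (u.2 % 2 = 1))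
      rw [h2] at h3
      have h4 := turn_step (p := p) (q := q) t (!decide (v.2 % 2 = 1))
      dsimp only at h1
      first | rw [← stepA_not] at h1 | rw [← stepB_not] at h1
      rw [h3] at h4
      rcases h4 with ⟨h5, h6⟩ | ⟨h5, h6⟩ <;> first | rw [h5] at h1 | rw [h6] at h1
      · first | exact Or.inr (Or.inl h1) | exact Or.inr (Or.inr h1)
      · first | exact Or.inr (Or.inl h1) | exact Or.inr (Or.inr h1)

section

variable (hp : 0 < p) (hq : 0 < q)

theorem proj_of_link {x : ℤ × ℤ} {c : Bool} {v : gridV p (2 * q)}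
    (h : Link p q (proj hp hq x c).1 v.1) : v = proj hp hq (x + stepA c) (!c) ∨
      v = proj hp hq (x + stepB p q c) (!c) ∨ v = proj hp hq x (!c) := by
  obtain ⟨s, hs, hc⟩ := rep_proj hp hq x c
  rcases rep_of_link (Subtype.prop _) v.2 h with ⟨h1, h2, h3⟩ | h | h
  · exact Or.inr (Or.inr (proj_not hp hq x c h1 h2 h3))
  all_goals
    have h := h.move hs
    rcases turn_step (p := p) (q := q) s ((proj hp hq x c).1.2 % 2 = 1) with ⟨h1, h2⟩ | ⟨h1, h2⟩ <;>
      first | rw [h1, ← hc] at h | rw [h2, ← hc] at h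
    · first | exact Or.inl (eq_proj hp hq h) | exact Or.inr (Or.inl (eq_proj hp hq h))
    · first | exact Or.inl (eq_proj hp hq h) | exact Or.inr (Or.inl (eq_proj hp hq h))

theorem link_proj (x : ℤ × ℤ) (c : Bool) :
    Link p q (proj hp hq x c).1 (proj hp hq (x + stepA c) (!c)).1 ∧
    Link p q (proj hp hq x c).1 (proj hp hq (x + stepB p q c) (!c)).1 ∧
    Link p q (proj hp hq x c).1 (proj hp hq x (!c)).1 := by
  obtain ⟨⟨v, hv, hl, h⟩, v', hv', hl', h'⟩ := exists_steps (Subtype.prop _) (rep_proj hp hq x c)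
  obtain ⟨w, hw, hl2, h1, h2, h3⟩ := exists_partner (proj hp hq x c)
  rw [← eq_proj hp hq (v := ⟨v, hv⟩) h, ← eq_proj hp hq (v := ⟨v', hv'⟩) h',
    ← proj_not hp hq x c (v := ⟨w, hw⟩) h1 h2 h3]
  exact ⟨hl, hl', hl2⟩

theorem proj_not_ne (x : ℤ × ℤ) (c : Bool) : proj hp hq x (!c) ≠ proj hp hq x c := by
  intro h
  obtain ⟨w, hw, -, h1, h2, h3⟩ := exists_partner (proj hp hq x c)
  rw [← proj_not hp hq x c (v := ⟨w, hw⟩) h1 h2 h3] at h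
  exact h3 (by rw [← h])

theorem step_cases (c : Bool) : ((p ≤ q ∧ stepA c = (1, 0) ∧ stepB p q c = (0, -1)) ∨
    (p ≤ q ∧ stepA c = (-1, 0) ∧ stepB p q c = (0, 1))) ∨
    (q < p ∧ stepA c = (1, 0) ∧ stepB p q c = (0, 1)) ∨
    (q < p ∧ stepA c = (-1, 0) ∧ stepB p q c = (0, -1)) := by
  rcases le_or_gt p q with h | h <;> cases c <;> simp [stepA, stepB, h, h.not_gt]

theorem proj_ne {x y : ℤ × ℤ} {c c' : Bool} {d : ℤ × ℤ} (hxy : y = x + d) (hd : d ≠ 0)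
    (h1 : |d.1 + d.2| < q) (h2 : |d.1 - d.2| < 2 * p) :
    site (proj hp hq x c) ≠ site (proj hp hq y c') := by
  subst hxy
  exact (site_proj_ne hp hq hd h1 h2).symm

/-- The inequalities compare displacements with the bounds `q` for the sum and `2 * p` for the
difference of coordinates. The critical one is `neAB2`: for `p ≤ q` the displacement is `±(2, 2)`,
of sum four in absolute value, whence `5 ≤ q`; for `q < p` it lies on the other diagonal, where `4 <
2 * p` suffices. -/
theorem hexCover (hp3 : 3 ≤ p) (hq3 : 3 ≤ q) (hpq : p ≤ q → 5 ≤ q) :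
    HexCover (hexS p q) stepA (stepB p q) (proj hp hq) where
  surj v := ⟨_, _, (eq_proj hp hq (rep_self v.1)).symm⟩
  adj x c w := by
    have hne : ∀ {w}, w = proj hp hq (x + stepA c) (!c) ∨ w = proj hp hq (x + stepB p q c) (!c) ∨
        w = proj hp hq x (!c) → proj hp hq x c ≠ w := by
      rintro w (rfl | rfl | rfl) h
      · refine proj_ne hp hq rfl ?_ ?_ ?_ (congrArg site h) <;>
          rcases step_cases (p := p) (q := q) c with (h | h) | h | h <;> rw [h.2.1] <;> simp <;> omega
      · refine proj_ne hp hq rfl ?_ ?_ ?_ (congrArg site h) <;>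
          rcases step_cases (p := p) (q := q) c with (h | h) | h | h <;> rw [h.2.2] <;> simp <;> omega
      · exact proj_not_ne hp hq x c h.symm
    constructor
    · rintro ⟨-, h⟩
      exact proj_of_link hp hq h
    · intro h
      refine ⟨hne h, ?_⟩
      have h' := link_proj hp hq x c
      rcases h with rfl | rfl | rfl
      · exact h'.1
      · exact h'.2.1
      · exact h'.2.2
  negA := stepA_not
  negB := stepB_not
  inv_z x c y d h := by
    obtain ⟨w, hw, -, h1, h2, h3⟩ := exists_partner (proj hp hq x c)
    rw [← proj_not hp hq x c (v := ⟨w, hw⟩) h1 h2 h3]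
    rw [h] at h1 h2 h3
    exact proj_not hp hq y d (v := ⟨w, hw⟩) h1 h2 h3
  inv_row x c y d h := proj_step_eq hp hq h
  neA x c d h := by
    refine proj_ne hp hq rfl ?_ ?_ ?_ (congrArg site h.symm) <;>
      rcases step_cases (p := p) (q := q) c with (h | h) | h | h <;> rw [h.2.1] <;> simp <;> omega
  neB x c d h := by
    refine proj_ne hp hq rfl ?_ ?_ ?_ (congrArg site h.symm) <;>
      rcases step_cases (p := p) (q := q) c with (h | h) | h | h <;> rw [h.2.2] <;> simp <;> omega
  neAB x c d d' h := by
    refine proj_ne hp hq (d := stepB p q c - stepA c) (by abel) ?_ ?_ ?_ (congrArg site h) <;>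
      rcases step_cases (p := p) (q := q) c with (h | h) | h | h <;> rw [h.2.1, h.2.2] <;>
      simp <;> omega
  neAB2 x c d h := by
    refine proj_ne hp hq (d := stepB p q c + stepB p q c - stepA c - stepA c) (by abel) ?_ ?_ ?_
      (congrArg site h) <;>
      rcases step_cases (p := p) (q := q) c with (h | h) | h | h <;> rw [h.2.1, h.2.2] <;>
      simp <;> omega

end

end HexS

end HexTiling

/-! ### The contraction of the brick wall: self-duality, and local structure of `S_{p,q}` -/

namespace HexTiling

theorem HexCover.comp_iso {V V' : Type*} {H : SimpleGraph V} {H' : SimpleGraph V'}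
    {A B : Bool → ℤ × ℤ} {E : ℤ × ℤ → Bool → V} (S : HexCover H A B E) (e : H' ≃g H) :
    HexCover H' A B fun x c => e.symm (E x c) where
  surj v := by
    obtain ⟨x, c, h⟩ := S.surj (e v)
    exact ⟨x, c, by rw [h, e.symm_apply_apply]⟩
  adj x c w := by
    rw [← e.map_adj_iff, e.apply_symm_apply, S.adj]
    simp only [RelIso.eq_symm_apply]
  negA := S.negA
  negB := S.negB
  inv_z x c y d h := congrArg e.symm (S.inv_z x c y d (e.symm.injective h))
  inv_row x c y d h := by
    simp only [EmbeddingLike.apply_eq_iff_eq]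
    exact S.inv_row x c y d (e.symm.injective h)
  neA x c d h := S.neA x c d (e.symm.injective h)
  neB x c d h := S.neB x c d (e.symm.injective h)
  neAB x c d d' h := S.neAB x c d d' (e.symm.injective h)
  neAB2 x c d h := S.neAB2 x c d (e.symm.injective h)

namespace HexS

variable {p q : ℕ}

/-- The edges of `S_{p,q}`. -/
def gridSE (p q : ℕ) (u v : ℕ × ℕ) : Prop :=
  gridE u v ∨ (p ≤ q ∧ gridSE₁ p q u v) ∨ (q < p ∧ gridSE₂ p q u v)

theorem gridSE_of_hexSE {u v : gridV p (2 * q)} (h : hexSE p q u.1 v.1) :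
    site u = site v ∨ gridSE p q (site u).1 (site v).1 ∨ gridSE p q (site v).1 (site u).1 := by
  obtain ⟨⟨a, d⟩, hu⟩ := u
  obtain ⟨⟨a', d'⟩, hv⟩ := v
  have h1 : a < p := hu.1
  have h2 : d < 2 * q := hu.2
  have h3 : a' < p := hv.1
  have h4 : d' < 2 * q := hv.2
  change hexSE p q (a, d) (a', d') at h
  simp only [site, Subtype.ext_iff, Prod.ext_iff]
  clear hu hv
  rcases h with ⟨h5, h6⟩ | ⟨h5, h6, h7⟩ | ⟨hpq, h⟩ | ⟨hpq, h⟩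
  · dsimp only at h5 h6
    by_cases h7 : d' / 2 = d / 2
    · exact Or.inl ⟨h5.symm, h7.symm⟩
    · exact Or.inr (Or.inl (Or.inl (Or.inr ⟨h5, by dsimp only; omega⟩)))
  · dsimp only at h5 h6 h7
    exact Or.inr (Or.inl (Or.inl (Or.inl ⟨h5, by dsimp only; omega⟩)))
  · refine Or.inr (Or.inl (Or.inr (Or.inl ⟨hpq, ?_⟩)))
    rcases h with ⟨h5, h6, h7⟩ | ⟨i, h5, h6, h7, h8, h9⟩ | ⟨i, h5, h6, h7, h8, h9⟩ <;>
      dsimp only at *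
    · exact Or.inl ⟨a, h1, Prod.ext rfl (by dsimp only; omega), Prod.ext h6 (by dsimp only; omega)⟩
    · exact Or.inr (Or.inl ⟨i, h5, Prod.ext h6 (by dsimp only; omega),
        Prod.ext h8 (by dsimp only; omega)⟩)
    · exact Or.inr (Or.inr ⟨i, h5, by omega, Prod.ext h6 (by dsimp only; omega),
        Prod.ext h8 (by dsimp only; omega)⟩)
  · refine Or.inr (Or.inl (Or.inr (Or.inr ⟨hpq, ?_⟩)))
    rcases h with ⟨h5, h6, h7, h8⟩ | ⟨i, h5, h6, h7, h8, h9⟩ | ⟨h5, h6, h7, h8⟩ <;>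
      dsimp only at *
    · exact Or.inl ⟨a, h5, Prod.ext rfl (by dsimp only; omega), Prod.ext h7 (by dsimp only; omega)⟩
    · exact Or.inr (Or.inl ⟨i, h5, Prod.ext h6 (by dsimp only; omega),
        Prod.ext h8 (by dsimp only; omega)⟩)
    · exact Or.inr (Or.inr ⟨a, h5, Prod.ext rfl (by dsimp only; omega),
        Prod.ext h7 (by dsimp only; omega)⟩)

theorem exists_hexSE_of_gridSE {w w' : gridV p q} (h : gridSE p q w.1 w'.1) :
    ∃ u v : gridV p (2 * q), hexSE p q u.1 v.1 ∧ site u = w ∧ site v = w' := by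
  obtain ⟨⟨a, b⟩, hu⟩ := w
  obtain ⟨⟨a', b'⟩, hv⟩ := w'
  have h1 : a < p := hu.1
  have h2 : b < q := hu.2
  have h3 : a' < p := hv.1
  have h4 : b' < q := hv.2
  change gridSE p q (a, b) (a', b') at h
  have key : ∀ c c' : ℕ, c / 2 = b → c' / 2 = b' → hexSE p q (a, c) (a', c') →
      ∃ u v : gridV p (2 * q), hexSE p q u.1 v.1 ∧ site u = ⟨(a, b), hu⟩ ∧
        site v = ⟨(a', b'), hv⟩ := by
    rintro c c' rfl rfl h
    exact ⟨⟨(a, c), h1, by dsimp only; omega⟩, ⟨(a', c'), h3, by dsimp only; omega⟩, h, rfl, rfl⟩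
  rcases h with (⟨h5, h6⟩ | ⟨h5, h6⟩) | ⟨hpq, h⟩ | ⟨hpq, h⟩
  · dsimp only at h5 h6
    exact key (2 * b) (2 * b + 1) (by omega) (by omega)
      (Or.inr (Or.inl ⟨h5, rfl, by dsimp only; omega⟩))
  · dsimp only at h5 h6
    exact key (2 * b + 1) (2 * b + 2) (by omega) (by omega) (Or.inl ⟨h5, rfl⟩)
  · rcases h with ⟨j, h5, h6, h7⟩ | ⟨i, h5, h6, h7⟩ | ⟨i, h5, h6, h7, h8⟩ <;>
      simp only [Prod.ext_iff] at *
    · refine key 0 (2 * b') (by omega) (by omega) (Or.inr (Or.inr (Or.inl ⟨hpq, Or.inl ?_⟩)))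
      dsimp only
      omega
    · refine key (2 * b + 1) (2 * q - 1) (by omega) (by omega)
        (Or.inr (Or.inr (Or.inl ⟨hpq, Or.inr (Or.inl ⟨b, ?_⟩)⟩)))
      dsimp only
      omega
    · refine key (2 * b + 1) (2 * b') (by omega) (by omega)
        (Or.inr (Or.inr (Or.inl ⟨hpq, Or.inr (Or.inr ⟨b, ?_⟩)⟩)))
      dsimp only
      omega
  · rcases h with ⟨j, h5, h6, h7⟩ | ⟨i, h5, h6, h7⟩ | ⟨i, h5, h6, h7⟩ <;>
      simp only [Prod.ext_iff] at *
    · refine key 0 (2 * b' + 1) (by omega) (by omega)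
        (Or.inr (Or.inr (Or.inr ⟨hpq, Or.inl ?_⟩)))
      dsimp only
      omega
    · refine key (2 * b + 1) (2 * b') (by omega) (by omega)
        (Or.inr (Or.inr (Or.inr ⟨hpq, Or.inr (Or.inl ⟨i, ?_⟩)⟩)))
      dsimp only
      omega
    · refine key (2 * b + 1) 0 (by omega) (by omega)
        (Or.inr (Or.inr (Or.inr ⟨hpq, Or.inr (Or.inr ?_)⟩)))
      dsimp only
      omega

theorem step_eq_unitStep (c : Bool) :
    (∃ i, stepA c = unitStep i) ∧ ∃ i, stepB p q c = unitStep i := by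
  rcases step_cases (p := p) (q := q) c with (⟨-, h, h'⟩ | ⟨-, h, h'⟩) | ⟨-, h, h'⟩ | ⟨-, h, h'⟩ <;>
    rw [h, h'] <;> decide

section

variable (hp : 0 < p) (hq : 0 < q)

theorem eq_or_eq_not_of_site_eq {x y : ℤ × ℤ} {c : Bool}
    (h : site (proj hp hq x false) = site (proj hp hq y false)) :
    proj hp hq y c = proj hp hq x c ∨ proj hp hq y c = proj hp hq x (!c) := by
  rw [site_proj_eq hp hq x _ c, site_proj_eq hp hq y _ c, site_eq_iff, loc_eq_iff] at h
  by_cases h' : (proj hp hq y c).1.2 = (proj hp hq x c).1.2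
  · exact Or.inl (Subtype.ext (Prod.ext h.1.symm h'))
  · exact Or.inr (proj_not hp hq x c h.1.symm h.2.symm h')

/-- Forgetting the ends turns the covering by the hexagonal lattice into one by the square lattice:
the edges that are not contracted leave in the directions `A` and `B`, which over both ends run
through the four unit vectors. -/
theorem gridCover_gridS (hp3 : 3 ≤ p) (hq3 : 3 ≤ q) :
    GridCover (gridS p q) fun x => site (proj hp hq x false) where
  surj := by
    rintro ⟨⟨a, b⟩, h1, h2⟩
    dsimp only at h1 h2
    have hmem : (a, 2 * b) ∈ gridV p (2 * q) := ⟨h1, by dsimp only; omega⟩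
    have h : (⟨(a, 2 * b), hmem⟩ : gridV p (2 * q)) = proj hp hq (loc p q (a, 2 * b)) false := by
      simpa [end_even] using eq_proj hp hq (v := ⟨_, hmem⟩) (rep_self (a, 2 * b))
    refine ⟨loc p q (a, 2 * b), ?_⟩
    change site (proj hp hq (loc p q (a, 2 * b)) false) = _
    rw [← h]
    exact Subtype.ext (Prod.ext rfl (by simp [site]))
  adj x w := by
    constructor
    · rintro ⟨hne, h⟩
      have key : ∃ u v, Link p q u.1 v.1 ∧ site u = site (proj hp hq x false) ∧ site v = w := by
        rcases h with h | h
        · obtain ⟨u, v, h1, h2, h3⟩ := exists_hexSE_of_gridSE h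
          exact ⟨u, v, Or.inl h1, h2, h3⟩
        · obtain ⟨u, v, h1, h2, h3⟩ := exists_hexSE_of_gridSE h
          exact ⟨v, u, Or.inr h1, h3, h2⟩
      obtain ⟨u, v, h1, h2, rfl⟩ := key
      obtain ⟨c, rfl⟩ : ∃ c, u = proj hp hq x c := by
        by_cases h3 : u.1.2 = (proj hp hq x false).1.2
        · exact ⟨false, Subtype.ext (Prod.ext (loc_eq_iff.1 (site_eq_iff.1 h2)).1 h3)⟩
        · have h4 := loc_eq_iff.1 (site_eq_iff.1 h2)
          exact ⟨_, proj_not hp hq x false h4.1 h4.2 h3⟩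
      obtain ⟨⟨i, hi⟩, j, hj⟩ := step_eq_unitStep (p := p) (q := q) c
      rcases proj_of_link hp hq h1 with rfl | rfl | rfl
      · exact ⟨i, by rw [← hi]; exact site_proj_eq hp hq _ _ _⟩
      · exact ⟨j, by rw [← hj]; exact site_proj_eq hp hq _ _ _⟩
      · exact absurd (h2.symm.trans (site_proj_eq hp hq _ _ _)) hne
    · rintro ⟨i, rfl⟩
      obtain ⟨c, hc⟩ := exists_unitStep (p := p) (q := q) i
      obtain ⟨h1, h2, -⟩ := link_proj hp hq x c
      have h : Link p q (proj hp hq x c).1 (proj hp hq (x + unitStep i) (!c)).1 := by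
        rcases hc with hc | hc <;> rwa [← hc]
      have hne : site (proj hp hq x c) ≠ site (proj hp hq (x + unitStep i) (!c)) := by
        refine proj_ne hp hq rfl (by clear h h1 h2 hc; decide +revert) ?_ ?_ <;>
          fin_cases i <;> simp [unitStep] <;> omega
      rw [site_proj_eq hp hq x _ c, site_proj_eq hp hq _ false (!c)]
      refine ⟨hne, ?_⟩
      rcases h with h | h
      · exact (gridSE_of_hexSE h).resolve_left hne
      · exact ((gridSE_of_hexSE h).resolve_left hne.symm).symm

/-- A short displacement changes sum and difference of the coordinates by at most five, whereas a
covering transformation other than the identity changes one of them by at least `min q (2 * p) ≥ 6`.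
-/
theorem isLocallyGrid_gridS (hp3 : 3 ≤ p) (hq6 : 6 ≤ q) : IsLocallyGrid (gridS p q) := by
  refine (gridCover_gridS (by omega) (by omega) hp3 (by omega)).isLocallyGrid fun x d hd h => ?_
  obtain ⟨s, hs⟩ := exists_sRel_of_site_eq _ _ h.symm
  have h1 : |d.1 + d.2| ≤ 5 ∧ |d.1 - d.2| ≤ 5 := by
    have h2 : |d.1| + |d.2| ≤ 5 := by rcases hd with hd | hd <;> omega
    exact ⟨(abs_add_le _ _).trans h2, (abs_sub _ _).trans h2⟩
  rcases hs.eq_zero_or_le (by omega) (by omega) with h | h | h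
  · exact h
  · omega
  · omega

/-- The displacement by which the tiling is mapped to its dual position. -/
def shift (p q : ℕ) (c : Bool) : ℤ × ℤ :=
  if q < p then (if c then (-1, -1) else 0) else if c then (-1, 0) else (0, -1)

theorem turn_shift (s c : Bool) :
    SRel.turn s (shift p q c) = shift p q (turnEnd p q s c) := by
  by_cases h : q < p <;> cases s <;> cases c <;> simp [SRel.turn, shift, turnEnd, h]

theorem turn_neg_shift (s c : Bool) :
    SRel.turn s (-shift p q (!c)) = -shift p q (!turnEnd p q s c) := by
  by_cases h : q < p <;> cases s <;> cases c <;> simp [SRel.turn, shift, turnEnd, h]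

theorem yields_of_iso {V : Type} {H : SimpleGraph V} (e : H ≃g hexS p q) (hp3 : 3 ≤ p)
    (hq3 : 3 ≤ q) (hpq : p ≤ q → 5 ≤ q) {P : Set (Sym2 V)}
    (hP : ∀ f, f ∈ P ↔ ∃ u v, u ≠ v ∧ site (e u) = site (e v) ∧ f = s(u, v)) :
    IsPerfectMatching H P ∧ Yields H P (gridS p q) (gridS p q) := by
  have hp : 0 < p := by omega
  have hq : 0 < q := by omega
  have S := (hexCover hp hq hp3 hq3 hpq).comp_iso e
  have hP' : P = {f | ∃ x c, f = s(e.symm (proj hp hq x c), e.symm (proj hp hq x (!c)))} := by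
    ext f
    rw [hP]
    constructor
    · rintro ⟨u, v, hne, h, rfl⟩
      obtain ⟨x, c, hu⟩ := S.surj u
      have hu' : e u = proj hp hq x c := by rw [← hu]; exact e.apply_symm_apply _
      rw [hu'] at h
      have h1 := loc_eq_iff.1 (site_eq_iff.1 h)
      -- Two different vertices over the same site are the two ends of one contracted edge.
      have h2 : (e v).1.2 ≠ (proj hp hq x c).1.2 := fun h2 =>
        hne (e.injective (hu'.trans (Subtype.ext (Prod.ext h1.1 h2.symm))))
      refine ⟨x, c, ?_⟩
      rw [hu, ← proj_not hp hq x c h1.1.symm h1.2.symm h2, e.symm_apply_apply]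
    · rintro ⟨x, c, rfl⟩
      refine ⟨_, _, fun h => proj_not_ne hp hq x c (e.symm.injective h).symm, ?_, rfl⟩
      rw [e.apply_symm_apply, e.apply_symm_apply]
      exact site_proj_eq hp hq _ _ _
  rw [hP']
  constructor
  · rw [← S.pairs_z]
    exact S.brick.isPerfectMatching_z
  refine S.yields (gridCover_gridS hp hq hp3 hq3) (fun v => site (e v)) ?_ ?_ exists_unitStep
    step_eq_unitStep ?_ (shift p q) ?_ ?_ ?_
  · intro x c
    rw [e.apply_symm_apply]
    exact site_proj_eq hp hq _ _ _
  · intro x y c h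
    rcases eq_or_eq_not_of_site_eq hp hq (c := c) h with h | h <;> simp [h]
  · intro x c
    have key : ∀ d d' : ℤ × ℤ, d' - d ≠ 0 → |(d' - d).1 + (d' - d).2| < q →
        |(d' - d).1 - (d' - d).2| < 2 * p →
        site (proj hp hq (x + d) false) ≠ site (proj hp hq (x + d') false) := fun d d' =>
      proj_ne hp hq (by abel)
    have h2 : (2 : ℤ) < q := by omega
    have h3 : (2 : ℤ) < 2 * p := by omega
    rw [stepA_not, stepB_not]
    rcases step_cases (p := p) (q := q) c with
      (⟨-, h, h'⟩ | ⟨-, h, h'⟩) | ⟨-, h, h'⟩ | ⟨-, h, h'⟩ <;>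
    · rw [h, h']
      refine ⟨key _ _ ?_ ?_ ?_, key _ _ ?_ ?_ ?_, key _ _ ?_ ?_ ?_, key _ _ ?_ ?_ ?_⟩ <;>
        norm_num <;> omega
  · rcases le_or_gt p q with h | h <;> simp [shift, stepA, stepB, h, h.not_gt]
  · intro x c y d h
    exact congrArg e.symm (proj_add_eq hp hq turn_shift (e.symm.injective h))
  · intro x c y d h
    have := proj_add_eq hp hq (D := fun c => -shift p q (!c)) turn_neg_shift (e.symm.injective h)
    exact congrArg e.symm (by simpa only [sub_eq_add_neg] using this)

end

end HexS

end HexTiling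

namespace HexTiling

/-- Reduces a concrete graph to the brick wall by coordinate changes `f` and `g` that are inverse to
each other. The edges of the matching may be listed in either direction; `hR` and `hR'` say that
they are the pairs of columns `2 * b` and `2 * b + 1`. -/
theorem HexS.yields_of_maps {p q : ℕ} {S : Set (ℕ × ℕ)} {E R : ℕ × ℕ → ℕ × ℕ → Prop}
    (f g : ℕ × ℕ → ℕ × ℕ) (hp3 : 3 ≤ p) (hq3 : 3 ≤ q) (hpq : p ≤ q → 5 ≤ q)
    (hf : ∀ u ∈ S, f u ∈ gridV p (2 * q)) (hg : ∀ u ∈ gridV p (2 * q), g u ∈ S)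
    (hgf : ∀ u ∈ S, g (f u) = u) (hfg : ∀ u ∈ gridV p (2 * q), f (g u) = u)
    (hE : ∀ u ∈ S, ∀ v ∈ S, E u v → hexSE p q (f u) (f v) ∨ hexSE p q (f v) (f u))
    (hE' : ∀ u ∈ gridV p (2 * q), ∀ v ∈ gridV p (2 * q), hexSE p q u v →
      E (g u) (g v) ∨ E (g v) (g u))
    (hR : ∀ u ∈ S, ∀ v ∈ S, R u v → u ≠ v ∧ (f u).1 = (f v).1 ∧ (f u).2 / 2 = (f v).2 / 2)
    (hR' : ∀ a b, a < p → b < q →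
      R (g (a, 2 * b)) (g (a, 2 * b + 1)) ∨ R (g (a, 2 * b + 1)) (g (a, 2 * b))) :
    IsPerfectMatching (graphOn S E) (pairsOn S R) ∧
      Yields (graphOn S E) (pairsOn S R) (gridS p q) (gridS p q) := by
  let e : graphOn S E ≃g hexS p q := graphOnIso (fun u => ⟨f u.1, hf _ u.2⟩)
    (fun u => ⟨g u.1, hg _ u.2⟩) (fun u => Subtype.ext (hgf _ u.2))
    (fun u => Subtype.ext (hfg _ u.2)) (fun u v => hE _ u.2 _ v.2) fun u v => hE' _ u.2 _ v.2
  refine HexS.yields_of_iso e hp3 hq3 hpq fun F => ⟨?_, ?_⟩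
  · rintro ⟨u, v, h, rfl⟩
    obtain ⟨h1, h2, h3⟩ := hR _ u.2 _ v.2 h
    exact ⟨u, v, fun h => h1 (congrArg _ h), Subtype.ext (Prod.ext h2 h3), rfl⟩
  · rintro ⟨u, v, hne, h, rfl⟩
    have h1 : (f u.1).1 = (f v.1).1 := congrArg (fun w => w.1.1) h
    have h2 : (f u.1).2 / 2 = (f v.1).2 / 2 := congrArg (fun w => w.1.2) h
    have h3 : (f u.1).2 ≠ (f v.1).2 := fun h3 => hne (Subtype.ext (by
      rw [← hgf _ u.2, ← hgf _ v.2, Prod.ext h1 h3]))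
    have key : ∀ u v : S, (f u.1).1 = (f v.1).1 → (f u.1).2 / 2 = (f v.1).2 / 2 →
        (f u.1).2 < (f v.1).2 → s(u, v) ∈ pairsOn S R := by
      intro u v h1 h2 h3
      have hu := hgf _ u.2
      have hv := hgf _ v.2
      have h4 := (hf _ u.2).1
      have h5 := (hf _ u.2).2
      rw [show f u.1 = ((f u.1).1, 2 * ((f u.1).2 / 2)) from Prod.ext rfl (by dsimp only; omega)]
        at hu
      rw [show f v.1 = ((f u.1).1, 2 * ((f u.1).2 / 2) + 1) from
        Prod.ext h1.symm (by dsimp only; omega)] at hv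
      rcases hR' _ _ h4 (show (f u.1).2 / 2 < q by omega) with h | h <;> rw [hu, hv] at h
      · exact ⟨u, v, h, rfl⟩
      · exact ⟨v, u, h, Sym2.eq_swap⟩
    rcases lt_or_gt_of_ne h3 with h3 | h3
    · exact key u v h1 h2 h3
    · rw [Sym2.eq_swap]
      exact key v u h1.symm h2.symm h3

/-! ### The graphs `H_{k,m,g}` -/

namespace HexG

variable {k m : ℕ}

/-- The vertex of the brick wall with `m + 1` rows that corresponds to a vertex of `H_{k,m,g}`. -/
def toWall (k m : ℕ) (v : ℕ × ℕ) : ℕ × ℕ :=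
  if v.1 ≤ m then (v.1, v.2 + v.1 + 2 - m)
  else if v.2 = 2 * (k - m - 1) then (0, 2 * k + 3)
  else ((v.2 - (2 * (k - m) - 1)) / 2, 1 - (v.2 - (2 * (k - m) - 1)) % 2)

/-- A shear turns the rows `0, …, m` of the ladder into the columns from `2 * 1` on. The row `m + 1`
fills the columns `0` and `1`, running through `(0, 1)`, `(0, 0)`, `(1, 1)`, `(1, 0)` and so on; its
first vertex does not fit there and completes row `0` at the far end. -/
def ofWall (k m : ℕ) (v : ℕ × ℕ) : ℕ × ℕ :=
  if v.1 = 0 ∧ v.2 = 2 * k + 3 then (m + 1, 2 * (k - m - 1))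
  else if v.2 ≤ 1 then (m + 1, 2 * (k - m) + 2 * v.1 - v.2)
  else (v.1, v.2 + m - 2 - v.1)

theorem mem_iff {i c : ℕ} : (i, c) ∈ hexGV k m ↔ (i ≤ m + 1 ∧ c < 2 * k + (m + 1) ∧
    m + 1 ≤ i + c + 1 ∧ i + c ≤ 2 * k + (m + 1)) ∧ ¬ (i = m + 1 ∧ c < 2 * (k - m) - 2) :=
  Iff.rfl

theorem mem_ladV {i c : ℕ} (h : (i, c) ∈ hexGV k m) : (i, c) ∈ ladV k (m + 1) := h.1

theorem toWall_of_le {i : ℕ} (h : i ≤ m) (c : ℕ) : toWall k m (i, c) = (i, c + i + 2 - m) :=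
  if_pos h

theorem toWall_corner : toWall k m (m + 1, 2 * (k - m - 1)) = (0, 2 * k + 3) := by
  simp [toWall]

theorem toWall_top (hk : m + 1 ≤ k) {c d : ℕ} (h : c = 2 * (k - m) - 1 + d) :
    toWall k m (m + 1, c) = (d / 2, 1 - d % 2) := by
  subst h
  rw [toWall, if_neg (by dsimp only; omega), if_neg (by dsimp only; omega)]
  simp

theorem ofWall_corner : ofWall k m (0, 2 * k + 3) = (m + 1, 2 * (k - m - 1)) := by
  simp [ofWall]

theorem ofWall_of_le (a : ℕ) {d : ℕ} (hd : d ≤ 1) :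
    ofWall k m (a, d) = (m + 1, 2 * (k - m) + 2 * a - d) := by
  rw [ofWall, if_neg (by dsimp only; omega), if_pos hd]

theorem ofWall_of_lt {a d : ℕ} (hd : 2 ≤ d) (h : a = 0 → d ≠ 2 * k + 3) :
    ofWall k m (a, d) = (a, d + m - 2 - a) := by
  rw [ofWall, if_neg (by dsimp only; tauto), if_neg (by dsimp only; omega)]

theorem toWall_mem (hk : m + 1 ≤ k) : ∀ u ∈ hexGV k m, toWall k m u ∈ gridV (m + 1) (2 * (k + 2)) := by
  rintro ⟨i, c⟩ h
  rw [mem_iff] at h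
  constructor <;> dsimp only [toWall] <;> split_ifs <;> dsimp only <;> omega

theorem ofWall_mem (hk : m + 1 ≤ k) : ∀ u ∈ gridV (m + 1) (2 * (k + 2)), ofWall k m u ∈ hexGV k m := by
  rintro ⟨a, d⟩ ⟨h1, h2⟩
  dsimp only at h1 h2
  unfold ofWall
  split_ifs <;> rw [mem_iff] <;> omega

theorem ofWall_toWall (hk : m + 1 ≤ k) : ∀ u ∈ hexGV k m, ofWall k m (toWall k m u) = u := by
  rintro ⟨i, c⟩ h
  rw [mem_iff] at h
  unfold toWall
  split_ifs with h1 h2 <;> dsimp only at *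
  · rw [ofWall_of_lt (by omega) (by omega), Prod.ext_iff]
    dsimp only
    omega
  · rw [ofWall_corner, Prod.ext_iff]
    dsimp only
    omega
  · rw [ofWall_of_le _ (by omega), Prod.ext_iff]
    dsimp only
    omega

theorem toWall_ofWall (hk : m + 1 ≤ k) :
    ∀ u ∈ gridV (m + 1) (2 * (k + 2)), toWall k m (ofWall k m u) = u := by
  rintro ⟨a, d⟩ ⟨h1, h2⟩
  unfold ofWall
  split_ifs with h3 h4 <;> dsimp only at *
  · rw [toWall_corner, h3.1, h3.2]
  · rw [toWall_top hk (d := 2 * a + 1 - d) (by omega), Prod.ext_iff]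
    dsimp only
    omega
  · rw [toWall_of_le (by omega), Prod.ext_iff]
    dsimp only
    omega

end HexG

/-! ### The graphs `H_{k,m,h}` -/

namespace HexH

variable {k m : ℕ}

/-- The vertex of the brick wall with `m + 1` rows that corresponds to a vertex of `H_{k,m,h}`. -/
def toWall (k m : ℕ) (v : ℕ × ℕ) : ℕ × ℕ :=
  if v = (m - k - 1, 3 * k + 2) then (m, 0) else (v.1, v.2 + v.1 + 1 - m)

/-- The shear already sends the additional vertex `s` to the last place of row `0`. Only `t` has to
be placed separately, at `(m, 0)`. -/
def ofWall (k m : ℕ) (v : ℕ × ℕ) : ℕ × ℕ :=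
  if v = (m, 0) then (m - k - 1, 3 * k + 2) else (v.1, v.2 + m - 1 - v.1)

theorem mem_iff {i c : ℕ} : (i, c) ∈ hexHV k m ↔ (i ≤ m ∧ c < 2 * k + m ∧
    m ≤ i + c + 1 ∧ i + c ≤ 2 * k + m) ∨ (i = 0 ∧ c = 2 * k + m) ∨
    (i = m - k - 1 ∧ c = 3 * k + 2) := by
  rw [← Prod.mk_inj, ← Prod.mk_inj]
  rfl

theorem mem_ladV {i c : ℕ} (h : (i, c) ∈ hexHV k m) (h1 : c < 2 * k + m) (h2 : i + c ≤ 2 * k + m)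
    (hk : k + 2 ≤ m) : (i, c) ∈ ladV k m := by
  rw [mem_iff] at h
  change _ ∧ _ ∧ _ ∧ _
  dsimp only
  omega

theorem toWall_extra : toWall k m (m - k - 1, 3 * k + 2) = (m, 0) := if_pos rfl

theorem toWall_of_le (hk : k + 2 ≤ m) {i c : ℕ} (h : i + c ≤ 2 * k + m) :
    toWall k m (i, c) = (i, c + i + 1 - m) :=
  if_neg (by rw [Prod.mk_inj]; omega)

theorem ofWall_extra : ofWall k m (m, 0) = (m - k - 1, 3 * k + 2) := if_pos rfl

theorem ofWall_of_ne {a d : ℕ} (h : a = m → d ≠ 0) :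
    ofWall k m (a, d) = (a, d + m - 1 - a) :=
  if_neg (by rw [Prod.mk_inj]; tauto)

theorem toWall_mem (hk : k + 2 ≤ m) :
    ∀ u ∈ hexHV k m, toWall k m u ∈ gridV (m + 1) (2 * (k + 1)) := by
  rintro ⟨i, c⟩ h
  rw [mem_iff] at h
  unfold toWall
  split_ifs with h1 <;> rw [Prod.mk_inj] at h1 <;> constructor <;> dsimp only <;> omega

theorem ofWall_mem (hk : k + 2 ≤ m) :
    ∀ u ∈ gridV (m + 1) (2 * (k + 1)), ofWall k m u ∈ hexHV k m := by
  rintro ⟨a, d⟩ ⟨h1, h2⟩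
  dsimp only at h1 h2
  unfold ofWall
  split_ifs with h <;> rw [Prod.mk_inj] at h <;> rw [mem_iff] <;> omega

theorem ofWall_toWall (hk : k + 2 ≤ m) : ∀ u ∈ hexHV k m, ofWall k m (toWall k m u) = u := by
  rintro ⟨i, c⟩ h
  rw [mem_iff] at h
  unfold toWall
  split_ifs with h1
  · rw [ofWall_extra, h1]
  · rw [Prod.mk_inj] at h1
    rw [ofWall_of_ne (by dsimp only; omega), Prod.ext_iff]
    dsimp only
    omega

theorem toWall_ofWall (hk : k + 2 ≤ m) :
    ∀ u ∈ gridV (m + 1) (2 * (k + 1)), toWall k m (ofWall k m u) = u := by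
  rintro ⟨a, d⟩ ⟨h1, h2⟩
  dsimp only at h1 h2
  unfold ofWall
  split_ifs with h
  · rw [toWall_extra, h]
  · rw [Prod.mk_inj] at h
    rw [toWall_of_le hk (by dsimp only; omega), Prod.ext_iff]
    dsimp only
    omega

end HexH

end HexTiling

/-! ### The edges of `H_{k,m,g}` and `H_{k,m,h}` in the coordinates of the wall -/

namespace HexTiling

theorem hexSE_row {p q a d d' : ℕ} (h : d' = d + 1) : hexSE p q (a, d) (a, d') := Or.inl ⟨rfl, h⟩

theorem hexSE_column {p q a d d' : ℕ} (h : d' = d + 1) (hd : d % 2 = 0) :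
    hexSE p q (a, d) (a + 1, d') := Or.inr (Or.inl ⟨rfl, h, hd⟩)

namespace HexG

variable {k m : ℕ}

/-- The edges of `H_{k,m,g}`. -/
def edge (k m : ℕ) (u v : ℕ × ℕ) : Prop :=
  ladE k (m + 1) u v ∨
  (u = (0, 2 * k + m) ∧ v = (m + 1, 2 * (k - m - 1))) ∨
  (∃ j, j + m + 2 ≤ k ∧ u = (0, 2 * k + m - (2 * j + 1)) ∧
    v = (m, 2 * (k - m - 1) - (2 * j + 2))) ∨
  (∃ i, i ≤ m ∧ u = (0, m + 2 * i + 1) ∧ v = (i + 1, 2 * k + m - i)) ∨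
  (∃ i, i ≤ m ∧ u = (m - i, i) ∧ v = (m + 1, 2 * k - (2 * i + 1)))

theorem hexSE_toWall (hk : m + 1 ≤ k) : ∀ u ∈ hexGV k m, ∀ v ∈ hexGV k m, edge k m u v →
    hexSE (m + 1) (k + 2) (toWall k m u) (toWall k m v) ∨
    hexSE (m + 1) (k + 2) (toWall k m v) (toWall k m u) := by
  have hpq : m + 1 ≤ k + 2 := by omega
  rintro ⟨i, c⟩ hu ⟨i', c'⟩ hv h
  rw [mem_iff] at hu hv
  rcases h with ⟨-, -, ⟨h1, h2⟩ | ⟨h1, h2, h3⟩⟩ | ⟨h1, h2⟩ | ⟨j, h1, h2, h3⟩ | ⟨j, h1, h2, h3⟩ |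
    ⟨j, h1, h2, h3⟩
  · dsimp only at h1 h2
    subst h1 h2
    rcases Nat.lt_or_ge m i' with h3 | h3
    · obtain rfl : i' = m + 1 := by omega
      obtain ⟨d, hd⟩ | rfl : (∃ d, c = 2 * (k - m) - 1 + d) ∨ c = 2 * (k - m - 1) := by
        by_cases h : c = 2 * (k - m - 1)
        · exact Or.inr h
        · exact Or.inl ⟨c - (2 * (k - m) - 1), by omega⟩
      · rw [toWall_top hk hd, toWall_top hk (d := d + 1) (by omega)]
        -- Along the last row of the ladder the edges become alternately contracted row edges and
        -- column edges of the wall.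
        rcases Nat.even_or_odd' d with ⟨e, rfl | rfl⟩
        · right
          rw [show (2 * e + 1) / 2 = 2 * e / 2 by omega]
          exact hexSE_row (by omega)
        · left
          rw [show (2 * e + 1 + 1) / 2 = (2 * e + 1) / 2 + 1 by omega]
          exact hexSE_column (by omega) (by omega)
      · rw [toWall_corner, toWall_top hk (d := 0) (by omega)]
        exact Or.inr (Or.inr (Or.inr (Or.inl ⟨hpq, Or.inr (Or.inl
          ⟨0, by omega, rfl, rfl, rfl, by dsimp only; omega⟩)⟩)))
    · rw [toWall_of_le h3, toWall_of_le h3]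
      exact Or.inl (hexSE_row (by omega))
  · dsimp only at h1 h2 h3
    subst h1 h2
    -- The rungs omitted from the ladder are those with `i + c'` of the parity of `m + 1`, so at the
    -- present rung the sum has the parity of `m` and the wall column is even.
    have h4 : ∀ j, i + c' ≠ m + 1 + 2 * j := fun j hj => h3 ⟨j, by omega, hj⟩
    have h5 : i + c' = m + 2 * ((i + c' - m) / 2) := by
      have := h4 ((i + c' - m) / 2)
      omega
    rcases Nat.lt_or_ge i m with h6 | h6
    · rw [toWall_of_le h6, toWall_of_le h6.le]
      exact Or.inl (hexSE_column (by omega) (by omega))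
    · obtain rfl : i = m := by omega
      rw [toWall_of_le le_rfl]
      right
      right
      right
      left
      refine ⟨hpq, ?_⟩
      by_cases h : c' = 2 * (k - i - 1)
      · subst h
        rw [toWall_corner]
        -- The displaced first vertex of the last row sits in column `2 * (k + 1) + 1` of row `0`,
        -- so its rung is the closing edge of the third kind with index `k + 1`.
        exact Or.inr (Or.inr ⟨k + 1, by omega, rfl, by dsimp only; omega, rfl,
          by dsimp only; omega⟩)
      · rw [toWall_top hk (d := c' - (2 * (k - i) - 1)) (by omega)]
        exact Or.inl ⟨by dsimp only; omega, rfl, by dsimp only; omega⟩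
  · rw [h1, h2, toWall_of_le (Nat.zero_le _), toWall_corner]
    exact Or.inl (hexSE_row (by omega))
  · rw [h2, h3, toWall_of_le (Nat.zero_le _), toWall_of_le le_rfl]
    exact Or.inl (Or.inr (Or.inr (Or.inl ⟨hpq, Or.inr (Or.inr
      ⟨k - j, by omega, rfl, by dsimp only; omega, rfl, by dsimp only; omega⟩)⟩)))
  · rw [h2, h3, toWall_of_le (Nat.zero_le _)]
    refine Or.inl (Or.inr (Or.inr (Or.inl ⟨hpq, ?_⟩)))
    rcases Nat.lt_or_ge j m with h4 | h4
    · rw [toWall_of_le h4]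
      exact Or.inr (Or.inl ⟨j + 1, by omega, rfl, by dsimp only; omega, rfl, by dsimp only; omega⟩)
    · obtain rfl : j = m := by omega
      rw [toWall_top hk (d := 2 * j + 1) (by omega)]
      exact Or.inr (Or.inr ⟨j + 1, by omega, rfl, by dsimp only; omega, by dsimp only; omega,
        by dsimp only; omega⟩)
  · rw [h2, h3, toWall_of_le (Nat.sub_le _ _), toWall_top hk (d := 2 * (m - j)) (by omega)]
    rw [show 2 * (m - j) / 2 = m - j by omega]
    exact Or.inr (hexSE_row (by omega))

theorem edge_row {i c c' : ℕ} (hu : (i, c) ∈ hexGV k m) (hv : (i, c') ∈ hexGV k m)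
    (h : c' = c + 1) : edge k m (i, c) (i, c') :=
  Or.inl ⟨mem_ladV hu, mem_ladV hv, Or.inl ⟨rfl, h⟩⟩

theorem edge_column {i c : ℕ} (hu : (i, c) ∈ hexGV k m) (hv : (i + 1, c) ∈ hexGV k m)
    (h : (i + c) % 2 = m % 2) : edge k m (i, c) (i + 1, c) :=
  Or.inl ⟨mem_ladV hu, mem_ladV hv, Or.inr ⟨rfl, rfl, fun ⟨j, _, hj⟩ => by
    dsimp only at hj; omega⟩⟩

theorem edge_ofWall (hk : m + 1 ≤ k) : ∀ u ∈ gridV (m + 1) (2 * (k + 2)),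
    ∀ v ∈ gridV (m + 1) (2 * (k + 2)), hexSE (m + 1) (k + 2) u v →
    edge k m (ofWall k m u) (ofWall k m v) ∨ edge k m (ofWall k m v) (ofWall k m u) := by
  rintro ⟨a, d⟩ hu ⟨a', d'⟩ hv h
  have hu' := ofWall_mem hk _ hu
  have hv' := ofWall_mem hk _ hv
  have h1 : a < m + 1 := hu.1
  have h2 : d < 2 * (k + 2) := hu.2
  have h3 : a' < m + 1 := hv.1
  have h4 : d' < 2 * (k + 2) := hv.2
  rcases h with ⟨h5, h6⟩ | ⟨h5, h6, h7⟩ | ⟨-, ⟨h5, h6, h7⟩ | ⟨i, h5, h6, h7, h8, h9⟩ |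
    ⟨i, h5, h6, h7, h8, h9⟩⟩ | ⟨h, -⟩
  · dsimp only at h5 h6
    subst h5 h6
    rcases Nat.lt_or_ge d 2 with h7 | h7
    · rw [ofWall_of_le _ (by omega)] at hu' ⊢
      rcases Nat.lt_or_ge d 1 with h8 | h8
      · rw [ofWall_of_le _ (by omega)] at hv' ⊢
        exact Or.inr (edge_row hv' hu' (by omega))
      · rw [ofWall_of_lt (by omega) (by omega)]
        exact Or.inr (Or.inr (Or.inr (Or.inr (Or.inr ⟨m - a', by omega,
          by rw [Prod.mk_inj]; omega, by rw [Prod.mk_inj]; omega⟩))))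
    · rw [ofWall_of_lt h7 (by omega)] at hu' ⊢
      by_cases h8 : a' = 0 ∧ d + 1 = 2 * k + 3
      · obtain ⟨rfl, h8⟩ := h8
        rw [h8, ofWall_corner]
        exact Or.inl (Or.inr (Or.inl ⟨by rw [Prod.mk_inj]; omega, rfl⟩))
      · rw [ofWall_of_lt (by omega) (by tauto)] at hv' ⊢
        exact Or.inl (edge_row hu' hv' (by omega))
  · dsimp only at h5 h6 h7
    subst h5 h6
    rcases Nat.lt_or_ge d 2 with h8 | h8
    · rw [ofWall_of_le _ (by omega)] at hu' hv' ⊢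
      rw [ofWall_of_le _ (by omega)]
      exact Or.inl (edge_row hu' hv' (by omega))
    · rw [ofWall_of_lt h8 (by omega)] at hu' ⊢
      rw [ofWall_of_lt (by omega) (by omega),
        show d + 1 + m - 2 - (a + 1) = d + m - 2 - a by omega] at hv' ⊢
      exact Or.inl (edge_column hu' hv' (by omega))
  · dsimp only at h5 h6 h7
    obtain rfl : m = a' := by omega
    subst h5 h7
    rw [ofWall_of_le _ (by omega)] at hu' ⊢
    rw [ofWall_of_lt (by omega) (by omega), show 2 * (k + 2 - (m + 1) + a) + m - 2 - m =
      2 * (k - m) + 2 * a - 0 by omega] at hv' ⊢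
    exact Or.inr (edge_column hv' hu' (by omega))
  · dsimp only at h6 h7 h8 h9
    subst h6 h7 h8 h9
    rcases Nat.eq_zero_or_pos a' with rfl | h
    · rw [show 2 * (k + 2) - 1 = 2 * k + 3 by omega, ofWall_corner] at hv' ⊢
      rw [ofWall_of_le _ (by omega)] at hu' ⊢
      exact Or.inr (edge_row hv' hu' (by omega))
    · rw [ofWall_of_lt (by omega) (by omega), ofWall_of_lt (by omega) (by omega)]
      exact Or.inl (Or.inr (Or.inr (Or.inr (Or.inl ⟨a' - 1, by omega, by rw [Prod.mk_inj]; omega,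
        by rw [Prod.mk_inj]; omega⟩))))
  · dsimp only at h6 h7 h8 h9
    obtain rfl : m = a' := by omega
    subst h6 h7 h9
    rcases Nat.lt_or_ge k i with h | h
    · obtain rfl : i = k + 1 := by omega
      rw [show 2 * (k + 1) + 1 = 2 * k + 3 by omega, ofWall_corner] at hu' ⊢
      rw [ofWall_of_lt (by omega) (by omega),
        show 2 * (k + 1 - (m + 1)) + m - 2 - m = 2 * (k - m - 1) by omega] at hv' ⊢
      exact Or.inr (edge_column hv' hu' (by omega))
    · rw [ofWall_of_lt (by omega) (by omega)]
      rcases Nat.lt_or_ge (m + 1) i with h' | h'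
      · rw [ofWall_of_lt (by omega) (by omega)]
        exact Or.inl (Or.inr (Or.inr (Or.inl ⟨k - i, by omega, by rw [Prod.mk_inj]; omega,
          by rw [Prod.mk_inj]; omega⟩)))
      · rw [ofWall_of_le _ (by omega)]
        exact Or.inl (Or.inr (Or.inr (Or.inr (Or.inl ⟨m, le_rfl, by rw [Prod.mk_inj]; omega,
          by rw [Prod.mk_inj]; omega⟩))))
  · omega

end HexG

theorem yields_hexG {k m : ℕ} (hm : 2 ≤ m) (hk : m + 1 ≤ k) :
    IsPerfectMatching (hexG k m) (hexGP k m) ∧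
      Yields (hexG k m) (hexGP k m) (gridS (m + 1) (k + 2)) (gridS (m + 1) (k + 2)) := by
  refine HexS.yields_of_maps (HexG.toWall k m) (HexG.ofWall k m) (by omega) (by omega)
    (fun _ => by omega) (HexG.toWall_mem hk) (HexG.ofWall_mem hk) (HexG.ofWall_toWall hk)
    (HexG.toWall_ofWall hk) (HexG.hexSE_toWall hk) (HexG.edge_ofWall hk) ?_ ?_
  · rintro ⟨i, c⟩ hu ⟨i', c'⟩ hv h
    rcases h with ⟨j, h, h1, h2⟩ | ⟨i, j, h, h', h'', h1, h2⟩ | ⟨j, h, h1, h2⟩ | ⟨h1, h2⟩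
    · rw [h1, h2, HexG.toWall_of_le (Nat.zero_le _), HexG.toWall_of_le (Nat.zero_le _), ne_eq,
        Prod.mk_inj]
      dsimp only
      omega
    · rw [h1, h2, HexG.toWall_of_le h', HexG.toWall_of_le h', ne_eq, Prod.mk_inj]
      dsimp only
      omega
    · rw [h1, h2, HexG.toWall_top hk (d := 2 * j) rfl,
        HexG.toWall_top hk (d := 2 * j + 1) (by omega), ne_eq, Prod.mk_inj]
      dsimp only
      omega
    · rw [h1, h2, HexG.toWall_of_le (Nat.zero_le _), HexG.toWall_corner, ne_eq, Prod.mk_inj]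
      dsimp only
      omega
  · intro a b ha hb
    rcases Nat.eq_zero_or_pos b with rfl | h
    · rw [HexG.ofWall_of_le _ (by omega), HexG.ofWall_of_le _ (by omega)]
      exact Or.inr (Or.inr (Or.inr (Or.inl ⟨a, by omega, by rw [Prod.mk_inj]; omega,
        by rw [Prod.mk_inj]; omega⟩)))
    · rw [HexG.ofWall_of_lt (by omega) (by omega)]
      left
      by_cases h1 : a = 0 ∧ b = k + 1
      · obtain ⟨rfl, rfl⟩ := h1
        rw [show 2 * (k + 1) + 1 = 2 * k + 3 by omega, HexG.ofWall_corner]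
        exact Or.inr (Or.inr (Or.inr ⟨by rw [Prod.mk_inj]; omega, rfl⟩))
      · rw [HexG.ofWall_of_lt (by omega) (by omega)]
        rcases Nat.eq_zero_or_pos a with rfl | h2
        · exact Or.inl ⟨b - 1, by omega, by rw [Prod.mk_inj]; omega, by rw [Prod.mk_inj]; omega⟩
        · exact Or.inr (Or.inl ⟨a, b - 1, by omega, by omega, by omega, by rw [Prod.mk_inj]; omega,
            by rw [Prod.mk_inj]; omega⟩)

namespace HexH

variable {k m : ℕ}

/-- The edges of `H_{k,m,h}`. -/
def edge (k m : ℕ) (u v : ℕ × ℕ) : Prop :=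
  ladE k m u v ∨
  (u = (0, 2 * k + m) ∧ v = (0, 2 * k + m - 1)) ∨
  (u = (0, 2 * k + m) ∧ v = (k + 1, m - k - 2)) ∨
  (u = (m - k - 1, 3 * k + 2) ∧ v = (m - k - 1, 3 * k + 1)) ∨
  (u = (m - k - 1, 3 * k + 2) ∧ v = (m, 0)) ∨
  (∃ j, 1 ≤ j ∧ j ≤ m - k - 2 ∧ u = (j, 2 * k + m - j) ∧ v = (k + j + 1, m - k - j - 2)) ∨
  (∃ i, i ≤ k ∧ u = (0, 2 * k + m - 2 * i) ∧ v = (i, m - (i + 1))) ∨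
  (u = (m - k - 1, 3 * k + 2) ∧ v = (m, 2 * k)) ∨
  (∃ i, i < k ∧ u = (m - k + i, 3 * k - i) ∧ v = (m, 2 * k - (2 * i + 1)))

theorem hexSE_toWall (hk : k + 2 ≤ m) : ∀ u ∈ hexHV k m, ∀ v ∈ hexHV k m, edge k m u v →
    hexSE (m + 1) (k + 1) (toWall k m u) (toWall k m v) ∨
    hexSE (m + 1) (k + 1) (toWall k m v) (toWall k m u) := by
  have hpq : k + 1 < m + 1 := by omega
  have hL : ∀ i c, (i, c) ∈ ladV k m → m ≤ i + c + 1 ∧ i + c ≤ 2 * k + m :=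
    fun i c h => ⟨h.2.2.1, h.2.2.2⟩
  rintro ⟨i, c⟩ - ⟨i', c'⟩ - h
  rcases h with ⟨h, h', ⟨h1, h2⟩ | ⟨h1, h2, h3⟩⟩ | ⟨h1, h2⟩ | ⟨h1, h2⟩ | ⟨h1, h2⟩ | ⟨h1, h2⟩ |
    ⟨j, h, h', h1, h2⟩ | ⟨j, h, h1, h2⟩ | ⟨h1, h2⟩ | ⟨j, h, h1, h2⟩
  · have h3 := hL _ _ h
    have h4 := hL _ _ h'
    rw [toWall_of_le hk h3.2, toWall_of_le hk h4.2]
    dsimp only at h1 h2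
    subst h1 h2
    exact Or.inl (hexSE_row (by omega))
  · have h4 := hL _ _ h
    have h5 := hL _ _ h'
    rw [toWall_of_le hk h4.2, toWall_of_le hk h5.2]
    dsimp only at h1 h2 h3
    subst h1 h2
    -- Here the omitted rungs have `i + c'` of the parity of `m`; for the remaining ones `c' + i + 1
    -- - m` is even, as column edges of the wall require.
    have h6 : ∀ j, i + c' ≠ m + 2 * j := fun j hj => h3 ⟨j, by omega, hj⟩
    have h7 := h6 ((i + c' - m) / 2)
    exact Or.inl (hexSE_column (by omega) (by omega))
  · rw [h1, h2, toWall_of_le hk (by omega), toWall_of_le hk (by omega)]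
    exact Or.inr (hexSE_row (by omega))
  · rw [h1, h2, toWall_of_le hk (by omega), toWall_of_le hk (by omega)]
    exact Or.inl (Or.inr (Or.inr (Or.inr ⟨hpq, Or.inr (Or.inr ⟨by dsimp only; omega,
      by dsimp only; omega, by dsimp only; omega, by dsimp only; omega⟩)⟩)))
  · rw [h1, h2, toWall_extra, toWall_of_le hk (by omega)]
    exact Or.inr (Or.inr (Or.inr (Or.inr ⟨hpq, Or.inr (Or.inr ⟨by dsimp only; omega,
      by dsimp only; omega, by dsimp only; omega, rfl⟩)⟩)))
  · rw [h1, h2, toWall_extra, toWall_of_le hk (by omega)]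
    exact Or.inl (hexSE_row (by omega))
  · rw [h1, h2, toWall_of_le hk (by omega), toWall_of_le hk (by omega)]
    exact Or.inl (Or.inr (Or.inr (Or.inr ⟨hpq, Or.inr (Or.inr ⟨by dsimp only; omega,
      by dsimp only; omega, by dsimp only; omega, by dsimp only; omega⟩)⟩)))
  · rw [h1, h2, toWall_of_le hk (by omega), toWall_of_le hk (by omega)]
    exact Or.inr (Or.inr (Or.inr (Or.inr ⟨hpq, Or.inl ⟨by dsimp only; omega,
      by dsimp only; omega, by dsimp only, by dsimp only; omega⟩⟩)))
  · rw [h1, h2, toWall_extra, toWall_of_le hk (by omega)]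
    exact Or.inr (Or.inr (Or.inr (Or.inr ⟨hpq, Or.inr (Or.inl ⟨0, by omega, rfl,
      by dsimp only; omega, rfl, rfl⟩)⟩)))
  · rw [h1, h2, toWall_of_le hk (by omega), toWall_of_le hk (by omega)]
    exact Or.inl (Or.inr (Or.inr (Or.inr ⟨hpq, Or.inr (Or.inl ⟨k - j, by omega,
      by dsimp only; omega, by dsimp only; omega, rfl, by dsimp only; omega⟩)⟩)))

theorem edge_row (hk : k + 2 ≤ m) {i c c' : ℕ} (hu : (i, c) ∈ hexHV k m) (hv : (i, c') ∈ hexHV k m)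
    (h : c' = c + 1) (hc : c' < 2 * k + m) (hi : i + c' ≤ 2 * k + m) :
    edge k m (i, c) (i, c') :=
  Or.inl ⟨mem_ladV hu (by omega) (by omega) hk, mem_ladV hv hc hi hk, Or.inl ⟨rfl, h⟩⟩

theorem edge_column (hk : k + 2 ≤ m) {i c : ℕ} (hu : (i, c) ∈ hexHV k m)
    (hv : (i + 1, c) ∈ hexHV k m) (hc : c < 2 * k + m) (hi : i + c < 2 * k + m)
    (h : (i + c) % 2 ≠ m % 2) : edge k m (i, c) (i + 1, c) :=
  Or.inl ⟨mem_ladV hu hc hi.le hk, mem_ladV hv hc (by omega) hk,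
    Or.inr ⟨rfl, rfl, fun ⟨j, _, hj⟩ => by dsimp only at hj; omega⟩⟩

theorem edge_ofWall (hk : k + 2 ≤ m) : ∀ u ∈ gridV (m + 1) (2 * (k + 1)),
    ∀ v ∈ gridV (m + 1) (2 * (k + 1)), hexSE (m + 1) (k + 1) u v →
    edge k m (ofWall k m u) (ofWall k m v) ∨ edge k m (ofWall k m v) (ofWall k m u) := by
  rintro ⟨a, d⟩ hu ⟨a', d'⟩ hv h
  have hu' := ofWall_mem hk _ hu
  have hv' := ofWall_mem hk _ hv
  have h1 : a < m + 1 := hu.1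
  have h2 : d < 2 * (k + 1) := hu.2
  have h3 : a' < m + 1 := hv.1
  have h4 : d' < 2 * (k + 1) := hv.2
  rcases h with ⟨h5, h6⟩ | ⟨h5, h6, h7⟩ | ⟨h, -⟩ | ⟨-, ⟨h5, h6, h7, h8⟩ | ⟨i, h5, h6, h7, h8, h9⟩ |
    ⟨h5, h6, h7, h8⟩⟩
  · dsimp only at h5 h6
    subst h5 h6
    rw [ofWall_of_ne (d := d + 1) (by omega)] at hv' ⊢
    by_cases h5 : a' = m ∧ d = 0
    · obtain ⟨rfl, rfl⟩ := h5
      rw [ofWall_extra]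
      exact Or.inl (Or.inr (Or.inr (Or.inr (Or.inr (Or.inl ⟨rfl, by rw [Prod.mk_inj]; omega⟩)))))
    rw [ofWall_of_ne (by tauto)] at hu' ⊢
    by_cases h6 : a' = 0 ∧ d = 2 * k
    · exact Or.inr (Or.inr (Or.inl ⟨by rw [Prod.mk_inj]; omega, by rw [Prod.mk_inj]; omega⟩))
    · exact Or.inl (edge_row hk hu' hv' (by omega) (by omega) (by omega))
  · dsimp only at h5 h6 h7
    subst h5 h6
    rw [ofWall_of_ne (by omega)] at hu' ⊢
    rw [ofWall_of_ne (by omega), show d + 1 + m - 1 - (a + 1) = d + m - 1 - a by omega] at hv' ⊢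
    exact Or.inl (edge_column hk hu' hv' (by omega) (by omega) (by omega))
  · omega
  · dsimp only at h5 h6 h7 h8
    subst h6 h7 h8
    rw [ofWall_of_ne (by omega), ofWall_of_ne (by omega)]
    exact Or.inr (Or.inr (Or.inr (Or.inr (Or.inr (Or.inr (Or.inr (Or.inl ⟨a, by omega,
      by rw [Prod.mk_inj]; omega, by rw [Prod.mk_inj]; omega⟩)))))))
  · dsimp only at h6 h7 h8 h9
    subst h6 h7 h8 h9
    rw [ofWall_of_ne (by omega), Nat.add_sub_cancel]
    rcases Nat.eq_zero_or_pos i with rfl | h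
    · rw [Nat.mul_zero, ofWall_extra]
      exact Or.inr (Or.inr (Or.inr (Or.inr (Or.inr (Or.inr (Or.inr (Or.inr (Or.inl ⟨rfl,
        by rw [Prod.mk_inj]; omega⟩))))))))
    · rw [ofWall_of_ne (by omega)]
      exact Or.inl (Or.inr (Or.inr (Or.inr (Or.inr (Or.inr (Or.inr (Or.inr (Or.inr ⟨k - i, by omega,
        by rw [Prod.mk_inj]; omega, by rw [Prod.mk_inj]; omega⟩))))))))
  · dsimp only at h5 h6 h7 h8
    subst h6 h7 h8
    rw [ofWall_of_ne (by omega)]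
    by_cases h : a + (k + 1) = m
    · rw [h, ofWall_extra]
      exact Or.inr (Or.inr (Or.inr (Or.inr (Or.inl ⟨rfl, by rw [Prod.mk_inj]; omega⟩))))
    rw [ofWall_of_ne (by omega)]
    rcases Nat.eq_zero_or_pos a with rfl | h'
    · exact Or.inl (Or.inr (Or.inr (Or.inl ⟨by rw [Prod.mk_inj]; omega,
        by rw [Prod.mk_inj]; omega⟩)))
    · exact Or.inl (Or.inr (Or.inr (Or.inr (Or.inr (Or.inr (Or.inl ⟨a, by omega, by omega,
        by rw [Prod.mk_inj]; omega, by rw [Prod.mk_inj]; omega⟩))))))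

end HexH

theorem yields_hexH {k m : ℕ} (hk2 : 2 ≤ k) (hk : k + 2 ≤ m) :
    IsPerfectMatching (hexH k m) (hexHP k m) ∧
      Yields (hexH k m) (hexHP k m) (gridS (m + 1) (k + 1)) (gridS (m + 1) (k + 1)) := by
  refine HexS.yields_of_maps (HexH.toWall k m) (HexH.ofWall k m) (by omega) (by omega)
    (fun _ => by omega) (HexH.toWall_mem hk) (HexH.ofWall_mem hk) (HexH.ofWall_toWall hk)
    (HexH.toWall_ofWall hk) (HexH.hexSE_toWall hk) (HexH.edge_ofWall hk) ?_ ?_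
  · rintro ⟨i, c⟩ hu ⟨i', c'⟩ hv h
    rcases h with ⟨i, j, h, h', h1, h2⟩ | ⟨j, h, h1, h2⟩ | ⟨h1, h2⟩
    · rw [h1, h2, HexH.toWall_of_le hk (by omega), HexH.toWall_of_le hk (by omega), ne_eq,
        Prod.mk_inj]
      dsimp only
      omega
    · rw [h1, h2, HexH.toWall_of_le hk (by omega), HexH.toWall_of_le hk (by omega), ne_eq,
        Prod.mk_inj]
      dsimp only
      omega
    · rw [h1, h2, HexH.toWall_extra, HexH.toWall_of_le hk (by omega), ne_eq, Prod.mk_inj]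
      dsimp only
      omega
  · intro a b ha hb
    rw [HexH.ofWall_of_ne (d := 2 * b + 1) (by omega)]
    left
    by_cases h : a = m ∧ b = 0
    · obtain ⟨rfl, rfl⟩ := h
      rw [Nat.mul_zero, HexH.ofWall_extra]
      exact Or.inr (Or.inr ⟨rfl, by rw [Prod.mk_inj]; omega⟩)
    · rw [HexH.ofWall_of_ne (by omega)]
      by_cases h' : a = m
      · exact Or.inr (Or.inl ⟨b - 1, by omega, by rw [Prod.mk_inj]; omega,
          by rw [Prod.mk_inj]; omega⟩)
      · exact Or.inl ⟨a, b, by omega, by omega, by rw [Prod.mk_inj]; omega,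
          by rw [Prod.mk_inj]; omega⟩

end HexTiling

theorem theorem3p2 :
    -- `H_{k,m,r}`
    (∀ k m r : ℕ, HexRRange k m r →
      IsPerfectMatching (hexR k m r) (cylP k m) ∧
      Yields (hexR k m r) (cylP k m) (torusT k (m + 1) r) (torusT k (m + 1) r) ∧
      (TorusRange k (m + 1) r → IsLocallyGrid (torusT k (m + 1) r))) ∧
    -- `H_{k,m,a}`, `k` even
    (∀ k m : ℕ, 2 ≤ m → 3 ≤ k → Even k →
      IsPerfectMatching (hexA k m) (cylP k m) ∧
      Yields (hexA k m) (cylP k m) (kleinK0 k (m + 1)) (kleinK2 k (m + 1)) ∧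
      (5 ≤ k → 4 ≤ m + 1 → IsLocallyGrid (kleinK0 k (m + 1))) ∧
      (5 ≤ k → 5 ≤ m + 1 → IsLocallyGrid (kleinK2 k (m + 1)))) ∧
    -- `H_{k,m,a}`, `k` odd
    (∀ k m : ℕ, 2 ≤ m → 3 ≤ k → Odd k →
      IsPerfectMatching (hexA k m) (cylP k m) ∧
      Yields (hexA k m) (cylP k m) (kleinK1 k (m + 1)) (kleinK1 k (m + 1)) ∧
      (5 ≤ k → 5 ≤ m + 1 → IsLocallyGrid (kleinK1 k (m + 1)))) ∧
    -- `H_{k,m,b}`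
    (∀ k m : ℕ, 3 ≤ m → Odd m → 4 ≤ k → Even k →
      IsPerfectMatching (hexB k m) (cylP k m) ∧
      Yields (hexB k m) (cylP k m) (kleinK2 k (m + 1)) (kleinK0 k (m + 1)) ∧
      (5 ≤ k → 5 ≤ m + 1 → IsLocallyGrid (kleinK2 k (m + 1))) ∧
      (5 ≤ k → 4 ≤ m + 1 → IsLocallyGrid (kleinK0 k (m + 1)))) ∧
    -- `H_{k,m,c}`
    (∀ k m : ℕ, 1 ≤ m → 6 ≤ k → Even k →
      Nonempty (hexC k m ≃g hexCKlein k m) ∧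
      IsPerfectMatching (hexCKlein k m) (hexCKleinP k m) ∧
      Yields (hexCKlein k m) (hexCKleinP k m)
        (kleinK0 (2 * m + 2) (k / 2)) (kleinK2 (2 * m + 2) (k / 2)) ∧
      (5 ≤ 2 * m + 2 → 4 ≤ k / 2 → IsLocallyGrid (kleinK0 (2 * m + 2) (k / 2))) ∧
      (5 ≤ 2 * m + 2 → 5 ≤ k / 2 → IsLocallyGrid (kleinK2 (2 * m + 2) (k / 2)))) ∧
    -- `H_{k,m,f}`
    (∀ k m : ℕ, 7 ≤ k → Odd k →
      Nonempty (hexF k m ≃g hexFKlein k m) ∧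
      (∀ l : ℕ, Even l → l + 3 ≤ k →
        ¬ IsMatching (hexFKleinP k m l) ∧
        Yields (hexFKlein k m) (hexFKleinP k m l)
          (kleinK2 (2 * m + 4) ((k - 1) / 2)) (kleinK0 (2 * m + 4) ((k - 1) / 2))) ∧
      (5 ≤ 2 * m + 4 → 5 ≤ (k - 1) / 2 → IsLocallyGrid (kleinK2 (2 * m + 4) ((k - 1) / 2))) ∧
      (5 ≤ 2 * m + 4 → 4 ≤ (k - 1) / 2 → IsLocallyGrid (kleinK0 (2 * m + 4) ((k - 1) / 2)))) ∧
    -- `H_{k,m,g}`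
    (∀ k m : ℕ, 3 ≤ m → m + 1 ≤ k →
      IsPerfectMatching (hexG k m) (hexGP k m) ∧
      Yields (hexG k m) (hexGP k m) (gridS (m + 1) (k + 2)) (gridS (m + 1) (k + 2)) ∧
      IsLocallyGrid (gridS (m + 1) (k + 2))) ∧
    -- `H_{k,m,h}`
    (∀ k m : ℕ, 2 ≤ k → k + 2 ≤ m →
      IsPerfectMatching (hexH k m) (hexHP k m) ∧
      Yields (hexH k m) (hexHP k m) (gridS (m + 1) (k + 1)) (gridS (m + 1) (k + 1)) ∧
      (6 ≤ k + 1 → IsLocallyGrid (gridS (m + 1) (k + 1)))) := by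
  refine ⟨fun k m r h => ?_, fun k m hm hk hk2 => ?_, fun k m hm hk hk2 => ?_,
    fun k m hm hm2 hk hk2 => ?_, fun k m hm hk hk2 => ?_, fun k m hk hk2 => ?_,
    fun k m hm hk => ?_, fun k m hk hm => ?_⟩
  · exact ⟨(yields_hexR h).1, (yields_hexR h).2, isLocallyGrid_torusT⟩
  · exact ⟨(yields_hexA_even hk hm).1, (yields_hexA_even hk hm).2,
      fun h h' => isLocallyGrid_kleinK0 h h' hk2, fun h h' => isLocallyGrid_kleinK2 h h'⟩
  · exact ⟨(yields_hexA_odd hk hm hk2).1, (yields_hexA_odd hk hm hk2).2,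
      fun h h' => isLocallyGrid_kleinK1 h h'⟩
  · have h := yields_hexB (k := k) (m := m) (by omega) (by omega) hm2
    exact ⟨h.1, h.2, fun h h' => isLocallyGrid_kleinK2 h h',
      fun h h' => isLocallyGrid_kleinK0 h h' hk2⟩
  · exact ⟨nonempty_hexC_iso hk hk2, isPerfectMatching_hexCKleinP hm hk hk2,
      yields_hexCKlein hm hk hk2, fun h h' => isLocallyGrid_kleinK0 h h' ⟨m + 1, by ring⟩,
      fun h h' => isLocallyGrid_kleinK2 h h'⟩
  · exact ⟨nonempty_hexF_iso hk hk2,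
      fun l hl hlk => ⟨not_isMatching_hexFKleinP hl hlk, yields_hexFKlein hk hk2 hl hlk⟩,
      fun h h' => isLocallyGrid_kleinK2 h h',
      fun h h' => isLocallyGrid_kleinK0 h h' ⟨m + 2, by ring⟩⟩
  · have h := yields_hexG (k := k) (m := m) (by omega) hk
    exact ⟨h.1, h.2, HexS.isLocallyGrid_gridS (by omega) (by omega)⟩
  · have h := yields_hexH hk hm
    exact ⟨h.1, h.2, fun h => HexS.isLocallyGrid_gridS (by omega) h⟩
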